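/- **Third Structure Theorem.** Let $N=n-1$, $\mathbf J=\begin{pmatrix}0&1\\-1&0\end{pmatrix}$, $\varrho>0$. For $R>0$ let $B_R=\{p\in\mathbb C^{N+1}: |\mathrm{Re}\,p|\le R,\ |\mathrm{Im}\,p_j|\le R\}$. Let $H_0(\mathbf y,z_2)$ be analytic and bounded on $B_{3\varrho}$, and let $H_1(\mathbf x,\mathbf y,\mathbf z)$, $\mathbf z=(z_1,z_2)$, be analytic and bounded on $\{|\mathrm{Im}\,x_j|\le3\varrho,\ |\mathrm{Im}\,z_1|\le 3\varrho,\ (\mathbf y,z_2)\in B_{3\varrho}\}$ and $2\pi$-periodic in $\mathbf x$ and $z_1$. For real $\varepsilon$ and complex $m,M$ put $H=H_0+\varepsilon H_1$ and $H_m=H+mz_1+\frac12Mz_1^2$. *Spaces.* For $\sigma\in[0,1]$ and an integer $d\ge 0$, $\mathcal A_{\sigma,d}$ is the space of $2\pi$-periodic functions on the closed strip $\{|\mathrm{Im}\,\xi_j|\le\sigma\varrho,\ 1\le j\le N\}\subset\mathbb C^N$, holomorphic in the open strip, with partial derivatives (along the real directions) up to order $d$ continuous on the closed strip, and norm $\|f\|_{\sigma,d}=\max_{|k|\le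 d}\sup|\partial^kf|$. Norms of vectors and matrices are maxima over components; $\overline f=(2\pi)^{-N}\int_{\mathbb T^{N}}f\,d\xi$; $\mathbf f'=(\partial f_i/\partial\xi_j)$ is the Jacobian, $\nabla\mathbf f=(\mathbf f')^\top$. Repeated indices are summed. *The operator.* To $\boldsymbol\varphi=(\beta,\varphi_0,\mathbf u,\mathbf w,W_{11},W_{12},W_{21})\in\mathbb C^{N}\times\mathcal A_{\sigma,d}\times\mathcal A_{\sigma,d}^{N}\times\mathcal A_{\sigma,d}^2\times\mathcal A_{\sigma,d}^3$ associate $$\mathbf V=(\mathbf I+\mathbf u')^{-\top},\quad \mathbf v=\beta+\mathbf V(\nabla\varphi_0-w_2\nabla w_1),\quad \mathbf W=\begin{pmatrix}W_{11}&W_{12}\\W_{21}&\frac{1+W_{12}W_{21}}{W_{11}}\end{pmatrix},$$ $$\boldsymbol\Lambda=-\mathbf V(\mathbf w')^\top\mathbf J\mathbf W,\qquad \mathbf R_i=-V_{ik}\,\frac{\partial\mathbf W^\top}{\partial\xi_k}\,\mathbf J\mathbf W .$$ For $\boldsymbol\omega\in\mathbb R^N$, $\alpha,k,e\in\mathbb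 C$, $\boldsymbol\Omega=\mathrm{diag}(-k,1)$, and all derivatives of $H_m$ taken at $(\boldsymbol\xi+\mathbf u,\mathbf v,\mathbf w)$, put $$\Phi_1=H_m(\boldsymbol\xi+\mathbf u,\mathbf v,\mathbf w)-e,\quad \Phi_2=\boldsymbol\Lambda^\top\nabla_yH_m+\mathbf W^\top\nabla_zH_m,\quad \Phi_3=\mathbf V^\top\nabla_yH_m-\boldsymbol\omega,$$ $$\Phi_4=\frac{\partial H_m}{\partial y_i}\mathbf R_i+\boldsymbol\Lambda^\top\frac{\partial^2H_m}{\partial\mathbf y^2}\boldsymbol\Lambda+\mathbf W^\top\frac{\partial^2H_m}{\partial\mathbf z\partial\mathbf y}\boldsymbol\Lambda+\Big(\mathbf W^\top\frac{\partial^2H_m}{\partial\mathbf z\partial\mathbf y}\boldsymbol\Lambda\Big)^\top+\mathbf W^\top\frac{\partial^2H_m}{\partial\mathbf z^2}\mathbf W-\boldsymbol\Omega,\quad \Phi_5=\overline{w_1}-\alpha .$$ *Change of variables.* For $\delta\boldsymbol\varphi=(\delta\beta,\delta\varphi_0,\delta\mathbf u,\delta\mathbf w,\delta W_{11},\delta W_{12},\delta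 W_{21})$ in the same space put $\delta\mathbf V=-\mathbf V(\nabla\delta\mathbf u)\mathbf V$, $\delta W_{22}=W_{11}^{-1}(W_{12}\delta W_{21}+W_{21}\delta W_{12}-W_{22}\delta W_{11})$, $\delta\mathbf v=\delta\beta+\mathbf V(\nabla\delta\varphi_0-w_2\nabla\delta w_1-\delta w_2\nabla w_1)+\delta\mathbf V(\nabla\varphi_0-w_2\nabla w_1)$, and $$\boldsymbol\chi=\mathbf V^\top\delta\mathbf u,\quad \boldsymbol\lambda=\mathbf W^{-1}\delta\mathbf w-\chi_i\mathbf W^{-1}\frac{\partial\mathbf w}{\partial\xi_i},\quad \boldsymbol\Gamma=\mathbf W^{-1}\delta\mathbf W-\chi_i\mathbf W^{-1}\frac{\partial\mathbf W}{\partial\xi_i},\quad \boldsymbol\mu=\mathbf V^{-1}\Big(\delta\mathbf v-\chi_i\frac{\partial\mathbf v}{\partial\xi_i}-\boldsymbol\Lambda\boldsymbol\lambda\Big).$$ *Remainders.* $$\Pi_1=\chi_i\frac{\partial\Phi_1}{\partial\xi_i}+\Phi_2\cdot\boldsymbol\lambda+\Phi_3\cdot\boldsymbol\mu,\qquad \Pi_2=\chi_i\frac{\partial\Phi_2}{\partial\xi_i}+\boldsymbol\Gamma^\top\Phi_2+\Phi_4\boldsymbol\lambda+(\mathbf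 J\boldsymbol\lambda)'\Phi_3,$$ $$\Pi_3=\chi_i\frac{\partial\Phi_3}{\partial\xi_i}-\boldsymbol\chi'\Phi_3,\qquad \Pi_4=\chi_i\frac{\partial\Phi_4}{\partial\xi_i}+\Phi_{3,i}\frac{\partial(\mathbf J\boldsymbol\Gamma)}{\partial\xi_i}+\Phi_4\boldsymbol\Gamma+(\Phi_4\boldsymbol\Gamma)^\top .$$ Put $\boldsymbol\partial=\omega_i\,\partial/\partial\xi_i$, $\mathbf S_0=\frac{\partial^2H_0}{\partial\mathbf y^2}(0,0)$, $\mathbf T_0=\frac{\partial^2H_0}{\partial\mathbf z\partial\mathbf y}(0,0)$, and, at $(\boldsymbol\xi+\mathbf u,\mathbf v,\mathbf w)$, $$\mathbf S=\mathbf V^\top\frac{\partial^2H}{\partial\mathbf y^2}\mathbf V,\qquad \mathbf T=\mathbf W^\top\frac{\partial^2H}{\partial\mathbf z\partial\mathbf y}\mathbf V+\boldsymbol\Lambda^\top\frac{\partial^2H}{\partial\mathbf y^2}\mathbf V .$$ **Theorem.** Let $\sigma\in[0,1]$ and $d\ge1$. There is $r_0>0$, depending only on $\sigma,d,\varrho,H_0,H_1$,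 and for every $\varepsilon_0>0$ there is $c>0$, depending only on $\sigma,d,\varrho,H_0,H_1,\varepsilon_0$, such that the following holds for all $|\varepsilon|\le\varepsilon_0$, $0<r\le r_0$, all $\alpha$ with $|\mathrm{Im}\,\alpha|\le\varrho$ and all $\boldsymbol\varphi$ as above with $\|\boldsymbol\varphi-(0,0,0,\alpha\mathbf e_1,1,0,0)\|_{\sigma,d}\le r$. (a) On the closed strip $\det(\mathbf I+\mathbf u')\ne0$, $W_{11}\neq0$ and $(\boldsymbol\xi+\mathbf u,\mathbf v,\mathbf w)$ lies in the domain of $H_1$. The matrices $\mathbf S,\mathbf T$ have entries in $\mathcal A_{\sigma,d-1}$ and $$\|\mathbf S-\mathbf S_0\|_{\sigma,d-1}+\|\mathbf T-\mathbf T_0\|_{\sigma,d-1}\le c(|\varepsilon|+r).$$ (b) There are symmetric $2\times2$ matrix functions $\mathbf U_{ij},\mathbf E_j,\mathbf K_i$ ($i=1,2$, $1\le j\le N$) with entries in $\mathcal A_{\sigma,d-1}$ and $\max_{i,j}\|\mathbf U_{ij}\|_{\sigma,d-1}+\max_j\|\mathbf E_j\|_{\sigma,d-1}+\max_i\|\mathbf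 K_i\|_{\sigma,d-1}\le c$ such that for all $\boldsymbol\omega\in\mathbb R^N$, all $k$ with $\mathrm{Re}\,k\in[0,1]$, $|\mathrm{Im}\,k|\le\varrho$, all $e,m,M\in\mathbb C$ and all $\delta\boldsymbol\varphi$ as above the following is true. Here "good points" means all points of the closed strip if $d\ge2$ and all points of the open strip if $d=1$ (where $\boldsymbol\mu$, $\partial\boldsymbol\chi/\partial\xi_i$, $\partial\boldsymbol\lambda/\partial\xi_i$, $\partial\boldsymbol\Gamma/\partial\xi_i$ and $\partial\Phi_j/\partial\xi_i$ are defined). 1. At good points $\mathrm{Tr}\,\boldsymbol\Gamma=0$; $\overline{\boldsymbol\mu}=\delta\beta$ (if $d\ge2$ or $\sigma>0$); and there is $\psi_0\in\mathcal A_{\sigma,d-1}$ with $\nabla\psi_0=\boldsymbol\mu-\delta\beta$ at good points. 2. The Gateaux derivatives $\delta\Phi_i=\lim_{t\to0}t^{-1}(\Phi_i(\boldsymbol\varphi+t\,\delta\boldsymbol\varphi)-\Phi_i(\boldsymbol\varphi))$, $t\in\mathbb C$, $i=1,\dots,4$, exist in $\mathcal A_{\sigma,d-1}$, $\delta\Phi_5$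 exists in $\mathbb C$, and at good points, for every $\psi_0$ with $\nabla\psi_0=\boldsymbol\mu-\delta\beta$ at good points, $$\delta\Phi_1=\boldsymbol\partial\psi_0+\boldsymbol\omega\cdot\delta\beta+\Pi_1,\qquad \delta\Phi_2=\mathbf J\boldsymbol\partial\boldsymbol\lambda+\boldsymbol\Omega\boldsymbol\lambda+\mathbf T\boldsymbol\mu+\Pi_2,$$ $$\delta\Phi_3=-\boldsymbol\partial\boldsymbol\chi+\mathbf S\boldsymbol\mu+\mathbf T^\top\boldsymbol\lambda+\Pi_3,$$ $$\delta\Phi_4=\boldsymbol\partial(\mathbf J\boldsymbol\Gamma)+\boldsymbol\Omega\boldsymbol\Gamma+(\boldsymbol\Omega\boldsymbol\Gamma)^\top+\mathbf U_{ij}\frac{\partial\lambda_i}{\partial\xi_j}+\mu_i\mathbf E_i+\lambda_i\mathbf K_i+\Pi_4,$$ $$\delta\Phi_5=\frac1{(2\pi)^{N}}\int_{\mathbb T^{N}}\Big((\mathbf W\boldsymbol\lambda)_1+\chi_i\frac{\partial w_1}{\partial\xi_i}\Big)\,d\boldsymbol\xi .$$ 3. If $\Phi_1,\dots,\Phi_4$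 vanish on the closed strip, then $\Pi_1,\dots,\Pi_4$ vanish there. -/

import Mathlib

open scoped Matrix ENNReal Topology
open Filter MeasureTheory

noncomputable section

namespace LowerTori

variable {N : ℕ}

/-! Throughout, `N = n - 1` is the dimension of the torus. Functions on the closed complex strip
`|Im ξ_j| ≤ h` are represented by functions on `ℂ^N`; only their values on the strip matter. -/

/-- The closed strip `|Im ξ_j| ≤ h`. -/
def strip (N : ℕ) (h : ℝ) : Set (Fin N → ℂ) := {ξ | ∀ j, |(ξ j).im| ≤ h}

/-- The open strip `|Im ξ_j| < h`. -/
def openStrip (N : ℕ) (h : ℝ) : Set (Fin N → ℂ) := {ξ | ∀ j, |(ξ j).im| < h}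

/-- The partial derivative `∂f/∂ξ_i`, taken along the real direction `e_i`. Translations in real
directions preserve the closed strip, so this makes sense on all of it (also for `h = 0`); where `f`
is holomorphic it is the complex partial derivative. -/
def pd (i : Fin N) (f : (Fin N → ℂ) → ℂ) (ξ : Fin N → ℂ) : ℂ :=
  deriv (fun t : ℝ => f (ξ + Pi.single i (t : ℂ))) 0

/-- Iterated partial derivatives. -/
def iterPd (l : List (Fin N)) (f : (Fin N → ℂ) → ℂ) : (Fin N → ℂ) → ℂ := l.foldr pd f

/-- Membership in the Banach space of functions on the closed strip of half-width `h` that are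
`2π`-periodic, holomorphic inside, and have continuous derivatives up to order `d` on the
closed strip. -/
structure MemA (h : ℝ) (d : ℕ) (f : (Fin N → ℂ) → ℂ) : Prop where
  periodic : ∀ ξ ∈ strip N h, ∀ j, f (ξ + Pi.single j (2 * Real.pi : ℂ)) = f ξ
  contDiff : ∀ b : Fin N → ℝ, (∀ j, |b j| ≤ h) →
    ContDiff ℝ d (fun x : Fin N → ℝ => f (fun j => (x j : ℂ) + (b j : ℂ) * Complex.I))
  continuousOn : ∀ l : List (Fin N), l.length ≤ d → ContinuousOn (iterPd l f) (strip N h)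
  holomorphic : DifferentiableOn ℂ f (openStrip N h)

/-- The norm `max_{|k| ≤ d} sup_{strip} |∂^k f|`, with values in `[0, ∞]`. -/
def normA (h : ℝ) (d : ℕ) (f : (Fin N → ℂ) → ℂ) : ℝ≥0∞ :=
  ⨆ l : {l : List (Fin N) // l.length ≤ d}, ⨆ ξ ∈ strip N h, ‖iterPd l.1 f ξ‖ₑ

/-- Norm of a vector valued function: the maximum over the components. -/
def vecNorm {ι : Type*} (h : ℝ) (d : ℕ) (f : (Fin N → ℂ) → ι → ℂ) : ℝ≥0∞ :=
  ⨆ i, normA h d (fun ξ => f ξ i)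

/-- Norm of a matrix valued function: the maximum over the entries. -/
def matNorm {ι κ : Type*} (h : ℝ) (d : ℕ) (f : (Fin N → ℂ) → Matrix ι κ ℂ) : ℝ≥0∞ :=
  ⨆ i, ⨆ j, normA h d (fun ξ => f ξ i j)

/-- All entries of a matrix valued function lie in the space `MemA h d`. -/
def MatMemA {ι κ : Type*} (h : ℝ) (d : ℕ) (f : (Fin N → ℂ) → Matrix ι κ ℂ) : Prop :=
  ∀ i j, MemA h d (fun ξ => f ξ i j)

/-- The gradient `∇f` of a scalar function. -/
def grad (f : (Fin N → ℂ) → ℂ) (ξ : Fin N → ℂ) : Fin N → ℂ := fun i => pd i f ξ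

/-- The Jacobian `f' = (∂f_i/∂ξ_j)` of a vector function. -/
def jac {m : ℕ} (f : (Fin N → ℂ) → Fin m → ℂ) (ξ : Fin N → ℂ) : Matrix (Fin m) (Fin N) ℂ :=
  Matrix.of fun i j => pd j (fun η => f η i) ξ

/-- The derivative `∂f/∂ξ_i` of a vector function. -/
def vpd {ι : Type*} (i : Fin N) (f : (Fin N → ℂ) → ι → ℂ) (ξ : Fin N → ℂ) : ι → ℂ :=
  fun p => pd i (fun η => f η p) ξ

/-- The derivative `∂A/∂ξ_i` of a matrix function. -/
def mpd {ι κ : Type*} (i : Fin N) (A : (Fin N → ℂ) → Matrix ι κ ℂ) (ξ : Fin N → ℂ) :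
    Matrix ι κ ℂ :=
  Matrix.of fun p q => pd i (fun η => A η p q) ξ

/-- The mean value `(2π)^{-N} ∫_{𝕋^N} f dξ` over the real torus. -/
def mean (f : (Fin N → ℂ) → ℂ) : ℂ :=
  (((2 * Real.pi) ^ N)⁻¹ : ℝ) *
    ∫ x in Set.Icc (0 : Fin N → ℝ) (fun _ => 2 * Real.pi), f (fun j => (x j : ℂ))

/-! ### Hamiltonians -/

/-- Phase space, with points `(x, y, z)`. -/
abbrev Phase (N : ℕ) : Type := (Fin N → ℂ) × (Fin N → ℂ) × (Fin 2 → ℂ)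

/-- The complex neighbourhood `|Re p| ≤ R`, `|Im p_j| ≤ R` of zero for `p = (y, z₂)`
(with the Euclidean norm of `Re p`). -/
def actionBall (N : ℕ) (R : ℝ) : Set ((Fin N → ℂ) × ℂ) :=
  {p | (∑ i, (p.1 i).re ^ 2) + p.2.re ^ 2 ≤ R ^ 2 ∧ (∀ i, |(p.1 i).im| ≤ R) ∧ |p.2.im| ≤ R}

/-- The points `(x, y, z)` with `(x, z₁)` in the strip and `(y, z₂)` in the ball of size `R`. -/
def phaseDomain (N : ℕ) (R : ℝ) : Set (Phase N) :=
  {p | (∀ i, |(p.1 i).im| ≤ R) ∧ |(p.2.2 0).im| ≤ R ∧ (p.2.1, p.2.2 1) ∈ actionBall N R}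

/-- The unperturbed Hamiltonian `H₀(y, z₂)` and the perturbation `H₁(x, y, z)` are analytic and
bounded on the complex domains of size `3ρ`, and `H₁` is `2π`-periodic in `x` and `z₁`. -/
structure AnalyticHamiltonian (ρ : ℝ) (H₀ : (Fin N → ℂ) × ℂ → ℂ) (H₁ : Phase N → ℂ) : Prop where
  analytic₀ : AnalyticOnNhd ℂ H₀ (actionBall N (3 * ρ))
  analytic₁ : AnalyticOnNhd ℂ H₁ (phaseDomain N (3 * ρ))
  periodic_x : ∀ p ∈ phaseDomain N (3 * ρ), ∀ j,
    H₁ (p.1 + Pi.single j (2 * Real.pi : ℂ), p.2.1, p.2.2) = H₁ p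
  periodic_z : ∀ p ∈ phaseDomain N (3 * ρ),
    H₁ (p.1, p.2.1, p.2.2 + Pi.single 0 (2 * Real.pi : ℂ)) = H₁ p
  bounded : ∃ C : ℝ, (∀ q ∈ actionBall N (3 * ρ), ‖H₀ q‖ ≤ C) ∧
    ∀ p ∈ phaseDomain N (3 * ρ), ‖H₁ p‖ ≤ C

/-- `H₀` as a function on phase space. -/
def lift₀ (H₀ : (Fin N → ℂ) × ℂ → ℂ) (p : Phase N) : ℂ := H₀ (p.2.1, p.2.2 1)

/-- `H = H₀ + ε H₁`. -/
def ham (H₀ : (Fin N → ℂ) × ℂ → ℂ) (H₁ : Phase N → ℂ) (ε : ℝ) (p : Phase N) : ℂ :=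
  lift₀ H₀ p + ε * H₁ p

/-- The modified Hamiltonian `H_m = H + m z₁ + M z₁² / 2`. -/
def modHam (H : Phase N → ℂ) (m M : ℂ) (p : Phase N) : ℂ :=
  H p + m * p.2.2 0 + M / 2 * p.2.2 0 ^ 2

/-- `∂F/∂y_j`. -/
def dY (j : Fin N) (F : Phase N → ℂ) (p : Phase N) : ℂ := fderiv ℂ F p (0, Pi.single j 1, 0)

/-- `∂F/∂z_j`. -/
def dZ (j : Fin 2) (F : Phase N → ℂ) (p : Phase N) : ℂ := fderiv ℂ F p (0, 0, Pi.single j 1)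

/-- `∇_y F`. -/
def gradY (F : Phase N → ℂ) (p : Phase N) : Fin N → ℂ := fun j => dY j F p

/-- `∇_z F`. -/
def gradZ (F : Phase N → ℂ) (p : Phase N) : Fin 2 → ℂ := fun j => dZ j F p

/-- `∂²F/∂y²`. -/
def hessYY (F : Phase N → ℂ) (p : Phase N) : Matrix (Fin N) (Fin N) ℂ :=
  Matrix.of fun i j => dY i (dY j F) p

/-- `∂²F/∂z∂y`, with entries `∂²F/∂z_i∂y_j`. -/
def hessZY (F : Phase N → ℂ) (p : Phase N) : Matrix (Fin 2) (Fin N) ℂ :=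
  Matrix.of fun i j => dZ i (dY j F) p

/-- `∂²F/∂z²`. -/
def hessZZ (F : Phase N → ℂ) (p : Phase N) : Matrix (Fin 2) (Fin 2) ℂ :=
  Matrix.of fun i j => dZ i (dZ j F) p

/-! ### The coordinates `φ = (β, φ₀, u, w, W₁₁, W₁₂, W₂₁)` on the group of canonical maps -/

/-- Coordinate vectors `φ = (β, φ₀, u, w, W₁₁, W₁₂, W₂₁)`. -/
structure Coord (N : ℕ) where
  β : Fin N → ℂ
  φ₀ : (Fin N → ℂ) → ℂ
  u : (Fin N → ℂ) → Fin N → ℂ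
  w : (Fin N → ℂ) → Fin 2 → ℂ
  W₁₁ : (Fin N → ℂ) → ℂ
  W₁₂ : (Fin N → ℂ) → ℂ
  W₂₁ : (Fin N → ℂ) → ℂ

instance : Add (Coord N) :=
  ⟨fun a b => ⟨a.β + b.β, a.φ₀ + b.φ₀, a.u + b.u, a.w + b.w, a.W₁₁ + b.W₁₁, a.W₁₂ + b.W₁₂,
    a.W₂₁ + b.W₂₁⟩⟩

instance : Sub (Coord N) :=
  ⟨fun a b => ⟨a.β - b.β, a.φ₀ - b.φ₀, a.u - b.u, a.w - b.w, a.W₁₁ - b.W₁₁, a.W₁₂ - b.W₁₂,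
    a.W₂₁ - b.W₂₁⟩⟩

instance : SMul ℂ (Coord N) :=
  ⟨fun t a => ⟨t • a.β, t • a.φ₀, t • a.u, t • a.w, t • a.W₁₁, t • a.W₁₂, t • a.W₂₁⟩⟩

/-- All functional components of the coordinate vector lie in the space `MemA h d`. -/
structure Coord.Mem (h : ℝ) (d : ℕ) (φ : Coord N) : Prop where
  φ₀ : MemA h d φ.φ₀
  u : ∀ i, MemA h d (fun ξ => φ.u ξ i)
  w : ∀ i, MemA h d (fun ξ => φ.w ξ i)
  W₁₁ : MemA h d φ.W₁₁
  W₁₂ : MemA h d φ.W₁₂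
  W₂₁ : MemA h d φ.W₂₁

/-- The norm of a coordinate vector: the maximum of the norms of its components. -/
def Coord.norm (h : ℝ) (d : ℕ) (φ : Coord N) : ℝ≥0∞ :=
  (⨆ i, ‖φ.β i‖ₑ) ⊔ normA h d φ.φ₀ ⊔ vecNorm h d φ.u ⊔ vecNorm h d φ.w ⊔
    normA h d φ.W₁₁ ⊔ normA h d φ.W₁₂ ⊔ normA h d φ.W₂₁

/-- `φ₀(α) = (0, 0, 0, α e₁, 1, 0, 0)`. -/
def Coord.base (N : ℕ) (α : ℂ) : Coord N where
  β := 0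
  φ₀ := 0
  u := 0
  w := fun _ => ![α, 0]
  W₁₁ := 1
  W₁₂ := 0
  W₂₁ := 0

/-- The symplectic matrix `J`. -/
def J : Matrix (Fin 2) (Fin 2) ℂ := !![0, 1; -1, 0]

namespace Coord

/-- `V = (I + u')^{-⊤}`. -/
def V (φ : Coord N) (ξ : Fin N → ℂ) : Matrix (Fin N) (Fin N) ℂ := ((1 + jac φ.u ξ)⁻¹)ᵀ

/-- `∇φ₀ - w₂ ∇w₁`. -/
def g (φ : Coord N) (ξ : Fin N → ℂ) : Fin N → ℂ :=
  grad φ.φ₀ ξ - φ.w ξ 1 • grad (fun η => φ.w η 0) ξ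

/-- `v = β + V (∇φ₀ - w₂ ∇w₁)`. -/
def v (φ : Coord N) (ξ : Fin N → ℂ) : Fin N → ℂ := φ.β + φ.V ξ *ᵥ φ.g ξ

/-- `W`, completed by `W₂₂ = (1 + W₁₂ W₂₁) / W₁₁`. -/
def W (φ : Coord N) (ξ : Fin N → ℂ) : Matrix (Fin 2) (Fin 2) ℂ :=
  !![φ.W₁₁ ξ, φ.W₁₂ ξ; φ.W₂₁ ξ, (1 + φ.W₁₂ ξ * φ.W₂₁ ξ) / φ.W₁₁ ξ]

/-- `Λ = -V (w')^⊤ J W`. -/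
def Lam (φ : Coord N) (ξ : Fin N → ℂ) : Matrix (Fin N) (Fin 2) ℂ :=
  -(φ.V ξ * (jac φ.w ξ)ᵀ * J * φ.W ξ)

/-- `R_i = -V_{ik} (∂W^⊤/∂ξ_k) J W`. -/
def R (φ : Coord N) (i : Fin N) (ξ : Fin N → ℂ) : Matrix (Fin 2) (Fin 2) ℂ :=
  -∑ k, φ.V ξ i k • ((mpd k φ.W ξ)ᵀ * J * φ.W ξ)

/-- The point `(ξ + u, v, w)`. -/
def pt (φ : Coord N) (ξ : Fin N → ℂ) : Phase N := (ξ + φ.u ξ, φ.v ξ, φ.w ξ)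

end Coord

/-! ### The operator `Φ`, for a given modified Hamiltonian `F` -/

/-- `Ω = diag(-k, 1)`. -/
def Om (k : ℂ) : Matrix (Fin 2) (Fin 2) ℂ := !![-k, 0; 0, 1]

def Phi₁ (F : Phase N → ℂ) (e : ℂ) (φ : Coord N) (ξ : Fin N → ℂ) : ℂ := F (φ.pt ξ) - e

def Phi₂ (F : Phase N → ℂ) (φ : Coord N) (ξ : Fin N → ℂ) : Fin 2 → ℂ :=
  (φ.Lam ξ)ᵀ *ᵥ gradY F (φ.pt ξ) + (φ.W ξ)ᵀ *ᵥ gradZ F (φ.pt ξ)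

def Phi₃ (F : Phase N → ℂ) (ω : Fin N → ℝ) (φ : Coord N) (ξ : Fin N → ℂ) : Fin N → ℂ :=
  (φ.V ξ)ᵀ *ᵥ gradY F (φ.pt ξ) - fun i => (ω i : ℂ)

def Phi₄ (F : Phase N → ℂ) (k : ℂ) (φ : Coord N) (ξ : Fin N → ℂ) : Matrix (Fin 2) (Fin 2) ℂ :=
  (∑ i, dY i F (φ.pt ξ) • φ.R i ξ) + (φ.Lam ξ)ᵀ * hessYY F (φ.pt ξ) * φ.Lam ξ
    + (φ.W ξ)ᵀ * hessZY F (φ.pt ξ) * φ.Lam ξ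
    + ((φ.W ξ)ᵀ * hessZY F (φ.pt ξ) * φ.Lam ξ)ᵀ
    + (φ.W ξ)ᵀ * hessZZ F (φ.pt ξ) * φ.W ξ - Om k

def Phi₅ (α : ℂ) (φ : Coord N) : ℂ := mean (fun ξ => φ.w ξ 0) - α

/-- `D` is the Gateaux differential at `φ` in the direction `δ` of the operator `P`, which takes
coordinate vectors to functions; the difference quotients converge in the norm of order `d`. -/
def IsGateaux (h : ℝ) (d : ℕ) (P : Coord N → (Fin N → ℂ) → ℂ) (φ δ : Coord N)
    (D : (Fin N → ℂ) → ℂ) : Prop :=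
  MemA h d D ∧
    Tendsto (fun t : ℂ => normA h d (fun ξ => t⁻¹ * (P (φ + t • δ) ξ - P φ ξ) - D ξ))
      (𝓝[≠] 0) (𝓝 0)

/-! ### The change of variables `δφ ↦ (δβ, ψ₀, χ, λ, Γ)` at the point `φ` -/

/-- The variation `δV = -V (∇δu) V`. -/
def dV (φ δ : Coord N) (ξ : Fin N → ℂ) : Matrix (Fin N) (Fin N) ℂ :=
  -(φ.V ξ * (jac δ.u ξ)ᵀ * φ.V ξ)

/-- The variation `δv`. -/
def dv (φ δ : Coord N) (ξ : Fin N → ℂ) : Fin N → ℂ :=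
  δ.β + φ.V ξ *ᵥ (grad δ.φ₀ ξ - φ.w ξ 1 • grad (fun η => δ.w η 0) ξ
    - δ.w ξ 1 • grad (fun η => φ.w η 0) ξ) + dV φ δ ξ *ᵥ φ.g ξ

/-- The variation `δW`, with
`δW₂₂ = (W₁₂ δW₂₁ + W₂₁ δW₁₂ - W₂₂ δW₁₁) / W₁₁`. -/
def dW (φ δ : Coord N) (ξ : Fin N → ℂ) : Matrix (Fin 2) (Fin 2) ℂ :=
  !![δ.W₁₁ ξ, δ.W₁₂ ξ; δ.W₂₁ ξ,
    (φ.W₁₂ ξ * δ.W₂₁ ξ + φ.W₂₁ ξ * δ.W₁₂ ξ - φ.W ξ 1 1 * δ.W₁₁ ξ) / φ.W₁₁ ξ]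

/-- `χ = V^⊤ δu`. -/
def chi (φ δ : Coord N) (ξ : Fin N → ℂ) : Fin N → ℂ := (φ.V ξ)ᵀ *ᵥ δ.u ξ

/-- `λ = W⁻¹ δw - χ_i W⁻¹ ∂w/∂ξ_i`. -/
def lam (φ δ : Coord N) (ξ : Fin N → ℂ) : Fin 2 → ℂ :=
  (φ.W ξ)⁻¹ *ᵥ δ.w ξ - ∑ i, chi φ δ ξ i • ((φ.W ξ)⁻¹ *ᵥ vpd i φ.w ξ)

/-- `Γ = W⁻¹ δW - χ_i W⁻¹ ∂W/∂ξ_i`. -/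
def Gam (φ δ : Coord N) (ξ : Fin N → ℂ) : Matrix (Fin 2) (Fin 2) ℂ :=
  (φ.W ξ)⁻¹ * dW φ δ ξ - ∑ i, chi φ δ ξ i • ((φ.W ξ)⁻¹ * mpd i φ.W ξ)

/-- `μ = V⁻¹ (δv - χ_i ∂v/∂ξ_i - Λ λ)`. -/
def mu (φ δ : Coord N) (ξ : Fin N → ℂ) : Fin N → ℂ :=
  (φ.V ξ)⁻¹ *ᵥ (dv φ δ ξ - (∑ i, chi φ δ ξ i • vpd i φ.v ξ) - φ.Lam ξ *ᵥ lam φ δ ξ)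

/-! ### The operators in the triangular form -/

/-- `∂f = ω_i ∂f/∂ξ_i`. -/
def dOm (ω : Fin N → ℝ) (f : (Fin N → ℂ) → ℂ) (ξ : Fin N → ℂ) : ℂ := ∑ i, (ω i : ℂ) * pd i f ξ

/-- `∂f` for a vector function `f`. -/
def vdOm {ι : Type*} (ω : Fin N → ℝ) (f : (Fin N → ℂ) → ι → ℂ) (ξ : Fin N → ℂ) : ι → ℂ :=
  fun p => dOm ω (fun η => f η p) ξ

/-- `∂A` for a matrix function `A`. -/
def mdOm {ι κ : Type*} (ω : Fin N → ℝ) (A : (Fin N → ℂ) → Matrix ι κ ℂ) (ξ : Fin N → ℂ) :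
    Matrix ι κ ℂ :=
  Matrix.of fun p q => dOm ω (fun η => A η p q) ξ

/-- `S = V^⊤ (∂²H/∂y²) V`. -/
def S (H : Phase N → ℂ) (φ : Coord N) (ξ : Fin N → ℂ) : Matrix (Fin N) (Fin N) ℂ :=
  (φ.V ξ)ᵀ * hessYY H (φ.pt ξ) * φ.V ξ

/-- `T = W^⊤ (∂²H/∂z∂y) V + Λ^⊤ (∂²H/∂y²) V`. -/
def T (H : Phase N → ℂ) (φ : Coord N) (ξ : Fin N → ℂ) : Matrix (Fin 2) (Fin N) ℂ :=
  (φ.W ξ)ᵀ * hessZY H (φ.pt ξ) * φ.V ξ + (φ.Lam ξ)ᵀ * hessYY H (φ.pt ξ) * φ.V ξ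

/-- `S₀ = ∂²H₀/∂y² (0, 0)`. -/
def S₀ (H₀ : (Fin N → ℂ) × ℂ → ℂ) : Matrix (Fin N) (Fin N) ℂ := hessYY (lift₀ H₀) 0

/-- `T₀ = ∂²H₀/∂z∂y (0, 0)`. -/
def T₀ (H₀ : (Fin N → ℂ) × ℂ → ℂ) : Matrix (Fin 2) (Fin N) ℂ := hessZY (lift₀ H₀) 0

/-- `Π₁ = χ_i ∂Φ₁/∂ξ_i + Φ₂ · λ + Φ₃ · μ`. -/
def Pi₁ (P₁ : (Fin N → ℂ) → ℂ) (P₂ : (Fin N → ℂ) → Fin 2 → ℂ) (P₃ : (Fin N → ℂ) → Fin N → ℂ)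
    (χ μ : (Fin N → ℂ) → Fin N → ℂ) (l : (Fin N → ℂ) → Fin 2 → ℂ) (ξ : Fin N → ℂ) : ℂ :=
  (∑ i, χ ξ i * pd i P₁ ξ) + P₂ ξ ⬝ᵥ l ξ + P₃ ξ ⬝ᵥ μ ξ

/-- `Π₂ = χ_i ∂Φ₂/∂ξ_i + Γ^⊤ Φ₂ + Φ₄ λ + (Jλ)' Φ₃`. -/
def Pi₂ (P₂ : (Fin N → ℂ) → Fin 2 → ℂ) (P₃ : (Fin N → ℂ) → Fin N → ℂ)
    (P₄ : (Fin N → ℂ) → Matrix (Fin 2) (Fin 2) ℂ)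
    (χ : (Fin N → ℂ) → Fin N → ℂ) (l : (Fin N → ℂ) → Fin 2 → ℂ)
    (Γ : (Fin N → ℂ) → Matrix (Fin 2) (Fin 2) ℂ) (ξ : Fin N → ℂ) : Fin 2 → ℂ :=
  (∑ i, χ ξ i • vpd i P₂ ξ) + (Γ ξ)ᵀ *ᵥ P₂ ξ + P₄ ξ *ᵥ l ξ + jac (fun η => J *ᵥ l η) ξ *ᵥ P₃ ξ

/-- `Π₃ = χ_i ∂Φ₃/∂ξ_i - χ' Φ₃`. -/
def Pi₃ (P₃ : (Fin N → ℂ) → Fin N → ℂ) (χ : (Fin N → ℂ) → Fin N → ℂ) (ξ : Fin N → ℂ) :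
    Fin N → ℂ :=
  (∑ i, χ ξ i • vpd i P₃ ξ) - jac χ ξ *ᵥ P₃ ξ

/-- `Π₄ = χ_i ∂Φ₄/∂ξ_i + Φ_{3,i} ∂(JΓ)/∂ξ_i + Φ₄ Γ + (Φ₄ Γ)^⊤`. -/
def Pi₄ (P₃ : (Fin N → ℂ) → Fin N → ℂ) (P₄ : (Fin N → ℂ) → Matrix (Fin 2) (Fin 2) ℂ)
    (χ : (Fin N → ℂ) → Fin N → ℂ) (Γ : (Fin N → ℂ) → Matrix (Fin 2) (Fin 2) ℂ)
    (ξ : Fin N → ℂ) : Matrix (Fin 2) (Fin 2) ℂ :=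
  (∑ i, χ ξ i • mpd i P₄ ξ) + (∑ i, P₃ ξ i • mpd i (fun η => J * Γ η) ξ)
    + P₄ ξ * Γ ξ + (P₄ ξ * Γ ξ)ᵀ

/-- Points of the closed strip at which all terms of the triangular form are defined for
components of class `d ≥ 1`: all points if `d ≥ 2`, the interior points if `d = 1`. -/
def goodPts (N : ℕ) (h : ℝ) (d : ℕ) : Set (Fin N → ℂ) :=
  {ξ | ξ ∈ strip N h ∧ (2 ≤ d ∨ ξ ∈ openStrip N h)}

end LowerTori

end

open LowerTori

noncomputable section

namespace LowerTori

variable {N : ℕ}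

/-! Fix a direction `δ` and let L = δ - χ_i ∂/∂ξ_i act on expressions in `φ` and ξ, where δ stands
for the derivative along `φ + t • δ` at t = 0. The vector χ solves (I + u')χ = δu, which says
exactly that L annihilates the angle component ξ + u. The other new variables name the remaining
variations: Lw = Wλ, LW = WΓ, Lv = Vμ + Λλ. Hence L applied to a function of (ξ + u, v, w) is a
directional derivative in y and z alone, and no x-derivative of the Hamiltonian ever appears
(`Setting.hasL_comp_pt`).

The matrices V, Λ and R_i contain derivatives of `φ`, so L has to be commuted with partial
derivatives: L ∂_k Q = ∂_k L Q + (∂_k χ_i) ∂_i Q (`JC2.hasL_pd_of_hasL`). In LΛ and LR_i the χ'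
terms cancel, and WᵀJW = J, a consequence of det W = 1, simplifies the rest (`Setting.hasL_chi_V`,
`Setting.hasL_chi_Lam`, `Setting.hasL_chi_R`). The Leibniz rule then gives LΦ_j. In it Vᵀ∇_yH_m is
replaced by ω + Φ₃: the vector ω produces the constant coefficient operator ∂, and Φ₃ goes into the
remainder. In the same way the bracket defining Φ₄ is Φ₄ + Ω. Adding χ_i ∂_iΦ_j back gives δΦ_j. The
matrices U come from the term V((Jλ)')ᵀ of LΛ, while E and K collect the directional derivatives of
the first and second derivatives of H, K also the R-part of LΛ. The terms m z₁ + M z₁²/2 do not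
enter these coefficients.

That μ - δβ is a gradient reflects the identity (I + u')ᵀ(v - β) = ∇φ₀ - w₂∇w₁: applying L to it
gives the potential u·δβ + Lφ₀ - w₂ Lw₁ (`Setting.grad_potential`), and integration over the torus
gives the mean of μ.

On the analytic side everything is holomorphic in t. The class `HF` consists of families, indexed by
an arbitrary set, whose ξ-derivatives up to a given order are bounded uniformly in the index, in t
and in ξ. It is stable under algebra, under inversion away from zero and under composition with the
Hamiltonian. Cauchy and Schwarz estimates in t, applied to each ξ-derivative, yield Gateaux
derivatives in norm (`exists_isGateaux`) and linear closeness to the base point (`HF.normA_sub_le`).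
Uniform constants are obtained by letting the index run through all admissible data. Compactness in
α is not available because Re α is arbitrary; for the same reason w₁ is only known to have bounded
derivatives, which is what the weaker class `HW` records. -/

/-! ### Holomorphic functions on normed spaces -/

/-- Second order Cauchy estimate on a disc. -/
theorem norm_sub_sub_deriv_le {f : ℂ → ℂ} {R C : ℝ} (hR : 0 < R)
    (hf : DifferentiableOn ℂ f (Metric.ball 0 R)) (hC : ∀ t ∈ Metric.ball (0 : ℂ) R, ‖f t‖ ≤ C)
    {t : ℂ} (ht : t ∈ Metric.ball (0 : ℂ) R) :
    ‖f t - f 0 - t * deriv f 0‖ ≤ 4 * C * (‖t‖ / R) ^ 2 := by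
  have h0 : (0 : ℂ) ∈ Metric.ball (0 : ℂ) R := Metric.mem_ball_self hR
  have hd0 : DifferentiableAt ℂ f 0 := hf.differentiableAt (Metric.isOpen_ball.mem_nhds h0)
  have hder : ‖deriv f 0‖ ≤ 2 * C / R := by
    refine Complex.norm_deriv_le_div_of_mapsTo_ball hf (fun z hz => ?_) hR
    rw [mem_closedBall_iff_norm]
    exact (norm_sub_le _ _).trans (by linarith [hC z hz, hC 0 h0])
  -- The Taylor remainder of order one is bounded by 2C + 2C on the disc and is o(s) at the centre,
  -- so the Schwarz lemma for a zero of order two applies.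
  have key := Complex.dist_le_mul_div_pow_of_mapsTo_ball_of_isLittleO
    (f := fun s => f s - f 0 - s * deriv f 0) (c := 0) (z := t) (R₁ := R) (R₂ := 4 * C) (n := 1)
    ((hf.sub_const _).sub (differentiableOn_id.mul_const _)) ?_ ?_ ht
  · simpa using key
  · intro z hz
    have hz' : ‖z‖ ≤ R := (mem_ball_zero_iff.1 hz).le
    have h1 : ‖z * deriv f 0‖ ≤ 2 * C := by
      rw [norm_mul]
      calc ‖z‖ * ‖deriv f 0‖ ≤ R * (2 * C / R) := by gcongr
        _ = 2 * C := by field_simp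
    have h2 := norm_sub_le (f z - f 0) (z * deriv f 0)
    have h3 := norm_sub_le (f z) (f 0)
    simp only [mem_closedBall_iff_norm, sub_self, zero_mul, sub_zero]
    linarith [hC z hz, hC 0 h0]
  · have := hd0.hasDerivAt.isLittleO
    simp only [sub_zero, smul_eq_mul, sub_self, zero_mul, pow_one] at this ⊢
    exact this.norm_right

/-- Uniform limits of holomorphic functions are holomorphic. -/
theorem differentiableAt_of_tendstoUniformlyOn {E ι : Type*} [NormedAddCommGroup E]
    [NormedSpace ℂ E] {x : E} {η : ℝ} (hη : 0 < η) {l : Filter ι} [l.NeBot]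
    {F : ι → E → ℂ} {f : E → ℂ}
    (hF : ∀ᶠ n in l, DifferentiableOn ℂ (F n) (Metric.ball x η))
    (hlim : TendstoUniformlyOn F f l (Metric.ball x η)) : DifferentiableAt ℂ f x := by
  have hsub : ∀ y ∈ Metric.ball x (η / 2), Metric.ball y (η / 2) ⊆ Metric.ball x η := by
    intro y hy
    refine Metric.ball_subset_ball' ?_
    rw [Metric.mem_ball] at hy
    linarith
  have hC : UniformCauchySeqOn (fun n => fderiv ℂ (F n)) l (Metric.ball x (η / 2)) := by
    intro u hu
    obtain ⟨ε, hε, hεu⟩ := Metric.mem_uniformity_dist.1 hu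
    -- Two members this close to `f` differ by at most εη/8, hence by εη/4 after subtracting the
    -- difference at `y`. Cauchy's estimate on a ball of radius η/2 turns this into ε/2 for the
    -- derivatives.
    have h1 := Metric.tendstoUniformlyOn_iff.1 hlim (ε * η / 16) (by positivity)
    filter_upwards [(h1.and hF).prod_mk (h1.and hF)] with m hm y hy
    refine hεu ?_
    have hb : ∀ z ∈ Metric.ball x η, ‖F m.1 z - F m.2 z‖ ≤ ε * η / 8 := by
      intro z hz
      rw [← dist_eq_norm]
      have := dist_triangle_left (F m.1 z) (F m.2 z) (f z)
      linarith [hm.1.1 z hz, hm.2.1 z hz]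
    have hdiff : ∀ n, DifferentiableOn ℂ (F n) (Metric.ball x η) → DifferentiableAt ℂ (F n) y :=
      fun n hn => hn.differentiableAt
        (Metric.isOpen_ball.mem_nhds (hsub y hy (Metric.mem_ball_self (half_pos hη))))
    have := Complex.norm_fderiv_le_div_of_mapsTo_ball (f := fun z => F m.1 z - F m.2 z) (c := y)
      (R₁ := η / 2) (R₂ := ε * η / 4) ((hm.1.2.sub hm.2.2).mono (hsub y hy)) (fun z hz => by
        rw [mem_closedBall_iff_norm]
        refine (norm_sub_le _ _).trans ?_
        linarith [hb z (hsub y hy hz), hb y (hsub y hy (Metric.mem_ball_self (half_pos hη)))])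
      (half_pos hη)
    rw [fderiv_fun_sub (hdiff _ hm.1.2) (hdiff _ hm.2.2), ← dist_eq_norm] at this
    refine this.trans_lt ?_
    have : ε * η / 4 / (η / 2) = ε / 2 := by field_simp; ring
    linarith
  choose! g hg using fun y (hy : y ∈ Metric.ball x (η / 2)) =>
    cauchy_map_iff_exists_tendsto.1 (hC.cauchy_map hy)
  have hU := hC.tendstoUniformlyOn_of_tendsto hg
  refine (hasFDerivAt_of_tendstoUniformlyOnFilter (l := l) (f := F) (f' := fun n => fderiv ℂ (F n))
    (g' := g) ?_ ?_ ?_).differentiableAt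
  · exact (tendstoUniformlyOn_iff_tendstoUniformlyOnFilter.1 hU).mono_right
      (le_principal_iff.2 (Metric.ball_mem_nhds x (half_pos hη)))
  · refine eventually_prod_iff.2 ⟨_, hF, fun y => y ∈ Metric.ball x η, Metric.ball_mem_nhds x hη, ?_⟩
    intro n hn y hy
    exact (hn.differentiableAt (Metric.isOpen_ball.mem_nhds hy)).hasFDerivAt
  · filter_upwards [Metric.ball_mem_nhds x hη] with y hy using hlim.tendsto_at hy

/-- Directional derivatives of holomorphic functions are holomorphic. -/
theorem differentiableOn_fderiv_apply {E : Type*} [NormedAddCommGroup E]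
    [NormedSpace ℂ E] {U : Set E} (hU : IsOpen U) {f : E → ℂ} (hf : DifferentiableOn ℂ f U) (e : E) :
    DifferentiableOn ℂ (fun y => fderiv ℂ f y e) U := by
  intro x hx
  obtain ⟨C, hC⟩ : ∃ C, ∀ᶠ y in 𝓝 x, ‖f y‖ ≤ C := by
    refine ⟨‖f x‖ + 1, ?_⟩
    have := ((hf.differentiableAt (hU.mem_nhds hx)).continuousAt.norm).eventually
      (gt_mem_nhds (show ‖f x‖ < ‖f x‖ + 1 by linarith))
    filter_upwards [this] with y hy using hy.le
  obtain ⟨η, hη, hball⟩ := Metric.mem_nhds_iff.1 (inter_mem hC (hU.mem_nhds hx))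
  have hC0 : 0 ≤ C := (norm_nonneg _).trans (hball (Metric.mem_ball_self hη)).1
  obtain ⟨R, hR, hRe⟩ : ∃ R : ℝ, 0 < R ∧ R * ‖e‖ ≤ η / 2 := by
    refine ⟨η / 2 / (‖e‖ + 1), by positivity, ?_⟩
    rw [div_mul_eq_mul_div, div_le_iff₀ (by positivity)]
    gcongr; linarith
  have hline : ∀ y ∈ Metric.ball x (η / 2), ∀ t ∈ Metric.ball (0 : ℂ) R,
      y + t • e ∈ Metric.ball x η := by
    intro y hy t ht
    rw [mem_ball_iff_norm] at hy ⊢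
    rw [mem_ball_zero_iff] at ht
    have h1 : ‖t • e‖ ≤ η / 2 := by
      rw [norm_smul]; exact (mul_le_mul_of_nonneg_right ht.le (norm_nonneg _)).trans hRe
    calc ‖y + t • e - x‖ = ‖(y - x) + t • e‖ := by congr 1; abel
      _ ≤ ‖y - x‖ + ‖t • e‖ := norm_add_le _ _
      _ < η := by linarith
  have hdiff : ∀ z ∈ Metric.ball x η, DifferentiableAt ℂ f z := fun z hz =>
    hf.differentiableAt (hU.mem_nhds (hball hz).2)
  -- The directional derivative is a locally uniform limit of holomorphic difference quotients: the
  -- second order Cauchy estimate bounds the error by a multiple of |t|.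
  refine (differentiableAt_of_tendstoUniformlyOn (half_pos hη) (l := 𝓝[≠] (0 : ℂ))
    (F := fun t y => t⁻¹ * (f (y + t • e) - f y)) ?_ ?_).differentiableWithinAt
  · filter_upwards [nhdsWithin_le_nhds (Metric.ball_mem_nhds (0 : ℂ) hR)] with t ht y hy
    refine DifferentiableAt.differentiableWithinAt ?_
    refine (((hdiff _ (hline y hy t ht)).comp y (by fun_prop)).sub (hdiff y ?_)).const_mul _
    exact Metric.ball_subset_ball (by linarith) hy
  · rw [Metric.tendstoUniformlyOn_iff]
    intro ε hε
    have hlim : Tendsto (fun t : ℂ => 4 * C * ‖t‖ / R ^ 2) (𝓝[≠] 0) (𝓝 0) := by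
      have : Tendsto (fun t : ℂ => 4 * C * ‖t‖ / R ^ 2) (𝓝 0) (𝓝 (4 * C * ‖(0:ℂ)‖ / R ^ 2)) :=
        Continuous.tendsto (by fun_prop) _
      simp only [norm_zero, mul_zero, zero_div] at this
      exact this.mono_left nhdsWithin_le_nhds
    filter_upwards [nhdsWithin_le_nhds (Metric.ball_mem_nhds (0 : ℂ) hR), self_mem_nhdsWithin,
      hlim.eventually (gt_mem_nhds hε)] with t ht ht0 hlt y hy
    have ht0' : t ≠ 0 := ht0
    have hd : ∀ s ∈ Metric.ball (0 : ℂ) R, HasDerivAt (fun s : ℂ => f (y + s • e))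
        (fderiv ℂ f (y + s • e) e) s := by
      intro s hs
      refine (hdiff _ (hline y hy s hs)).hasFDerivAt.comp_hasDerivAt s ?_
      simpa using ((hasDerivAt_id s).smul_const e).const_add y
    have := norm_sub_sub_deriv_le hR (fun s hs => (hd s hs).differentiableAt.differentiableWithinAt)
      (fun s hs => (hball (hline y hy s hs)).1) ht
    rw [(hd 0 (Metric.mem_ball_self hR)).deriv] at this
    simp only [zero_smul, add_zero] at this
    rw [dist_comm, dist_eq_norm]
    have e1 : t⁻¹ * (f (y + t • e) - f y) - fderiv ℂ f y e
        = t⁻¹ * (f (y + t • e) - f y - t * fderiv ℂ f y e) := by field_simp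
    rw [e1, norm_mul, norm_inv]
    refine lt_of_le_of_lt ?_ hlt
    calc ‖t‖⁻¹ * _ ≤ ‖t‖⁻¹ * (4 * C * (‖t‖ / R) ^ 2) := by gcongr
      _ = 4 * C * ‖t‖ / R ^ 2 := by
        have : ‖t‖ ≠ 0 := norm_ne_zero_iff.2 ht0'
        field_simp

/-- Holomorphic functions on open sets of finite dimensional spaces are smooth. -/
theorem contDiffOn_of_differentiableOn {E : Type*} [NormedAddCommGroup E] [NormedSpace ℂ E]
    [FiniteDimensional ℂ E] {U : Set E} (hU : IsOpen U) (n : ℕ) :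
    ∀ {f : E → ℂ}, DifferentiableOn ℂ f U → ContDiffOn ℂ n f U := by
  induction n with
  | zero => intro f hf; exact contDiffOn_zero.2 hf.continuousOn
  | succ n ih =>
    intro f hf
    rw [Nat.cast_add, Nat.cast_one, contDiffOn_succ_iff_fderiv_of_isOpen hU]
    refine ⟨hf, by simp, contDiffOn_clm_apply.2 fun e => ih (differentiableOn_fderiv_apply hU hf e)⟩

/-- A function with continuous partial derivatives is differentiable. -/
theorem hasFDerivAt_of_partial {ι : Type*} [Fintype ι] [DecidableEq ι] {g : (ι → ℝ) → ℂ}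
    {g' : ι → (ι → ℝ) → ℂ} (x : ι → ℝ)
    (hg : ∀ y j, HasDerivAt (fun t : ℝ => g (y + Pi.single j t)) (g' j y) 0)
    (hc : ∀ j, ContinuousAt (g' j) x) :
    HasFDerivAt g (∑ j, (ContinuousLinearMap.proj (R := ℝ) (φ := fun _ : ι => ℝ) j).smulRight
      (g' j x)) x := by
  rw [hasFDerivAt_iff_isLittleO_nhds_zero, Asymptotics.isLittleO_iff]
  intro c hc0
  obtain ⟨c', hc'0, hc'⟩ : ∃ c' : ℝ, 0 < c' ∧ c' * Fintype.card ι ≤ c := by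
    refine ⟨c / (Fintype.card ι + 1), by positivity, ?_⟩
    rw [div_mul_eq_mul_div, div_le_iff₀ (by positivity)]
    gcongr; linarith
  have hnear : ∀ᶠ y in 𝓝 x, ∀ j, ‖g' j y - g' j x‖ ≤ c' := by
    rw [eventually_all]
    intro j
    filter_upwards [(hc j).eventually (Metric.closedBall_mem_nhds _ hc'0)] with y hy
    simpa [dist_eq_norm] using hy
  obtain ⟨δ, hδ, hδ'⟩ := Metric.eventually_nhds_iff_ball.1 hnear
  filter_upwards [Metric.ball_mem_nhds (0 : ι → ℝ) hδ] with h hh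
  rw [mem_ball_zero_iff] at hh
  -- The increment `h` is switched on one coordinate at a time. By the mean value inequality each
  -- coordinate costs at most c'‖h‖, since the partial derivative stays within c' of its value at
  -- `x`.
  have claim : ∀ s : Finset ι, ‖g (x + fun i => if i ∈ s then h i else 0) - g x
      - ∑ j ∈ s, h j • g' j x‖ ≤ s.card * (c' * ‖h‖) := by
    intro s
    induction s using Finset.induction_on with
    | empty => simp [← Pi.zero_def]
    | insert j s hj ih =>
      set k : ι → ℝ := fun i => if i ∈ s then h i else 0 with hk
      have hins : (fun i => if i ∈ insert j s then h i else 0) = k + Pi.single j (h j) := by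
        ext i
        by_cases hij : i = j
        · subst hij; simp [hk, hj]
        · simp [hk, hij, Finset.mem_insert]
      rw [hins, Finset.sum_insert hj, Finset.card_insert_of_notMem hj]
      have hpd : ∀ t : ℝ, HasDerivAt (fun t : ℝ => g (x + (k + Pi.single j t)) - t • g' j x)
          (g' j (x + k + Pi.single j t) - g' j x) t := by
        intro t
        have h1 := hg (x + k + Pi.single j t) j
        have h2 : HasDerivAt (fun s : ℝ => g (x + (k + Pi.single j s)))
            (g' j (x + k + Pi.single j t)) t := by
          have h3 := HasDerivAt.comp_sub_const t t (f := fun s : ℝ => g (x + k + Pi.single j t + Pi.single j s)) (by simpa using h1)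
          refine h3.congr_of_eventuallyEq (Eventually.of_forall fun s => ?_)
          simp only
          congr 1
          rw [add_assoc (x + k), ← Pi.single_add, add_sub_cancel, add_assoc]
        have h4 := (hasDerivAt_id t).smul_const (g' j x)
        rw [one_smul] at h4
        exact h2.sub h4
      have hmem : ∀ t : ℝ, |t| ≤ |h j| → x + k + Pi.single j t ∈ Metric.ball x δ := by
        intro t ht
        rw [mem_ball_iff_norm, add_assoc, add_sub_cancel_left]
        refine lt_of_le_of_lt ?_ hh
        rw [pi_norm_le_iff_of_nonneg (norm_nonneg _)]
        intro i
        by_cases hij : i = j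
        · subst hij; simpa [hk, hj] using ht.trans (norm_le_pi_norm h i)
        · by_cases his : i ∈ s
          · simpa [hk, hij, his] using norm_le_pi_norm h i
          · simp [hk, hij, his]
      have hmv := Convex.norm_image_sub_le_of_norm_hasDerivWithin_le
        (f := fun t : ℝ => g (x + (k + Pi.single j t)) - t • g' j x)
        (s := Set.Icc (-|h j|) |h j|) (C := c') (x := 0) (y := h j)
        (fun t _ => (hpd t).hasDerivWithinAt) (fun t ht => hδ' _ (hmem t (abs_le.2 ht)) j)
        (convex_Icc _ _) ⟨by simp, abs_nonneg _⟩ ⟨neg_abs_le _, le_abs_self _⟩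
      simp only [Pi.single_zero, add_zero, zero_smul, sub_zero] at hmv
      have hhj : ‖h j‖ ≤ ‖h‖ := norm_le_pi_norm h j
      have split : ∀ a b c d e : ℂ, a - c - (d + e) = (a - d - b) + (b - c - e) := by
        intros; ring
      rw [split _ (g (x + k))]
      refine (norm_add_le _ _).trans ((add_le_add hmv ih).trans ?_)
      have := mul_le_mul_of_nonneg_left hhj hc'0.le
      push_cast
      rw [add_mul, one_mul]
      linarith
  have := claim Finset.univ
  simp only [Finset.mem_univ, if_true] at this
  simp only [sum_apply, ContinuousLinearMap.smulRight_apply,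
    ContinuousLinearMap.proj_apply]
  refine this.trans ?_
  rw [Finset.card_univ, ← mul_assoc, mul_comm _ c']
  gcongr

/-! ### Strips and partial derivatives -/

/-- The point of `ℂ^N` with real part `x` and imaginary part `b`. -/
def slice (b x : Fin N → ℝ) : Fin N → ℂ := fun j => (x j : ℂ) + (b j : ℂ) * Complex.I

theorem slice_re_im (ξ : Fin N → ℂ) : slice (fun j => (ξ j).im) (fun j => (ξ j).re) = ξ := by
  ext j; exact Complex.re_add_im (ξ j)

theorem slice_mem_strip {h : ℝ} {b : Fin N → ℝ} (hb : ∀ j, |b j| ≤ h) (x : Fin N → ℝ) :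
    slice b x ∈ strip N h := by
  intro j; simpa [slice] using hb j

theorem slice_add_single (b x : Fin N → ℝ) (j : Fin N) (t : ℝ) :
    slice b x + Pi.single j (t : ℂ) = slice b (x + Pi.single j t) := by
  ext i
  by_cases hij : i = j
  · subst hij; simp [slice]; ring
  · simp [slice, hij]

theorem continuous_slice (b : Fin N → ℝ) : Continuous (slice b) := by
  unfold slice; fun_prop

theorem contDiff_slice (b : Fin N → ℝ) (n : ℕ∞) : ContDiff ℝ n (slice b) := by
  unfold slice
  refine contDiff_pi.2 fun j => ContDiff.add ?_ contDiff_const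
  exact Complex.ofRealCLM.contDiff.comp (contDiff_apply ℝ ℝ j)

theorem strip_add_real {h : ℝ} {ξ : Fin N → ℂ} (hξ : ξ ∈ strip N h) (x : Fin N → ℝ) :
    (ξ + fun j => (x j : ℂ)) ∈ strip N h := by
  intro j; simpa using hξ j

theorem single_ofReal (j : Fin N) (t : ℝ) :
    (Pi.single j (t : ℂ) : Fin N → ℂ) = fun i => ((Pi.single j t : Fin N → ℝ) i : ℂ) := by
  ext i
  by_cases hij : i = j
  · subst hij; simp
  · simp [hij]

theorem strip_add_single {h : ℝ} {ξ : Fin N → ℂ} (hξ : ξ ∈ strip N h) (j : Fin N) (t : ℝ) :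
    ξ + Pi.single j (t : ℂ) ∈ strip N h := by
  rw [single_ofReal]; exact strip_add_real hξ _

theorem strip_add_period {h : ℝ} {ξ : Fin N → ℂ} (hξ : ξ ∈ strip N h) (j : Fin N) :
    ξ + Pi.single j (2 * Real.pi : ℂ) ∈ strip N h := by
  simpa using strip_add_single hξ j (2 * Real.pi)

theorem openStrip_subset {h : ℝ} : openStrip N h ⊆ strip N h := fun _ hξ j => (hξ j).le

theorem isOpen_openStrip {h : ℝ} : IsOpen (openStrip N h) := by
  simp only [openStrip, Set.ofPred_forall]
  exact isOpen_iInter_of_finite fun j => isOpen_lt (by fun_prop) continuous_const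

/-- Differentiability in the real direction `e_j`. -/
def DirDiff (j : Fin N) (f : (Fin N → ℂ) → ℂ) (ξ : Fin N → ℂ) : Prop :=
  DifferentiableAt ℝ (fun t : ℝ => f (ξ + Pi.single j (t : ℂ))) 0

theorem DirDiff.hasDerivAt {j : Fin N} {f : (Fin N → ℂ) → ℂ} {ξ : Fin N → ℂ} (hf : DirDiff j f ξ) :
    HasDerivAt (fun t : ℝ => f (ξ + Pi.single j (t : ℂ))) (pd j f ξ) 0 :=
  DifferentiableAt.hasDerivAt hf

theorem hasDerivAt_line {j : Fin N} {f : (Fin N → ℂ) → ℂ} {ξ : Fin N → ℂ} {s : ℝ}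
    (hf : DirDiff j f (ξ + Pi.single j (s : ℂ))) :
    HasDerivAt (fun t : ℝ => f (ξ + Pi.single j (t : ℂ))) (pd j f (ξ + Pi.single j (s : ℂ))) s := by
  have h3 := HasDerivAt.comp_sub_const s s
    (f := fun t : ℝ => f (ξ + Pi.single j (s : ℂ) + Pi.single j (t : ℂ)))
    (by simpa using hf.hasDerivAt)
  refine h3.congr_of_eventuallyEq (Eventually.of_forall fun t => ?_)
  simp only
  congr 1
  rw [add_assoc, ← Pi.single_add]
  congr 2
  push_cast; ring

theorem pd_eq_of_hasDerivAt {j : Fin N} {f : (Fin N → ℂ) → ℂ} {ξ : Fin N → ℂ} {a : ℂ}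
    (h : HasDerivAt (fun t : ℝ => f (ξ + Pi.single j (t : ℂ))) a 0) : pd j f ξ = a := h.deriv

theorem eqOn_line {h : ℝ} {f g : (Fin N → ℂ) → ℂ} (hfg : ∀ ξ ∈ strip N h, f ξ = g ξ)
    {ξ : Fin N → ℂ} (hξ : ξ ∈ strip N h) (j : Fin N) :
    (fun t : ℝ => f (ξ + Pi.single j (t : ℂ))) = fun t : ℝ => g (ξ + Pi.single j (t : ℂ)) :=
  funext fun t => hfg _ (strip_add_single hξ j t)

/-- Translations in real directions preserve the closed strip, so `pd` never sees values off it.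
This is what allows identities valid only on the strip to be differentiated, boundary points
included. -/
theorem pd_congr {h : ℝ} {f g : (Fin N → ℂ) → ℂ} (hfg : ∀ ξ ∈ strip N h, f ξ = g ξ)
    {ξ : Fin N → ℂ} (hξ : ξ ∈ strip N h) (j : Fin N) : pd j f ξ = pd j g ξ := by
  unfold pd; rw [eqOn_line hfg hξ j]

theorem dirDiff_congr {h : ℝ} {f g : (Fin N → ℂ) → ℂ} (hfg : ∀ ξ ∈ strip N h, f ξ = g ξ)
    {ξ : Fin N → ℂ} (hξ : ξ ∈ strip N h) {j : Fin N} (hf : DirDiff j f ξ) : DirDiff j g ξ := by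
  unfold DirDiff at *; rwa [← eqOn_line hfg hξ j]

theorem hasDerivAt_add_single (ξ : Fin N → ℂ) (j : Fin N) (t : ℝ) :
    HasDerivAt (fun t : ℝ => ξ + Pi.single j (t : ℂ)) (Pi.single j 1) t := by
  have : (fun t : ℝ => ξ + Pi.single j (t : ℂ)) =
      fun t : ℝ => ξ + (t : ℂ) • (Pi.single j (1 : ℂ) : Fin N → ℂ) := by
    ext t i
    by_cases hij : i = j
    · subst hij; simp
    · simp [hij]
  rw [this]
  simpa using ((Complex.ofRealCLM.hasDerivAt (x := t)).smul_const
    (Pi.single j (1 : ℂ) : Fin N → ℂ)).const_add ξ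

theorem hasDerivAt_line_of_hol {h : ℝ} {f : (Fin N → ℂ) → ℂ}
    (hf : DifferentiableOn ℂ f (openStrip N h)) {ξ : Fin N → ℂ} (hξ : ξ ∈ openStrip N h)
    (j : Fin N) :
    HasDerivAt (fun t : ℝ => f (ξ + Pi.single j (t : ℂ))) (fderiv ℂ f ξ (Pi.single j 1)) 0 := by
  have h1 := ((hf.differentiableAt (isOpen_openStrip.mem_nhds hξ)).hasFDerivAt.restrictScalars ℝ)
  have h2 := hasDerivAt_add_single ξ j 0
  have h3 : ξ + Pi.single j ((0 : ℝ) : ℂ) = ξ := by simp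
  have h4 : HasFDerivAt f ((fderiv ℂ f ξ).restrictScalars ℝ) (ξ + Pi.single j ((0 : ℝ) : ℂ)) := by
    rw [h3]; exact h1
  exact h4.comp_hasDerivAt (0 : ℝ) h2

theorem differentiableOn_pd {h : ℝ} {f : (Fin N → ℂ) → ℂ}
    (hf : DifferentiableOn ℂ f (openStrip N h)) (j : Fin N) :
    DifferentiableOn ℂ (pd j f) (openStrip N h) :=
  (differentiableOn_fderiv_apply isOpen_openStrip hf (Pi.single j 1)).congr fun _ hξ =>
    pd_eq_of_hasDerivAt (hasDerivAt_line_of_hol hf hξ j)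

/-! ### The space `MemA` by induction on the number of derivatives -/

/-- The properties of elements of `MemA` without derivatives. -/
structure BaseA (h : ℝ) (f : (Fin N → ℂ) → ℂ) : Prop where
  periodic : ∀ ξ ∈ strip N h, ∀ j, f (ξ + Pi.single j (2 * Real.pi : ℂ)) = f ξ
  cont : ContinuousOn f (strip N h)
  hol : DifferentiableOn ℂ f (openStrip N h)

theorem MemA.base {h : ℝ} {d : ℕ} {f : (Fin N → ℂ) → ℂ} (hf : MemA h d f) : BaseA h f :=
  ⟨hf.periodic, hf.continuousOn [] (Nat.zero_le _), hf.holomorphic⟩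

theorem BaseA.memA {h : ℝ} {f : (Fin N → ℂ) → ℂ} (hf : BaseA h f) : MemA h 0 f where
  periodic := hf.periodic
  contDiff b hb := by
    refine contDiff_zero.2 (hf.cont.comp_continuous (continuous_slice b) (slice_mem_strip hb))
  continuousOn l hl := by
    obtain rfl := List.length_eq_zero_iff.1 (Nat.le_zero.1 hl)
    exact hf.cont
  holomorphic := hf.hol

theorem iterPd_append (l : List (Fin N)) (j : Fin N) (f : (Fin N → ℂ) → ℂ) :
    iterPd (l ++ [j]) f = iterPd l (pd j f) := by
  simp [iterPd]

theorem iterPd_congr {h : ℝ} {f g : (Fin N → ℂ) → ℂ} (hfg : ∀ ξ ∈ strip N h, f ξ = g ξ)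
    (l : List (Fin N)) : ∀ ξ ∈ strip N h, iterPd l f ξ = iterPd l g ξ := by
  induction l with
  | nil => exact hfg
  | cons j l ih => exact fun ξ hξ => pd_congr ih hξ j

/-- The last entry of the list is the derivative applied first. Peeling it off reduces derivatives
of `f` to derivatives of `pd j f`, which is the shape needed for induction on the order. -/
theorem forall_list_succ {d : ℕ} {P : List (Fin N) → Prop} :
    (∀ l : List (Fin N), l.length ≤ d + 1 → P l) ↔
      P [] ∧ ∀ j, ∀ l : List (Fin N), l.length ≤ d → P (l ++ [j]) := by
  refine ⟨fun h => ⟨h [] (Nat.zero_le _), fun j l hl => h _ (by simpa using hl)⟩, fun h l hl => ?_⟩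
  rcases List.eq_nil_or_concat l with rfl | ⟨l', j, rfl⟩
  · exact h.1
  · rw [List.concat_eq_append] at hl ⊢
    exact h.2 j l' (by simpa using hl)

theorem MemA.dirDiff {h : ℝ} {d : ℕ} {f : (Fin N → ℂ) → ℂ} (hf : MemA h d f) (hd : 1 ≤ d)
    {ξ : Fin N → ℂ} (hξ : ξ ∈ strip N h) (j : Fin N) : DirDiff j f ξ := by
  have h1 : Differentiable ℝ (fun x => f (slice (fun j => (ξ j).im) x)) :=
    (hf.contDiff (fun j => (ξ j).im) hξ).differentiable (by exact_mod_cast (by omega : d ≠ 0))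
  have h2 : (fun t : ℝ => f (ξ + Pi.single j (t : ℂ))) =
      (fun x => f (slice (fun j => (ξ j).im) x)) ∘
        fun t : ℝ => (fun j => (ξ j).re) + Pi.single j t := by
    ext t
    simp only [Function.comp, ← slice_add_single, slice_re_im]
  unfold DirDiff
  rw [h2]
  refine (h1 _).comp _ ?_
  refine DifferentiableAt.const_add _ ?_
  exact (ContinuousLinearMap.single ℝ (fun _ : Fin N => ℝ) j).differentiableAt

theorem pd_slice {f : (Fin N → ℂ) → ℂ} {b x : Fin N → ℝ}
    (hf : DifferentiableAt ℝ (fun x => f (slice b x)) x) (j : Fin N) :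
    pd j f (slice b x) = fderiv ℝ (fun x => f (slice b x)) x (Pi.single j 1) := by
  apply pd_eq_of_hasDerivAt
  simp_rw [slice_add_single]
  have h2 : HasDerivAt (fun t : ℝ => x + Pi.single j t) (Pi.single j 1) 0 := by
    simpa using (((ContinuousLinearMap.single ℝ (fun _ : Fin N => ℝ) j)).hasDerivAt
      (x := (0 : ℝ))).const_add x
  have h3 : HasFDerivAt (fun x => f (slice b x)) (fderiv ℝ (fun x => f (slice b x)) x)
    (x + Pi.single j (0 : ℝ)) := by simpa using hf.hasFDerivAt
  exact h3.comp_hasDerivAt (0 : ℝ) h2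

theorem MemA.pd {h : ℝ} {d : ℕ} {f : (Fin N → ℂ) → ℂ} (hf : MemA h (d + 1) f) (j : Fin N) :
    MemA h d (pd j f) where
  periodic ξ hξ k := by
    unfold LowerTori.pd
    congr 1
    ext t
    rw [add_right_comm, hf.periodic _ (strip_add_single hξ j t)]
  contDiff b hb := by
    have h1 := hf.contDiff b hb
    have h2 : (fun x => LowerTori.pd j f (slice b x)) =
        fun x => fderiv ℝ (fun x => f (slice b x)) x (Pi.single j 1) := by
      ext x
      exact pd_slice ((h1.differentiable (by exact_mod_cast d.succ_ne_zero)) x) j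
    change ContDiff ℝ d (fun x => LowerTori.pd j f (slice b x))
    rw [h2]
    refine (h1.fderiv_right (m := d) (by exact_mod_cast le_rfl)).clm_apply contDiff_const
  continuousOn l hl := by
    rw [← iterPd_append]
    exact hf.continuousOn _ (by simpa using hl)
  holomorphic := differentiableOn_pd hf.holomorphic j

/-- Converse of `MemA.pd`: on each real slice, existing and continuous partial derivatives give
joint differentiability by `hasFDerivAt_of_partial`. All later statements about `MemA` can therefore
be proved by induction on the order. -/
theorem memA_succ {h : ℝ} {d : ℕ} {f : (Fin N → ℂ) → ℂ} (hb : BaseA h f)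
    (hf : ∀ j, (∀ ξ ∈ strip N h, DirDiff j f ξ) ∧ MemA h d (pd j f)) : MemA h (d + 1) f where
  periodic := hb.periodic
  contDiff b hbh := by
    change ContDiff ℝ ((d + 1 : ℕ) : WithTop ℕ∞) (fun x => f (slice b x))
    rw [Nat.cast_add, Nat.cast_one, contDiff_succ_iff_hasFDerivAt]
    refine ⟨fun x => ∑ j, (ContinuousLinearMap.proj (R := ℝ) (φ := fun _ : Fin N => ℝ) j).smulRight
      (pd j f (slice b x)), ?_, fun x => ?_⟩
    · refine ContDiff.sum fun j _ => ?_
      exact contDiff_const.smulRight ((hf j).2.contDiff b hbh)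
    · refine hasFDerivAt_of_partial (g' := fun j y => pd j f (slice b y)) x (fun y j => ?_) fun j => ?_
      · simp_rw [← slice_add_single]
        exact ((hf j).1 _ (slice_mem_strip hbh y)).hasDerivAt
      · exact ((hf j).2.base.cont.comp_continuous (continuous_slice b)
          (slice_mem_strip hbh)).continuousAt
  continuousOn := by
    refine forall_list_succ.2 ⟨hb.cont, fun j l hl => ?_⟩
    rw [iterPd_append]
    exact (hf j).2.continuousOn l hl
  holomorphic := hb.hol

theorem BaseA.congr {h : ℝ} {f g : (Fin N → ℂ) → ℂ} (hf : BaseA h f)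
    (hfg : ∀ ξ ∈ strip N h, f ξ = g ξ) : BaseA h g where
  periodic ξ hξ j := by
    rw [← hfg _ hξ, ← hfg _ (strip_add_period hξ j), hf.periodic ξ hξ]
  cont := hf.cont.congr fun ξ hξ => (hfg ξ hξ).symm
  hol := hf.hol.congr fun ξ hξ => (hfg ξ (openStrip_subset hξ)).symm

theorem MemA.congr {h : ℝ} {d : ℕ} : ∀ {f g : (Fin N → ℂ) → ℂ}, MemA h d f →
    (∀ ξ ∈ strip N h, f ξ = g ξ) → MemA h d g := by
  induction d with
  | zero => exact fun hf hfg => (hf.base.congr hfg).memA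
  | succ d ih =>
    exact fun hf hfg => memA_succ (hf.base.congr hfg) fun j =>
      ⟨fun ξ hξ => dirDiff_congr hfg hξ (hf.dirDiff (by omega) hξ j),
        ih (hf.pd j) fun ξ hξ => pd_congr hfg hξ j⟩

/-! ### The norm -/

theorem normA_le_iff {h : ℝ} {d : ℕ} {f : (Fin N → ℂ) → ℂ} {C : ℝ≥0∞} :
    normA h d f ≤ C ↔ ∀ l : List (Fin N), l.length ≤ d → ∀ ξ ∈ strip N h, ‖iterPd l f ξ‖ₑ ≤ C := by
  simp [normA, iSup_le_iff]

theorem normA_zero_le_iff {h : ℝ} {f : (Fin N → ℂ) → ℂ} {C : ℝ≥0∞} :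
    normA h 0 f ≤ C ↔ ∀ ξ ∈ strip N h, ‖f ξ‖ₑ ≤ C := by
  rw [normA_le_iff]
  refine ⟨fun h => h [] le_rfl, fun h l hl => ?_⟩
  obtain rfl := List.length_eq_zero_iff.1 (Nat.le_zero.1 hl)
  exact h

theorem normA_succ_le_iff {h : ℝ} {d : ℕ} {f : (Fin N → ℂ) → ℂ} {C : ℝ≥0∞} :
    normA h (d + 1) f ≤ C ↔ (∀ ξ ∈ strip N h, ‖f ξ‖ₑ ≤ C) ∧ ∀ j, normA h d (pd j f) ≤ C := by
  simp only [normA_le_iff, forall_list_succ, iterPd_append]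
  rfl

theorem normA_congr {h : ℝ} {d : ℕ} {f g : (Fin N → ℂ) → ℂ} (hfg : ∀ ξ ∈ strip N h, f ξ = g ξ) :
    normA h d f = normA h d g := by
  unfold normA
  refine iSup_congr fun l => iSup_congr fun ξ => iSup_congr fun hξ => ?_
  rw [iterPd_congr hfg l.1 ξ hξ]

theorem enorm_le_normA {h : ℝ} {d : ℕ} {f : (Fin N → ℂ) → ℂ} {ξ : Fin N → ℂ}
    (hξ : ξ ∈ strip N h) : ‖f ξ‖ₑ ≤ normA h d f :=
  normA_le_iff.1 le_rfl [] (Nat.zero_le _) ξ hξ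

theorem enorm_le_ofReal {z : ℂ} {C : ℝ} (h : ‖z‖ ≤ C) : ‖z‖ₑ ≤ ENNReal.ofReal C := by
  rw [← ofReal_norm]; exact ENNReal.ofReal_le_ofReal h

theorem norm_le_of_enorm_le {z : ℂ} {C : ℝ} (hC : 0 ≤ C) (h : ‖z‖ₑ ≤ ENNReal.ofReal C) :
    ‖z‖ ≤ C := by
  rwa [← ofReal_norm, ENNReal.ofReal_le_ofReal_iff hC] at h

/-! ### Second derivatives at good points -/

/-- The two alternatives in `goodPts` supply second derivatives for different reasons: by definition
of the space if d ≥ 2, and by holomorphy at interior points. -/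
theorem MemA.contDiffAt_slice {h : ℝ} {d : ℕ} {f : (Fin N → ℂ) → ℂ} (hf : MemA h d f)
    {ξ : Fin N → ℂ} (hξ : ξ ∈ goodPts N h d) :
    ContDiffAt ℝ 2 (fun x => f (slice (fun j => (ξ j).im) x)) (fun j => (ξ j).re) := by
  rcases hξ.2 with hd | ho
  · exact ((hf.contDiff _ hξ.1).of_le (by exact_mod_cast hd)).contDiffAt
  · have h1 : ContDiffAt ℂ 2 f ξ :=
      (contDiffOn_of_differentiableOn isOpen_openStrip 2 hf.holomorphic).contDiffAt
        (isOpen_openStrip.mem_nhds ho)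
    have h2 : ContDiffAt ℝ 2 f (slice (fun j => (ξ j).im) (fun j => (ξ j).re)) := by
      rw [slice_re_im]; exact h1.restrict_scalars ℝ
    exact h2.comp _ ((contDiff_slice _ 2).contDiffAt)

theorem hasDerivAt_pd {f : (Fin N → ℂ) → ℂ} {ξ : Fin N → ℂ}
    (hf : ContDiffAt ℝ 2 (fun x => f (slice (fun j => (ξ j).im) x)) (fun j => (ξ j).re))
    (i j : Fin N) :
    HasDerivAt (fun t : ℝ => pd i f (ξ + Pi.single j (t : ℂ)))
      (fderiv ℝ (fderiv ℝ (fun x => f (slice (fun j => (ξ j).im) x))) (fun j => (ξ j).re)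
        (Pi.single j 1) (Pi.single i 1)) 0 := by
  set b : Fin N → ℝ := fun j => (ξ j).im
  set x : Fin N → ℝ := fun j => (ξ j).re with hx
  set g : (Fin N → ℝ) → ℂ := fun x => f (slice b x)
  have hxξ : slice b x = ξ := slice_re_im ξ
  have hline : HasDerivAt (fun t : ℝ => x + Pi.single j t) (Pi.single j 1) 0 := by
    simpa using (((ContinuousLinearMap.single ℝ (fun _ : Fin N => ℝ) j)).hasDerivAt
      (x := (0 : ℝ))).const_add x
  have hnear : ∀ᶠ y in 𝓝 x, DifferentiableAt ℝ g y := by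
    filter_upwards [hf.eventually (by simp)] with y hy
    exact hy.differentiableAt (by simp)
  have hd : DifferentiableAt ℝ (fderiv ℝ g) x :=
    (hf.fderiv_right (m := 1) (by norm_num)).differentiableAt (by simp)
  have h3 : HasFDerivAt (fderiv ℝ g) (fderiv ℝ (fderiv ℝ g) x) (x + Pi.single j (0 : ℝ)) := by
    simpa using hd.hasFDerivAt
  have h4 : HasDerivAt (fun t : ℝ => fderiv ℝ g (x + Pi.single j t) (Pi.single i 1))
      (fderiv ℝ (fderiv ℝ g) x (Pi.single j 1) (Pi.single i 1)) 0 :=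
    ((ContinuousLinearMap.apply ℝ ℂ (Pi.single i (1 : ℝ) : Fin N → ℝ)).hasFDerivAt).comp_hasDerivAt
      (0 : ℝ) (h3.comp_hasDerivAt (0 : ℝ) hline)
  have h5 : Tendsto (fun t : ℝ => x + Pi.single j t) (𝓝 0) (𝓝 x) := by
    have := hline.continuousAt.tendsto
    rwa [Pi.single_zero, add_zero] at this
  refine h4.congr_of_eventuallyEq ?_
  filter_upwards [h5.eventually hnear] with t ht
  rw [← hxξ, slice_add_single, pd_slice ht]

theorem MemA.dirDiff_pd {h : ℝ} {d : ℕ} {f : (Fin N → ℂ) → ℂ} (hf : MemA h d f)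
    {ξ : Fin N → ℂ} (hξ : ξ ∈ goodPts N h d) (i j : Fin N) : DirDiff j (LowerTori.pd i f) ξ :=
  (hasDerivAt_pd (hf.contDiffAt_slice hξ) i j).differentiableAt

/-! ### Holomorphic families of functions on the strip

A family `f i t ξ` depends on an index `i`, on a parameter `t` in the complex unit disc and on a
point `ξ` of the strip. The classes below require holomorphy in `t` and in `ξ`, and bounds which
are uniform in all variables. -/

theorem pd_const (c : ℂ) (j : Fin N) (ξ : Fin N → ℂ) : pd j (fun _ => c) ξ = 0 := by simp [pd]

theorem DirDiff.add {f g : (Fin N → ℂ) → ℂ} {j : Fin N} {ξ : Fin N → ℂ} (hf : DirDiff j f ξ)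
    (hg : DirDiff j g ξ) : DirDiff j (fun η => f η + g η) ξ := DifferentiableAt.fun_add hf hg

theorem DirDiff.mul {f g : (Fin N → ℂ) → ℂ} {j : Fin N} {ξ : Fin N → ℂ} (hf : DirDiff j f ξ)
    (hg : DirDiff j g ξ) : DirDiff j (fun η => f η * g η) ξ := DifferentiableAt.fun_mul hf hg

theorem DirDiff.neg {f : (Fin N → ℂ) → ℂ} {j : Fin N} {ξ : Fin N → ℂ} (hf : DirDiff j f ξ) :
    DirDiff j (fun η => -f η) ξ := DifferentiableAt.fun_neg hf

theorem DirDiff.sub {f g : (Fin N → ℂ) → ℂ} {j : Fin N} {ξ : Fin N → ℂ} (hf : DirDiff j f ξ)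
    (hg : DirDiff j g ξ) : DirDiff j (fun η => f η - g η) ξ := DifferentiableAt.fun_sub hf hg

theorem DirDiff.sum {ι : Type*} {s : Finset ι} {f : ι → (Fin N → ℂ) → ℂ} {j : Fin N}
    {ξ : Fin N → ℂ} (hf : ∀ a ∈ s, DirDiff j (f a) ξ) : DirDiff j (fun η => ∑ a ∈ s, f a η) ξ :=
  DifferentiableAt.fun_sum hf

theorem DirDiff.inv {f : (Fin N → ℂ) → ℂ} {j : Fin N} {ξ : Fin N → ℂ} (hf : DirDiff j f ξ)
    (h0 : f ξ ≠ 0) : DirDiff j (fun η => (f η)⁻¹) ξ :=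
  DifferentiableAt.fun_inv hf (by simpa using h0)

theorem dirDiff_const (c : ℂ) (j : Fin N) (ξ : Fin N → ℂ) : DirDiff j (fun _ => c) ξ :=
  differentiableAt_const _

theorem pd_add {f g : (Fin N → ℂ) → ℂ} {j : Fin N} {ξ : Fin N → ℂ} (hf : DirDiff j f ξ)
    (hg : DirDiff j g ξ) : pd j (fun η => f η + g η) ξ = pd j f ξ + pd j g ξ :=
  deriv_fun_add hf hg

theorem pd_sub {f g : (Fin N → ℂ) → ℂ} {j : Fin N} {ξ : Fin N → ℂ} (hf : DirDiff j f ξ)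
    (hg : DirDiff j g ξ) : pd j (fun η => f η - g η) ξ = pd j f ξ - pd j g ξ :=
  deriv_fun_sub hf hg

theorem pd_neg {f : (Fin N → ℂ) → ℂ} {j : Fin N} {ξ : Fin N → ℂ} :
    pd j (fun η => -f η) ξ = -pd j f ξ := by
  unfold pd; exact deriv.fun_neg

theorem pd_sum {ι : Type*} {s : Finset ι} {f : ι → (Fin N → ℂ) → ℂ} {j : Fin N}
    {ξ : Fin N → ℂ} (hf : ∀ a ∈ s, DirDiff j (f a) ξ) :
    pd j (fun η => ∑ a ∈ s, f a η) ξ = ∑ a ∈ s, pd j (f a) ξ :=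
  deriv_fun_sum hf

theorem pd_mul {f g : (Fin N → ℂ) → ℂ} {j : Fin N} {ξ : Fin N → ℂ} (hf : DirDiff j f ξ)
    (hg : DirDiff j g ξ) : pd j (fun η => f η * g η) ξ = pd j f ξ * g ξ + f ξ * pd j g ξ := by
  unfold pd
  rw [deriv_fun_mul hf hg]
  simp

theorem pd_const_mul {f : (Fin N → ℂ) → ℂ} {j : Fin N} {ξ : Fin N → ℂ} (c : ℂ)
    (hf : DirDiff j f ξ) : pd j (fun η => c * f η) ξ = c * pd j f ξ :=
  deriv_const_mul c hf

theorem pd_inv {f : (Fin N → ℂ) → ℂ} {j : Fin N} {ξ : Fin N → ℂ} (hf : DirDiff j f ξ)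
    (h0 : f ξ ≠ 0) : pd j (fun η => (f η)⁻¹) ξ = -(pd j f ξ * ((f ξ)⁻¹ * (f ξ)⁻¹)) := by
  unfold pd
  rw [deriv_fun_inv'' hf (by simpa using h0)]
  simp only [Complex.ofReal_zero, Pi.single_zero, add_zero]
  field_simp

section Families
variable {I : Type*} {h : ℝ}

/-- Families which are continuous on the strip and holomorphic. -/
structure FamW (h : ℝ) (f : I → ℂ → (Fin N → ℂ) → ℂ) : Prop where
  cont : ∀ i, ∀ t ∈ Metric.ball (0 : ℂ) 1, ContinuousOn (f i t) (strip N h)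
  hol : ∀ i, ∀ t ∈ Metric.ball (0 : ℂ) 1, DifferentiableOn ℂ (f i t) (openStrip N h)
  holT : ∀ i, ∀ ξ ∈ strip N h, DifferentiableOn ℂ (fun t => f i t ξ) (Metric.ball (0 : ℂ) 1)

/-- Families which moreover are periodic and uniformly bounded. -/
structure FamB (h : ℝ) (f : I → ℂ → (Fin N → ℂ) → ℂ) : Prop extends FamW h f where
  periodic : ∀ i, ∀ t ∈ Metric.ball (0 : ℂ) 1, ∀ ξ ∈ strip N h, ∀ j,
    f i t (ξ + Pi.single j (2 * Real.pi : ℂ)) = f i t ξ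
  bdd : ∃ C : ℝ, ∀ i, ∀ t ∈ Metric.ball (0 : ℂ) 1, ∀ ξ ∈ strip N h, ‖f i t ξ‖ ≤ C

/-- All members of the family have partial derivatives on the strip. -/
def HasPd (h : ℝ) (f : I → ℂ → (Fin N → ℂ) → ℂ) : Prop :=
  ∀ i, ∀ t ∈ Metric.ball (0 : ℂ) 1, ∀ ξ ∈ strip N h, ∀ j, DirDiff j (f i t) ξ

/-- Families with `d` uniformly bounded derivatives. -/
def HF (h : ℝ) : ℕ → (I → ℂ → (Fin N → ℂ) → ℂ) → Prop
  | 0, f => FamB h f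
  | d + 1, f => FamB h f ∧ HasPd h f ∧ ∀ j, HF h d (fun i t => pd j (f i t))

/-- Families with `d` derivatives, where all derivatives of order at least one are uniformly
bounded and periodic. -/
def HW (h : ℝ) : ℕ → (I → ℂ → (Fin N → ℂ) → ℂ) → Prop
  | 0, f => FamW h f
  | d + 1, f => FamW h f ∧ HasPd h f ∧ ∀ j, HF h d (fun i t => pd j (f i t))

theorem HF.famB {d : ℕ} {f : I → ℂ → (Fin N → ℂ) → ℂ} (hf : HF h d f) : FamB h f := by
  cases d with
  | zero => exact hf
  | succ d => exact hf.1

theorem HW.famW {d : ℕ} {f : I → ℂ → (Fin N → ℂ) → ℂ} (hf : HW h d f) : FamW h f := by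
  cases d with
  | zero => exact hf
  | succ d => exact hf.1

theorem HF.hw {d : ℕ} {f : I → ℂ → (Fin N → ℂ) → ℂ} (hf : HF h d f) : HW h d f := by
  cases d with
  | zero => exact hf.toFamW
  | succ d => exact ⟨hf.1.toFamW, hf.2⟩

theorem HF.pred {d : ℕ} : ∀ {f : I → ℂ → (Fin N → ℂ) → ℂ}, HF h (d + 1) f → HF h d f := by
  induction d with
  | zero => exact fun hf => hf.1
  | succ d ih => exact fun hf => ⟨hf.1, hf.2.1, fun j => ih (hf.2.2 j)⟩

theorem HW.pred {d : ℕ} {f : I → ℂ → (Fin N → ℂ) → ℂ} (hf : HW h (d + 1) f) : HW h d f := by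
  cases d with
  | zero => exact hf.1
  | succ d => exact ⟨hf.1, hf.2.1, fun j => (hf.2.2 j).pred⟩

theorem HF.pd {d : ℕ} {f : I → ℂ → (Fin N → ℂ) → ℂ} (hf : HF h (d + 1) f) (j : Fin N) :
    HF h d (fun i t => pd j (f i t)) := hf.2.2 j

theorem FamW.congr {f g : I → ℂ → (Fin N → ℂ) → ℂ} (hf : FamW h f)
    (hfg : ∀ i, ∀ t ∈ Metric.ball (0 : ℂ) 1, ∀ ξ ∈ strip N h, f i t ξ = g i t ξ) : FamW h g where
  cont i t ht := (hf.cont i t ht).congr fun ξ hξ => (hfg i t ht ξ hξ).symm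
  hol i t ht := (hf.hol i t ht).congr fun ξ hξ => (hfg i t ht ξ (openStrip_subset hξ)).symm
  holT i ξ hξ := (hf.holT i ξ hξ).congr fun t ht => (hfg i t ht ξ hξ).symm

theorem FamB.congr {f g : I → ℂ → (Fin N → ℂ) → ℂ} (hf : FamB h f)
    (hfg : ∀ i, ∀ t ∈ Metric.ball (0 : ℂ) 1, ∀ ξ ∈ strip N h, f i t ξ = g i t ξ) : FamB h g where
  toFamW := hf.toFamW.congr hfg
  periodic i t ht ξ hξ j := by
    rw [← hfg i t ht _ hξ, ← hfg i t ht _ (strip_add_period hξ j), hf.periodic i t ht ξ hξ]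
  bdd := by
    obtain ⟨C, hC⟩ := hf.bdd
    exact ⟨C, fun i t ht ξ hξ => by rw [← hfg i t ht ξ hξ]; exact hC i t ht ξ hξ⟩

theorem HasPd.congr {f g : I → ℂ → (Fin N → ℂ) → ℂ} (hf : HasPd h f)
    (hfg : ∀ i, ∀ t ∈ Metric.ball (0 : ℂ) 1, ∀ ξ ∈ strip N h, f i t ξ = g i t ξ) : HasPd h g :=
  fun i t ht ξ hξ j => dirDiff_congr (hfg i t ht) hξ (hf i t ht ξ hξ j)

theorem HF.congr {d : ℕ} : ∀ {f g : I → ℂ → (Fin N → ℂ) → ℂ}, HF h d f →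
    (∀ i, ∀ t ∈ Metric.ball (0 : ℂ) 1, ∀ ξ ∈ strip N h, f i t ξ = g i t ξ) → HF h d g := by
  induction d with
  | zero => exact fun hf hfg => FamB.congr hf hfg
  | succ d ih =>
    exact fun hf hfg => ⟨hf.1.congr hfg, hf.2.1.congr hfg, fun j =>
      ih (hf.2.2 j) fun i t ht ξ hξ => pd_congr (hfg i t ht) hξ j⟩

theorem FamW.add {f g : I → ℂ → (Fin N → ℂ) → ℂ} (hf : FamW h f) (hg : FamW h g) :
    FamW h (fun i t ξ => f i t ξ + g i t ξ) where
  cont i t ht := (hf.cont i t ht).add (hg.cont i t ht)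
  hol i t ht := (hf.hol i t ht).add (hg.hol i t ht)
  holT i ξ hξ := (hf.holT i ξ hξ).add (hg.holT i ξ hξ)

theorem FamB.add {f g : I → ℂ → (Fin N → ℂ) → ℂ} (hf : FamB h f) (hg : FamB h g) :
    FamB h (fun i t ξ => f i t ξ + g i t ξ) where
  toFamW := hf.toFamW.add hg.toFamW
  periodic i t ht ξ hξ j := by rw [hf.periodic i t ht ξ hξ, hg.periodic i t ht ξ hξ]
  bdd := by
    obtain ⟨C, hC⟩ := hf.bdd
    obtain ⟨D, hD⟩ := hg.bdd
    exact ⟨C + D, fun i t ht ξ hξ => norm_add_le_of_le (hC i t ht ξ hξ) (hD i t ht ξ hξ)⟩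

theorem FamB.mul {f g : I → ℂ → (Fin N → ℂ) → ℂ} (hf : FamB h f) (hg : FamB h g) :
    FamB h (fun i t ξ => f i t ξ * g i t ξ) where
  cont i t ht := (hf.cont i t ht).mul (hg.cont i t ht)
  hol i t ht := (hf.hol i t ht).mul (hg.hol i t ht)
  holT i ξ hξ := (hf.holT i ξ hξ).mul (hg.holT i ξ hξ)
  periodic i t ht ξ hξ j := by rw [hf.periodic i t ht ξ hξ, hg.periodic i t ht ξ hξ]
  bdd := by
    obtain ⟨C, hC⟩ := hf.bdd
    obtain ⟨D, hD⟩ := hg.bdd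
    refine ⟨C * D, fun i t ht ξ hξ => ?_⟩
    rw [norm_mul]
    exact mul_le_mul (hC i t ht ξ hξ) (hD i t ht ξ hξ) (norm_nonneg _)
      ((norm_nonneg _).trans (hC i t ht ξ hξ))

theorem FamB.neg {f : I → ℂ → (Fin N → ℂ) → ℂ} (hf : FamB h f) :
    FamB h (fun i t ξ => -f i t ξ) where
  cont i t ht := (hf.cont i t ht).neg
  hol i t ht := (hf.hol i t ht).neg
  holT i ξ hξ := (hf.holT i ξ hξ).neg
  periodic i t ht ξ hξ j := by rw [hf.periodic i t ht ξ hξ]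
  bdd := by simpa using hf.bdd

theorem FamB.inv {f : I → ℂ → (Fin N → ℂ) → ℂ} (hf : FamB h f) {c : ℝ} (hc : 0 < c)
    (hfc : ∀ i, ∀ t ∈ Metric.ball (0 : ℂ) 1, ∀ ξ ∈ strip N h, c ≤ ‖f i t ξ‖) :
    FamB h (fun i t ξ => (f i t ξ)⁻¹) := by
  have h0 : ∀ i, ∀ t ∈ Metric.ball (0 : ℂ) 1, ∀ ξ ∈ strip N h, f i t ξ ≠ 0 := fun i t ht ξ hξ =>
    norm_pos_iff.1 (hc.trans_le (hfc i t ht ξ hξ))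
  exact {
    cont i t ht := (hf.cont i t ht).inv₀ (h0 i t ht)
    hol i t ht := (hf.hol i t ht).inv fun ξ hξ => h0 i t ht ξ (openStrip_subset hξ)
    holT i ξ hξ := (hf.holT i ξ hξ).inv fun t ht => h0 i t ht ξ hξ
    periodic i t ht ξ hξ j := by rw [hf.periodic i t ht ξ hξ]
    bdd := ⟨c⁻¹, fun i t ht ξ hξ => by
      rw [norm_inv]; exact inv_anti₀ hc (hfc i t ht ξ hξ)⟩ }

theorem HF.add {d : ℕ} : ∀ {f g : I → ℂ → (Fin N → ℂ) → ℂ}, HF h d f → HF h d g →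
    HF h d (fun i t ξ => f i t ξ + g i t ξ) := by
  induction d with
  | zero => exact fun hf hg => FamB.add hf hg
  | succ d ih =>
    exact fun hf hg => ⟨hf.1.add hg.1,
      fun i t ht ξ hξ j => (hf.2.1 i t ht ξ hξ j).add (hg.2.1 i t ht ξ hξ j),
      fun j => (ih (hf.2.2 j) (hg.2.2 j)).congr fun i t ht ξ hξ =>
        (pd_add (hf.2.1 i t ht ξ hξ j) (hg.2.1 i t ht ξ hξ j)).symm⟩

theorem HW.add {d : ℕ} {f g : I → ℂ → (Fin N → ℂ) → ℂ} (hf : HW h d f) (hg : HW h d g) :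
    HW h d (fun i t ξ => f i t ξ + g i t ξ) := by
  cases d with
  | zero => exact FamW.add hf hg
  | succ d =>
    exact ⟨hf.1.add hg.1,
      fun i t ht ξ hξ j => (hf.2.1 i t ht ξ hξ j).add (hg.2.1 i t ht ξ hξ j),
      fun j => ((hf.2.2 j).add (hg.2.2 j)).congr fun i t ht ξ hξ =>
        (pd_add (hf.2.1 i t ht ξ hξ j) (hg.2.1 i t ht ξ hξ j)).symm⟩

theorem HF.mul {d : ℕ} : ∀ {f g : I → ℂ → (Fin N → ℂ) → ℂ}, HF h d f → HF h d g →
    HF h d (fun i t ξ => f i t ξ * g i t ξ) := by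
  induction d with
  | zero => exact fun hf hg => FamB.mul hf hg
  | succ d ih =>
    exact fun hf hg => ⟨hf.1.mul hg.1,
      fun i t ht ξ hξ j => (hf.2.1 i t ht ξ hξ j).mul (hg.2.1 i t ht ξ hξ j),
      fun j => ((ih (hf.2.2 j) hg.pred).add (ih hf.pred (hg.2.2 j))).congr fun i t ht ξ hξ =>
        (pd_mul (hf.2.1 i t ht ξ hξ j) (hg.2.1 i t ht ξ hξ j)).symm⟩

theorem HF.neg {d : ℕ} : ∀ {f : I → ℂ → (Fin N → ℂ) → ℂ}, HF h d f →
    HF h d (fun i t ξ => -f i t ξ) := by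
  induction d with
  | zero => exact fun hf => FamB.neg hf
  | succ d ih =>
    exact fun hf => ⟨hf.1.neg,
      fun i t ht ξ hξ j => (hf.2.1 i t ht ξ hξ j).neg,
      fun j => (ih (hf.2.2 j)).congr fun i t ht ξ hξ => pd_neg.symm⟩

theorem HF.sub {d : ℕ} {f g : I → ℂ → (Fin N → ℂ) → ℂ} (hf : HF h d f) (hg : HF h d g) :
    HF h d (fun i t ξ => f i t ξ - g i t ξ) := by
  simpa only [sub_eq_add_neg] using hf.add hg.neg

/-- The derivative -f'·(f⁻¹)² involves f⁻¹ only to the previous order, so the induction closes. The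
uniform lower bound keeps the inverses uniformly bounded. -/
theorem HF.inv {d : ℕ} {c : ℝ} (hc : 0 < c) : ∀ {f : I → ℂ → (Fin N → ℂ) → ℂ}, HF h d f →
    (∀ i, ∀ t ∈ Metric.ball (0 : ℂ) 1, ∀ ξ ∈ strip N h, c ≤ ‖f i t ξ‖) →
    HF h d (fun i t ξ => (f i t ξ)⁻¹) := by
  induction d with
  | zero => exact fun hf hfc => FamB.inv hf hc hfc
  | succ d ih =>
    intro f hf hfc
    have h0 : ∀ i, ∀ t ∈ Metric.ball (0 : ℂ) 1, ∀ ξ ∈ strip N h, f i t ξ ≠ 0 :=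
      fun i t ht ξ hξ => norm_pos_iff.1 (hc.trans_le (hfc i t ht ξ hξ))
    have hi := ih hf.pred hfc
    exact ⟨hf.1.inv hc hfc,
      fun i t ht ξ hξ j => (hf.2.1 i t ht ξ hξ j).inv (h0 i t ht ξ hξ),
      fun j => ((hf.2.2 j).mul (hi.mul hi)).neg.congr fun i t ht ξ hξ =>
        (pd_inv (hf.2.1 i t ht ξ hξ j) (h0 i t ht ξ hξ)).symm⟩

/-- Families independent of the point of the strip. -/
theorem HF.of_param {d : ℕ} : ∀ {c : I → ℂ → ℂ} {C : ℝ},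
    (∀ i, DifferentiableOn ℂ (c i) (Metric.ball 0 1)) →
    (∀ i, ∀ t ∈ Metric.ball (0 : ℂ) 1, ‖c i t‖ ≤ C) → HF (N := N) h d (fun i t _ => c i t) := by
  have base : ∀ {c : I → ℂ → ℂ} {C : ℝ}, (∀ i, DifferentiableOn ℂ (c i) (Metric.ball 0 1)) →
      (∀ i, ∀ t ∈ Metric.ball (0 : ℂ) 1, ‖c i t‖ ≤ C) → FamB (N := N) h (fun i t _ => c i t) :=
    fun {c C} hc hC =>
    { cont := fun _ _ _ => continuousOn_const
      hol := fun _ _ _ => differentiableOn_const _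
      holT := fun i _ _ => hc i
      periodic := fun _ _ _ _ _ _ => rfl
      bdd := ⟨C, fun i t ht _ _ => hC i t ht⟩ }
  induction d with
  | zero => exact fun hc hC => base hc hC
  | succ d ih =>
    exact fun hc hC => ⟨base hc hC, fun i t _ ξ _ j => dirDiff_const _ j ξ, fun j =>
      (ih (c := fun _ _ => 0) (C := 0) (fun _ => differentiableOn_const _) (by simp)).congr
        fun i t _ ξ _ => (pd_const _ j ξ).symm⟩

theorem HF.const {d : ℕ} (c : ℂ) : HF (N := N) h d (fun (_ : I) _ _ => c) :=
  HF.of_param (C := ‖c‖) (fun _ => differentiableOn_const _) fun _ _ _ => le_rfl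

theorem HF.sum {d : ℕ} {ι : Type*} (s : Finset ι) {f : ι → I → ℂ → (Fin N → ℂ) → ℂ}
    (hf : ∀ a ∈ s, HF h d (f a)) : HF h d (fun i t ξ => ∑ a ∈ s, f a i t ξ) := by
  classical
  induction s using Finset.induction_on with
  | empty => simpa using HF.const (0 : ℂ)
  | insert a s ha ih =>
    simp only [Finset.sum_insert ha]
    exact (hf a (Finset.mem_insert_self a s)).add
      (ih fun b hb => hf b (Finset.mem_insert_of_mem hb))

theorem HF.prod {d : ℕ} {ι : Type*} (s : Finset ι) {f : ι → I → ℂ → (Fin N → ℂ) → ℂ}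
    (hf : ∀ a ∈ s, HF h d (f a)) : HF h d (fun i t ξ => ∏ a ∈ s, f a i t ξ) := by
  classical
  induction s using Finset.induction_on with
  | empty => simpa using HF.const (1 : ℂ)
  | insert a s ha ih =>
    simp only [Finset.prod_insert ha]
    exact (hf a (Finset.mem_insert_self a s)).mul
      (ih fun b hb => hf b (Finset.mem_insert_of_mem hb))

theorem HF.baseA {d : ℕ} {f : I → ℂ → (Fin N → ℂ) → ℂ} (hf : HF h d f) (i : I) {t : ℂ}
    (ht : t ∈ Metric.ball (0 : ℂ) 1) : BaseA h (f i t) :=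
  ⟨hf.famB.periodic i t ht, hf.famB.cont i t ht, hf.famB.hol i t ht⟩

theorem HF.memA {d : ℕ} : ∀ {f : I → ℂ → (Fin N → ℂ) → ℂ}, HF h d f → ∀ i,
    ∀ t ∈ Metric.ball (0 : ℂ) 1, MemA h d (f i t) := by
  induction d with
  | zero => exact fun hf i t ht => (hf.baseA i ht).memA
  | succ d ih =>
    exact fun hf i t ht => memA_succ (hf.baseA i ht) fun j =>
      ⟨fun ξ hξ => hf.2.1 i t ht ξ hξ j, ih (hf.2.2 j) i t ht⟩

theorem HF.normA_le {d : ℕ} : ∀ {f : I → ℂ → (Fin N → ℂ) → ℂ}, HF h d f → ∃ C : ℝ, 0 ≤ C ∧ ∀ i,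
    ∀ t ∈ Metric.ball (0 : ℂ) 1, normA h d (f i t) ≤ ENNReal.ofReal C := by
  induction d with
  | zero =>
    intro f hf
    obtain ⟨C, hC⟩ := hf.famB.bdd
    refine ⟨max C 0, le_max_right _ _, fun i t ht => normA_zero_le_iff.2 fun ξ hξ => ?_⟩
    exact enorm_le_ofReal ((hC i t ht ξ hξ).trans (le_max_left _ _))
  | succ d ih =>
    intro f hf
    obtain ⟨C, hC⟩ := hf.1.bdd
    choose D hD0 hD using fun j => ih (hf.2.2 j)
    have hDs : ∀ j, D j ≤ ∑ k, D k := fun j =>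
      Finset.single_le_sum (fun k _ => hD0 k) (Finset.mem_univ j)
    have hS : 0 ≤ ∑ k, D k := Finset.sum_nonneg fun k _ => hD0 k
    refine ⟨max C 0 + ∑ k, D k, by positivity, fun i t ht =>
      normA_succ_le_iff.2 ⟨fun ξ hξ => enorm_le_ofReal ?_, fun j => (hD j i t ht).trans ?_⟩⟩
    · exact (hC i t ht ξ hξ).trans ((le_max_left _ _).trans (by linarith))
    · exact ENNReal.ofReal_le_ofReal ((hDs j).trans (by linarith [le_max_right C 0]))

/-- Affine families in the parameter. -/
theorem HF.line {d : ℕ} {C : ℝ} (hC : 0 ≤ C) : ∀ {a b : I → (Fin N → ℂ) → ℂ},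
    (∀ i, MemA h d (a i)) → (∀ i, MemA h d (b i)) →
    (∀ i, normA h d (a i) ≤ ENNReal.ofReal C) → (∀ i, normA h d (b i) ≤ ENNReal.ofReal C) →
    HF h d (fun i t ξ => a i ξ + t * b i ξ) := by
  have base : ∀ {d : ℕ} {a b : I → (Fin N → ℂ) → ℂ},
      (∀ i, MemA h d (a i)) → (∀ i, MemA h d (b i)) →
      (∀ i, normA h d (a i) ≤ ENNReal.ofReal C) → (∀ i, normA h d (b i) ≤ ENNReal.ofReal C) →
      FamB h (fun i t ξ => a i ξ + t * b i ξ) := fun {d a b} ha hb hna hnb =>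
    { cont := fun i t _ => (ha i).base.cont.add ((hb i).base.cont.const_smul t)
      hol := fun i t _ => (ha i).holomorphic.add ((hb i).holomorphic.const_mul t)
      holT := fun i ξ _ => by fun_prop
      periodic := fun i t _ ξ hξ j => by rw [(ha i).periodic ξ hξ, (hb i).periodic ξ hξ]
      bdd := ⟨C + 1 * C, fun i t ht ξ hξ => by
        refine norm_add_le_of_le (norm_le_of_enorm_le hC ((enorm_le_normA hξ).trans (hna i))) ?_
        rw [norm_mul]
        exact mul_le_mul (mem_ball_zero_iff.1 ht).le
          (norm_le_of_enorm_le hC ((enorm_le_normA hξ).trans (hnb i))) (norm_nonneg _) zero_le_one⟩ }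
  induction d with
  | zero => exact fun ha hb hna hnb => base ha hb hna hnb
  | succ d ih =>
    intro a b ha hb hna hnb
    have hda := fun i ξ hξ j => (ha i).dirDiff (by omega) (ξ := ξ) hξ j
    have hdb := fun i ξ hξ j => (hb i).dirDiff (by omega) (ξ := ξ) hξ j
    refine ⟨base ha hb hna hnb,
      fun i t ht ξ hξ j => (hda i ξ hξ j).add ((dirDiff_const t j ξ).mul (hdb i ξ hξ j)), fun j =>
        (ih (fun i => (ha i).pd j) (fun i => (hb i).pd j)
        (fun i => (normA_succ_le_iff.1 (hna i)).2 j) (fun i => (normA_succ_le_iff.1 (hnb i)).2 j)).congr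
          fun i t ht ξ hξ => ?_⟩
    rw [pd_add (hda i ξ hξ j) ((dirDiff_const t j ξ).mul (hdb i ξ hξ j)),
      pd_const_mul t (hdb i ξ hξ j)]

/-! ### Differentiation with respect to the parameter -/

theorem zero_mem_unit_ball : (0 : ℂ) ∈ Metric.ball (0 : ℂ) 1 := Metric.mem_ball_self one_pos

/-- Schwarz lemma in the parameter. With the same estimate for the ξ-derivatives it gives the linear
dependence on the distance to the base point. -/
theorem FamB.norm_sub_le {f : I → ℂ → (Fin N → ℂ) → ℂ} (hf : FamB h f) : ∃ C : ℝ, 0 ≤ C ∧ ∀ i,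
    ∀ t ∈ Metric.ball (0 : ℂ) 1, ∀ ξ ∈ strip N h, ‖f i t ξ - f i 0 ξ‖ ≤ C * ‖t‖ := by
  obtain ⟨C, hC⟩ := hf.bdd
  refine ⟨2 * max C 0, by positivity, fun i t ht ξ hξ => ?_⟩
  have := Complex.dist_le_div_mul_dist_of_mapsTo_ball (R₂ := 2 * max C 0) (hf.holT i ξ hξ)
    (fun z hz => by
      rw [mem_closedBall_iff_norm]
      have h1 := hC i z hz ξ hξ
      have h2 := hC i 0 zero_mem_unit_ball ξ hξ
      exact (_root_.norm_sub_le _ _).trans (by linarith [le_max_left C 0])) ht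
  simpa [dist_eq_norm] using this

theorem FamB.norm_sub_sub_le {f : I → ℂ → (Fin N → ℂ) → ℂ} (hf : FamB h f) : ∃ C : ℝ, 0 ≤ C ∧
    ∀ i, ∀ t ∈ Metric.ball (0 : ℂ) 1, ∀ ξ ∈ strip N h,
      ‖f i t ξ - f i 0 ξ - t * deriv (fun t => f i t ξ) 0‖ ≤ C * ‖t‖ ^ 2 := by
  obtain ⟨C, hC⟩ := hf.bdd
  refine ⟨4 * max C 0, by positivity, fun i t ht ξ hξ => ?_⟩
  simpa using norm_sub_sub_deriv_le one_pos (hf.holT i ξ hξ)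
    (fun t ht => (hC i t ht ξ hξ).trans (le_max_left C 0)) ht

theorem FamB.tendstoUniformlyOn {f : I → ℂ → (Fin N → ℂ) → ℂ} (hf : FamB h f) (i : I) :
    TendstoUniformlyOn (fun (t : ℂ) ξ => t⁻¹ * (f i t ξ - f i 0 ξ))
      (fun ξ => deriv (fun t => f i t ξ) 0) (𝓝[≠] 0) (strip N h) := by
  obtain ⟨C, hC0, hC⟩ := hf.norm_sub_sub_le
  rw [Metric.tendstoUniformlyOn_iff]
  intro ε hε
  have hlim : Tendsto (fun t : ℂ => C * ‖t‖) (𝓝[≠] 0) (𝓝 0) := by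
    have : Tendsto (fun t : ℂ => C * ‖t‖) (𝓝 0) (𝓝 (C * ‖(0 : ℂ)‖)) :=
      Continuous.tendsto (by fun_prop) _
    simp only [norm_zero, mul_zero] at this
    exact this.mono_left nhdsWithin_le_nhds
  filter_upwards [nhdsWithin_le_nhds (Metric.ball_mem_nhds (0 : ℂ) one_pos), self_mem_nhdsWithin,
    hlim.eventually (gt_mem_nhds hε)] with t ht ht0 hlt ξ hξ
  have ht0' : t ≠ 0 := ht0
  rw [dist_comm, dist_eq_norm]
  have e1 : t⁻¹ * (f i t ξ - f i 0 ξ) - deriv (fun t => f i t ξ) 0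
      = t⁻¹ * (f i t ξ - f i 0 ξ - t * deriv (fun t => f i t ξ) 0) := by field_simp
  rw [e1, norm_mul, norm_inv]
  refine lt_of_le_of_lt ?_ hlt
  calc ‖t‖⁻¹ * _ ≤ ‖t‖⁻¹ * (C * ‖t‖ ^ 2) := by gcongr; exact hC i t ht ξ hξ
    _ = C * ‖t‖ := by
      have : ‖t‖ ≠ 0 := norm_ne_zero_iff.2 ht0'
      field_simp

theorem eventually_mem_unit_ball : ∀ᶠ t in 𝓝[≠] (0 : ℂ), t ∈ Metric.ball (0 : ℂ) 1 :=
  nhdsWithin_le_nhds (Metric.ball_mem_nhds (0 : ℂ) one_pos)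

/-- By `FamB.tendstoUniformlyOn` the parameter derivative is a uniform limit of difference quotients
on the whole closed strip, so continuity up to the boundary and holomorphy inside survive. -/
theorem FamB.baseA_deriv {f : I → ℂ → (Fin N → ℂ) → ℂ} (hf : FamB h f) (i : I) :
    BaseA h (fun ξ => deriv (fun t => f i t ξ) 0) where
  periodic ξ hξ j := by
    refine Filter.EventuallyEq.deriv_eq ?_
    filter_upwards [Metric.ball_mem_nhds (0 : ℂ) one_pos] with t ht
    exact hf.periodic i t ht ξ hξ j
  cont := by
    refine (hf.tendstoUniformlyOn i).continuousOn (Eventually.frequently ?_)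
    filter_upwards [eventually_mem_unit_ball] with t ht
    exact ((hf.cont i t ht).sub (hf.cont i 0 zero_mem_unit_ball)).const_smul t⁻¹
  hol ξ hξ := by
    obtain ⟨η, hη, hb⟩ := Metric.isOpen_iff.1 isOpen_openStrip ξ hξ
    refine (differentiableAt_of_tendstoUniformlyOn hη ?_
      ((hf.tendstoUniformlyOn i).mono (hb.trans openStrip_subset))).differentiableWithinAt
    filter_upwards [eventually_mem_unit_ball] with t ht
    exact (((hf.hol i t ht).sub (hf.hol i 0 zero_mem_unit_ball)).const_mul t⁻¹).mono hb

/-- Interchange of ∂/∂t with ∂/∂ξ_j: the quotients in t converge, and their ξ_j-derivatives converge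
uniformly because the family of ξ_j-derivatives is itself bounded and holomorphic in t. -/
theorem HF.hasDerivAt_deriv {d : ℕ} {f : I → ℂ → (Fin N → ℂ) → ℂ} (hf : HF h (d + 1) f) (i : I)
    {ξ : Fin N → ℂ} (hξ : ξ ∈ strip N h) (j : Fin N) :
    HasDerivAt (fun s : ℝ => deriv (fun t => f i t (ξ + Pi.single j (s : ℂ))) 0)
      (deriv (fun t => LowerTori.pd j (f i t) ξ) 0) 0 := by
  have hF := (hf.2.2 j).famB
  have h0 : ξ + Pi.single j ((0 : ℝ) : ℂ) = ξ := by simp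
  have := hasDerivAt_of_tendstoUniformly (l := 𝓝[≠] (0 : ℂ))
    (f := fun (t : ℂ) (s : ℝ) => t⁻¹ * (f i t (ξ + Pi.single j (s : ℂ))
      - f i 0 (ξ + Pi.single j (s : ℂ))))
    (f' := fun (t : ℂ) (s : ℝ) => t⁻¹ * (LowerTori.pd j (f i t) (ξ + Pi.single j (s : ℂ))
      - LowerTori.pd j (f i 0) (ξ + Pi.single j (s : ℂ))))
    (g := fun s : ℝ => deriv (fun t => f i t (ξ + Pi.single j (s : ℂ))) 0)
    (g' := fun s : ℝ => deriv (fun t => LowerTori.pd j (f i t) (ξ + Pi.single j (s : ℂ))) 0)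
    ?_ ?_ ?_ 0
  · simpa only [h0] using this
  · rw [Metric.tendstoUniformly_iff]
    intro ε hε
    filter_upwards [Metric.tendstoUniformlyOn_iff.1 (hF.tendstoUniformlyOn i) ε hε] with t ht s
    exact ht _ (strip_add_single hξ j s)
  · filter_upwards [eventually_mem_unit_ball] with t ht s
    have hs := strip_add_single hξ j s
    exact ((hasDerivAt_line (hf.2.1 i t ht _ hs j)).sub
      (hasDerivAt_line (hf.2.1 i 0 zero_mem_unit_ball _ hs j))).const_mul _
  · intro s
    exact (hf.1.tendstoUniformlyOn i).tendsto_at (strip_add_single hξ j s)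

theorem HF.memA_deriv {d : ℕ} : ∀ {f : I → ℂ → (Fin N → ℂ) → ℂ}, HF h d f → ∀ i,
    MemA h d (fun ξ => deriv (fun t => f i t ξ) 0) := by
  induction d with
  | zero => exact fun hf i => (FamB.baseA_deriv hf i).memA
  | succ d ih =>
    exact fun hf i => memA_succ (hf.1.baseA_deriv i) fun j =>
      ⟨fun ξ hξ => (hf.hasDerivAt_deriv i hξ j).differentiableAt,
        (ih (hf.2.2 j) i).congr fun ξ hξ => (pd_eq_of_hasDerivAt (hf.hasDerivAt_deriv i hξ j)).symm⟩

theorem HF.normA_sub_le {d : ℕ} : ∀ {f : I → ℂ → (Fin N → ℂ) → ℂ}, HF h d f → ∃ C : ℝ, 0 ≤ C ∧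
    ∀ i, ∀ t ∈ Metric.ball (0 : ℂ) 1,
      normA h d (fun ξ => f i t ξ - f i 0 ξ) ≤ ENNReal.ofReal (C * ‖t‖) := by
  induction d with
  | zero =>
    intro f hf
    obtain ⟨C, hC0, hC⟩ := FamB.norm_sub_le hf
    exact ⟨C, hC0, fun i t ht => normA_zero_le_iff.2 fun ξ hξ => enorm_le_ofReal (hC i t ht ξ hξ)⟩
  | succ d ih =>
    intro f hf
    obtain ⟨C, hC0, hC⟩ := hf.1.norm_sub_le
    choose D hD0 hD using fun j => ih (hf.2.2 j)
    have hDs : ∀ j, D j ≤ ∑ k, D k := fun j =>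
      Finset.single_le_sum (fun k _ => hD0 k) (Finset.mem_univ j)
    have hS : 0 ≤ ∑ k, D k := Finset.sum_nonneg fun k _ => hD0 k
    refine ⟨C + ∑ k, D k, by positivity, fun i t ht =>
      normA_succ_le_iff.2 ⟨fun ξ hξ => enorm_le_ofReal ?_, fun j => ?_⟩⟩
    · refine (hC i t ht ξ hξ).trans ?_
      gcongr; linarith
    · rw [normA_congr (h := h) fun ξ hξ => pd_sub (hf.2.1 i t ht ξ hξ j)
        (hf.2.1 i 0 zero_mem_unit_ball ξ hξ j)]
      refine (hD j i t ht).trans (ENNReal.ofReal_le_ofReal ?_)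
      gcongr; linarith [hDs j]

/-- The quadratic Cauchy remainder holds for each ξ-derivative separately, because ∂/∂t and ∂/∂ξ_j
commute. Divided by t, it becomes Gateaux differentiability in the norm of order `d`. -/
theorem HF.normA_sub_sub_le {d : ℕ} : ∀ {f : I → ℂ → (Fin N → ℂ) → ℂ}, HF h d f → ∃ C : ℝ, 0 ≤ C ∧
    ∀ i, ∀ t ∈ Metric.ball (0 : ℂ) 1,
      normA h d (fun ξ => f i t ξ - f i 0 ξ - t * deriv (fun t => f i t ξ) 0)
        ≤ ENNReal.ofReal (C * ‖t‖ ^ 2) := by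
  induction d with
  | zero =>
    intro f hf
    obtain ⟨C, hC0, hC⟩ := FamB.norm_sub_sub_le hf
    exact ⟨C, hC0, fun i t ht => normA_zero_le_iff.2 fun ξ hξ => enorm_le_ofReal (hC i t ht ξ hξ)⟩
  | succ d ih =>
    intro f hf
    obtain ⟨C, hC0, hC⟩ := hf.1.norm_sub_sub_le
    choose D hD0 hD using fun j => ih (hf.2.2 j)
    have hDs : ∀ j, D j ≤ ∑ k, D k := fun j =>
      Finset.single_le_sum (fun k _ => hD0 k) (Finset.mem_univ j)
    have hS : 0 ≤ ∑ k, D k := Finset.sum_nonneg fun k _ => hD0 k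
    refine ⟨C + ∑ k, D k, by positivity, fun i t ht =>
      normA_succ_le_iff.2 ⟨fun ξ hξ => enorm_le_ofReal ?_, fun j => ?_⟩⟩
    · refine (hC i t ht ξ hξ).trans ?_
      gcongr; linarith
    · rw [normA_congr (h := h) (g := fun ξ => LowerTori.pd j (f i t) ξ - LowerTori.pd j (f i 0) ξ
        - t * deriv (fun t => LowerTori.pd j (f i t) ξ) 0) fun ξ hξ => ?_]
      · refine (hD j i t ht).trans (ENNReal.ofReal_le_ofReal ?_)
        gcongr; linarith [hDs j]
      · have h1 := hf.2.1 i t ht ξ hξ j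
        have h2 := hf.2.1 i 0 zero_mem_unit_ball ξ hξ j
        have h3 := hf.hasDerivAt_deriv i hξ j
        have h3' : DirDiff j (fun ξ => deriv (fun t => f i t ξ) 0) ξ := h3.differentiableAt
        rw [pd_sub (h1.sub h2) ((dirDiff_const t j ξ).mul h3'), pd_sub h1 h2, pd_const_mul t h3',
          pd_eq_of_hasDerivAt (f := fun ξ => deriv (fun t => f i t ξ) 0) h3]

theorem normA_const_mul_le {d : ℕ} (c : ℂ) : ∀ {f : (Fin N → ℂ) → ℂ} {C : ℝ≥0∞},
    normA h d f ≤ C → normA h d (fun ξ => c * f ξ) ≤ ‖c‖ₑ * C := by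
  induction d with
  | zero =>
    intro f C hf
    refine normA_zero_le_iff.2 fun ξ hξ => ?_
    rw [enorm_mul]
    gcongr
    exact normA_zero_le_iff.1 hf ξ hξ
  | succ d ih =>
    intro f C hf
    refine normA_succ_le_iff.2 ⟨fun ξ hξ => ?_, fun j => ?_⟩
    · rw [enorm_mul]
      gcongr
      exact (normA_succ_le_iff.1 hf).1 ξ hξ
    · have : pd j (fun ξ => c * f ξ) = fun ξ => c * pd j f ξ :=
        funext fun ξ => deriv_const_mul_field c
      rw [this]
      exact ih ((normA_succ_le_iff.1 hf).2 j)

theorem MemA.const_mul {d : ℕ} (c : ℂ) : ∀ {f : (Fin N → ℂ) → ℂ}, MemA h d f →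
    MemA h d (fun ξ => c * f ξ) := by
  have base : ∀ {f : (Fin N → ℂ) → ℂ}, BaseA h f → BaseA h (fun ξ => c * f ξ) := fun hf =>
    ⟨fun ξ hξ j => by rw [hf.periodic ξ hξ], hf.cont.const_smul c, hf.hol.const_mul c⟩
  induction d with
  | zero => exact fun hf => (base hf.base).memA
  | succ d ih =>
    exact fun hf => memA_succ (base hf.base) fun j =>
      ⟨fun ξ hξ => (dirDiff_const c j ξ).mul (hf.dirDiff (by omega) hξ j),
        (ih (hf.pd j)).congr fun ξ hξ => (pd_const_mul c (hf.dirDiff (by omega) hξ j)).symm⟩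

/-- Operators which are holomorphic along a complex line are Gateaux differentiable. -/
theorem exists_isGateaux {d : ℕ} {P : Coord N → (Fin N → ℂ) → ℂ} {φ δ : Coord N} {s : ℂ}
    (hs : s ≠ 0) {f : Unit → ℂ → (Fin N → ℂ) → ℂ} (hf : HF h d f)
    (hP : ∀ t ∈ Metric.ball (0 : ℂ) 1, ∀ ξ ∈ strip N h, P (φ + (s * t) • δ) ξ = f () t ξ)
    (hP0 : ∀ ξ ∈ strip N h, P φ ξ = f () 0 ξ) :
    ∃ D, IsGateaux h d P φ δ D ∧
      ∀ ξ ∈ strip N h, HasDerivAt (fun t : ℂ => P (φ + t • δ) ξ) (D ξ) 0 := by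
  set D' : (Fin N → ℂ) → ℂ := fun ξ => deriv (fun t => f () t ξ) 0 with hD'
  have hP' : ∀ t ∈ Metric.ball (0 : ℂ) ‖s‖, ∀ ξ ∈ strip N h,
      s⁻¹ * t ∈ Metric.ball (0 : ℂ) 1 ∧ P (φ + t • δ) ξ = f () (s⁻¹ * t) ξ := by
    intro t ht ξ hξ
    have hm : s⁻¹ * t ∈ Metric.ball (0 : ℂ) 1 := by
      rw [mem_ball_zero_iff] at ht ⊢
      rw [norm_mul, norm_inv, inv_mul_lt_iff₀ (norm_pos_iff.2 hs)]
      simpa using ht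
    refine ⟨hm, ?_⟩
    rw [← hP _ hm ξ hξ, mul_inv_cancel_left₀ hs]
  have hsball : ∀ᶠ t in 𝓝 (0 : ℂ), t ∈ Metric.ball (0 : ℂ) ‖s‖ :=
    Metric.ball_mem_nhds _ (norm_pos_iff.2 hs)
  -- The family runs along `s • δ`, so its parameter derivative is `s` times the derivative in the
  -- direction `δ`.
  refine ⟨fun ξ => s⁻¹ * D' ξ, ⟨(hf.memA_deriv ()).const_mul _, ?_⟩, fun ξ hξ => ?_⟩
  · obtain ⟨C, hC0, hC⟩ := hf.normA_sub_sub_le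
    have hlim : Tendsto (fun t : ℂ => ENNReal.ofReal (C * ‖s⁻¹‖ * ‖s⁻¹ * t‖)) (𝓝[≠] 0) (𝓝 0) := by
      have h1 : Continuous fun t : ℂ => ENNReal.ofReal (C * ‖s⁻¹‖ * ‖s⁻¹ * t‖) :=
        ENNReal.continuous_ofReal.comp (by fun_prop)
      have h2 := h1.tendsto 0
      simp only [mul_zero, norm_zero, ENNReal.ofReal_zero] at h2
      exact h2.mono_left nhdsWithin_le_nhds
    refine tendsto_of_tendsto_of_tendsto_of_le_of_le' tendsto_const_nhds hlim
      (Eventually.of_forall fun _ => zero_le) ?_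
    filter_upwards [nhdsWithin_le_nhds hsball, self_mem_nhdsWithin] with t ht ht0
    have ht0' : t ≠ 0 := ht0
    -- Membership of s⁻¹t in the unit disc is stored in `hP'` only together with a point of the
    -- strip; over an empty strip every norm vanishes.
    rcases (strip N h).eq_empty_or_nonempty with he | ⟨ξ₀, hξ₀⟩
    · exact normA_le_iff.2 fun l _ ξ hξ => by simp [he] at hξ
    have hm := (hP' t ht ξ₀ hξ₀).1
    rw [normA_congr (h := h) (g := fun ξ => t⁻¹ * (f () (s⁻¹ * t) ξ - f () 0 ξ - s⁻¹ * t * D' ξ))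
      fun ξ hξ => by
        rw [(hP' t ht ξ hξ).2, hP0 ξ hξ]
        field_simp]
    refine (normA_const_mul_le t⁻¹ (hC () _ hm)).trans ?_
    rw [← ofReal_norm, ← ENNReal.ofReal_mul (norm_nonneg _)]
    refine ENNReal.ofReal_le_ofReal (le_of_eq ?_)
    have : ‖t‖ ≠ 0 := norm_ne_zero_iff.2 ht0'
    rw [norm_mul, norm_inv t]
    field_simp
  · have h1 : HasDerivAt (fun t => f () t ξ) (D' ξ) (s⁻¹ * 0) := by
      rw [mul_zero]
      exact ((hf.famB.holT () ξ hξ).differentiableAt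
        (Metric.isOpen_ball.mem_nhds zero_mem_unit_ball)).hasDerivAt
    have h2 : HasDerivAt (fun t : ℂ => f () (s⁻¹ * t) ξ) (D' ξ * s⁻¹) 0 := by
      have := h1.comp (0 : ℂ) ((hasDerivAt_id (0 : ℂ)).const_mul s⁻¹)
      rwa [mul_one] at this
    have h3 : HasDerivAt (fun t : ℂ => f () (s⁻¹ * t) ξ) (s⁻¹ * D' ξ) 0 := by rwa [mul_comm]
    refine h3.congr_of_eventuallyEq ?_
    filter_upwards [hsball] with t ht
    exact (hP' t ht ξ hξ).2

end Families

/-! ### Analytic functions on phase space -/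

/-- The interior of `phaseDomain N R`. -/
def openDomain (N : ℕ) (R : ℝ) : Set (Phase N) :=
  {p | (∀ i, |(p.1 i).im| < R) ∧ |(p.2.2 0).im| < R ∧
    (∑ i, (p.2.1 i).re ^ 2) + (p.2.2 1).re ^ 2 < R ^ 2 ∧ (∀ i, |(p.2.1 i).im| < R) ∧
    |(p.2.2 1).im| < R}

theorem isOpen_openDomain {R : ℝ} : IsOpen (openDomain N R) := by
  have h1 : IsOpen {p : Phase N | ∀ i, |(p.1 i).im| < R} := by
    simp only [Set.ofPred_forall]
    exact isOpen_iInter_of_finite fun j => isOpen_lt (by fun_prop) continuous_const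
  have h2 : IsOpen {p : Phase N | |(p.2.2 0).im| < R} := isOpen_lt (by fun_prop) continuous_const
  have h3 : IsOpen {p : Phase N | (∑ i, (p.2.1 i).re ^ 2) + (p.2.2 1).re ^ 2 < R ^ 2} :=
    isOpen_lt (by fun_prop) continuous_const
  have h4 : IsOpen {p : Phase N | ∀ i, |(p.2.1 i).im| < R} := by
    simp only [Set.ofPred_forall]
    exact isOpen_iInter_of_finite fun j => isOpen_lt (by fun_prop) continuous_const
  have h5 : IsOpen {p : Phase N | |(p.2.2 1).im| < R} := isOpen_lt (by fun_prop) continuous_const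
  exact h1.inter (h2.inter (h3.inter (h4.inter h5)))

theorem openDomain_subset {R : ℝ} : openDomain N R ⊆ phaseDomain N R := fun _ hp =>
  ⟨fun i => (hp.1 i).le, hp.2.1.le, hp.2.2.1.le, fun i => (hp.2.2.2.1 i).le, hp.2.2.2.2.le⟩

theorem nonneg_of_mem_phaseDomain {R : ℝ} {p : Phase N} (hp : p ∈ phaseDomain N R) : 0 ≤ R :=
  (abs_nonneg _).trans hp.2.1

theorem phaseDomain_subset_openDomain {R R' : ℝ} (h : R < R') :
    phaseDomain N R ⊆ openDomain N R' := fun p hp => by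
  have hR := nonneg_of_mem_phaseDomain hp
  exact ⟨fun i => (hp.1 i).trans_lt h, hp.2.1.trans_lt h,
    hp.2.2.1.trans_lt (by nlinarith), fun i => (hp.2.2.2.1 i).trans_lt h, hp.2.2.2.2.trans_lt h⟩

/-- The domain is unbounded in Re x and Re z₁, so a uniform distance between two sizes cannot come
from compactness and is computed explicitly. -/
theorem exists_ball_subset_phaseDomain (N : ℕ) {R R' : ℝ} (h : R < R') :
    ∃ η : ℝ, 0 < η ∧ ∀ p ∈ phaseDomain N R, Metric.ball p η ⊆ phaseDomain N R' := by
  by_cases hR : 0 ≤ R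
  swap
  · exact ⟨1, one_pos, fun p hp => absurd (nonneg_of_mem_phaseDomain hp) hR⟩
  -- A shift by η ≤ 1 changes the square of a real part of modulus at most R by at most η(2R + 1),
  -- and N + 1 such squares enter the Euclidean condition.
  set K : ℝ := (N + 1) * (2 * R + 1) with hK
  have hKpos : 0 < K := by positivity
  have hd : 0 < R' ^ 2 - R ^ 2 := by nlinarith
  obtain ⟨η, hη, h1, h2, h3⟩ : ∃ η : ℝ, 0 < η ∧ η ≤ 1 ∧ η ≤ R' - R ∧ η * K ≤ R' ^ 2 - R ^ 2 := by
    refine ⟨min 1 (min (R' - R) ((R' ^ 2 - R ^ 2) / K)), ?_, min_le_left _ _,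
      (min_le_right _ _).trans (min_le_left _ _), ?_⟩
    · exact lt_min one_pos (lt_min (by linarith) (by positivity))
    · rw [← le_div_iff₀ hKpos]
      exact (min_le_right _ _).trans (min_le_right _ _)
  refine ⟨η, hη, fun p hp q hq => ?_⟩
  rw [mem_ball_iff_norm] at hq
  have hx : ∀ i, ‖q.1 i - p.1 i‖ ≤ η := fun i =>
    (norm_le_pi_norm (q.1 - p.1) i).trans ((norm_fst_le (q - p)).trans hq.le)
  have hy : ∀ i, ‖q.2.1 i - p.2.1 i‖ ≤ η := fun i =>
    (norm_le_pi_norm (q.2.1 - p.2.1) i).trans ((norm_fst_le (q - p).2).trans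
      ((norm_snd_le (q - p)).trans hq.le))
  have hz : ∀ i, ‖q.2.2 i - p.2.2 i‖ ≤ η := fun i =>
    (norm_le_pi_norm (q.2.2 - p.2.2) i).trans ((norm_snd_le (q - p).2).trans
      ((norm_snd_le (q - p)).trans hq.le))
  have him : ∀ {a b : ℂ}, ‖b - a‖ ≤ η → |a.im| ≤ R → |b.im| ≤ R' := by
    intro a b hab ha
    have h4 := (Complex.abs_im_le_norm (b - a)).trans hab
    rw [Complex.sub_im] at h4
    have := abs_sub_abs_le_abs_sub b.im a.im
    linarith
  have hre : ∀ {a b : ℂ}, ‖b - a‖ ≤ η → |a.re| ≤ R → b.re ^ 2 ≤ a.re ^ 2 + η * (2 * R + 1) := by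
    intro a b hab ha
    have h4 := (Complex.abs_re_le_norm (b - a)).trans hab
    rw [Complex.sub_re] at h4
    set e := b.re - a.re
    have hb : b.re = a.re + e := by simp [e]
    have h5 : a.re * e ≤ R * η :=
      (le_abs_self _).trans (by rw [abs_mul]; gcongr)
    have h6 : e ^ 2 ≤ η := by
      rw [← sq_abs]; nlinarith [abs_nonneg e]
    rw [hb]; nlinarith
  have hsq : ∀ {x : ℝ}, x ^ 2 ≤ R ^ 2 → |x| ≤ R := fun hx => abs_le_of_sq_le_sq hx hR
  have hsum := hp.2.2.1
  simp only at hsum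
  have hyre : ∀ i, |(p.2.1 i).re| ≤ R := fun i => hsq <| by
    have := Finset.single_le_sum (f := fun i => (p.2.1 i).re ^ 2) (fun i _ => sq_nonneg _)
      (Finset.mem_univ i)
    nlinarith [sq_nonneg (p.2.2 1).re]
  have hzre : |(p.2.2 1).re| ≤ R := hsq <| by
    have := Finset.sum_nonneg (s := Finset.univ) (f := fun i => (p.2.1 i).re ^ 2)
      (fun i _ => sq_nonneg _)
    linarith
  refine ⟨fun i => him (hx i) (hp.1 i), him (hz 0) hp.2.1, ?_,
    fun i => him (hy i) (hp.2.2.2.1 i), him (hz 1) hp.2.2.2.2⟩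
  have hs : ∑ i, (q.2.1 i).re ^ 2 ≤ ∑ i, ((p.2.1 i).re ^ 2 + η * (2 * R + 1)) :=
    Finset.sum_le_sum fun i _ => hre (hy i) (hyre i)
  rw [Finset.sum_add_distrib, Finset.sum_const, Finset.card_univ, Fintype.card_fin,
    nsmul_eq_mul] at hs
  have := hre (hz 1) hzre
  simp only
  rw [hK] at h3
  linarith

/-! ### Bounded holomorphic functions on phase space and their composition with families -/

section Nice
variable {I : Type*} {ρ : ℝ}

/-- Families of holomorphic functions on phase space which are periodic in `x` and uniformly
bounded on smaller domains. -/
structure Nice (ρ : ℝ) (F : I → Phase N → ℂ) : Prop where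
  hol : ∀ i, DifferentiableOn ℂ (F i) (openDomain N (3 * ρ))
  periodic : ∀ i, ∀ p ∈ openDomain N (3 * ρ), ∀ j,
    F i (p.1 + Pi.single j (2 * Real.pi : ℂ), p.2.1, p.2.2) = F i p
  bdd : ∀ R < 3 * ρ, ∃ C : ℝ, ∀ i, ∀ p ∈ phaseDomain N R, ‖F i p‖ ≤ C

/-- Cauchy's estimate on a slightly larger domain. The class is closed under differentiation
precisely because bounds are demanded only on the domains of size R < 3ρ, each with its own
constant. -/
theorem Nice.fderiv {F : I → Phase N → ℂ} (hF : Nice ρ F) (e : Phase N) :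
    Nice ρ (fun i p => fderiv ℂ (F i) p e) where
  hol i := differentiableOn_fderiv_apply isOpen_openDomain (hF.hol i) e
  periodic i p hp j := by
    have h1 : (fun q : Phase N => F i (q + (Pi.single j (2 * Real.pi : ℂ), 0))) =ᶠ[𝓝 p] F i := by
      filter_upwards [isOpen_openDomain.mem_nhds hp] with q hq
      rw [← hF.periodic i q hq j]
      congr 1
      ext <;> simp
    have h2 := h1.fderiv_eq (𝕜 := ℂ)
    rw [fderiv_comp_add_right] at h2
    have h3 : p + (Pi.single j (2 * Real.pi : ℂ), 0)
        = (p.1 + Pi.single j (2 * Real.pi : ℂ), p.2.1, p.2.2) := by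
      ext <;> simp
    rw [h3] at h2
    rw [h2]
  bdd R hR := by
    obtain ⟨R', h1, h2⟩ := exists_between hR
    obtain ⟨η, hη, hb⟩ := exists_ball_subset_phaseDomain N h1
    obtain ⟨C, hC⟩ := hF.bdd R' h2
    refine ⟨2 * C / η * ‖e‖, fun i p hp => ?_⟩
    refine (ContinuousLinearMap.le_opNorm _ _).trans ?_
    gcongr
    refine Complex.norm_fderiv_le_div_of_mapsTo_ball
      ((hF.hol i).mono ((hb p hp).trans (phaseDomain_subset_openDomain h2))) (fun q hq => ?_) hη
    rw [mem_closedBall_iff_norm]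
    refine (norm_sub_le _ _).trans ?_
    linarith [hC i q (hb p hp hq), hC i p (hb p hp (Metric.mem_ball_self hη))]

theorem Nice.dY {F : I → Phase N → ℂ} (hF : Nice ρ F) (j : Fin N) : Nice ρ (fun i => dY j (F i)) :=
  hF.fderiv _

theorem Nice.dZ {F : I → Phase N → ℂ} (hF : Nice ρ F) (j : Fin 2) : Nice ρ (fun i => dZ j (F i)) :=
  hF.fderiv _

/-- `∂F/∂x_j`. -/
def dX (j : Fin N) (F : Phase N → ℂ) (p : Phase N) : ℂ := fderiv ℂ F p (Pi.single j 1, 0, 0)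

theorem fderiv_phase (F : Phase N → ℂ) (p v : Phase N) :
    fderiv ℂ F p v = (∑ i, v.1 i * dX i F p) + (∑ i, v.2.1 i * dY i F p)
      + ∑ i, v.2.2 i * dZ i F p := by
  have hv : v = (∑ i, v.1 i • ((Pi.single i 1, 0, 0) : Phase N))
      + (∑ i, v.2.1 i • ((0, Pi.single i 1, 0) : Phase N))
      + ∑ i, v.2.2 i • ((0, 0, Pi.single i 1) : Phase N) := by
    ext j
    · simp [Prod.fst_sum, Finset.sum_apply, Pi.single_apply]
    · simp [Prod.fst_sum, Prod.snd_sum, Finset.sum_apply, Pi.single_apply]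
    · fin_cases j <;> simp [Prod.snd_sum]
  conv_lhs => rw [hv]
  simp only [map_add, map_sum, map_smul, smul_eq_mul]
  rfl

theorem fderiv_fderiv_comm {F : Phase N → ℂ} {R : ℝ} (hF : DifferentiableOn ℂ F (openDomain N R))
    {p : Phase N} (hp : p ∈ openDomain N R) (e e' : Phase N) :
    fderiv ℂ (fun q => fderiv ℂ F q e) p e' = fderiv ℂ (fun q => fderiv ℂ F q e') p e := by
  have h2 : ContDiffAt ℂ 2 F p := (contDiffOn_of_differentiableOn isOpen_openDomain 2 hF).contDiffAt
    (isOpen_openDomain.mem_nhds hp)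
  have h3 : DifferentiableAt ℂ (fderiv ℂ F) p :=
    (h2.fderiv_right (m := 1) (by norm_num)).differentiableAt (by simp)
  have h4 : ∀ e e' : Phase N, fderiv ℂ (fun q => fderiv ℂ F q e) p e'
      = fderiv ℂ (fderiv ℂ F) p e' e := by
    intro e e'
    rw [fderiv_clm_apply h3 (differentiableAt_const e)]
    simp
  rw [h4, h4]
  exact (h2.isSymmSndFDerivAt (by simp)) _ _

variable {h : ℝ}

theorem hasDerivAt_phase {q : ℝ → Phase N} {q' : Phase N} {s : ℝ}
    (h1 : ∀ a, HasDerivAt (fun t => (q t).1 a) (q'.1 a) s)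
    (h2 : ∀ a, HasDerivAt (fun t => (q t).2.1 a) (q'.2.1 a) s)
    (h3 : ∀ a, HasDerivAt (fun t => (q t).2.2 a) (q'.2.2 a) s) : HasDerivAt q q' s :=
  HasDerivAt.prodMk (f₁ := fun t => (q t).1) (hasDerivAt_pi.2 h1)
    (HasDerivAt.prodMk (f₁ := fun t => (q t).2.1) (f₂ := fun t => (q t).2.2)
      (hasDerivAt_pi.2 h2) (hasDerivAt_pi.2 h3))

theorem hasDerivAt_comp_phase {F : Phase N → ℂ} {q : ℝ → Phase N} {q' : Phase N} {s : ℝ}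
    (hF : DifferentiableAt ℂ F (q s)) (hq : HasDerivAt q q' s) :
    HasDerivAt (fun t => F (q t)) (fderiv ℂ F (q s) q') s :=
  (hF.hasFDerivAt.restrictScalars ℝ).comp_hasDerivAt s hq

/-- Families of maps to phase space with which one can compose. -/
structure PhaseFam (ρ h : ℝ) (d : ℕ) (q : I → ℂ → (Fin N → ℂ) → Phase N) : Prop where
  x : ∀ a, HW h d (fun i t ξ => (q i t ξ).1 a)
  y : ∀ a, HW h d (fun i t ξ => (q i t ξ).2.1 a)
  z : ∀ a, HW h d (fun i t ξ => (q i t ξ).2.2 a)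
  dom : ∃ R < 3 * ρ, ∀ i, ∀ t ∈ Metric.ball (0 : ℂ) 1, ∀ ξ ∈ strip N h,
    q i t ξ ∈ phaseDomain N R
  periodic : ∀ i, ∀ t ∈ Metric.ball (0 : ℂ) 1, ∀ ξ ∈ strip N h, ∀ j,
    q i t (ξ + Pi.single j (2 * Real.pi : ℂ))
      = ((q i t ξ).1 + Pi.single j (2 * Real.pi : ℂ), (q i t ξ).2.1, (q i t ξ).2.2)

theorem PhaseFam.pred {d : ℕ} {q : I → ℂ → (Fin N → ℂ) → Phase N} (hq : PhaseFam ρ h (d + 1) q) :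
    PhaseFam ρ h d q :=
  ⟨fun a => (hq.x a).pred, fun a => (hq.y a).pred, fun a => (hq.z a).pred, hq.dom, hq.periodic⟩

theorem PhaseFam.mem_openDomain {d : ℕ} {q : I → ℂ → (Fin N → ℂ) → Phase N}
    (hq : PhaseFam ρ h d q) (i : I) {t : ℂ} (ht : t ∈ Metric.ball (0 : ℂ) 1) {ξ : Fin N → ℂ}
    (hξ : ξ ∈ strip N h) : q i t ξ ∈ openDomain N (3 * ρ) := by
  obtain ⟨R, hR, hdom⟩ := hq.dom
  exact phaseDomain_subset_openDomain hR (hdom i t ht ξ hξ)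

theorem PhaseFam.famB_comp {d : ℕ} {q : I → ℂ → (Fin N → ℂ) → Phase N} (hq : PhaseFam ρ h d q)
    {F : I → Phase N → ℂ} (hF : Nice ρ F) : FamB h (fun i t ξ => F i (q i t ξ)) where
  cont i t ht := (hF.hol i).continuousOn.comp
    (ContinuousOn.prodMk (continuousOn_pi.2 fun a => (hq.x a).famW.cont i t ht)
      (ContinuousOn.prodMk (continuousOn_pi.2 fun a => (hq.y a).famW.cont i t ht)
        (continuousOn_pi.2 fun a => (hq.z a).famW.cont i t ht)))
    fun ξ hξ => hq.mem_openDomain i ht hξ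
  hol i t ht := (hF.hol i).comp
    (DifferentiableOn.prodMk (differentiableOn_pi.2 fun a => (hq.x a).famW.hol i t ht)
      (DifferentiableOn.prodMk (differentiableOn_pi.2 fun a => (hq.y a).famW.hol i t ht)
        (differentiableOn_pi.2 fun a => (hq.z a).famW.hol i t ht)))
    fun ξ hξ => hq.mem_openDomain i ht (openStrip_subset hξ)
  holT i ξ hξ := (hF.hol i).comp
    (DifferentiableOn.prodMk (f₁ := fun t => (q i t ξ).1)
      (differentiableOn_pi.2 fun a => (hq.x a).famW.holT i ξ hξ)
      (DifferentiableOn.prodMk (f₁ := fun t => (q i t ξ).2.1) (f₂ := fun t => (q i t ξ).2.2)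
        (differentiableOn_pi.2 fun a => (hq.y a).famW.holT i ξ hξ)
        (differentiableOn_pi.2 fun a => (hq.z a).famW.holT i ξ hξ)))
    fun t ht => hq.mem_openDomain i ht hξ
  periodic i t ht ξ hξ j := by
    rw [hq.periodic i t ht ξ hξ j, hF.periodic i _ (hq.mem_openDomain i ht hξ) j]
  bdd := by
    obtain ⟨R, hR, hdom⟩ := hq.dom
    obtain ⟨C, hC⟩ := hF.bdd R hR
    exact ⟨C, fun i t ht ξ hξ => hC i _ (hdom i t ht ξ hξ)⟩

/-- By the chain rule ∂_j(F∘q) is a sum of products of ∂_j q with partial derivatives of F along q.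
The former are bounded families even though q itself is only of class `HW`, the latter are again
`Nice`, so induction on the order applies. -/
theorem PhaseFam.comp {d : ℕ} : ∀ {q : I → ℂ → (Fin N → ℂ) → Phase N}, PhaseFam ρ h d q →
    ∀ {F : I → Phase N → ℂ}, Nice ρ F → HF h d (fun i t ξ => F i (q i t ξ)) := by
  induction d with
  | zero => exact fun hq F hF => hq.famB_comp hF
  | succ d ih =>
    intro q hq F hF
    have hder : ∀ i, ∀ t ∈ Metric.ball (0 : ℂ) 1, ∀ ξ ∈ strip N h, ∀ j,
        HasDerivAt (fun s : ℝ => F i (q i t (ξ + Pi.single j (s : ℂ))))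
        ((∑ a, pd j (fun ξ => (q i t ξ).1 a) ξ * dX a (F i) (q i t ξ))
          + (∑ a, pd j (fun ξ => (q i t ξ).2.1 a) ξ * dY a (F i) (q i t ξ))
          + ∑ a, pd j (fun ξ => (q i t ξ).2.2 a) ξ * dZ a (F i) (q i t ξ)) 0 := by
      intro i t ht ξ hξ j
      have h0 : ξ + Pi.single j ((0 : ℝ) : ℂ) = ξ := by simp
      have h1 := hasDerivAt_phase (q := fun s : ℝ => q i t (ξ + Pi.single j (s : ℂ))) (s := 0)
        (q' := (fun a => pd j (fun ξ => (q i t ξ).1 a) ξ,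
          fun a => pd j (fun ξ => (q i t ξ).2.1 a) ξ, fun a => pd j (fun ξ => (q i t ξ).2.2 a) ξ))
        (fun a => ((hq.x a).2.1 i t ht ξ hξ j).hasDerivAt)
        (fun a => ((hq.y a).2.1 i t ht ξ hξ j).hasDerivAt)
        (fun a => ((hq.z a).2.1 i t ht ξ hξ j).hasDerivAt)
      have hm := hq.mem_openDomain i ht hξ
      rw [← h0] at hm
      have h2 := hasDerivAt_comp_phase
        ((hF.hol i).differentiableAt (isOpen_openDomain.mem_nhds hm)) h1
      rw [h0, fderiv_phase] at h2
      exact h2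
    refine ⟨hq.famB_comp hF, fun i t ht ξ hξ j => (hder i t ht ξ hξ j).differentiableAt,
      fun j => HF.congr ?_ fun i t ht ξ hξ => (pd_eq_of_hasDerivAt (hder i t ht ξ hξ j)).symm⟩
    exact ((HF.sum _ fun a _ => ((hq.x a).2.2 j).mul (ih hq.pred (hF.fderiv _))).add
      (HF.sum _ fun a _ => ((hq.y a).2.2 j).mul (ih hq.pred (hF.fderiv _)))).add
      (HF.sum _ fun a _ => ((hq.z a).2.2 j).mul (ih hq.pred (hF.fderiv _)))

theorem AnalyticHamiltonian.nice_lift {H₀ : (Fin N → ℂ) × ℂ → ℂ} {H₁ : Phase N → ℂ}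
    (hH : AnalyticHamiltonian ρ H₀ H₁) : Nice ρ (fun _ : I => lift₀ H₀) where
  hol _ := by
    have hp : Differentiable ℂ fun p : Phase N => (p.2.1, p.2.2 1) := by fun_prop
    exact (hH.analytic₀.differentiableOn).comp hp.differentiableOn
      fun p hp => (openDomain_subset hp).2.2
  periodic _ p _ j := rfl
  bdd R hR := by
    obtain ⟨C, hC, -⟩ := hH.bounded
    exact ⟨C, fun _ p hp => hC _ (openDomain_subset (phaseDomain_subset_openDomain hR hp)).2.2⟩

theorem AnalyticHamiltonian.nice_pert {H₀ : (Fin N → ℂ) × ℂ → ℂ} {H₁ : Phase N → ℂ}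
    (hH : AnalyticHamiltonian ρ H₀ H₁) : Nice ρ (fun _ : I => H₁) where
  hol _ := hH.analytic₁.differentiableOn.mono openDomain_subset
  periodic _ p hp j := hH.periodic_x p (openDomain_subset hp) j
  bdd R hR := by
    obtain ⟨C, -, hC⟩ := hH.bounded
    exact ⟨C, fun _ p hp => hC _ (openDomain_subset (phaseDomain_subset_openDomain hR hp))⟩

/-- The perturbation parameter is allowed to vary with the index, so that bounds for this family
depend on ε only through ε₀. -/
theorem AnalyticHamiltonian.nice_ham {H₀ : (Fin N → ℂ) × ℂ → ℂ} {H₁ : Phase N → ℂ}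
    (hH : AnalyticHamiltonian ρ H₀ H₁) {ε₀ : ℝ} (ε : I → ℝ) (hε : ∀ i, |ε i| ≤ ε₀) :
    Nice ρ (fun i => ham H₀ H₁ (ε i)) where
  hol i := ((hH.nice_lift (I := Unit)).hol ()).add
    (((hH.nice_pert (I := Unit)).hol ()).const_mul (ε i : ℂ))
  periodic i p hp j := by
    simp only [ham]
    rw [(hH.nice_lift (I := Unit)).periodic () p hp j, (hH.nice_pert (I := Unit)).periodic () p hp j]
  bdd R hR := by
    obtain ⟨C, hC⟩ := (hH.nice_lift (I := Unit)).bdd R hR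
    obtain ⟨D, hD⟩ := (hH.nice_pert (I := Unit)).bdd R hR
    refine ⟨C + ε₀ * D, fun i p hp => norm_add_le_of_le (hC () p hp) ?_⟩
    rw [norm_mul, Complex.norm_real, Real.norm_eq_abs]
    exact mul_le_mul (hε i) (hD () p hp) (norm_nonneg _) ((abs_nonneg _).trans (hε i))

end Nice

/-! ### Matrix valued families and their inverses -/

section MatrixFamilies
variable {I : Type*} {h : ℝ} {d : ℕ} {ι κ ν : Type*}

/-- Matrix valued families all of whose entries are in the class `HF`. -/
def MHF (h : ℝ) (d : ℕ) (A : I → ℂ → (Fin N → ℂ) → Matrix ι κ ℂ) : Prop :=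
  ∀ p q, HF h d (fun i t ξ => A i t ξ p q)

theorem MHF.mul [Fintype κ] {A : I → ℂ → (Fin N → ℂ) → Matrix ι κ ℂ}
    {B : I → ℂ → (Fin N → ℂ) → Matrix κ ν ℂ}
    (hA : MHF h d A) (hB : MHF h d B) : MHF h d (fun i t ξ => A i t ξ * B i t ξ) := fun p q => by
  simp only [Matrix.mul_apply]
  exact HF.sum _ fun a _ => (hA p a).mul (hB a q)

theorem MHF.add {A B : I → ℂ → (Fin N → ℂ) → Matrix ι κ ℂ} (hA : MHF h d A) (hB : MHF h d B) :
    MHF h d (fun i t ξ => A i t ξ + B i t ξ) := fun p q => (hA p q).add (hB p q)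

theorem MHF.neg {A : I → ℂ → (Fin N → ℂ) → Matrix ι κ ℂ} (hA : MHF h d A) :
    MHF h d (fun i t ξ => -A i t ξ) := fun p q => (hA p q).neg

theorem MHF.transpose {A : I → ℂ → (Fin N → ℂ) → Matrix ι κ ℂ} (hA : MHF h d A) :
    MHF h d (fun i t ξ => (A i t ξ)ᵀ) := fun p q => hA q p

theorem MHF.const (A : Matrix ι κ ℂ) : MHF (N := N) h d (fun (_ : I) _ _ => A) :=
  fun _ _ => HF.const _

theorem MHF.smul {f : I → ℂ → (Fin N → ℂ) → ℂ} {A : I → ℂ → (Fin N → ℂ) → Matrix ι κ ℂ}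
    (hf : HF h d f) (hA : MHF h d A) : MHF h d (fun i t ξ => f i t ξ • A i t ξ) :=
  fun p q => hf.mul (hA p q)

theorem MHF.sum {α : Type*} (s : Finset α) {A : α → I → ℂ → (Fin N → ℂ) → Matrix ι κ ℂ}
    (hA : ∀ a ∈ s, MHF h d (A a)) : MHF h d (fun i t ξ => ∑ a ∈ s, A a i t ξ) := fun p q => by
  simp only [Matrix.sum_apply]
  exact HF.sum _ fun a ha => hA a ha p q

theorem MHF.det [Fintype ι] [DecidableEq ι] {A : I → ℂ → (Fin N → ℂ) → Matrix ι ι ℂ}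
    (hA : MHF h d A) : HF h d (fun i t ξ => (A i t ξ).det) := by
  simp only [Matrix.det_apply']
  exact HF.sum _ fun σ _ => (HF.const _).mul (HF.prod _ fun a _ => hA _ _)

theorem MHF.adjugate [Fintype ι] [DecidableEq ι] {A : I → ℂ → (Fin N → ℂ) → Matrix ι ι ℂ}
    (hA : MHF h d A) : MHF h d (fun i t ξ => (A i t ξ).adjugate) := fun p q => by
  simp only [Matrix.adjugate_apply]
  refine MHF.det fun a b => ?_
  simp only [Matrix.updateRow_apply]
  split_ifs
  · exact HF.const _
  · exact hA a b

/-- Cramer's rule: the adjugate is polynomial in the entries, so only the determinant has to stay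
away from zero. -/
theorem MHF.inv [Fintype ι] [DecidableEq ι] {A : I → ℂ → (Fin N → ℂ) → Matrix ι ι ℂ}
    (hA : MHF h d A) {c : ℝ} (hc : 0 < c)
    (hAc : ∀ i, ∀ t ∈ Metric.ball (0 : ℂ) 1, ∀ ξ ∈ strip N h, c ≤ ‖(A i t ξ).det‖) :
    MHF h d (fun i t ξ => (A i t ξ)⁻¹) := by
  simp only [Matrix.inv_def, Ring.inverse_eq_inv']
  exact MHF.smul (HF.inv hc hA.det hAc) hA.adjugate

theorem MHF.memA {A : I → ℂ → (Fin N → ℂ) → Matrix ι κ ℂ} (hA : MHF h d A) (i : I) {t : ℂ}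
    (ht : t ∈ Metric.ball (0 : ℂ) 1) : MatMemA h d (A i t) := fun p q => (hA p q).memA i t ht

theorem exists_matNorm_le [Finite ι] [Finite κ] {A B : I → ℂ → (Fin N → ℂ) → Matrix ι κ ℂ}
    {s : I → ℂ → ℝ} (hs : ∀ i t, 0 ≤ s i t)
    (hA : ∀ p q, ∃ C : ℝ, 0 ≤ C ∧ ∀ i, ∀ t ∈ Metric.ball (0 : ℂ) 1,
      normA h d (fun ξ => A i t ξ p q - B i t ξ p q) ≤ ENNReal.ofReal (C * s i t)) :
    ∃ C : ℝ, 0 ≤ C ∧ ∀ i, ∀ t ∈ Metric.ball (0 : ℂ) 1,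
      matNorm h d (fun ξ => A i t ξ - B i t ξ) ≤ ENNReal.ofReal (C * s i t) := by
  cases nonempty_fintype ι
  cases nonempty_fintype κ
  choose C hC0 hC using hA
  have h1 : ∀ p, 0 ≤ ∑ q, C p q := fun p => Finset.sum_nonneg fun q _ => hC0 p q
  refine ⟨∑ p, ∑ q, C p q, Finset.sum_nonneg fun p _ => h1 p, fun i t ht =>
    iSup_le fun p => iSup_le fun q => (hC p q i t ht).trans (ENNReal.ofReal_le_ofReal ?_)⟩
  have h2 : C p q ≤ ∑ q, C p q := Finset.single_le_sum (fun q _ => hC0 p q) (Finset.mem_univ q)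
  have h3 : ∑ q, C p q ≤ ∑ p, ∑ q, C p q :=
    Finset.single_le_sum (f := fun p => ∑ q, C p q) (fun p _ => h1 p) (Finset.mem_univ p)
  exact mul_le_mul_of_nonneg_right (h2.trans h3) (hs i t)

theorem MHF.matNorm_le [Finite ι] [Finite κ] {A : I → ℂ → (Fin N → ℂ) → Matrix ι κ ℂ}
    (hA : MHF h d A) : ∃ C : ℝ, 0 ≤ C ∧ ∀ i, ∀ t ∈ Metric.ball (0 : ℂ) 1,
      matNorm h d (A i t) ≤ ENNReal.ofReal C := by
  obtain ⟨C, hC0, hC⟩ := exists_matNorm_le (h := h) (d := d) (A := A) (B := fun _ _ _ => 0)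
    (s := fun _ _ => 1) (fun _ _ => zero_le_one) fun p q => by
      obtain ⟨C, hC0, hC⟩ := (hA p q).normA_le
      exact ⟨C, hC0, fun i t ht => by simpa using hC i t ht⟩
  exact ⟨C, hC0, fun i t ht => by simpa using hC i t ht⟩

theorem MHF.matNorm_sub_le [Finite ι] [Finite κ] {A : I → ℂ → (Fin N → ℂ) → Matrix ι κ ℂ}
    (hA : MHF h d A) : ∃ C : ℝ, 0 ≤ C ∧ ∀ i, ∀ t ∈ Metric.ball (0 : ℂ) 1,
      matNorm h d (fun ξ => A i t ξ - A i 0 ξ) ≤ ENNReal.ofReal (C * ‖t‖) :=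
  exists_matNorm_le (s := fun _ t => ‖t‖) (fun _ _ => norm_nonneg _) fun p q =>
    (hA p q).normA_sub_le

end MatrixFamilies

/-! ### The second and third order coefficients of the transformed Hamiltonian -/

/-- The derivative of `G` in the direction `(0, η, ζ)`. -/
def dirD (G : Phase N → ℂ) (p : Phase N) (η : Fin N → ℂ) (ζ : Fin 2 → ℂ) : ℂ :=
  (∑ a, η a * dY a G p) + ∑ c, ζ c * dZ c G p

/-- The quadratic part of the variation of the transformed Hamiltonian in the direction
`(0, η, ζ)`. -/
def cubic (F : Phase N → ℂ) (φ : Coord N) (η : Fin N → ℂ) (ζ : Fin 2 → ℂ) (ξ : Fin N → ℂ) :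
    Matrix (Fin 2) (Fin 2) ℂ :=
  (∑ i, dirD (dY i F) (φ.pt ξ) η ζ • φ.R i ξ)
    + (φ.Lam ξ)ᵀ * (Matrix.of fun i j => dirD (dY i (dY j F)) (φ.pt ξ) η ζ) * φ.Lam ξ
    + (φ.W ξ)ᵀ * (Matrix.of fun i j => dirD (dZ i (dY j F)) (φ.pt ξ) η ζ) * φ.Lam ξ
    + ((φ.W ξ)ᵀ * (Matrix.of fun i j => dirD (dZ i (dY j F)) (φ.pt ξ) η ζ) * φ.Lam ξ)ᵀ
    + (φ.W ξ)ᵀ * (Matrix.of fun i j => dirD (dZ i (dZ j F)) (φ.pt ξ) η ζ) * φ.W ξ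

/-- The matrix with entries `(R_i)_{pl}`, for fixed `l`. -/
def Rcol (φ : Coord N) (l : Fin 2) (ξ : Fin N → ℂ) : Matrix (Fin N) (Fin 2) ℂ :=
  Matrix.of fun i p => φ.R i ξ p l

/-- The matrices `U_{ij}`. -/
def coefU (F : Phase N → ℂ) (φ : Coord N) (i : Fin 2) (j : Fin N) (ξ : Fin N → ℂ) :
    Matrix (Fin 2) (Fin 2) ℂ :=
  (Matrix.of fun p q => T F φ ξ p j * J q i) + (Matrix.of fun p q => T F φ ξ p j * J q i)ᵀ

/-- The matrices `E_j`. -/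
def coefE (F : Phase N → ℂ) (φ : Coord N) (j : Fin N) (ξ : Fin N → ℂ) : Matrix (Fin 2) (Fin 2) ℂ :=
  cubic F φ (fun a => φ.V ξ a j) 0 ξ

/-- The matrices `K_l`. -/
def coefK (F : Phase N → ℂ) (φ : Coord N) (l : Fin 2) (ξ : Fin N → ℂ) : Matrix (Fin 2) (Fin 2) ℂ :=
  cubic F φ (fun a => φ.Lam ξ a l) (fun c => φ.W ξ c l) ξ
    + (((φ.W ξ)ᵀ * hessZY F (φ.pt ξ) + (φ.Lam ξ)ᵀ * hessYY F (φ.pt ξ)) * Rcol φ l ξ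
      + (((φ.W ξ)ᵀ * hessZY F (φ.pt ξ) + (φ.Lam ξ)ᵀ * hessYY F (φ.pt ξ)) * Rcol φ l ξ)ᵀ)

/-! ### Families of coordinate vectors -/

section CoordFamilies
variable {I : Type*} {ρ h : ℝ} {d : ℕ}

/-- Families of coordinate vectors in a neighbourhood of the base points. -/
structure CoordFam (ρ h : ℝ) (d : ℕ) (Φ : I → ℂ → Coord N) : Prop where
  β : ∀ a, HF (N := N) h d (fun i t _ => (Φ i t).β a)
  φ₀ : HF h (d + 1) (fun i t => (Φ i t).φ₀)
  u : ∀ a, HF h (d + 1) (fun i t ξ => (Φ i t).u ξ a)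
  w : ∀ a, HW h (d + 1) (fun i t ξ => (Φ i t).w ξ a)
  w₁ : HF h (d + 1) (fun i t ξ => (Φ i t).w ξ 1)
  w_periodic : ∀ i, ∀ t ∈ Metric.ball (0 : ℂ) 1, ∀ ξ ∈ strip N h, ∀ j,
    (Φ i t).w (ξ + Pi.single j (2 * Real.pi : ℂ)) = (Φ i t).w ξ
  W₁₁ : HF h (d + 1) (fun i t => (Φ i t).W₁₁)
  W₁₂ : HF h (d + 1) (fun i t => (Φ i t).W₁₂)
  W₂₁ : HF h (d + 1) (fun i t => (Φ i t).W₂₁)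
  det : ∀ i, ∀ t ∈ Metric.ball (0 : ℂ) 1, ∀ ξ ∈ strip N h,
    1 / 2 ≤ ‖(1 + jac (Φ i t).u ξ).det‖
  W₁₁_ge : ∀ i, ∀ t ∈ Metric.ball (0 : ℂ) 1, ∀ ξ ∈ strip N h, 1 / 2 ≤ ‖(Φ i t).W₁₁ ξ‖
  dom : ∃ R < 3 * ρ, ∀ i, ∀ t ∈ Metric.ball (0 : ℂ) 1, ∀ ξ ∈ strip N h,
    (Φ i t).pt ξ ∈ phaseDomain N R

namespace CoordFam
variable {Φ : I → ℂ → Coord N}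

theorem jac_u (hΦ : CoordFam ρ h d Φ) : MHF h d (fun i t ξ => jac (Φ i t).u ξ) :=
  fun p q => (hΦ.u p).pd q

theorem jac_w (hΦ : CoordFam ρ h d Φ) : MHF h d (fun i t ξ => jac (Φ i t).w ξ) :=
  fun p q => (hΦ.w p).2.2 q

theorem V (hΦ : CoordFam ρ h d Φ) : MHF h d (fun i t ξ => (Φ i t).V ξ) :=
  (MHF.inv ((MHF.const 1).add hΦ.jac_u) (by norm_num : (0 : ℝ) < 1 / 2) hΦ.det).transpose

/-- No derivatives of the coordinates enter W, so it keeps all d + 1 of theirs. The extra one is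
spent in the matrices R_i, which contain ∂W. -/
theorem W_succ (hΦ : CoordFam ρ h d Φ) : MHF h (d + 1) (fun i t ξ => (Φ i t).W ξ) := by
  have h1 : HF h (d + 1) fun i t ξ =>
      (1 + (Φ i t).W₁₂ ξ * (Φ i t).W₂₁ ξ) * ((Φ i t).W₁₁ ξ)⁻¹ :=
    ((HF.const 1).add (hΦ.W₁₂.mul hΦ.W₂₁)).mul
      (HF.inv (by norm_num : (0 : ℝ) < 1 / 2) hΦ.W₁₁ hΦ.W₁₁_ge)
  intro p q
  fin_cases p <;> fin_cases q
  · exact hΦ.W₁₁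
  · exact hΦ.W₁₂
  · exact hΦ.W₂₁
  · exact h1

theorem W (hΦ : CoordFam ρ h d Φ) : MHF h d (fun i t ξ => (Φ i t).W ξ) :=
  fun p q => (hΦ.W_succ p q).pred

theorem Lam (hΦ : CoordFam ρ h d Φ) : MHF h d (fun i t ξ => (Φ i t).Lam ξ) :=
  (((hΦ.V.mul hΦ.jac_w.transpose).mul (MHF.const J)).mul hΦ.W).neg

theorem R (hΦ : CoordFam ρ h d Φ) (a : Fin N) : MHF h d (fun i t ξ => (Φ i t).R a ξ) :=
  (MHF.sum _ fun k _ => MHF.smul (hΦ.V a k)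
    (((MHF.transpose (A := fun i t ξ => mpd k (Φ i t).W ξ)
      fun p q => (hΦ.W_succ p q).pd k).mul (MHF.const J)).mul hΦ.W)).neg

theorem v (hΦ : CoordFam ρ h d Φ) (a : Fin N) : HF h d (fun i t ξ => (Φ i t).v ξ a) :=
  (hΦ.β a).add (HF.sum Finset.univ fun k _ => (hΦ.V a k).mul
    ((hΦ.φ₀.pd k).sub (hΦ.w₁.pred.mul ((hΦ.w 0).2.2 k))))

/-- The identity map is neither bounded nor periodic, but its derivatives are constants. This is one
reason for working with `HW`. -/
theorem _root_.LowerTori.HW.coord (a : Fin N) :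
    HW h d (fun (_ : I) (_ : ℂ) (ξ : Fin N → ℂ) => ξ a) := by
  have h0 : FamW h (fun (_ : I) (_ : ℂ) (ξ : Fin N → ℂ) => ξ a) :=
    ⟨fun _ _ _ => by fun_prop, fun _ _ _ => by fun_prop, fun _ _ _ => by fun_prop⟩
  have h1 : ∀ (ξ : Fin N → ℂ) j, HasDerivAt (fun t : ℝ => (ξ + Pi.single j (t : ℂ) : Fin N → ℂ) a)
      ((Pi.single j 1 : Fin N → ℂ) a) 0 := fun ξ j =>
    hasDerivAt_pi.1 (hasDerivAt_add_single ξ j 0) a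
  cases d with
  | zero => exact h0
  | succ d =>
    exact ⟨h0, fun _ _ _ ξ _ j => (h1 ξ j).differentiableAt, fun j =>
      (HF.const ((Pi.single j 1 : Fin N → ℂ) a)).congr fun _ _ _ ξ _ =>
        (pd_eq_of_hasDerivAt (f := fun ξ => ξ a) (h1 ξ j)).symm⟩

theorem v_periodic (hΦ : CoordFam ρ h d Φ) (i : I) {t : ℂ} (ht : t ∈ Metric.ball (0 : ℂ) 1)
    {ξ : Fin N → ℂ} (hξ : ξ ∈ strip N h) (j : Fin N) :
    (Φ i t).v (ξ + Pi.single j (2 * Real.pi : ℂ)) = (Φ i t).v ξ :=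
  funext fun a => (hΦ.v a).famB.periodic i t ht ξ hξ j

theorem pt (hΦ : CoordFam ρ h d Φ) : PhaseFam ρ h d (fun i t ξ => (Φ i t).pt ξ) where
  x a := (HW.coord a).add (hΦ.u a).pred.hw
  y a := (hΦ.v a).hw
  z a := (hΦ.w a).pred
  dom := hΦ.dom
  periodic i t ht ξ hξ j := by
    have hu : (Φ i t).u (ξ + Pi.single j (2 * Real.pi : ℂ)) = (Φ i t).u ξ :=
      funext fun a => (hΦ.u a).famB.periodic i t ht ξ hξ j
    simp only [Coord.pt, hu, hΦ.v_periodic i ht hξ j, hΦ.w_periodic i t ht ξ hξ j]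
    rw [add_right_comm]

section Hamiltonian
variable {F : I → Phase N → ℂ}

theorem hessYY (hΦ : CoordFam ρ h d Φ) (hF : Nice ρ F) :
    MHF h d (fun i t ξ => hessYY (F i) ((Φ i t).pt ξ)) := fun p q => hΦ.pt.comp ((hF.dY q).dY p)

theorem hessZY (hΦ : CoordFam ρ h d Φ) (hF : Nice ρ F) :
    MHF h d (fun i t ξ => hessZY (F i) ((Φ i t).pt ξ)) := fun p q => hΦ.pt.comp ((hF.dY q).dZ p)

theorem S (hΦ : CoordFam ρ h d Φ) (hF : Nice ρ F) :
    MHF h d (fun i t ξ => S (F i) (Φ i t) ξ) :=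
  (hΦ.V.transpose.mul (hΦ.hessYY hF)).mul hΦ.V

theorem T (hΦ : CoordFam ρ h d Φ) (hF : Nice ρ F) :
    MHF h d (fun i t ξ => T (F i) (Φ i t) ξ) :=
  ((hΦ.W.transpose.mul (hΦ.hessZY hF)).mul hΦ.V).add
    ((hΦ.Lam.transpose.mul (hΦ.hessYY hF)).mul hΦ.V)

theorem dirD (hΦ : CoordFam ρ h d Φ) {G : I → Phase N → ℂ} (hG : Nice ρ G)
    {η : Fin N → I → ℂ → (Fin N → ℂ) → ℂ} {ζ : Fin 2 → I → ℂ → (Fin N → ℂ) → ℂ}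
    (hη : ∀ a, HF h d (η a)) (hζ : ∀ a, HF h d (ζ a)) :
    HF h d (fun i t ξ => dirD (G i) ((Φ i t).pt ξ) (fun a => η a i t ξ) (fun c => ζ c i t ξ)) :=
  (HF.sum _ fun a _ => (hη a).mul (hΦ.pt.comp (hG.dY a))).add
    (HF.sum _ fun a _ => (hζ a).mul (hΦ.pt.comp (hG.dZ a)))

theorem cubic (hΦ : CoordFam ρ h d Φ) (hF : Nice ρ F)
    {η : Fin N → I → ℂ → (Fin N → ℂ) → ℂ} {ζ : Fin 2 → I → ℂ → (Fin N → ℂ) → ℂ}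
    (hη : ∀ a, HF h d (η a)) (hζ : ∀ a, HF h d (ζ a)) :
    MHF h d (fun i t ξ => cubic (F i) (Φ i t) (fun a => η a i t ξ) (fun c => ζ c i t ξ) ξ) := by
  have hZY : MHF h d (fun i t ξ => ((Φ i t).W ξ)ᵀ * (Matrix.of fun a b =>
      LowerTori.dirD (dZ a (dY b (F i))) ((Φ i t).pt ξ) (fun a => η a i t ξ)
        (fun c => ζ c i t ξ)) * (Φ i t).Lam ξ) :=
    (hΦ.W.transpose.mul fun p q => hΦ.dirD ((hF.dY q).dZ p) hη hζ).mul hΦ.Lam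
  exact ((((MHF.sum _ fun a _ => MHF.smul (hΦ.dirD (hF.dY a) hη hζ) (hΦ.R a)).add
    ((hΦ.Lam.transpose.mul fun p q => hΦ.dirD ((hF.dY q).dY p) hη hζ).mul hΦ.Lam)).add
    hZY).add hZY.transpose).add
    ((hΦ.W.transpose.mul fun p q => hΦ.dirD ((hF.dZ q).dZ p) hη hζ).mul hΦ.W)

theorem coefU (hΦ : CoordFam ρ h d Φ) (hF : Nice ρ F) (a : Fin 2) (b : Fin N) :
    MHF h d (fun i t ξ => coefU (F i) (Φ i t) a b ξ) := by
  have h1 : MHF h d (fun i t ξ => (Matrix.of fun p q => LowerTori.T (F i) (Φ i t) ξ p b * J q a :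
      Matrix (Fin 2) (Fin 2) ℂ)) := fun p q => (hΦ.T hF p b).mul (HF.const _)
  exact h1.add h1.transpose

theorem coefE (hΦ : CoordFam ρ h d Φ) (hF : Nice ρ F) (b : Fin N) :
    MHF h d (fun i t ξ => coefE (F i) (Φ i t) b ξ) :=
  hΦ.cubic hF (fun a => hΦ.V a b) fun _ => HF.const 0

theorem coefK (hΦ : CoordFam ρ h d Φ) (hF : Nice ρ F) (l : Fin 2) :
    MHF h d (fun i t ξ => coefK (F i) (Φ i t) l ξ) := by
  have h1 := ((hΦ.W.transpose.mul (hΦ.hessZY hF)).add (hΦ.Lam.transpose.mul (hΦ.hessYY hF))).mul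
    (B := fun i t ξ => Rcol (Φ i t) l ξ) fun a p => hΦ.R a p l
  exact (hΦ.cubic hF (fun a => hΦ.Lam a l) fun c => hΦ.W c l).add (h1.add h1.transpose)

end Hamiltonian

end CoordFam
end CoordFamilies

/-! ### Finiteness of the norms -/

/-- Along each real coordinate line the function is periodic, and the coordinates are shifted one
after the other. -/
theorem periodic_int {h : ℝ} {f : (Fin N → ℂ) → ℂ}
    (hf : ∀ ξ ∈ strip N h, ∀ j, f (ξ + Pi.single j (2 * Real.pi : ℂ)) = f ξ) {ξ : Fin N → ℂ}
    (hξ : ξ ∈ strip N h) (n : Fin N → ℤ) :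
    f (ξ + fun j => ((n j * (2 * Real.pi) : ℝ) : ℂ)) = f ξ := by
  have key : ∀ s : Finset (Fin N),
      f (ξ + fun j => (((if j ∈ s then n j * (2 * Real.pi) else 0 : ℝ)) : ℂ)) = f ξ := by
    intro s
    induction s using Finset.induction_on with
    | empty => simp [← Pi.zero_def]
    | insert j s hj ih =>
      set η : Fin N → ℂ := ξ + fun j => (((if j ∈ s then n j * (2 * Real.pi) else 0 : ℝ)) : ℂ)
      have hη : η ∈ strip N h := strip_add_real hξ _
      have hper : Function.Periodic (fun t : ℝ => f (η + Pi.single j (t : ℂ))) (2 * Real.pi) := by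
        intro t
        have := hf _ (strip_add_single hη j t) j
        rw [add_assoc, ← Pi.single_add] at this
        simpa using this
      have h1 : (ξ + fun i => (((if i ∈ insert j s then n i * (2 * Real.pi) else 0 : ℝ)) : ℂ))
          = η + Pi.single j ((n j * (2 * Real.pi) : ℝ) : ℂ) := by
        ext i
        by_cases hij : i = j
        · subst hij; simp [η, hj]
        · simp [η, hij, Finset.mem_insert]
      rw [h1, ← ih]
      have h2 := hper.int_mul (n j) 0
      simpa using h2
  simpa using key Finset.univ

/-- Periodicity moves every point into a compact cell of the closed strip. Hence each single element
has finite norm, and small multiples of any direction are admissible. -/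
theorem BaseA.bounded {h : ℝ} {f : (Fin N → ℂ) → ℂ} (hf : BaseA h f) :
    ∃ C : ℝ, 0 ≤ C ∧ ∀ ξ ∈ strip N h, ‖f ξ‖ ≤ C := by
  set K : Set (Fin N → ℂ) := (Set.univ.pi fun _ => (Set.Icc 0 (2 * Real.pi)) ×ℂ (Set.Icc (-h) h))
    with hK
  have hKc : IsCompact K := isCompact_univ_pi fun _ => isCompact_Icc.reProdIm isCompact_Icc
  have hKs : K ⊆ strip N h := fun ξ hξ j => abs_le.2 (hξ j (Set.mem_univ j)).2
  obtain ⟨C, hC⟩ := hKc.exists_bound_of_continuousOn (hf.cont.mono hKs)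
  refine ⟨max C 0, le_max_right _ _, fun ξ hξ => ?_⟩
  choose n hn using fun j => existsUnique_add_zsmul_mem_Ico Real.two_pi_pos (ξ j).re 0 |>.exists
  rw [← periodic_int hf.periodic hξ n]
  refine (hC _ fun j _ => ⟨?_, ?_⟩).trans (le_max_left _ _)
  · have := hn j
    simp only [zsmul_eq_mul, zero_add] at this
    simpa using Set.Ico_subset_Icc_self this
  · simpa using abs_le.1 (hξ j)

theorem MemA.normA_lt_top {h : ℝ} {d : ℕ} : ∀ {f : (Fin N → ℂ) → ℂ}, MemA h d f →
    ∃ C : ℝ, 0 ≤ C ∧ normA h d f ≤ ENNReal.ofReal C := by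
  induction d with
  | zero =>
    intro f hf
    obtain ⟨C, hC0, hC⟩ := hf.base.bounded
    exact ⟨C, hC0, normA_zero_le_iff.2 fun ξ hξ => enorm_le_ofReal (hC ξ hξ)⟩
  | succ d ih =>
    intro f hf
    obtain ⟨C, hC0, hC⟩ := hf.base.bounded
    choose D hD0 hD using fun j => ih (hf.pd j)
    have hDs : ∀ j, D j ≤ ∑ k, D k := fun j =>
      Finset.single_le_sum (fun k _ => hD0 k) (Finset.mem_univ j)
    have hS : 0 ≤ ∑ k, D k := Finset.sum_nonneg fun k _ => hD0 k
    refine ⟨C + ∑ k, D k, by positivity, normA_succ_le_iff.2 ⟨fun ξ hξ => enorm_le_ofReal ?_,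
      fun j => (hD j).trans (ENNReal.ofReal_le_ofReal ?_)⟩⟩
    · exact (hC ξ hξ).trans (by linarith)
    · linarith [hDs j]

theorem MemA.sub_const {h : ℝ} {d : ℕ} {f : (Fin N → ℂ) → ℂ} (hf : MemA h d f) (c : ℂ) :
    MemA h d (fun ξ => f ξ - c) := by
  have hb : BaseA h (fun ξ => f ξ - c) := ⟨fun ξ hξ j => by rw [hf.periodic ξ hξ],
    hf.base.cont.sub continuousOn_const, hf.holomorphic.sub_const c⟩
  cases d with
  | zero => exact hb.memA
  | succ d =>
    refine memA_succ hb fun j => ⟨fun ξ hξ => (hf.dirDiff (by omega) hξ j).sub (dirDiff_const c j ξ),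
      (hf.pd j).congr fun ξ hξ => ?_⟩
    rw [pd_sub (hf.dirDiff (by omega) hξ j) (dirDiff_const c j ξ), pd_const, sub_zero]

/-! ### Bounds for coordinate vectors -/

/-- All components of a coordinate vector have norm at most `r`. -/
structure Coord.Bd (h : ℝ) (d : ℕ) (r : ℝ) (ψ : Coord N) : Prop where
  β : ∀ a, ‖ψ.β a‖ ≤ r
  φ₀ : normA h d ψ.φ₀ ≤ ENNReal.ofReal r
  u : ∀ a, normA h d (fun ξ => ψ.u ξ a) ≤ ENNReal.ofReal r
  w : ∀ a, normA h d (fun ξ => ψ.w ξ a) ≤ ENNReal.ofReal r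
  W₁₁ : normA h d ψ.W₁₁ ≤ ENNReal.ofReal r
  W₁₂ : normA h d ψ.W₁₂ ≤ ENNReal.ofReal r
  W₂₁ : normA h d ψ.W₂₁ ≤ ENNReal.ofReal r

theorem Coord.bd_of_norm_le {h : ℝ} {d : ℕ} {r : ℝ} (hr : 0 ≤ r) {ψ : Coord N}
    (hψ : ψ.norm h d ≤ ENNReal.ofReal r) : ψ.Bd h d r := by
  simp only [Coord.norm, sup_le_iff, iSup_le_iff, vecNorm] at hψ
  obtain ⟨⟨⟨⟨⟨⟨h1, h2⟩, h3⟩, h4⟩, h5⟩, h6⟩, h7⟩ := hψ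
  exact ⟨fun a => norm_le_of_enorm_le hr (h1 a), h2, h3, h4, h5, h6, h7⟩

theorem Coord.Bd.smul {h : ℝ} {d : ℕ} {r : ℝ} {ψ : Coord N} (hψ : ψ.Bd h d r) (s : ℂ) :
    (s • ψ).Bd h d (‖s‖ * r) := by
  have key : ∀ {f : (Fin N → ℂ) → ℂ}, normA h d f ≤ ENNReal.ofReal r →
      normA h d (fun ξ => s * f ξ) ≤ ENNReal.ofReal (‖s‖ * r) := fun {f} hf => by
    rw [ENNReal.ofReal_mul (norm_nonneg _), ofReal_norm]
    exact normA_const_mul_le s hf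
  exact ⟨fun a => by
    change ‖s * ψ.β a‖ ≤ _
    rw [norm_mul]; exact mul_le_mul_of_nonneg_left (hψ.β a) (norm_nonneg _),
    key hψ.φ₀, fun a => key (hψ.u a), fun a => key (hψ.w a), key hψ.W₁₁, key hψ.W₁₂, key hψ.W₂₁⟩

theorem Coord.Mem.smul {h : ℝ} {d : ℕ} {ψ : Coord N} (hψ : ψ.Mem h d) (s : ℂ) :
    (s • ψ).Mem h d :=
  ⟨hψ.φ₀.const_mul s, fun a => (hψ.u a).const_mul s, fun a => (hψ.w a).const_mul s,
    hψ.W₁₁.const_mul s, hψ.W₁₂.const_mul s, hψ.W₂₁.const_mul s⟩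

theorem Coord.Bd.mono {h : ℝ} {d : ℕ} {r r' : ℝ} {ψ : Coord N} (hψ : ψ.Bd h d r) (hr : r ≤ r') :
    ψ.Bd h d r' :=
  ⟨fun a => (hψ.β a).trans hr, hψ.φ₀.trans (ENNReal.ofReal_le_ofReal hr),
    fun a => (hψ.u a).trans (ENNReal.ofReal_le_ofReal hr),
    fun a => (hψ.w a).trans (ENNReal.ofReal_le_ofReal hr),
    hψ.W₁₁.trans (ENNReal.ofReal_le_ofReal hr), hψ.W₁₂.trans (ENNReal.ofReal_le_ofReal hr),
    hψ.W₂₁.trans (ENNReal.ofReal_le_ofReal hr)⟩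

theorem Coord.Mem.exists_bd {h : ℝ} {d : ℕ} {ψ : Coord N} (hψ : ψ.Mem h d) :
    ∃ C : ℝ, 0 ≤ C ∧ ψ.Bd h d C := by
  obtain ⟨C1, h1, h1'⟩ := hψ.φ₀.normA_lt_top
  choose C2 h2 h2' using fun a => (hψ.u a).normA_lt_top
  choose C3 h3 h3' using fun a => (hψ.w a).normA_lt_top
  obtain ⟨C4, h4, h4'⟩ := hψ.W₁₁.normA_lt_top
  obtain ⟨C5, h5, h5'⟩ := hψ.W₁₂.normA_lt_top
  obtain ⟨C6, h6, h6'⟩ := hψ.W₂₁.normA_lt_top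
  have e0 : ∀ a, ‖ψ.β a‖ ≤ ∑ b, ‖ψ.β b‖ := fun a =>
    Finset.single_le_sum (f := fun b => ‖ψ.β b‖) (fun b _ => norm_nonneg _) (Finset.mem_univ a)
  have e2 : ∀ a, C2 a ≤ ∑ b, C2 b := fun a =>
    Finset.single_le_sum (fun b _ => h2 b) (Finset.mem_univ a)
  have e3 : ∀ a, C3 a ≤ ∑ b, C3 b := fun a =>
    Finset.single_le_sum (fun b _ => h3 b) (Finset.mem_univ a)
  have p0 : 0 ≤ ∑ b, ‖ψ.β b‖ := Finset.sum_nonneg fun b _ => norm_nonneg _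
  have p2 : 0 ≤ ∑ b, C2 b := Finset.sum_nonneg fun b _ => h2 b
  have p3 : 0 ≤ ∑ b, C3 b := Finset.sum_nonneg fun b _ => h3 b
  refine ⟨(∑ b, ‖ψ.β b‖) + C1 + (∑ b, C2 b) + (∑ b, C3 b) + C4 + C5 + C6, by positivity, ?_⟩
  constructor
  · intro a; linarith [e0 a]
  · exact h1'.trans (ENNReal.ofReal_le_ofReal (by linarith))
  · exact fun a => (h2' a).trans (ENNReal.ofReal_le_ofReal (by linarith [e2 a]))
  · exact fun a => (h3' a).trans (ENNReal.ofReal_le_ofReal (by linarith [e3 a]))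
  · exact h4'.trans (ENNReal.ofReal_le_ofReal (by linarith))
  · exact h5'.trans (ENNReal.ofReal_le_ofReal (by linarith))
  · exact h6'.trans (ENNReal.ofReal_le_ofReal (by linarith))

/-! ### Neighbourhoods of the base points -/

/-- Pointwise smallness of a coordinate vector relative to a base point. -/
structure Coord.SmallAt (s : ℝ) (α : ℂ) (ψ : Coord N) (ξ : Fin N → ℂ) : Prop where
  β : ∀ a, ‖ψ.β a‖ ≤ s
  dφ₀ : ∀ a, ‖pd a ψ.φ₀ ξ‖ ≤ s
  u : ∀ a, ‖ψ.u ξ a‖ ≤ s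
  du : ∀ a b, ‖jac ψ.u ξ a b‖ ≤ s
  w₀ : ‖ψ.w ξ 0 - α‖ ≤ s
  w₁ : ‖ψ.w ξ 1‖ ≤ s
  dw₀ : ∀ a, ‖pd a (fun η => ψ.w η 0) ξ‖ ≤ s
  W₁₁ : ‖ψ.W₁₁ ξ - 1‖ ≤ s

/-- Continuity at A = 0, where the determinant is 1 and the adjugate is the identity. -/
theorem exists_det_adjugate_bound (N : ℕ) : ∃ s : ℝ, 0 < s ∧ ∀ A : Matrix (Fin N) (Fin N) ℂ,
    (∀ a b, ‖A a b‖ ≤ s) → 1 / 2 ≤ ‖(1 + A).det‖ ∧ ∀ a b, ‖(1 + A).adjugate a b‖ ≤ 2 := by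
  have hadd : Continuous fun f : Fin N → Fin N → ℂ => 1 + (Matrix.of f : Matrix _ _ ℂ) :=
    continuous_const.add continuous_id
  have h1 : ∀ᶠ f in 𝓝 (0 : Fin N → Fin N → ℂ), 1 / 2 < ‖(1 + (Matrix.of f : Matrix _ _ ℂ)).det‖ := by
    have hc : Continuous fun f : Fin N → Fin N → ℂ => ‖(1 + (Matrix.of f : Matrix _ _ ℂ)).det‖ :=
      hadd.matrix_det.norm
    refine hc.continuousAt.eventually (lt_mem_nhds ?_)
    change 1 / 2 < ‖(1 + (0 : Matrix (Fin N) (Fin N) ℂ)).det‖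
    norm_num
  have h2 : ∀ a b, ∀ᶠ f in 𝓝 (0 : Fin N → Fin N → ℂ),
      ‖(1 + (Matrix.of f : Matrix _ _ ℂ)).adjugate a b‖ < 2 := by
    intro a b
    have hc : Continuous fun f : Fin N → Fin N → ℂ =>
        ‖(1 + (Matrix.of f : Matrix _ _ ℂ)).adjugate a b‖ :=
      (hadd.matrix_adjugate.matrix_elem a b).norm
    refine hc.continuousAt.eventually (gt_mem_nhds ?_)
    change ‖(1 + (0 : Matrix (Fin N) (Fin N) ℂ)).adjugate a b‖ < 2
    rw [add_zero, Matrix.adjugate_one, Matrix.one_apply]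
    split_ifs <;> norm_num
  have h3 := h1.and (eventually_all.2 fun a => eventually_all.2 (h2 a))
  obtain ⟨δ, hδ, hb⟩ := Metric.eventually_nhds_iff_ball.1 h3
  refine ⟨δ / 2, by positivity, fun A hA => ?_⟩
  have hmem : (fun a b => A a b) ∈ Metric.ball (0 : Fin N → Fin N → ℂ) δ := by
    rw [mem_ball_zero_iff]
    refine lt_of_le_of_lt ?_ (half_lt_self hδ)
    exact (pi_norm_le_iff_of_nonneg (by positivity)).2 fun a =>
      (pi_norm_le_iff_of_nonneg (by positivity)).2 fun b => hA a b
  obtain ⟨e1, e2⟩ := hb _ hmem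
  exact ⟨e1.le, fun a b => (e2 a b).le⟩

/-- In the neighbourhoods of size `s` of the base points all objects are well defined. -/
def IsRadius (N : ℕ) (ρ s : ℝ) : Prop :=
  ∀ h : ℝ, h ≤ ρ → ∀ α : ℂ, |α.im| ≤ ρ → ∀ (ψ : Coord N) (ξ : Fin N → ℂ), ξ ∈ strip N h →
    ψ.SmallAt s α ξ → 1 / 2 ≤ ‖(1 + jac ψ.u ξ).det‖ ∧ 1 / 2 ≤ ‖ψ.W₁₁ ξ‖ ∧
      ψ.pt ξ ∈ phaseDomain N (2 * ρ)

/-- The base point enters the domain condition only through Im α, so one radius serves all α. Aiming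
at size 2ρ leaves room for Cauchy estimates inside 3ρ. -/
theorem exists_radius (N : ℕ) {ρ : ℝ} (hρ : 0 < ρ) : ∃ s : ℝ, 0 < s ∧ IsRadius N ρ s := by
  obtain ⟨s₁, hs₁, hdet⟩ := exists_det_adjugate_bound N
  -- The entries of V are at most 4 and those of ∇φ₀ - w₂∇w₁ at most 2s, so the components of v are
  -- at most (8N + 1)s. This choice makes v and w₂ at most ρ/(N + 1) in each component, and N + 1
  -- such squares sum to at most ρ².
  set κ : ℝ := ρ / ((N + 1) * (8 * N + 1)) with hκ
  have hκ0 : 0 < κ := by positivity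
  set s : ℝ := min s₁ (min (1 / 2) (min κ ρ)) with hs
  have hs0 : 0 < s := lt_min hs₁ (lt_min (by norm_num) (lt_min hκ0 hρ))
  have e1 : s ≤ s₁ := min_le_left _ _
  have e2 : s ≤ 1 / 2 := (min_le_right _ _).trans (min_le_left _ _)
  have e3 : s ≤ κ := ((min_le_right _ _).trans (min_le_right _ _)).trans (min_le_left _ _)
  have e4 : s ≤ ρ := ((min_le_right _ _).trans (min_le_right _ _)).trans (min_le_right _ _)
  refine ⟨s, hs0, fun h hh α hα ψ ξ hξ hψ => ?_⟩
  obtain ⟨d1, d2⟩ := hdet (jac ψ.u ξ) fun a b => (hψ.du a b).trans e1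
  have hV : ∀ a b, ‖ψ.V ξ a b‖ ≤ 4 := by
    intro a b
    simp only [Coord.V, Matrix.transpose_apply, Matrix.inv_def, Ring.inverse_eq_inv',
      Matrix.smul_apply, smul_eq_mul, norm_mul, norm_inv]
    calc ‖(1 + jac ψ.u ξ).det‖⁻¹ * ‖(1 + jac ψ.u ξ).adjugate b a‖ ≤ (1 / 2)⁻¹ * 2 := by
          gcongr
          exact d2 b a
      _ = 4 := by norm_num
  have hg : ∀ a, ‖ψ.g ξ a‖ ≤ 2 * s := by
    intro a
    refine (norm_sub_le_of_le (hψ.dφ₀ a) (r₂ := s) ?_).trans (by linarith)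
    change ‖ψ.w ξ 1 * pd a (fun η => ψ.w η 0) ξ‖ ≤ s
    rw [norm_mul]
    calc _ ≤ s * 1 := mul_le_mul hψ.w₁ ((hψ.dw₀ a).trans (by linarith)) (norm_nonneg _) hs0.le
      _ = s := mul_one s
  have hv : ∀ a, ‖ψ.v ξ a‖ ≤ (8 * N + 1) * s := by
    intro a
    have h1 : ‖(ψ.V ξ *ᵥ ψ.g ξ) a‖ ≤ ∑ b : Fin N, 4 * (2 * s) := by
      change ‖∑ b, ψ.V ξ a b * ψ.g ξ b‖ ≤ _
      refine (norm_sum_le _ _).trans (Finset.sum_le_sum fun b _ => ?_)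
      rw [norm_mul]
      exact mul_le_mul (hV a b) (hg b) (norm_nonneg _) (by norm_num)
    rw [Finset.sum_const, Finset.card_univ, Fintype.card_fin, nsmul_eq_mul] at h1
    refine (norm_add_le_of_le (hψ.β a) h1).trans (le_of_eq (by ring))
  have hvρ : ∀ a, ‖ψ.v ξ a‖ ≤ ρ / (N + 1) := by
    intro a
    refine (hv a).trans ?_
    calc (8 * N + 1) * s ≤ (8 * N + 1) * κ := by gcongr
      _ = ρ / (N + 1) := by rw [hκ]; field_simp
  have hw₁ρ : ‖ψ.w ξ 1‖ ≤ ρ / (N + 1) := by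
    refine (hψ.w₁.trans e3).trans ?_
    rw [hκ]
    gcongr
    have : (0 : ℝ) ≤ N := Nat.cast_nonneg N
    nlinarith
  have hρN : ρ / (N + 1) ≤ ρ := div_le_self hρ.le (by linarith [(Nat.cast_nonneg N : (0 : ℝ) ≤ N)])
  have hre : ∀ {z : ℂ}, ‖z‖ ≤ ρ / (N + 1) → z.re ^ 2 ≤ (ρ / (N + 1)) ^ 2 := by
    intro z hz
    exact sq_le_sq' (by linarith [neg_abs_le z.re, Complex.abs_re_le_norm z])
      ((le_abs_self _).trans ((Complex.abs_re_le_norm z).trans hz))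
  refine ⟨d1, ?_, fun i => ?_, ?_, ?_, fun i => ?_, ?_⟩
  · have := norm_sub_norm_le 1 (ψ.W₁₁ ξ)
    rw [norm_one, norm_sub_rev] at this
    linarith [hψ.W₁₁]
  · change |(ξ i + ψ.u ξ i).im| ≤ _
    rw [Complex.add_im]
    have := abs_add_le (ξ i).im (ψ.u ξ i).im
    linarith [hξ i, (Complex.abs_im_le_norm (ψ.u ξ i)).trans (hψ.u i)]
  · change |(ψ.w ξ 0).im| ≤ _
    have h1 := (Complex.abs_im_le_norm _).trans hψ.w₀
    rw [Complex.sub_im] at h1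
    have := abs_sub_abs_le_abs_sub (ψ.w ξ 0).im α.im
    linarith
  · change (∑ i, (ψ.v ξ i).re ^ 2) + (ψ.w ξ 1).re ^ 2 ≤ (2 * ρ) ^ 2
    have h1 : ∑ i, (ψ.v ξ i).re ^ 2 ≤ ∑ i : Fin N, (ρ / (N + 1)) ^ 2 :=
      Finset.sum_le_sum fun i _ => hre (hvρ i)
    rw [Finset.sum_const, Finset.card_univ, Fintype.card_fin, nsmul_eq_mul] at h1
    have h2 := hre hw₁ρ
    have h3 : (N + 1) * (ρ / (N + 1)) ^ 2 = ρ * (ρ / (N + 1)) := by field_simp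
    have h4 : ρ * (ρ / (N + 1)) ≤ ρ * ρ := by gcongr
    nlinarith
  · exact (Complex.abs_im_le_norm _).trans ((hvρ i).trans (by linarith))
  · exact (Complex.abs_im_le_norm _).trans (hw₁ρ.trans (by linarith))

/-! ### Lines near the base points as admissible families -/

section Lines
variable {I : Type*} {ρ h : ℝ} {d : ℕ}

/-- Accommodates α, whose real part is unbounded over the index set. -/
theorem HW.of_index (c : I → ℂ) : HW (N := N) h d (fun i _ _ => c i) := by
  have h0 : FamW (N := N) h (fun (i : I) (_ : ℂ) _ => c i) :=
    ⟨fun _ _ _ => by fun_prop, fun _ _ _ => by fun_prop, fun _ _ _ => by fun_prop⟩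
  cases d with
  | zero => exact h0
  | succ d =>
    exact ⟨h0, fun _ _ _ ξ _ j => dirDiff_const _ j ξ, fun j =>
      (HF.const 0).congr fun i _ _ ξ _ => (pd_const _ j ξ).symm⟩

theorem norm_pd_le {f : (Fin N → ℂ) → ℂ} {r : ℝ} (hr : 0 ≤ r)
    (hf : normA h (d + 1) f ≤ ENNReal.ofReal r) {ξ : Fin N → ℂ} (hξ : ξ ∈ strip N h) (j : Fin N) :
    ‖pd j f ξ‖ ≤ r :=
  norm_le_of_enorm_le hr ((enorm_le_normA hξ).trans ((normA_succ_le_iff.1 hf).2 j))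

theorem norm_le_of_normA_le {f : (Fin N → ℂ) → ℂ} {r : ℝ} (hr : 0 ≤ r)
    (hf : normA h d f ≤ ENNReal.ofReal r) {ξ : Fin N → ℂ} (hξ : ξ ∈ strip N h) :
    ‖f ξ‖ ≤ r :=
  norm_le_of_enorm_le hr ((enorm_le_normA hξ).trans hf)

theorem smallAt_line {r : ℝ} (hr : 0 ≤ r) {α : ℂ} {φ δ : Coord N} (hφ : φ.Mem h (d + 1))
    (hδ : δ.Mem h (d + 1)) (hφr : (φ - Coord.base N α).Bd h (d + 1) r) (hδr : δ.Bd h (d + 1) r)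
    {t : ℂ} (ht : t ∈ Metric.ball (0 : ℂ) 1) {ξ : Fin N → ℂ} (hξ : ξ ∈ strip N h) :
    (φ + t • δ).SmallAt (2 * r) α ξ := by
  have ht1 : ‖t‖ ≤ 1 := (mem_ball_zero_iff.1 ht).le
  have key : ∀ {a b : ℂ}, ‖a‖ ≤ r → ‖b‖ ≤ r → ‖a + t * b‖ ≤ 2 * r := by
    intro a b ha hb
    refine (norm_add_le _ _).trans ?_
    rw [norm_mul]
    nlinarith [norm_nonneg b]
  have hpd : ∀ {f g : (Fin N → ℂ) → ℂ} (a : Fin N), MemA h (d + 1) f → MemA h (d + 1) g →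
      normA h (d + 1) f ≤ ENNReal.ofReal r → normA h (d + 1) g ≤ ENNReal.ofReal r →
      ‖pd a (fun ξ => f ξ + t * g ξ) ξ‖ ≤ 2 * r := by
    intro f g a hf hg hfr hgr
    have h1 := hf.dirDiff (by omega) hξ a
    have h2 := hg.dirDiff (by omega) hξ a
    rw [pd_add h1 ((dirDiff_const t a ξ).mul h2), pd_const_mul t h2]
    exact key (norm_pd_le hr hfr hξ a) (norm_pd_le hr hgr hξ a)
  have hφ₀ : normA h (d + 1) φ.φ₀ ≤ ENNReal.ofReal r := by
    have := hφr.φ₀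
    change normA h (d + 1) (φ.φ₀ - 0) ≤ _ at this
    rwa [sub_zero] at this
  have hu : ∀ a, normA h (d + 1) (fun ξ => φ.u ξ a) ≤ ENNReal.ofReal r := by
    intro a
    have := hφr.u a
    change normA h (d + 1) (fun ξ => φ.u ξ a - 0) ≤ _ at this
    simpa only [sub_zero] using this
  have hw0 : normA h (d + 1) (fun ξ => φ.w ξ 0 - α) ≤ ENNReal.ofReal r := hφr.w 0
  have hw1 : normA h (d + 1) (fun ξ => φ.w ξ 1) ≤ ENNReal.ofReal r := by
    have := hφr.w 1
    change normA h (d + 1) (fun ξ => φ.w ξ 1 - 0) ≤ _ at this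
    simpa only [sub_zero] using this
  have hW : normA h (d + 1) (fun ξ => φ.W₁₁ ξ - 1) ≤ ENNReal.ofReal r := hφr.W₁₁
  constructor
  · intro a
    refine key ?_ (hδr.β a)
    have := hφr.β a
    change ‖φ.β a - 0‖ ≤ r at this
    rwa [sub_zero] at this
  · exact fun a => hpd a hφ.φ₀ hδ.φ₀ hφ₀ hδr.φ₀
  · exact fun a => key (norm_le_of_normA_le hr (hu a) hξ) (norm_le_of_normA_le hr (hδr.u a) hξ)
  · exact fun a b => hpd b (hφ.u a) (hδ.u a) (hu a) (hδr.u a)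
  · have := key (norm_le_of_normA_le hr hw0 hξ) (norm_le_of_normA_le hr (hδr.w 0) hξ)
    rwa [sub_add_eq_add_sub] at this
  · exact key (norm_le_of_normA_le hr hw1 hξ) (norm_le_of_normA_le hr (hδr.w 1) hξ)
  · intro a
    have := hpd a ((hφ.w 0).sub_const α) (hδ.w 0) hw0 (hδr.w 0)
    have h1 := (hφ.w 0).dirDiff (by omega) hξ a
    have h2 := (hδ.w 0).dirDiff (by omega) hξ a
    have h3 := (dirDiff_const t a ξ).mul h2
    rw [pd_add (h1.sub (dirDiff_const α a ξ)) h3, pd_sub h1 (dirDiff_const α a ξ), pd_const,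
      sub_zero, ← pd_add h1 h3] at this
    exact this
  · have := key (norm_le_of_normA_le hr hW hξ) (norm_le_of_normA_le hr hδr.W₁₁ hξ)
    rwa [sub_add_eq_add_sub] at this

/-- Makes complex lines through admissible points accessible to the Cauchy estimates. The point and
|t| < 1 times the direction each contribute at most `r`, hence smallness 2r = s. Since the index is
arbitrary, all resulting bounds are uniform over any collection of such lines. -/
theorem coordFam_line {r s : ℝ} (hρ : 0 < ρ) (hr : 0 ≤ r) (hrs : 2 * r = s) (hh : h ≤ ρ)
    (hs : IsRadius N ρ s)
    {α : I → ℂ} {φ δ : I → Coord N} (hα : ∀ i, |(α i).im| ≤ ρ) (hφ : ∀ i, (φ i).Mem h (d + 1))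
    (hδ : ∀ i, (δ i).Mem h (d + 1)) (hφr : ∀ i, (φ i - Coord.base N (α i)).Bd h (d + 1) r)
    (hδr : ∀ i, (δ i).Bd h (d + 1) r) :
    CoordFam ρ h d (fun i t => φ i + t • δ i) := by
  have hsm := fun i t (ht : t ∈ Metric.ball (0 : ℂ) 1) ξ (hξ : ξ ∈ strip N h) =>
    hs h hh (α i) (hα i) _ ξ hξ (hrs ▸ smallAt_line hr (hφ i) (hδ i) (hφr i) (hδr i) ht hξ)
  have hw0 : HF h (d + 1) (fun i t ξ => (φ i).w ξ 0 - α i + t * (δ i).w ξ 0) :=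
    HF.line hr (fun i => ((hφ i).w 0).sub_const (α i)) (fun i => (hδ i).w 0)
      (fun i => (hφr i).w 0) fun i => (hδr i).w 0
  have hw1 : HF h (d + 1) (fun i t ξ => (φ i).w ξ 1 - 0 + t * (δ i).w ξ 1) :=
    HF.line hr (fun i => ((hφ i).w 1).sub_const 0) (fun i => (hδ i).w 1)
      (fun i => (hφr i).w 1) fun i => (hδr i).w 1
  have hw1' : HF h (d + 1) (fun i t ξ => (φ i).w ξ 1 + t * (δ i).w ξ 1) := by
    simpa only [sub_zero] using hw1
  have hW : HF h (d + 1) (fun i t ξ => (φ i).W₁₁ ξ - 1 + t * (δ i).W₁₁ ξ) :=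
    HF.line hr (fun i => ((hφ i).W₁₁).sub_const 1) (fun i => (hδ i).W₁₁)
      (fun i => (hφr i).W₁₁) fun i => (hδr i).W₁₁
  have hlin : ∀ {a b : I → (Fin N → ℂ) → ℂ},
      (∀ i, MemA h (d + 1) (a i)) → (∀ i, MemA h (d + 1) (b i)) →
      (∀ i, normA h (d + 1) (fun ξ => a i ξ - 0) ≤ ENNReal.ofReal r) →
      (∀ i, normA h (d + 1) (b i) ≤ ENNReal.ofReal r) →
      HF h (d + 1) (fun i t ξ => a i ξ + t * b i ξ) := fun {a b} ha hb hna hnb =>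
    HF.line hr ha hb (fun i => by simpa only [sub_zero] using hna i) hnb
  constructor
  · intro a
    refine HF.of_param (c := fun i t => (φ i).β a + t * (δ i).β a) (C := r + 1 * r)
      (fun i => by fun_prop) fun i t ht => norm_add_le_of_le ?_ ?_
    · have := (hφr i).β a
      change ‖(φ i).β a - 0‖ ≤ r at this
      rwa [sub_zero] at this
    · rw [norm_mul]
      exact mul_le_mul (mem_ball_zero_iff.1 ht).le ((hδr i).β a) (norm_nonneg _) zero_le_one
  · exact hlin (fun i => (hφ i).φ₀) (fun i => (hδ i).φ₀) (fun i => (hφr i).φ₀) fun i => (hδr i).φ₀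
  · exact fun a => hlin (fun i => (hφ i).u a) (fun i => (hδ i).u a) (fun i => (hφr i).u a)
      fun i => (hδr i).u a
  · intro a
    fin_cases a
    -- Only w₁ - α is uniformly bounded; adding α back lands in `HW`, not in `HF`.
    · have := hw0.hw.add (HW.of_index α)
      have e : ∀ (i : I) (t : ℂ) (ξ : Fin N → ℂ), (φ i).w ξ 0 - α i + t * (δ i).w ξ 0 + α i
          = (φ i).w ξ 0 + t * (δ i).w ξ 0 := fun i t ξ => by ring
      simp only [e] at this
      exact this
    · exact hw1'.hw
  · exact hw1'
  · intro i t ht ξ hξ j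
    have h1 : (φ i).w (ξ + Pi.single j (2 * Real.pi : ℂ)) = (φ i).w ξ :=
      funext fun a => ((hφ i).w a).periodic ξ hξ j
    have h2 : (δ i).w (ξ + Pi.single j (2 * Real.pi : ℂ)) = (δ i).w ξ :=
      funext fun a => ((hδ i).w a).periodic ξ hξ j
    change (φ i).w _ + t • (δ i).w _ = (φ i).w _ + t • (δ i).w _
    rw [h1, h2]
  · have := hW.add (HF.const 1)
    have e : ∀ (i : I) (t : ℂ) (ξ : Fin N → ℂ), (φ i).W₁₁ ξ - 1 + t * (δ i).W₁₁ ξ + 1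
        = (φ i).W₁₁ ξ + t * (δ i).W₁₁ ξ := fun i t ξ => by ring
    simp only [e] at this
    exact this
  · exact hlin (fun i => (hφ i).W₁₂) (fun i => (hδ i).W₁₂) (fun i => (hφr i).W₁₂)
      fun i => (hδr i).W₁₂
  · exact hlin (fun i => (hφ i).W₂₁) (fun i => (hδ i).W₂₁) (fun i => (hφr i).W₂₁)
      fun i => (hδr i).W₂₁
  · exact fun i t ht ξ hξ => (hsm i t ht ξ hξ).1
  · exact fun i t ht ξ hξ => (hsm i t ht ξ hξ).2.1
  · exact ⟨2 * ρ, by linarith, fun i t ht ξ hξ => (hsm i t ht ξ hξ).2.2⟩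

end Lines

/-! ### The derivation `δ - c_i ∂/∂ξ_i` -/

/-- The real lines through `(0, ξ)` in the direction of the parameter and of the coordinates. -/
def curve (ξ : Fin N → ℂ) : Option (Fin N) → ℝ → ℂ × (Fin N → ℂ)
  | none, s => ((s : ℂ), ξ)
  | some i, s => (0, ξ + Pi.single i (s : ℂ))

theorem curve_zero (ξ : Fin N → ℂ) (o : Option (Fin N)) : curve ξ o 0 = (0, ξ) := by
  cases o <;> simp [curve]

/-- At the point `ξ` the family `Q` has the value `q`, and `(∂/∂t - c_i ∂/∂ξ_i) Q = ℓ` at `t = 0`. -/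
def HasL (c : Fin N → ℂ) (ξ : Fin N → ℂ) (Q : ℂ → (Fin N → ℂ) → ℂ) (q ℓ : ℂ) : Prop :=
  Q 0 ξ = q ∧ ∃ a : Option (Fin N) → ℂ,
    (∀ o, HasDerivAt (fun s : ℝ => Q (curve ξ o s).1 (curve ξ o s).2) (a o) 0) ∧
    ℓ = a none - ∑ i, c i * a (some i)

section HasL
variable {c ξ : Fin N → ℂ} {Q Q' : ℂ → (Fin N → ℂ) → ℂ} {q q' ℓ ℓ' : ℂ}

theorem HasL.value_curve (hQ : HasL c ξ Q q ℓ) (o : Option (Fin N)) :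
    Q (curve ξ o 0).1 (curve ξ o 0).2 = q := by rw [curve_zero]; exact hQ.1

theorem HasL.const (x : ℂ) : HasL c ξ (fun _ _ => x) x 0 :=
  ⟨rfl, fun _ => 0, fun _ => hasDerivAt_const _ _, by simp⟩

theorem HasL.add (hQ : HasL c ξ Q q ℓ) (hQ' : HasL c ξ Q' q' ℓ') :
    HasL c ξ (fun t η => Q t η + Q' t η) (q + q') (ℓ + ℓ') := by
  obtain ⟨h1, a, ha, rfl⟩ := hQ
  obtain ⟨h1', a', ha', rfl⟩ := hQ'
  refine ⟨by simp only [h1, h1'], fun o => a o + a' o, fun o => (ha o).add (ha' o), ?_⟩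
  simp only [mul_add, Finset.sum_add_distrib]
  ring

theorem HasL.neg (hQ : HasL c ξ Q q ℓ) : HasL c ξ (fun t η => -Q t η) (-q) (-ℓ) := by
  obtain ⟨h1, a, ha, rfl⟩ := hQ
  refine ⟨by simp only [h1], fun o => -a o, fun o => (ha o).neg, ?_⟩
  simp only [mul_neg, Finset.sum_neg_distrib]
  ring

theorem HasL.sub (hQ : HasL c ξ Q q ℓ) (hQ' : HasL c ξ Q' q' ℓ') :
    HasL c ξ (fun t η => Q t η - Q' t η) (q - q') (ℓ - ℓ') := by
  simpa only [sub_eq_add_neg] using hQ.add hQ'.neg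

theorem HasL.mul (hQ : HasL c ξ Q q ℓ) (hQ' : HasL c ξ Q' q' ℓ') :
    HasL c ξ (fun t η => Q t η * Q' t η) (q * q') (ℓ * q' + q * ℓ') := by
  have e := hQ.value_curve
  have e' := hQ'.value_curve
  obtain ⟨h1, a, ha, rfl⟩ := hQ
  obtain ⟨h1', a', ha', rfl⟩ := hQ'
  refine ⟨by simp only [h1, h1'], fun o => a o * q' + q * a' o, fun o => ?_, ?_⟩
  · have := (ha o).mul (ha' o)
    rwa [e, e'] at this
  · simp only [mul_add, Finset.sum_add_distrib, sub_mul, mul_sub, Finset.sum_mul, Finset.mul_sum]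
    have h2 : ∑ i, c i * (q * a' (some i)) = ∑ i, q * (c i * a' (some i)) :=
      Finset.sum_congr rfl fun i _ => by ring
    have h3 : ∑ i, c i * (a (some i) * q') = ∑ i, c i * a (some i) * q' :=
      Finset.sum_congr rfl fun i _ => by ring
    rw [h2, h3]
    ring

theorem HasL.inv (hQ : HasL c ξ Q q ℓ) (hq : q ≠ 0) :
    HasL c ξ (fun t η => (Q t η)⁻¹) q⁻¹ (-ℓ / q ^ 2) := by
  have e := hQ.value_curve
  obtain ⟨h1, a, ha, rfl⟩ := hQ
  refine ⟨by simp only [h1], fun o => -a o / q ^ 2, fun o => ?_, ?_⟩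
  · have := (ha o).inv (by rwa [e])
    rwa [e] at this
  · have h2 : ∑ i, c i * (-a (some i) / q ^ 2) = -(∑ i, c i * a (some i)) / q ^ 2 := by
      rw [← Finset.sum_neg_distrib, Finset.sum_div]
      exact Finset.sum_congr rfl fun i _ => by ring
    rw [h2]; ring

theorem HasL.sum {ι : Type*} (s : Finset ι) {Q : ι → ℂ → (Fin N → ℂ) → ℂ} {q ℓ : ι → ℂ}
    (hQ : ∀ a ∈ s, HasL c ξ (Q a) (q a) (ℓ a)) :
    HasL c ξ (fun t η => ∑ a ∈ s, Q a t η) (∑ a ∈ s, q a) (∑ a ∈ s, ℓ a) := by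
  classical
  induction s using Finset.induction_on with
  | empty => simpa using HasL.const (0 : ℂ)
  | insert b s hb ih =>
    simp only [Finset.sum_insert hb]
    exact (hQ b (Finset.mem_insert_self b s)).add
      (ih fun a ha => hQ a (Finset.mem_insert_of_mem ha))

theorem HasL.exists_prod {ι : Type*} (s : Finset ι) {Q : ι → ℂ → (Fin N → ℂ) → ℂ} {q : ι → ℂ}
    (hQ : ∀ a ∈ s, ∃ ℓ, HasL c ξ (Q a) (q a) ℓ) :
    ∃ ℓ, HasL c ξ (fun t η => ∏ a ∈ s, Q a t η) (∏ a ∈ s, q a) ℓ := by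
  classical
  induction s using Finset.induction_on with
  | empty => exact ⟨0, by simpa using HasL.const (1 : ℂ)⟩
  | insert b s hb ih =>
    obtain ⟨ℓ, hℓ⟩ := hQ b (Finset.mem_insert_self b s)
    obtain ⟨ℓ', hℓ'⟩ := ih fun a ha => hQ a (Finset.mem_insert_of_mem ha)
    simp only [Finset.prod_insert hb]
    exact ⟨_, hℓ.mul hℓ'⟩

theorem HasL.congr (hQ : HasL c ξ Q q ℓ)
    (h : ∀ o, ∀ᶠ s in 𝓝 (0 : ℝ), Q (curve ξ o s).1 (curve ξ o s).2
      = Q' (curve ξ o s).1 (curve ξ o s).2) : HasL c ξ Q' q ℓ := by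
  obtain ⟨h1, a, ha, h2⟩ := hQ
  refine ⟨?_, a, fun o => (ha o).congr_of_eventuallyEq ((h o).mono fun s hs => hs.symm), h2⟩
  have := (h none).self_of_nhds
  rw [curve_zero] at this
  rw [← this, h1]

theorem HasL.unique (hQ : HasL c ξ Q q ℓ) (hQ' : HasL c ξ Q q' ℓ') : ℓ = ℓ' := by
  obtain ⟨-, a, ha, rfl⟩ := hQ
  obtain ⟨-, a', ha', rfl⟩ := hQ'
  have : a = a' := funext fun o => (ha o).unique (ha' o)
  rw [this]

theorem HasL.eventually_ne (hQ : HasL c ξ Q q ℓ) (hq : q ≠ 0) (o : Option (Fin N)) :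
    ∀ᶠ s in 𝓝 (0 : ℝ), Q (curve ξ o s).1 (curve ξ o s).2 ≠ 0 := by
  have e := hQ.value_curve o
  obtain ⟨-, a, ha, -⟩ := hQ
  exact (ha o).continuousAt.eventually_ne (by rwa [e])

theorem HasL.dirDiff (hQ : HasL c ξ Q q ℓ) (i : Fin N) : DirDiff i (Q 0) ξ := by
  obtain ⟨-, a, ha, -⟩ := hQ
  exact (ha (some i)).differentiableAt

/-- Recovers the variation from the derivation. The terms χ_i ∂Φ_j/∂ξ_i of the remainders originate
here. -/
theorem HasL.deriv_eq (hQ : HasL c ξ Q q ℓ) :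
    HasDerivAt (fun s : ℝ => Q (s : ℂ) ξ) (ℓ + ∑ i, c i * pd i (Q 0) ξ) 0 := by
  obtain ⟨-, a, ha, rfl⟩ := hQ
  have h1 : ∀ i, pd i (Q 0) ξ = a (some i) := fun i => pd_eq_of_hasDerivAt (ha (some i))
  simp only [h1, sub_add_cancel]
  exact ha none

theorem HasL.of_hasDerivAt {a : ℂ} (h0 : HasDerivAt (fun s : ℝ => Q (s : ℂ) ξ) a 0)
    (hi : ∀ i, DirDiff i (Q 0) ξ) : HasL c ξ Q (Q 0 ξ) (a - ∑ i, c i * pd i (Q 0) ξ) :=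
  ⟨rfl, fun o => o.elim a fun i => pd i (Q 0) ξ, fun o => by
    cases o with
    | none => exact h0
    | some i => exact (hi i).hasDerivAt, rfl⟩

theorem HasL.of_eq {q₁ ℓ₁ : ℂ} (hQ : HasL c ξ Q q ℓ) (hq : q = q₁) (hℓ : ℓ = ℓ₁) :
    HasL c ξ Q q₁ ℓ₁ := by rwa [← hq, ← hℓ]

/-- Chain rule. -/
theorem HasL.comp {G : Phase N → ℂ} {P : ℂ → (Fin N → ℂ) → Phase N} {p : Phase N}
    (hG : DifferentiableAt ℂ G p) (hp : P 0 ξ = p) {x y : Fin N → ℂ} {z : Fin 2 → ℂ}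
    {xv yv : Fin N → ℂ} {zv : Fin 2 → ℂ}
    (hx : ∀ a, HasL c ξ (fun t η => (P t η).1 a) (xv a) (x a))
    (hy : ∀ a, HasL c ξ (fun t η => (P t η).2.1 a) (yv a) (y a))
    (hz : ∀ a, HasL c ξ (fun t η => (P t η).2.2 a) (zv a) (z a)) :
    HasL c ξ (fun t η => G (P t η)) (G p) (fderiv ℂ G p (x, y, z)) := by
  choose hx1 ax hax hxe using hx
  choose hy1 ay hay hye using hy
  choose hz1 az haz hze using hz
  have hP : ∀ o, HasDerivAt (fun s : ℝ => P (curve ξ o s).1 (curve ξ o s).2)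
      ((fun a => ax a o, fun a => ay a o, fun a => az a o) : Phase N) 0 := fun o =>
    hasDerivAt_phase (fun a => hax a o) (fun a => hay a o) (fun a => haz a o)
  refine ⟨by simp only [hp], fun o => fderiv ℂ G p (fun a => ax a o, fun a => ay a o, fun a => az a o),
    fun o => ?_, ?_⟩
  · have hp' : P (curve ξ o 0).1 (curve ξ o 0).2 = p := by rw [curve_zero]; exact hp
    have := hasDerivAt_comp_phase (by rwa [hp']) (hP o)
    rwa [hp'] at this
  · have : ((x, y, z) : Phase N) = ((fun a => ax a none, fun a => ay a none, fun a => az a none) :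
        Phase N) - ∑ i, c i • ((fun a => ax a (some i), fun a => ay a (some i),
          fun a => az a (some i)) : Phase N) := by
      refine Prod.ext ?_ (Prod.ext ?_ ?_)
      · ext a; simp [Prod.fst_sum, hxe a, Finset.sum_apply]
      · ext a; simp [Prod.fst_sum, Prod.snd_sum, hye a, Finset.sum_apply]
      · ext a; simp [Prod.snd_sum, hze a, Finset.sum_apply]
    rw [this]
    simp only [map_sub, map_sum, map_smul, smul_eq_mul]

end HasL

/-! ### The derivation on matrices -/

section MHasL
variable {c ξ : Fin N → ℂ} {ι κ ν : Type*}

/-- The entrywise version of `HasL`. -/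
def MHasL (c ξ : Fin N → ℂ) (Q : ℂ → (Fin N → ℂ) → Matrix ι κ ℂ) (A L : Matrix ι κ ℂ) : Prop :=
  ∀ p q, HasL c ξ (fun t η => Q t η p q) (A p q) (L p q)

theorem MHasL.const (A : Matrix ι κ ℂ) : MHasL c ξ (fun _ _ => A) A 0 := fun _ _ => HasL.const _

theorem MHasL.add {Q Q' : ℂ → (Fin N → ℂ) → Matrix ι κ ℂ} {A A' L L' : Matrix ι κ ℂ}
    (hQ : MHasL c ξ Q A L) (hQ' : MHasL c ξ Q' A' L') :
    MHasL c ξ (fun t η => Q t η + Q' t η) (A + A') (L + L') := fun p q => (hQ p q).add (hQ' p q)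

theorem MHasL.sub {Q Q' : ℂ → (Fin N → ℂ) → Matrix ι κ ℂ} {A A' L L' : Matrix ι κ ℂ}
    (hQ : MHasL c ξ Q A L) (hQ' : MHasL c ξ Q' A' L') :
    MHasL c ξ (fun t η => Q t η - Q' t η) (A - A') (L - L') := fun p q => (hQ p q).sub (hQ' p q)

theorem MHasL.neg {Q : ℂ → (Fin N → ℂ) → Matrix ι κ ℂ} {A L : Matrix ι κ ℂ}
    (hQ : MHasL c ξ Q A L) : MHasL c ξ (fun t η => -Q t η) (-A) (-L) := fun p q => (hQ p q).neg

theorem MHasL.transpose {Q : ℂ → (Fin N → ℂ) → Matrix ι κ ℂ} {A L : Matrix ι κ ℂ}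
    (hQ : MHasL c ξ Q A L) : MHasL c ξ (fun t η => (Q t η)ᵀ) Aᵀ Lᵀ := fun p q => hQ q p

theorem MHasL.mul [Fintype κ] {Q : ℂ → (Fin N → ℂ) → Matrix ι κ ℂ}
    {Q' : ℂ → (Fin N → ℂ) → Matrix κ ν ℂ} {A L : Matrix ι κ ℂ} {A' L' : Matrix κ ν ℂ}
    (hQ : MHasL c ξ Q A L) (hQ' : MHasL c ξ Q' A' L') :
    MHasL c ξ (fun t η => Q t η * Q' t η) (A * A') (L * A' + A * L') := fun p q => by
  have := HasL.sum Finset.univ fun k _ => (hQ p k).mul (hQ' k q)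
  simp only [Matrix.mul_apply, Matrix.add_apply]
  rwa [Finset.sum_add_distrib] at this

theorem MHasL.smul {f : ℂ → (Fin N → ℂ) → ℂ} {x ℓ : ℂ} {Q : ℂ → (Fin N → ℂ) → Matrix ι κ ℂ}
    {A L : Matrix ι κ ℂ} (hf : HasL c ξ f x ℓ) (hQ : MHasL c ξ Q A L) :
    MHasL c ξ (fun t η => f t η • Q t η) (x • A) (ℓ • A + x • L) := fun p q => hf.mul (hQ p q)

theorem MHasL.sum {α : Type*} (s : Finset α) {Q : α → ℂ → (Fin N → ℂ) → Matrix ι κ ℂ}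
    {A L : α → Matrix ι κ ℂ} (hQ : ∀ a ∈ s, MHasL c ξ (Q a) (A a) (L a)) :
    MHasL c ξ (fun t η => ∑ a ∈ s, Q a t η) (∑ a ∈ s, A a) (∑ a ∈ s, L a) := fun p q => by
  simp only [Matrix.sum_apply]
  exact HasL.sum s fun a ha => hQ a ha p q

theorem MHasL.of_eq {Q : ℂ → (Fin N → ℂ) → Matrix ι κ ℂ} {A L A' L' : Matrix ι κ ℂ}
    (hQ : MHasL c ξ Q A L) (hA : A = A') (hL : L = L') : MHasL c ξ Q A' L' := by
  rwa [← hA, ← hL]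

theorem MHasL.mulVec [Fintype κ] {Q : ℂ → (Fin N → ℂ) → Matrix ι κ ℂ} {A L : Matrix ι κ ℂ}
    {f : ℂ → (Fin N → ℂ) → κ → ℂ} {x ℓ : κ → ℂ} (hQ : MHasL c ξ Q A L)
    (hf : ∀ k, HasL c ξ (fun t η => f t η k) (x k) (ℓ k)) (p : ι) :
    HasL c ξ (fun t η => (Q t η *ᵥ f t η) p) ((A *ᵥ x) p) ((L *ᵥ x + A *ᵥ ℓ) p) := by
  have := HasL.sum Finset.univ fun k _ => (hQ p k).mul (hf k)
  rw [Finset.sum_add_distrib] at this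
  exact this

theorem MHasL.exists_det [Fintype ι] [DecidableEq ι] {Q : ℂ → (Fin N → ℂ) → Matrix ι ι ℂ}
    {A : Matrix ι ι ℂ} (hQ : ∀ p q, ∃ ℓ, HasL c ξ (fun t η => Q t η p q) (A p q) ℓ) :
    ∃ ℓ, HasL c ξ (fun t η => (Q t η).det) A.det ℓ := by
  simp only [Matrix.det_apply']
  choose ℓ hℓ using fun σ : Equiv.Perm ι =>
    HasL.exists_prod Finset.univ fun a _ => hQ (σ a) a
  exact ⟨_, HasL.sum _ fun σ _ => (HasL.const _).mul (hℓ σ)⟩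

/-- Cramer's rule shows only that the derivation of the inverse exists. Its value then follows by
applying the product rule to Q Q⁻¹ = 1, which holds near 0 along every curve because the determinant
stays nonzero. -/
theorem MHasL.inv [Fintype ι] [DecidableEq ι] {Q : ℂ → (Fin N → ℂ) → Matrix ι ι ℂ}
    {A L : Matrix ι ι ℂ} (hQ : MHasL c ξ Q A L) (hA : A.det ≠ 0) :
    MHasL c ξ (fun t η => (Q t η)⁻¹) A⁻¹ (-(A⁻¹ * L * A⁻¹)) := by
  obtain ⟨ℓd, hd⟩ := MHasL.exists_det fun p q => ⟨_, hQ p q⟩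
  have hu : IsUnit A.det := isUnit_iff_ne_zero.2 hA
  have hex : ∀ p q, ∃ ℓ, HasL c ξ (fun t η => (Q t η)⁻¹ p q) (A⁻¹ p q) ℓ := by
    intro p q
    obtain ⟨ℓ, hℓ⟩ : ∃ ℓ, HasL c ξ (fun t η => (Q t η).adjugate p q) (A.adjugate p q) ℓ := by
      simp only [Matrix.adjugate_apply]
      refine MHasL.exists_det fun a b => ?_
      simp only [Matrix.updateRow_apply]
      split_ifs
      · exact ⟨_, HasL.const _⟩
      · exact ⟨_, hQ a b⟩
    simp only [Matrix.inv_def, Ring.inverse_eq_inv', Matrix.smul_apply, smul_eq_mul]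
    exact ⟨_, (hd.inv hA).mul hℓ⟩
  choose L' hL' using hex
  have hprod := hQ.mul (A' := A⁻¹) (L' := Matrix.of L') (fun p q => hL' p q)
  have hone : MHasL c ξ (fun t η => Q t η * (Q t η)⁻¹) 1 0 := fun p q =>
    (HasL.const ((1 : Matrix ι ι ℂ) p q)).congr fun o => by
      filter_upwards [hd.eventually_ne hA o] with s hs
      rw [Matrix.mul_nonsing_inv _ (isUnit_iff_ne_zero.2 hs)]
  have h1 : L * A⁻¹ + A * Matrix.of L' = 0 := by
    ext p q
    exact (hprod p q).unique (hone p q)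
  have h2 : Matrix.of L' = -(A⁻¹ * L * A⁻¹) := by
    have h3 := congrArg (fun X => A⁻¹ * X) h1
    simp only [Matrix.mul_add, Matrix.mul_zero] at h3
    rw [Matrix.nonsing_inv_mul_cancel_left _ _ hu] at h3
    rw [Matrix.mul_assoc]
    exact eq_neg_of_add_eq_zero_right h3
  rw [← h2]
  exact fun p q => hL' p q

end MHasL

/-! ### Families which are twice differentiable in all variables -/

/-- Twice continuously differentiable families near `(0, ξ)`. -/
def JC2 (ξ : Fin N → ℂ) (Q : ℂ → (Fin N → ℂ) → ℂ) : Prop :=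
  ContDiffAt ℝ 2 (fun p : ℝ × (Fin N → ℝ) => Q (p.1 : ℂ) (slice (fun j => (ξ j).im) p.2))
    (0, fun j => (ξ j).re)

section JC2
variable {ξ : Fin N → ℂ} {Q Q' : ℂ → (Fin N → ℂ) → ℂ}

theorem JC2.const (x : ℂ) : JC2 ξ (fun _ _ => x) := contDiffAt_const

theorem JC2.add (hQ : JC2 ξ Q) (hQ' : JC2 ξ Q') : JC2 ξ (fun t η => Q t η + Q' t η) :=
  ContDiffAt.add hQ hQ'

theorem JC2.mul (hQ : JC2 ξ Q) (hQ' : JC2 ξ Q') : JC2 ξ (fun t η => Q t η * Q' t η) :=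
  ContDiffAt.mul hQ hQ'

theorem JC2.inv (hQ : JC2 ξ Q) (h0 : Q 0 ξ ≠ 0) : JC2 ξ (fun t η => (Q t η)⁻¹) :=
  ContDiffAt.inv hQ (by simpa [slice_re_im] using h0)

theorem JC2.line {h : ℝ} {d : ℕ} {f g : (Fin N → ℂ) → ℂ} (hf : MemA h d f) (hg : MemA h d g)
    (hξ : ξ ∈ goodPts N h d) : JC2 ξ (fun t η => f η + t * g η) := by
  have h1 : ∀ {f : (Fin N → ℂ) → ℂ}, MemA h d f → JC2 ξ (fun _ η => f η) := fun {f} hf =>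
    ContDiffAt.comp (f := fun p : ℝ × (Fin N → ℝ) => p.2) (0, fun j => (ξ j).re)
      (hf.contDiffAt_slice hξ) contDiffAt_snd
  have h2 : JC2 ξ (fun t _ => t) :=
    (Complex.ofRealCLM.contDiff.contDiffAt).comp (f := fun p : ℝ × (Fin N → ℝ) => p.1) _
      contDiffAt_fst
  exact (h1 hf).add (h2.mul (h1 hg))

end JC2

/-! ### Commutation of the derivation with the partial derivatives -/

/-- The direction of `curve` in the space of real variables. -/
def curveDir : Option (Fin N) → ℝ × (Fin N → ℝ)
  | none => (1, 0)
  | some i => (0, Pi.single i 1)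

section JC2
variable {ξ : Fin N → ℂ} {Q : ℂ → (Fin N → ℂ) → ℂ}

theorem curve_eq (ξ : Fin N → ℂ) (o : Option (Fin N)) (s : ℝ) :
    curve ξ o s = ((((0, fun j => (ξ j).re) + s • curveDir o : ℝ × (Fin N → ℝ)).1 : ℂ),
      slice (fun j => (ξ j).im) ((0, fun j => (ξ j).re) + s • curveDir o : ℝ × (Fin N → ℝ)).2) := by
  cases o with
  | none => simp [curve, curveDir, slice_re_im]
  | some i =>
    have h1 : s • (Pi.single i 1 : Fin N → ℝ) = Pi.single i s := by
      rw [← Pi.single_smul]; simp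
    simp only [curve, curveDir, Prod.smul_mk, smul_zero, Prod.mk_add_mk, add_zero, h1,
      Complex.ofReal_zero]
    rw [← slice_add_single, slice_re_im]

theorem hasDerivAt_curveDir (p : ℝ × (Fin N → ℝ)) (o : Option (Fin N)) :
    HasDerivAt (fun s : ℝ => p + s • curveDir o) (curveDir o) 0 := by
  simpa using ((hasDerivAt_id (0 : ℝ)).smul_const (curveDir o)).const_add p

/-- The family as a function of real variables. -/
def realForm (ξ : Fin N → ℂ) (Q : ℂ → (Fin N → ℂ) → ℂ) (p : ℝ × (Fin N → ℝ)) : ℂ :=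
  Q (p.1 : ℂ) (slice (fun j => (ξ j).im) p.2)

theorem pd_realForm (i : Fin N) (t : ℝ) (x : Fin N → ℝ)
    (hQ : DifferentiableAt ℝ (realForm ξ Q) (t, x)) :
    pd i (Q t) (slice (fun j => (ξ j).im) x) = fderiv ℝ (realForm ξ Q) (t, x) (curveDir (some i)) := by
  apply pd_eq_of_hasDerivAt
  have h3 := HasFDerivAt.comp_hasDerivAt (f := fun s : ℝ => (t, x) + s • curveDir (some i))
    (l := realForm ξ Q) (l' := fderiv ℝ (realForm ξ Q) (t, x)) (0 : ℝ)
    (by simpa using hQ.hasFDerivAt) (hasDerivAt_curveDir (t, x) (some i))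
  refine h3.congr_of_eventuallyEq (Eventually.of_forall fun s => ?_)
  have h1 : s • (Pi.single i 1 : Fin N → ℝ) = Pi.single i s := by
    rw [← Pi.single_smul]; simp
  simp [realForm, curveDir, h1, slice_add_single]

theorem deriv_realForm (x : Fin N → ℝ) (hQ : DifferentiableAt ℝ (realForm ξ Q) (0, x)) :
    deriv (fun s : ℝ => Q s (slice (fun j => (ξ j).im) x)) 0
      = fderiv ℝ (realForm ξ Q) (0, x) (curveDir none) := by
  apply HasDerivAt.deriv
  have h3 := HasFDerivAt.comp_hasDerivAt (f := fun s : ℝ => (0, x) + s • curveDir none)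
    (l := realForm ξ Q) (l' := fderiv ℝ (realForm ξ Q) (0, x)) (0 : ℝ)
    (by simpa using hQ.hasFDerivAt) (hasDerivAt_curveDir (0, x) none)
  refine h3.congr_of_eventuallyEq (Eventually.of_forall fun s => ?_)
  simp [realForm, curveDir]

theorem JC2.eventually_differentiableAt (hQ : JC2 ξ Q) (o : Option (Fin N)) :
    ∀ᶠ s in 𝓝 (0 : ℝ), DifferentiableAt ℝ (realForm ξ Q)
      ((0, fun j => (ξ j).re) + s • curveDir o) := by
  have h1 : ∀ᶠ p in 𝓝 ((0, fun j => (ξ j).re) : ℝ × (Fin N → ℝ)),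
      DifferentiableAt ℝ (realForm ξ Q) p := by
    filter_upwards [ContDiffAt.eventually hQ (by simp)] with p hp
    exact ContDiffAt.differentiableAt hp (by norm_num)
  have h2 := (hasDerivAt_curveDir (0, fun j => (ξ j).re) o).continuousAt
  have h3 : Tendsto (fun s : ℝ => ((0, fun j => (ξ j).re) + s • curveDir o : ℝ × (Fin N → ℝ)))
      (𝓝 0) (𝓝 (0, fun j => (ξ j).re)) := by
    have := h2.tendsto
    simpa using this
  exact h3.eventually h1

theorem JC2.hasDerivAt_fderiv (hQ : JC2 ξ Q) (o : Option (Fin N)) (v : ℝ × (Fin N → ℝ)) :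
    HasDerivAt (fun s : ℝ => fderiv ℝ (realForm ξ Q) ((0, fun j => (ξ j).re) + s • curveDir o) v)
      (fderiv ℝ (fderiv ℝ (realForm ξ Q)) (0, fun j => (ξ j).re) (curveDir o) v) 0 := by
  have h1 : DifferentiableAt ℝ (fderiv ℝ (realForm ξ Q)) (0, fun j => (ξ j).re) :=
    (ContDiffAt.fderiv_right (m := 1) hQ (by norm_num)).differentiableAt (by norm_num)
  have h3 := HasFDerivAt.comp_hasDerivAt (f := fun s : ℝ => (0, fun j => (ξ j).re) + s • curveDir o)
    (l := fderiv ℝ (realForm ξ Q)) (l' := fderiv ℝ (fderiv ℝ (realForm ξ Q)) (0, fun j => (ξ j).re))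
    (0 : ℝ) (by simpa using h1.hasFDerivAt) (hasDerivAt_curveDir _ o)
  exact h3.clm_apply (hasDerivAt_const _ _) |>.congr_deriv (by simp)

theorem JC2.hasDerivAt_pd (hQ : JC2 ξ Q) (k : Fin N) (o : Option (Fin N)) :
    HasDerivAt (fun s : ℝ => pd k (Q (curve ξ o s).1) (curve ξ o s).2)
      (fderiv ℝ (fderiv ℝ (realForm ξ Q)) (0, fun j => (ξ j).re) (curveDir o)
        (curveDir (some k))) 0 := by
  refine (hQ.hasDerivAt_fderiv o (curveDir (some k))).congr_of_eventuallyEq ?_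
  filter_upwards [hQ.eventually_differentiableAt o] with s hs
  rw [curve_eq]
  exact pd_realForm k _ _ hs

theorem JC2.hasDerivAt_deriv (hQ : JC2 ξ Q) (k : Fin N) :
    HasDerivAt (fun s : ℝ => deriv (fun t : ℝ => Q t (ξ + Pi.single k (s : ℂ))) 0)
      (fderiv ℝ (fderiv ℝ (realForm ξ Q)) (0, fun j => (ξ j).re) (curveDir (some k))
        (curveDir none)) 0 := by
  refine (hQ.hasDerivAt_fderiv (some k) (curveDir none)).congr_of_eventuallyEq ?_
  filter_upwards [hQ.eventually_differentiableAt (some k)] with s hs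
  have h1 : ξ + Pi.single k (s : ℂ) = (curve ξ (some k) s).2 := rfl
  have h2 : ((0, fun j => (ξ j).re) + s • curveDir (some k) : ℝ × (Fin N → ℝ))
      = (0, ((0, fun j => (ξ j).re) + s • curveDir (some k) : ℝ × (Fin N → ℝ)).2) := by
    refine Prod.ext ?_ rfl
    simp [curveDir]
  rw [h1, curve_eq, h2]
  exact deriv_realForm _ (by rw [← h2]; exact hs)

theorem JC2.pd_pd_comm (hQ : JC2 ξ Q) (i k : Fin N) :
    pd i (pd k (Q 0)) ξ = pd k (pd i (Q 0)) ξ := by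
  rw [pd_eq_of_hasDerivAt (hQ.hasDerivAt_pd k (some i)),
    pd_eq_of_hasDerivAt (hQ.hasDerivAt_pd i (some k))]
  exact (ContDiffAt.isSymmSndFDerivAt hQ (by simp)) _ _

theorem JC2.dirDiff_pd (hQ : JC2 ξ Q) (i k : Fin N) : DirDiff k (pd i (Q 0)) ξ :=
  (hQ.hasDerivAt_pd i (some k)).differentiableAt

/-- Symmetry of the second derivative of the family as a function of the real variables (t, x)
jointly: mixed derivatives in t and ξ_k commute as well as those in ξ_i and ξ_k. -/
theorem JC2.hasL_pd (hQ : JC2 ξ Q) (c : Fin N → ℂ) (k : Fin N) :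
    HasL c ξ (fun t => pd k (Q t)) (pd k (Q 0) ξ)
      (pd k (fun η => deriv (fun s : ℝ => Q s η) 0) ξ - ∑ i, c i * pd k (pd i (Q 0)) ξ) := by
  refine ⟨rfl, _, fun o => hQ.hasDerivAt_pd k o, ?_⟩
  have hs := ContDiffAt.isSymmSndFDerivAt (f := realForm ξ Q) hQ (by simp)
  rw [pd_eq_of_hasDerivAt (hQ.hasDerivAt_deriv k), hs (curveDir none)]
  congr 1
  refine Finset.sum_congr rfl fun i _ => ?_
  rw [← hQ.pd_pd_comm i k, pd_eq_of_hasDerivAt (hQ.hasDerivAt_pd k (some i))]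

/-- The commutator of the derivation with `∂/∂ξ_k`. -/
theorem JC2.hasL_pd_of_hasL (hQ : JC2 ξ Q) {h : ℝ} (hξ : ξ ∈ strip N h)
    {χ : (Fin N → ℂ) → Fin N → ℂ} {q ℓ : (Fin N → ℂ) → ℂ}
    (hL : ∀ η ∈ strip N h, HasL (χ η) η Q (q η) (ℓ η)) {k : Fin N}
    (hχ : ∀ i, DirDiff k (fun η => χ η i) ξ) :
    HasL (χ ξ) ξ (fun t => pd k (Q t)) (pd k (Q 0) ξ)
      (pd k ℓ ξ + ∑ i, pd i (Q 0) ξ * pd k (fun η => χ η i) ξ) := by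
  refine (hQ.hasL_pd (χ ξ) k).of_eq rfl ?_
  have h1 : ∀ η ∈ strip N h, ℓ η
      = deriv (fun s : ℝ => Q s η) 0 - ∑ i, χ η i * pd i (Q 0) η := fun η hη => by
    rw [(hL η hη).deriv_eq.deriv]; ring
  have h2 : DirDiff k (fun η => deriv (fun s : ℝ => Q s η) 0) ξ :=
    (hQ.hasDerivAt_deriv k).differentiableAt
  have h3 : ∀ i, DirDiff k (fun η => χ η i * pd i (Q 0) η) ξ := fun i =>
    (hχ i).mul (hQ.dirDiff_pd i k)
  rw [pd_congr h1 hξ k, pd_sub h2 (DirDiff.sum fun i _ => h3 i), pd_sum fun i _ => h3 i]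
  simp only [fun i => pd_mul (hχ i) (hQ.dirDiff_pd i k), Finset.sum_add_distrib]
  have h4 : ∑ i, pd k (fun η => χ η i) ξ * pd i (Q 0) ξ
      = ∑ i, pd i (Q 0) ξ * pd k (fun η => χ η i) ξ := Finset.sum_congr rfl fun i _ => mul_comm _ _
  rw [h4]; ring

end JC2

/-- Separates the computation of the plain variation (c = 0) from the choice of the vector field c.
-/
theorem HasL.change {ξ : Fin N → ℂ} {Q : ℂ → (Fin N → ℂ) → ℂ} {q ℓ : ℂ}
    (hQ : HasL 0 ξ Q q ℓ) (c : Fin N → ℂ) : HasL c ξ Q q (ℓ - ∑ i, c i * pd i (Q 0) ξ) := by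
  obtain ⟨h1, a, ha, rfl⟩ := hQ
  refine ⟨h1, a, ha, ?_⟩
  simp only [fun i => pd_eq_of_hasDerivAt (f := Q 0) (ha (some i)), Pi.zero_apply, zero_mul,
    Finset.sum_const_zero, sub_zero]

theorem HasL.line {h : ℝ} {d : ℕ} {f g : (Fin N → ℂ) → ℂ} (hf : MemA h d f) (hd : 1 ≤ d)
    {ξ : Fin N → ℂ} (hξ : ξ ∈ strip N h) (c : Fin N → ℂ) :
    HasL c ξ (fun t η => f η + t * g η) (f ξ) (g ξ - ∑ i, c i * pd i f ξ) := by
  have h0 : (fun η => f η + (0 : ℂ) * g η) = f := by simp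
  have h1 : HasDerivAt (fun s : ℝ => f ξ + (s : ℂ) * g ξ) (g ξ) 0 := by
    simpa using ((Complex.ofRealCLM.hasDerivAt (x := (0 : ℝ))).mul_const (g ξ)).const_add (f ξ)
  have h2 := HasL.of_hasDerivAt (c := c) (Q := fun t η => f η + t * g η) h1
    fun i => by rw [h0]; exact hf.dirDiff hd hξ i
  rw [h0] at h2
  exact h2.of_eq (by simp) rfl

theorem Coord.add_zero_smul (φ δ : Coord N) : φ + (0 : ℂ) • δ = φ := by
  change Coord.mk (φ.β + (0 : ℂ) • δ.β) (φ.φ₀ + (0 : ℂ) • δ.φ₀) (φ.u + (0 : ℂ) • δ.u)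
    (φ.w + (0 : ℂ) • δ.w) (φ.W₁₁ + (0 : ℂ) • δ.W₁₁) (φ.W₁₂ + (0 : ℂ) • δ.W₁₂)
    (φ.W₂₁ + (0 : ℂ) • δ.W₂₁) = φ
  simp only [zero_smul, add_zero]

/-- A point `φ` in the coordinate space at which all objects are defined, and a direction `δ`. -/
structure Setting (h : ℝ) (d : ℕ) (φ δ : Coord N) : Prop where
  hd : 1 ≤ d
  mem : φ.Mem h d
  memδ : δ.Mem h d
  det : ∀ ξ ∈ strip N h, (1 + jac φ.u ξ).det ≠ 0
  W₁₁ : ∀ ξ ∈ strip N h, φ.W₁₁ ξ ≠ 0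

/-! ### Algebra of the matrix `W` -/

theorem W_inv {φ : Coord N} {ξ : Fin N → ℂ} (h : φ.W₁₁ ξ ≠ 0) :
    (φ.W ξ)⁻¹ = !![φ.W ξ 1 1, -φ.W ξ 0 1; -φ.W ξ 1 0, φ.W ξ 0 0] := by
  apply Matrix.inv_eq_left_inv
  ext i j
  fin_cases i <;> fin_cases j <;>
    simp [Coord.W, Matrix.mul_apply, Fin.sum_univ_two] <;> field_simp <;> ring

theorem W_det {φ : Coord N} {ξ : Fin N → ℂ} (h : φ.W₁₁ ξ ≠ 0) : (φ.W ξ).det = 1 := by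
  simp only [Coord.W, Matrix.det_fin_two_of]
  field_simp
  ring

theorem W_mul_inv {φ : Coord N} {ξ : Fin N → ℂ} (h : φ.W₁₁ ξ ≠ 0) : φ.W ξ * (φ.W ξ)⁻¹ = 1 :=
  Matrix.mul_nonsing_inv _ (by rw [W_det h]; exact isUnit_one)

theorem transpose_mul_J_mul (A : Matrix (Fin 2) (Fin 2) ℂ) : Aᵀ * J * A = A.det • J := by
  ext i j
  fin_cases i <;> fin_cases j <;>
    simp [J, Matrix.mul_apply, Fin.sum_univ_two, Matrix.det_fin_two] <;> ring

theorem W_symplectic {φ : Coord N} {ξ : Fin N → ℂ} (h : φ.W₁₁ ξ ≠ 0) :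
    (φ.W ξ)ᵀ * J * φ.W ξ = J := by rw [transpose_mul_J_mul, W_det h, one_smul]

/-- The derivative of the determinant of a `2 × 2` matrix. -/
def detDeriv (A X : Matrix (Fin 2) (Fin 2) ℂ) : ℂ :=
  X 0 0 * A 1 1 + A 0 0 * X 1 1 - (X 0 1 * A 1 0 + A 0 1 * X 1 0)

/-- For 2 × 2 matrices the antisymmetric part of XᵀJA is a multiple of J with coefficient
proportional to the derivative of the determinant. So symmetry expresses that X is tangent to the
level set of det at A. -/
theorem isSymm_of_detDeriv {A X : Matrix (Fin 2) (Fin 2) ℂ} (h : detDeriv A X = 0) :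
    (Xᵀ * J * A).IsSymm := by
  unfold detDeriv at h
  ext i j
  fin_cases i <;> fin_cases j <;>
    simp [J, Matrix.mul_apply, Fin.sum_univ_two]
  · linear_combination -h
  · linear_combination h

theorem trace_inv_mul {φ : Coord N} {ξ : Fin N → ℂ} (h : φ.W₁₁ ξ ≠ 0)
    (X : Matrix (Fin 2) (Fin 2) ℂ) : ((φ.W ξ)⁻¹ * X).trace = detDeriv (φ.W ξ) X := by
  rw [W_inv h]
  simp only [Matrix.trace_fin_two, Matrix.mul_apply, Fin.sum_univ_two, detDeriv]
  simp
  ring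

theorem J_mul_isSymm {A : Matrix (Fin 2) (Fin 2) ℂ} (h : A.trace = 0) : (J * A).IsSymm := by
  rw [Matrix.trace_fin_two] at h
  ext i j
  simp only [J, Matrix.transpose_apply, Matrix.mul_apply, Fin.sum_univ_two]
  fin_cases i <;> fin_cases j <;> simp
  · linear_combination -h
  · linear_combination h

theorem J_transpose : Jᵀ = -J := by
  ext i j
  fin_cases i <;> fin_cases j <;> simp [J]

/-! ### First order variations -/

theorem hasL_pd_line {h : ℝ} {d : ℕ} {ξ : Fin N → ℂ} {f g : (Fin N → ℂ) → ℂ} (hf : MemA h d f) (hg : MemA h d g)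
    (hξ : ξ ∈ goodPts N h d) (k : Fin N) :
    HasL 0 ξ (fun t => pd k (fun η => f η + t * g η)) (pd k f ξ) (pd k g ξ) := by
  have h1 := (JC2.line hf hg hξ).hasL_pd 0 k
  have h2 : ∀ η, deriv (fun s : ℝ => f η + s * g η) 0 = g η := fun η => by
    apply HasDerivAt.deriv
    simpa using ((Complex.ofRealCLM.hasDerivAt (x := (0 : ℝ))).mul_const (g η)).const_add (f η)
  simpa [h2] using h1

namespace Setting
variable {h : ℝ} {d : ℕ} {φ δ : Coord N} (hS : Setting h d φ δ) {ξ : Fin N → ℂ}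
include hS

/-- The formula for δW₂₂ is the linearisation of the constraint det W = 1. -/
theorem detDeriv_dW (hξ : ξ ∈ strip N h) : detDeriv (φ.W ξ) (dW φ δ ξ) = 0 := by
  have := hS.W₁₁ ξ hξ
  simp [detDeriv, dW, Coord.W]
  field_simp
  ring

theorem hasL_u (hξ : ξ ∈ strip N h) (c : Fin N → ℂ) (a : Fin N) :
    HasL c ξ (fun t η => (φ + t • δ).u η a) (φ.u ξ a)
      (δ.u ξ a - ∑ i, c i * pd i (fun η => φ.u η a) ξ) := HasL.line (hS.mem.u a) hS.hd hξ c

theorem hasL_w (hξ : ξ ∈ strip N h) (c : Fin N → ℂ) (a : Fin 2) :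
    HasL c ξ (fun t η => (φ + t • δ).w η a) (φ.w ξ a)
      (δ.w ξ a - ∑ i, c i * pd i (fun η => φ.w η a) ξ) := HasL.line (hS.mem.w a) hS.hd hξ c

theorem hasL_φ₀ (hξ : ξ ∈ strip N h) (c : Fin N → ℂ) :
    HasL c ξ (fun t => (φ + t • δ).φ₀) (φ.φ₀ ξ) (δ.φ₀ ξ - ∑ i, c i * pd i φ.φ₀ ξ) :=
  HasL.line hS.mem.φ₀ hS.hd hξ c

theorem hasL_W (hξ : ξ ∈ strip N h) : MHasL 0 ξ (fun t => (φ + t • δ).W) (φ.W ξ) (dW φ δ ξ) := by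
  have e : ∀ {f g : (Fin N → ℂ) → ℂ}, MemA h d f →
      HasL 0 ξ (fun t η => f η + t * g η) (f ξ) (g ξ) := fun hf =>
    (HasL.line hf hS.hd hξ 0).of_eq rfl (by simp)
  have h11 : HasL 0 ξ (fun t => (φ + t • δ).W₁₁) _ _ := e (g := δ.W₁₁) hS.mem.W₁₁
  have h12 : HasL 0 ξ (fun t => (φ + t • δ).W₁₂) _ _ := e (g := δ.W₁₂) hS.mem.W₁₂
  have h21 : HasL 0 ξ (fun t => (φ + t • δ).W₂₁) _ _ := e (g := δ.W₂₁) hS.mem.W₂₁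
  have h0 := hS.W₁₁ ξ hξ
  have h22 := ((HasL.const 1).add (h12.mul h21)).mul (h11.inv h0)
  intro p q
  fin_cases p <;> fin_cases q
  · exact h11
  · exact h12
  · exact h21
  · refine h22.of_eq (by simp [Coord.W, div_eq_mul_inv]) ?_
    simp [dW, Coord.W]
    field_simp
    ring

theorem dirDiff_W (hξ : ξ ∈ strip N h) (p q : Fin 2) (i : Fin N) :
    DirDiff i (fun η => φ.W η p q) ξ := by
  have := (hS.hasL_W hξ p q).dirDiff i
  simpa only [Coord.add_zero_smul] using this

theorem detDeriv_mpd (hξ : ξ ∈ strip N h) (i : Fin N) : detDeriv (φ.W ξ) (mpd i φ.W ξ) = 0 := by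
  have h1 : pd i (fun η => φ.W η 0 0 * φ.W η 1 1 - φ.W η 0 1 * φ.W η 1 0) ξ = 0 := by
    rw [pd_congr (g := fun _ => 1) (fun η hη => ?_) hξ i, pd_const]
    rw [← W_det (hS.W₁₁ η hη), Matrix.det_fin_two]
  have hW := fun p q => hS.dirDiff_W hξ p q i
  rw [pd_sub ((hW _ _).mul (hW _ _)) ((hW _ _).mul (hW _ _)), pd_mul (hW _ _) (hW _ _),
    pd_mul (hW _ _) (hW _ _)] at h1
  exact h1

/-- Both δW and the derivatives ∂_i W are tangent to the group of matrices of determinant 1, and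
left translation by W⁻¹ sends tangent vectors to traceless matrices. -/
theorem trace_Gam (hξ : ξ ∈ strip N h) : (Gam φ δ ξ).trace = 0 := by
  have h0 := hS.W₁₁ ξ hξ
  simp only [Gam, Matrix.trace_sub, Matrix.trace_sum, Matrix.trace_smul, trace_inv_mul h0,
    hS.detDeriv_dW hξ, hS.detDeriv_mpd hξ]
  simp

theorem R_isSymm (hξ : ξ ∈ strip N h) (a : Fin N) : (φ.R a ξ).IsSymm := by
  have h1 : ∀ k, ((mpd k φ.W ξ)ᵀ * J * φ.W ξ).IsSymm := fun k =>
    isSymm_of_detDeriv (hS.detDeriv_mpd hξ k)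
  unfold Coord.R Matrix.IsSymm
  rw [Matrix.transpose_neg, Matrix.transpose_sum]
  simp only [Matrix.transpose_smul, (h1 _).eq]

theorem W_mulVec_lam (hξ : ξ ∈ strip N h) (p : Fin 2) :
    (φ.W ξ *ᵥ lam φ δ ξ) p = δ.w ξ p - ∑ i, chi φ δ ξ i * pd i (fun η => φ.w η p) ξ := by
  have h1 := W_mul_inv (hS.W₁₁ ξ hξ)
  simp only [lam, Matrix.mulVec_sub, Matrix.mulVec_sum, Matrix.mulVec_smul, Matrix.mulVec_mulVec,
    h1, Matrix.one_mulVec]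
  simp [vpd, Finset.sum_apply]

theorem W_mul_Gam (hξ : ξ ∈ strip N h) :
    φ.W ξ * Gam φ δ ξ = dW φ δ ξ - ∑ i, chi φ δ ξ i • mpd i φ.W ξ := by
  have h1 := W_mul_inv (hS.W₁₁ ξ hξ)
  simp only [Gam, Matrix.mul_sub, Matrix.mul_sum, Matrix.mul_smul, ← Matrix.mul_assoc, h1,
    Matrix.one_mul]

theorem jac_mulVec_chi (hξ : ξ ∈ strip N h) : (1 + jac φ.u ξ) *ᵥ chi φ δ ξ = δ.u ξ := by
  have h1 : IsUnit (1 + jac φ.u ξ).det := isUnit_iff_ne_zero.2 (hS.det ξ hξ)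
  simp only [chi, Coord.V, Matrix.transpose_transpose, Matrix.mulVec_mulVec,
    Matrix.mul_nonsing_inv _ h1, Matrix.one_mulVec]

/-- This is (I + u')χ = δu read componentwise: the variation of u relative to the field χ is χ
itself. -/
theorem chi_eq (hξ : ξ ∈ strip N h) (a : Fin N) :
    δ.u ξ a - ∑ i, chi φ δ ξ i * pd i (fun η => φ.u η a) ξ = chi φ δ ξ a := by
  rw [← hS.jac_mulVec_chi hξ, Matrix.add_mulVec, Matrix.one_mulVec]
  simp [Matrix.mulVec, dotProduct, jac, mul_comm]

theorem hasL_chi_u (hξ : ξ ∈ strip N h) (a : Fin N) :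
    HasL (chi φ δ ξ) ξ (fun t η => (φ + t • δ).u η a) (φ.u ξ a) (chi φ δ ξ a) :=
  (hS.hasL_u hξ _ a).of_eq rfl (hS.chi_eq hξ a)

theorem hasL_chi_w (hξ : ξ ∈ strip N h) (a : Fin 2) :
    HasL (chi φ δ ξ) ξ (fun t η => (φ + t • δ).w η a) (φ.w ξ a) ((φ.W ξ *ᵥ lam φ δ ξ) a) :=
  (hS.hasL_w hξ _ a).of_eq rfl (hS.W_mulVec_lam hξ a).symm

theorem hasL_chi_W (hξ : ξ ∈ strip N h) :
    MHasL (chi φ δ ξ) ξ (fun t => (φ + t • δ).W) (φ.W ξ) (φ.W ξ * Gam φ δ ξ) := fun p q => by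
  refine ((hS.hasL_W hξ p q).change _).of_eq rfl ?_
  rw [hS.W_mul_Gam hξ]
  simp [Coord.add_zero_smul, mpd, Matrix.sum_apply]

/-- The key cancellation: the identity map contributes -χ and u contributes +χ. It is the reason for
the choice of χ and removes all x-derivatives of the Hamiltonian. -/
theorem hasL_x (hξ : ξ ∈ strip N h) (a : Fin N) :
    HasL (chi φ δ ξ) ξ (fun t η => ((φ + t • δ).pt η).1 a) ((φ.pt ξ).1 a) 0 := by
  have h1 : HasL (chi φ δ ξ) ξ (fun _ η => η a) (ξ a) (-chi φ δ ξ a) := by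
    refine ⟨rfl, fun o => o.elim 0 fun i => (Pi.single i 1 : Fin N → ℂ) a, fun o => ?_, ?_⟩
    · cases o with
      | none => exact hasDerivAt_const _ _
      | some i => exact hasDerivAt_pi.1 (hasDerivAt_add_single ξ i 0) a
    · simp [Pi.single_apply]
  exact (h1.add (hS.hasL_chi_u hξ a)).of_eq rfl (by ring)

/-! ### Second order variations -/

theorem jC2_u (hξ : ξ ∈ goodPts N h d) (a : Fin N) : JC2 ξ (fun t η => (φ + t • δ).u η a) :=
  JC2.line (hS.mem.u a) (hS.memδ.u a) hξ

theorem jC2_w (hξ : ξ ∈ goodPts N h d) (a : Fin 2) : JC2 ξ (fun t η => (φ + t • δ).w η a) :=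
  JC2.line (hS.mem.w a) (hS.memδ.w a) hξ

theorem jC2_φ₀ (hξ : ξ ∈ goodPts N h d) : JC2 ξ (fun t => (φ + t • δ).φ₀) :=
  JC2.line hS.mem.φ₀ hS.memδ.φ₀ hξ

theorem jC2_W (hξ : ξ ∈ goodPts N h d) (p q : Fin 2) :
    JC2 ξ (fun t η => (φ + t • δ).W η p q) := by
  have h11 : JC2 ξ (fun t => (φ + t • δ).W₁₁) := JC2.line hS.mem.W₁₁ hS.memδ.W₁₁ hξ
  have h12 : JC2 ξ (fun t => (φ + t • δ).W₁₂) := JC2.line hS.mem.W₁₂ hS.memδ.W₁₂ hξ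
  have h21 : JC2 ξ (fun t => (φ + t • δ).W₂₁) := JC2.line hS.mem.W₂₁ hS.memδ.W₂₁ hξ
  have h22 := ((JC2.const 1).add (h12.mul h21)).mul
    (h11.inv (by rw [Coord.add_zero_smul]; exact hS.W₁₁ ξ hξ.1))
  fin_cases p <;> fin_cases q
  · exact h11
  · exact h12
  · exact h21
  · exact h22

theorem hasL_jac_u (hξ : ξ ∈ goodPts N h d) :
    MHasL 0 ξ (fun t η => 1 + jac (φ + t • δ).u η) (1 + jac φ.u ξ) (jac δ.u ξ) := by
  have h1 : MHasL 0 ξ (fun t η => jac (φ + t • δ).u η) (jac φ.u ξ) (jac δ.u ξ) := fun a k =>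
    hasL_pd_line (hS.mem.u a) (hS.memδ.u a) hξ k
  exact ((MHasL.const 1).add h1).of_eq rfl (zero_add _)

theorem hasL_V (hξ : ξ ∈ goodPts N h d) :
    MHasL 0 ξ (fun t η => (φ + t • δ).V η) (φ.V ξ) (dV φ δ ξ) := by
  refine ((hS.hasL_jac_u hξ).inv (hS.det ξ hξ.1)).transpose.of_eq rfl ?_
  simp only [dV, Coord.V, Matrix.transpose_neg, Matrix.transpose_mul, Matrix.mul_assoc]

theorem hasL_v (hξ : ξ ∈ goodPts N h d) (a : Fin N) :
    HasL 0 ξ (fun t η => (φ + t • δ).v η a) (φ.v ξ a) (dv φ δ ξ a) := by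
  have hβ : HasL 0 ξ (fun t _ => (φ + t • δ).β a) (φ.β a) (δ.β a) := by
    have h1 : HasDerivAt (fun s : ℝ => φ.β a + (s : ℂ) * δ.β a) (δ.β a) 0 := by
      simpa using ((Complex.ofRealCLM.hasDerivAt (x := (0 : ℝ))).mul_const (δ.β a)).const_add (φ.β a)
    refine (HasL.of_hasDerivAt (c := 0) (Q := fun t _ => (φ + t • δ).β a) (ξ := ξ) h1
      fun i => dirDiff_const _ _ _).of_eq ?_ ?_
    · rw [Coord.add_zero_smul]
    · simp
  have hw1 := (hS.hasL_w hξ.1 0 1)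
  have hg : ∀ k, HasL 0 ξ (fun t η => (φ + t • δ).g η k) (φ.g ξ k)
      ((grad δ.φ₀ ξ - φ.w ξ 1 • grad (fun η => δ.w η 0) ξ
        - δ.w ξ 1 • grad (fun η => φ.w η 0) ξ) k) := fun k => by
    have h1 := (hasL_pd_line hS.mem.φ₀ hS.memδ.φ₀ hξ k).sub
      (hw1.mul (hasL_pd_line (hS.mem.w 0) (hS.memδ.w 0) hξ k))
    refine HasL.of_eq h1 rfl ?_
    simp [grad]
    ring
  have := hβ.add ((hS.hasL_V hξ).mulVec hg a)
  refine this.of_eq rfl ?_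
  simp only [dv, Pi.add_apply]
  ring

theorem dirDiff_V (hξ : ξ ∈ goodPts N h d) (a b i : Fin N) : DirDiff i (fun η => φ.V η a b) ξ := by
  simpa only [Coord.add_zero_smul] using (hS.hasL_V hξ a b).dirDiff i

theorem dirDiff_chi (hξ : ξ ∈ goodPts N h d) (a i : Fin N) : DirDiff i (fun η => chi φ δ η a) ξ :=
  DirDiff.sum (s := Finset.univ) fun k _ => (hS.dirDiff_V hξ k a i).mul ((hS.memδ.u k).dirDiff hS.hd hξ.1 i)

theorem dirDiff_W_inv (hξ : ξ ∈ strip N h) (p q : Fin 2) (i : Fin N) :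
    DirDiff i (fun η => (φ.W η)⁻¹ p q) ξ := by
  have hW := fun p q => hS.dirDiff_W hξ p q i
  refine dirDiff_congr (f := fun η => !![φ.W η 1 1, -φ.W η 0 1; -φ.W η 1 0, φ.W η 0 0] p q)
    (fun η hη => by rw [W_inv (hS.W₁₁ η hη)]) hξ ?_
  fin_cases p <;> fin_cases q
  · exact hW 1 1
  · exact (hW 0 1).neg
  · exact (hW 1 0).neg
  · exact hW 0 0

theorem dirDiff_lam (hξ : ξ ∈ goodPts N h d) (p : Fin 2) (i : Fin N) :
    DirDiff i (fun η => lam φ δ η p) ξ := by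
  have h1 : ∀ j, DirDiff i (fun η => (chi φ δ η j • ((φ.W η)⁻¹ *ᵥ vpd j φ.w η)) p) ξ := fun j =>
    (hS.dirDiff_chi hξ j i).mul (DirDiff.sum (s := Finset.univ) fun q _ => (hS.dirDiff_W_inv hξ.1 p q i).mul
      ((hS.mem.w q).dirDiff_pd hξ j i))
  have h2 : DirDiff i (fun η => ((φ.W η)⁻¹ *ᵥ δ.w η) p) ξ :=
    DirDiff.sum (s := Finset.univ) fun q _ => (hS.dirDiff_W_inv hξ.1 p q i).mul ((hS.memδ.w q).dirDiff hS.hd hξ.1 i)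
  simp only [lam, Pi.sub_apply, Finset.sum_apply]
  exact h2.sub (DirDiff.sum fun j _ => h1 j)

theorem dirDiff_dW (hξ : ξ ∈ strip N h) (p q : Fin 2) (i : Fin N) :
    DirDiff i (fun η => dW φ δ η p q) ξ := by
  have e : ∀ {f}, MemA h d f → DirDiff i f ξ := fun hf => hf.dirDiff hS.hd hξ i
  have h0 := hS.W₁₁ ξ hξ
  have h22 : DirDiff i (fun η => (φ.W₁₂ η * δ.W₂₁ η + φ.W₂₁ η * δ.W₁₂ η - φ.W η 1 1 * δ.W₁₁ η) *
      (φ.W₁₁ η)⁻¹) ξ :=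
    ((((e hS.mem.W₁₂).mul (e hS.memδ.W₂₁)).add ((e hS.mem.W₂₁).mul (e hS.memδ.W₁₂))).sub
      ((hS.dirDiff_W hξ 1 1 i).mul (e hS.memδ.W₁₁))).mul ((e hS.mem.W₁₁).inv h0)
  fin_cases p <;> fin_cases q
  · exact e hS.memδ.W₁₁
  · exact e hS.memδ.W₁₂
  · exact e hS.memδ.W₂₁
  · exact h22

theorem dirDiff_pd_W (hξ : ξ ∈ goodPts N h d) (p q : Fin 2) (i j : Fin N) :
    DirDiff i (pd j (fun η => φ.W η p q)) ξ := by
  have := (hS.jC2_W hξ p q).dirDiff_pd j i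
  simpa only [Coord.add_zero_smul] using this

theorem dirDiff_Gam (hξ : ξ ∈ goodPts N h d) (p q : Fin 2) (i : Fin N) :
    DirDiff i (fun η => Gam φ δ η p q) ξ := by
  have h1 : ∀ j, DirDiff i (fun η => (chi φ δ η j • ((φ.W η)⁻¹ * mpd j φ.W η)) p q) ξ := fun j =>
    (hS.dirDiff_chi hξ j i).mul (DirDiff.sum (s := Finset.univ) fun k _ => (hS.dirDiff_W_inv hξ.1 p k i).mul
      (hS.dirDiff_pd_W hξ k q i j))
  have h2 : DirDiff i (fun η => ((φ.W η)⁻¹ * dW φ δ η) p q) ξ :=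
    DirDiff.sum (s := Finset.univ) fun k _ => (hS.dirDiff_W_inv hξ.1 p k i).mul (hS.dirDiff_dW hξ.1 k q i)
  simp only [Gam, Matrix.sub_apply, Matrix.sum_apply]
  exact h2.sub (DirDiff.sum fun j _ => h1 j)

end Setting

/-! ### The derivation of the frame V, Λ, R_i and of v -/

namespace Setting
variable {h : ℝ} {d : ℕ} {φ δ : Coord N} (hS : Setting h d φ δ) {ξ : Fin N → ℂ}
include hS

/-- Commuting L with the partial derivatives gives L(I + u') = (I + u')χ'; inverting and transposing
yields the claim. -/
theorem hasL_chi_V (hξ : ξ ∈ goodPts N h d) :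
    MHasL (chi φ δ ξ) ξ (fun t η => (φ + t • δ).V η) (φ.V ξ)
      (-(φ.V ξ * (jac (chi φ δ) ξ)ᵀ)) := by
  have h1 : MHasL (chi φ δ ξ) ξ (fun t η => 1 + jac (φ + t • δ).u η) (1 + jac φ.u ξ)
      ((1 + jac φ.u ξ) * jac (chi φ δ) ξ) := by
    have h2 : MHasL (chi φ δ ξ) ξ (fun t η => jac (φ + t • δ).u η) (jac φ.u ξ)
        ((1 + jac φ.u ξ) * jac (chi φ δ) ξ) := fun a k => by
      refine ((hS.jC2_u hξ a).hasL_pd_of_hasL hξ.1 (fun η hη => hS.hasL_chi_u hη a)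
        fun i => hS.dirDiff_chi hξ i k).of_eq ?_ ?_
      · rw [Coord.add_zero_smul]; rfl
      · rw [Coord.add_zero_smul, Matrix.add_mul, Matrix.one_mul]; rfl
    exact ((MHasL.const 1).add h2).of_eq rfl (zero_add _)
  have hu : IsUnit (1 + jac φ.u ξ).det := isUnit_iff_ne_zero.2 (hS.det ξ hξ.1)
  refine (h1.inv (hS.det ξ hξ.1)).transpose.of_eq rfl ?_
  rw [Matrix.nonsing_inv_mul_cancel_left _ _ hu, Matrix.transpose_neg, Matrix.transpose_mul]
  rfl

theorem hasL_jac_w (hξ : ξ ∈ goodPts N h d) :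
    MHasL (chi φ δ ξ) ξ (fun t η => jac (φ + t • δ).w η) (jac φ.w ξ)
      (jac (fun η => φ.W η *ᵥ lam φ δ η) ξ + jac φ.w ξ * jac (chi φ δ) ξ) := fun a k => by
  refine ((hS.jC2_w hξ a).hasL_pd_of_hasL hξ.1 (fun η hη => hS.hasL_chi_w hη a)
    fun i => hS.dirDiff_chi hξ i k).of_eq ?_ ?_
  · rw [Coord.add_zero_smul]; rfl
  · rw [Coord.add_zero_smul]; rfl

theorem hasL_mpd_W (hξ : ξ ∈ goodPts N h d) (k : Fin N) :
    MHasL (chi φ δ ξ) ξ (fun t η => mpd k (φ + t • δ).W η) (mpd k φ.W ξ)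
      (mpd k (fun η => φ.W η * Gam φ δ η) ξ
        + ∑ i, jac (chi φ δ) ξ i k • mpd i φ.W ξ) := fun a b => by
  refine ((hS.jC2_W hξ a b).hasL_pd_of_hasL hξ.1 (fun η hη => hS.hasL_chi_W hη a b)
    fun i => hS.dirDiff_chi hξ i k).of_eq ?_ ?_
  · rw [Coord.add_zero_smul]; rfl
  · rw [Coord.add_zero_smul]
    simp only [Matrix.add_apply, Matrix.sum_apply, Matrix.smul_apply, smul_eq_mul]
    simp only [mpd, jac, Matrix.of_apply, mul_comm]

theorem jac_W_mulVec_lam (hξ : ξ ∈ goodPts N h d) (a : Fin 2) (k : Fin N) :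
    jac (fun η => φ.W η *ᵥ lam φ δ η) ξ a k
      = (φ.W ξ * jac (lam φ δ) ξ) a k + (mpd k φ.W ξ *ᵥ lam φ δ ξ) a := by
  have h1 := fun q => hS.dirDiff_W hξ.1 a q k
  have h2 := fun q => hS.dirDiff_lam hξ q k
  have h3 : jac (fun η => φ.W η *ᵥ lam φ δ η) ξ a k
      = pd k (fun η => ∑ q, φ.W η a q * lam φ δ η q) ξ := rfl
  rw [h3, pd_sum fun q _ => (h1 q).mul (h2 q)]
  simp only [fun q => pd_mul (h1 q) (h2 q), Finset.sum_add_distrib]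
  exact add_comm _ _

theorem mpd_W_mul_Gam (hξ : ξ ∈ goodPts N h d) (k : Fin N) :
    mpd k (fun η => φ.W η * Gam φ δ η) ξ
      = mpd k φ.W ξ * Gam φ δ ξ + φ.W ξ * mpd k (Gam φ δ) ξ := by
  ext a b
  have h1 := fun q => hS.dirDiff_W hξ.1 a q k
  have h2 := fun q => hS.dirDiff_Gam hξ q b k
  have h3 : mpd k (fun η => φ.W η * Gam φ δ η) ξ a b
      = pd k (fun η => ∑ q, φ.W η a q * Gam φ δ η q b) ξ := rfl
  rw [h3, pd_sum fun q _ => (h1 q).mul (h2 q)]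
  simp only [fun q => pd_mul (h1 q) (h2 q), Finset.sum_add_distrib]
  rfl

theorem jac_J_mulVec_lam (hξ : ξ ∈ goodPts N h d) :
    jac (fun η => J *ᵥ lam φ δ η) ξ = J * jac (lam φ δ) ξ := by
  ext a k
  have h2 := fun q => hS.dirDiff_lam hξ q k
  have h3 : jac (fun η => J *ᵥ lam φ δ η) ξ a k = pd k (fun η => ∑ q, J a q * lam φ δ η q) ξ := rfl
  rw [h3, pd_sum fun q _ => (dirDiff_const _ _ _).mul (h2 q)]
  simp only [fun q => pd_const_mul (J a q) (h2 q)]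
  rfl

theorem mpd_J_mul_Gam (hξ : ξ ∈ goodPts N h d) (k : Fin N) :
    mpd k (fun η => J * Gam φ δ η) ξ = J * mpd k (Gam φ δ) ξ := by
  ext a b
  have h2 := fun q => hS.dirDiff_Gam hξ q b k
  have h3 : mpd k (fun η => J * Gam φ δ η) ξ a b = pd k (fun η => ∑ q, J a q * Gam φ δ η q b) ξ :=
    rfl
  rw [h3, pd_sum fun q _ => (dirDiff_const _ _ _).mul (h2 q)]
  simp only [fun q => pd_const_mul (J a q) (h2 q)]
  rfl

theorem mpd_J_mul_Gam_isSymm (hξ : ξ ∈ strip N h) (k : Fin N) :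
    (mpd k (fun η => J * Gam φ δ η) ξ).IsSymm := by
  ext a b
  exact pd_congr (fun η hη => congrFun (congrFun (J_mul_isSymm (hS.trace_Gam hη)).eq a) b) hξ k

/-- In the product rule for -V(w')ᵀJW the χ' term of LV cancels the commutator term of Lw'. What is
left of Lw' is (Wλ)' = Wλ' + W'λ: the first part simplifies through WᵀJW = J, the second is an
R-matrix contracted with λ, and LW = WΓ gives ΛΓ. -/
theorem hasL_chi_Lam (hξ : ξ ∈ goodPts N h d) :
    MHasL (chi φ δ ξ) ξ (fun t η => (φ + t • δ).Lam η) (φ.Lam ξ)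
      (φ.V ξ * (jac (fun η => J *ᵥ lam φ δ η) ξ)ᵀ + φ.Lam ξ * Gam φ δ ξ
        + ∑ l, lam φ δ ξ l • Rcol φ l ξ) := by
  refine ((((hS.hasL_chi_V hξ).mul (hS.hasL_jac_w hξ).transpose).mul (MHasL.const J)).mul
    (hS.hasL_chi_W hξ.1)).neg.of_eq rfl ?_
  have hsym := W_symplectic (hS.W₁₁ ξ hξ.1)
  have h1 : (jac (fun η => φ.W η *ᵥ lam φ δ η) ξ)ᵀ = (jac (lam φ δ) ξ)ᵀ * (φ.W ξ)ᵀ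
      + Matrix.of fun k a => (mpd k φ.W ξ *ᵥ lam φ δ ξ) a := by
    rw [← Matrix.transpose_mul]
    ext k a
    exact hS.jac_W_mulVec_lam hξ a k
  -- The definition of R_i with a transposed index pair; symmetry of R_i allows it to be read as
  -- `Rcol`.
  have h2 : φ.V ξ * (Matrix.of fun k a => (mpd k φ.W ξ *ᵥ lam φ δ ξ) a) * J * φ.W ξ
      = -∑ l, lam φ δ ξ l • Rcol φ l ξ := by
    ext a p
    have h3 : (∑ l, lam φ δ ξ l • Rcol φ l ξ) a p = ∑ l, lam φ δ ξ l * φ.R a ξ l p := by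
      simp only [Matrix.sum_apply, Matrix.smul_apply, Rcol, Matrix.of_apply, smul_eq_mul]
      exact Finset.sum_congr rfl fun l _ => by rw [(hS.R_isSymm hξ.1 a).apply]
    rw [Matrix.neg_apply, h3]
    simp only [Coord.R, Matrix.neg_apply, Matrix.sum_apply, Matrix.smul_apply, smul_eq_mul, mul_neg,
      Finset.sum_neg_distrib, neg_neg, Finset.mul_sum]
    rw [Finset.sum_comm, Matrix.mul_assoc, Matrix.mul_assoc, Matrix.mul_apply]
    refine Finset.sum_congr rfl fun k _ => ?_
    have h4 : ∀ l, lam φ δ ξ l * (φ.V ξ a k * ((mpd k φ.W ξ)ᵀ * J * φ.W ξ) l p)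
        = φ.V ξ a k * (lam φ δ ξ l * ((mpd k φ.W ξ)ᵀ * (J * φ.W ξ)) l p) := fun l => by
      rw [Matrix.mul_assoc]; ring
    simp only [h4, ← Finset.mul_sum]
    congr 1
    simp only [Matrix.mul_apply, Matrix.of_apply, Matrix.mulVec, dotProduct, Matrix.transpose_apply,
      Fin.sum_univ_two]
    ring
  have h5 : (J * jac (lam φ δ) ξ)ᵀ = -((jac (lam φ δ) ξ)ᵀ * J) := by
    rw [Matrix.transpose_mul, J_transpose, Matrix.mul_neg]
  have h6 : φ.V ξ * ((jac (lam φ δ) ξ)ᵀ * (φ.W ξ)ᵀ) * J * φ.W ξ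
      = φ.V ξ * ((jac (lam φ δ) ξ)ᵀ * J) := by
    conv_rhs => rw [← hsym]
    simp only [Matrix.mul_assoc]
  rw [hS.jac_J_mulVec_lam hξ, h5, Matrix.transpose_add, h1, Matrix.transpose_mul, Coord.Lam]
  simp only [Matrix.mul_add, Matrix.add_mul, Matrix.mul_zero, Matrix.neg_mul, Matrix.mul_neg,
    add_zero, h2, h6]
  simp only [Matrix.mul_assoc]
  abel

/-- As for Λ, the χ' term of LV cancels the commutator term of L∂_kW. The remaining (WΓ)' yields
∂(JΓ) and one of the two products of R_i with Γ; LW = WΓ yields the other. -/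
theorem hasL_chi_R (hξ : ξ ∈ goodPts N h d) (a : Fin N) :
    MHasL (chi φ δ ξ) ξ (fun t η => (φ + t • δ).R a η) (φ.R a ξ)
      ((∑ j, φ.V ξ a j • mpd j (fun η => J * Gam φ δ η) ξ) + φ.R a ξ * Gam φ δ ξ
        + (φ.R a ξ * Gam φ δ ξ)ᵀ) := by
  refine (MHasL.sum Finset.univ fun k _ => MHasL.smul (hS.hasL_chi_V hξ a k)
    (((hS.hasL_mpd_W hξ k).transpose.mul (MHasL.const J)).mul (hS.hasL_chi_W hξ.1))).neg.of_eq
      rfl ?_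
  have hsym := W_symplectic (hS.W₁₁ ξ hξ.1)
  set χ' := jac (chi φ δ) ξ
  set X : Fin N → Matrix (Fin 2) (Fin 2) ℂ := fun k => (mpd k φ.W ξ)ᵀ * J * φ.W ξ with hX
  -- Here Γ'ᵀWᵀJW = Γ'ᵀJ = -(JΓ')ᵀ, and JΓ' is symmetric because Γ is traceless throughout the
  -- strip.
  have h1 : ∀ k, (mpd k (fun η => φ.W η * Gam φ δ η) ξ)ᵀ * J * φ.W ξ
      = (Gam φ δ ξ)ᵀ * X k - mpd k (fun η => J * Gam φ δ η) ξ := fun k => by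
    rw [← (hS.mpd_J_mul_Gam_isSymm hξ.1 k).eq, hS.mpd_J_mul_Gam hξ, hS.mpd_W_mul_Gam hξ]
    have e : (mpd k (Gam φ δ) ξ)ᵀ * ((φ.W ξ)ᵀ * J * φ.W ξ) = (mpd k (Gam φ δ) ξ)ᵀ * J := by
      rw [hsym]
    simp only [Matrix.mul_assoc] at e
    simp only [Matrix.transpose_add, Matrix.transpose_mul, Matrix.add_mul, J_transpose,
      Matrix.mul_neg, sub_neg_eq_add, hX, Matrix.mul_assoc, e]
  have h2 : ∀ k, (∑ i, χ' i k • mpd i φ.W ξ)ᵀ * J * φ.W ξ = ∑ i, χ' i k • X i := fun k => by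
    simp only [Matrix.transpose_sum, Matrix.transpose_smul, Matrix.sum_mul, Matrix.smul_mul, hX]
  have h3 : ∑ k, (φ.V ξ * χ'ᵀ) a k • X k = ∑ k, φ.V ξ a k • ∑ i, χ' i k • X i := by
    simp only [Matrix.mul_apply, Matrix.transpose_apply, Finset.sum_smul, Finset.smul_sum, mul_smul]
    exact Finset.sum_comm
  have hR : φ.R a ξ = -∑ k, φ.V ξ a k • X k := rfl
  have h4 : (φ.R a ξ * Gam φ δ ξ)ᵀ = -∑ k, φ.V ξ a k • ((Gam φ δ ξ)ᵀ * X k) := by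
    rw [Matrix.transpose_mul, (hS.R_isSymm hξ.1 a).eq, hR, Matrix.mul_neg, Matrix.mul_sum]
    simp only [Matrix.mul_smul]
  have h5 : ∀ k, (mpd k φ.W ξ)ᵀ * J * (φ.W ξ * Gam φ δ ξ) = X k * Gam φ δ ξ := fun k => by
    simp only [hX, Matrix.mul_assoc]
  have h6 : (∑ k, φ.V ξ a k • (X k * Gam φ δ ξ)) = -(φ.R a ξ * Gam φ δ ξ) := by
    rw [hR, Matrix.neg_mul, neg_neg, Matrix.sum_mul]
    simp only [Matrix.smul_mul]
  rw [h4]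
  simp only [Matrix.transpose_add, Matrix.mul_zero, add_zero, Matrix.add_mul, h1, h2, h5, smul_add,
    smul_sub, Finset.sum_add_distrib, Finset.sum_sub_distrib, Matrix.neg_apply, neg_smul,
    Finset.sum_neg_distrib, h6]
  have h7 : ∑ k, (φ.V ξ * χ'ᵀ) a k • ((mpd k φ.W ξ)ᵀ * J * φ.W ξ)
    = ∑ k, φ.V ξ a k • ∑ i, χ' i k • X i := h3
  rw [h7]
  abel

theorem V_mulVec_mu (hξ : ξ ∈ strip N h) :
    φ.V ξ *ᵥ mu φ δ ξ + φ.Lam ξ *ᵥ lam φ δ ξ = dv φ δ ξ - ∑ i, chi φ δ ξ i • vpd i φ.v ξ := by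
  have h1 : φ.V ξ * (φ.V ξ)⁻¹ = 1 := by
    apply Matrix.mul_nonsing_inv
    rw [Coord.V, Matrix.det_transpose, Matrix.det_nonsing_inv]
    have := isUnit_iff_ne_zero.2 (hS.det ξ hξ)
    exact this.ringInverse
  rw [mu, Matrix.mulVec_mulVec, h1, Matrix.one_mulVec]
  abel

/-- The definition of μ is exactly this identity solved for μ: the action variation is split along
the columns of V and of Λ. -/
theorem hasL_chi_v (hξ : ξ ∈ goodPts N h d) (a : Fin N) :
    HasL (chi φ δ ξ) ξ (fun t η => (φ + t • δ).v η a) (φ.v ξ a)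
      ((φ.V ξ *ᵥ mu φ δ ξ + φ.Lam ξ *ᵥ lam φ δ ξ) a) := by
  refine ((hS.hasL_v hξ a).change _).of_eq rfl ?_
  rw [hS.V_mulVec_mu hξ.1, Coord.add_zero_smul]
  simp [Finset.sum_apply, vpd]

/-- The derivation along the solution map acts on functions of phase space as a directional
derivative. -/
theorem hasL_comp_pt (hξ : ξ ∈ goodPts N h d) {G : Phase N → ℂ}
    (hG : DifferentiableAt ℂ G (φ.pt ξ)) :
    HasL (chi φ δ ξ) ξ (fun t η => G ((φ + t • δ).pt η)) (G (φ.pt ξ))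
      (dirD G (φ.pt ξ) (φ.V ξ *ᵥ mu φ δ ξ + φ.Lam ξ *ᵥ lam φ δ ξ) (φ.W ξ *ᵥ lam φ δ ξ)) := by
  refine (HasL.comp (P := fun t η => (φ + t • δ).pt η) hG (by rw [Coord.add_zero_smul])
    (hS.hasL_x hξ.1) (hS.hasL_chi_v hξ) (hS.hasL_chi_w hξ.1)).of_eq rfl ?_
  rw [fderiv_phase]
  simp [dirD]

end Setting

/-! ### Second and third derivatives of the Hamiltonian -/

theorem dirD_add (G : Phase N → ℂ) (p : Phase N) (η η' : Fin N → ℂ) (ζ ζ' : Fin 2 → ℂ) :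
    dirD G p (η + η') (ζ + ζ') = dirD G p η ζ + dirD G p η' ζ' := by
  simp only [dirD, Pi.add_apply, add_mul, Finset.sum_add_distrib]
  ring

theorem dirD_sum {ι : Type*} (s : Finset ι) (G : Phase N → ℂ) (p : Phase N) (x : ι → ℂ)
    (η : ι → Fin N → ℂ) (ζ : ι → Fin 2 → ℂ) :
    dirD G p (∑ i ∈ s, x i • η i) (∑ i ∈ s, x i • ζ i) = ∑ i ∈ s, x i * dirD G p (η i) (ζ i) := by
  classical
  induction s using Finset.induction_on with
  | empty => simp [dirD]
  | insert a s ha ih =>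
    rw [Finset.sum_insert ha, Finset.sum_insert ha, Finset.sum_insert ha, dirD_add, ih]
    simp [dirD, mul_add, Finset.mul_sum, mul_assoc]

theorem cubic_add (F : Phase N → ℂ) (φ : Coord N) (η η' : Fin N → ℂ) (ζ ζ' : Fin 2 → ℂ)
    (ξ : Fin N → ℂ) :
    cubic F φ (η + η') (ζ + ζ') ξ = cubic F φ η ζ ξ + cubic F φ η' ζ' ξ := by
  have e : ∀ {ι κ : Type} (f g : ι → κ → ℂ), (Matrix.of fun i j => f i j + g i j)
      = Matrix.of f + Matrix.of g := fun f g => rfl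
  simp only [cubic, dirD_add, e, add_smul, Finset.sum_add_distrib, Matrix.mul_add, Matrix.add_mul,
    Matrix.transpose_add]
  abel

theorem cubic_sum {ι : Type*} (s : Finset ι) (F : Phase N → ℂ) (φ : Coord N) (x : ι → ℂ)
    (η : ι → Fin N → ℂ) (ζ : ι → Fin 2 → ℂ) (ξ : Fin N → ℂ) :
    cubic F φ (∑ i ∈ s, x i • η i) (∑ i ∈ s, x i • ζ i) ξ
      = ∑ i ∈ s, x i • cubic F φ (η i) (ζ i) ξ := by
  have e : ∀ {κ ν : Type} (f : κ → ν → ι → ℂ), (Matrix.of fun a b => ∑ i ∈ s, x i * f a b i)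
      = ∑ i ∈ s, x i • Matrix.of fun a b => f a b i := fun f => by
    ext a b; simp [Matrix.sum_apply]
  simp only [cubic, dirD_sum, e, smul_add, Finset.sum_add_distrib, Matrix.mul_sum, Matrix.sum_mul,
    Matrix.transpose_sum, Matrix.mul_smul, Matrix.smul_mul, Matrix.transpose_smul, Finset.sum_smul,
    Finset.smul_sum, mul_smul]
  rw [Finset.sum_comm]

section Derivatives
variable {F : Phase N → ℂ} {R : ℝ} (hF : DifferentiableOn ℂ F (openDomain N R)) {p : Phase N}
  (hp : p ∈ openDomain N R)
include hF

theorem differentiableOn_dY (j : Fin N) : DifferentiableOn ℂ (dY j F) (openDomain N R) :=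
  differentiableOn_fderiv_apply isOpen_openDomain hF _

theorem differentiableOn_dZ (j : Fin 2) : DifferentiableOn ℂ (dZ j F) (openDomain N R) :=
  differentiableOn_fderiv_apply isOpen_openDomain hF _

include hp

theorem hessYY_isSymm : (hessYY F p).IsSymm := by
  ext i j
  exact fderiv_fderiv_comm hF hp _ _

theorem hessZZ_isSymm : (hessZZ F p).IsSymm := by
  ext i j
  exact fderiv_fderiv_comm hF hp _ _

theorem dirD_dY (η : Fin N → ℂ) (ζ : Fin 2 → ℂ) (a : Fin N) :
    dirD (dY a F) p η ζ = (hessYY F p *ᵥ η + (hessZY F p)ᵀ *ᵥ ζ) a := by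
  rw [← (hessYY_isSymm hF hp).eq]
  simp [dirD, Matrix.mulVec, dotProduct, hessYY, hessZY, mul_comm]

theorem dirD_dZ (η : Fin N → ℂ) (ζ : Fin 2 → ℂ) (a : Fin 2) :
    dirD (dZ a F) p η ζ = (hessZY F p *ᵥ η + hessZZ F p *ᵥ ζ) a := by
  rw [← (hessZZ_isSymm hF hp).eq]
  have : ∀ b, dY b (dZ a F) p = dZ a (dY b F) p := fun b => fderiv_fderiv_comm hF hp _ _
  simp only [dirD, Matrix.mulVec, dotProduct, hessZZ, hessZY, mul_comm, this, Pi.add_apply,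
    Matrix.transpose_apply, Matrix.of_apply]

end Derivatives

theorem mulVec_dotProduct {ι κ : Type*} [Fintype ι] [Fintype κ] (A : Matrix ι κ ℂ) (x : κ → ℂ)
    (y : ι → ℂ) : (A *ᵥ x) ⬝ᵥ y = (Aᵀ *ᵥ y) ⬝ᵥ x := by
  rw [dotProduct_comm, Matrix.dotProduct_mulVec, Matrix.mulVec_transpose]

theorem sum_Rcol_transpose_mulVec (φ : Coord N) (l : Fin 2 → ℂ) (y : Fin N → ℂ) (ξ : Fin N → ℂ) :
    (∑ q, l q • Rcol φ q ξ)ᵀ *ᵥ y = (∑ i, y i • φ.R i ξ) *ᵥ l := by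
  ext a
  simp only [Matrix.mulVec, dotProduct, Matrix.transpose_apply, Matrix.sum_apply, Matrix.smul_apply,
    smul_eq_mul, Rcol, Matrix.of_apply, Finset.sum_mul]
  rw [Finset.sum_comm]
  exact Finset.sum_congr rfl fun q _ => Finset.sum_congr rfl fun i _ => by ring

/-- The form is linear in the direction, so the direction (Vμ + Λλ, Wλ) is resolved along its
components μ_j and λ_l. The coefficients are the matrices E_j and the third order part of K_l. -/
theorem cubic_mulVec (F : Phase N → ℂ) (φ : Coord N) (x : Fin N → ℂ) (y : Fin 2 → ℂ)
    (ξ : Fin N → ℂ) :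
    cubic F φ (φ.V ξ *ᵥ x + φ.Lam ξ *ᵥ y) (φ.W ξ *ᵥ y) ξ
      = (∑ j, x j • coefE F φ j ξ)
        + ∑ l, y l • cubic F φ (fun a => φ.Lam ξ a l) (fun c => φ.W ξ c l) ξ := by
  have h1 : ∀ {ι κ : Type} [Fintype κ] (A : Matrix ι κ ℂ) (x : κ → ℂ),
      A *ᵥ x = ∑ j, x j • fun i => A i j := fun A x => by
    ext i
    simp [Matrix.mulVec, dotProduct, Finset.sum_apply, mul_comm]
  have h2 : φ.W ξ *ᵥ y = (∑ j, x j • (0 : Fin 2 → ℂ)) + φ.W ξ *ᵥ y := by simp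
  rw [h2, cubic_add, h1 (φ.V ξ), h1 (φ.Lam ξ), h1 (φ.W ξ), cubic_sum, cubic_sum]
  rfl

/-! ### The derivation of the operators Φ₁, …, Φ₄ -/

namespace Setting
variable {h : ℝ} {d : ℕ} {φ δ : Coord N} (hS : Setting h d φ δ) {ξ : Fin N → ℂ}
  {F : Phase N → ℂ} {R : ℝ} (hF : DifferentiableOn ℂ F (openDomain N R))
include hS

theorem J_mulVec_vdOm (hξ : ξ ∈ goodPts N h d) (ω : Fin N → ℝ) :
    J *ᵥ vdOm ω (lam φ δ) ξ = jac (fun η => J *ᵥ lam φ δ η) ξ *ᵥ fun i => (ω i : ℂ) := by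
  rw [hS.jac_J_mulVec_lam hξ, ← Matrix.mulVec_mulVec]
  congr 1
  ext a
  simp [vdOm, dOm, Matrix.mulVec, dotProduct, jac, mul_comm]

theorem hasL_hess (hξ : ξ ∈ goodPts N h d) (hp : φ.pt ξ ∈ openDomain N R)
    {ι κ : Type*} {G : ι → κ → Phase N → ℂ}
    (hG : ∀ i j, DifferentiableOn ℂ (G i j) (openDomain N R)) :
    MHasL (chi φ δ ξ) ξ (fun t η => Matrix.of fun i j => G i j ((φ + t • δ).pt η))
      (Matrix.of fun i j => G i j (φ.pt ξ))
      (Matrix.of fun i j => dirD (G i j) (φ.pt ξ)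
        (φ.V ξ *ᵥ mu φ δ ξ + φ.Lam ξ *ᵥ lam φ δ ξ) (φ.W ξ *ᵥ lam φ δ ξ)) := fun i j =>
  hS.hasL_comp_pt hξ ((hG i j).differentiableAt (isOpen_openDomain.mem_nhds hp))

include hF

/-- The y-part of the directional derivative pairs Vᵀ∇_yH with μ, and Vᵀ∇_yH = ω + Φ₃; everything
paired with λ is Φ₂ by definition. -/
theorem hasL_Phi₁ (hξ : ξ ∈ goodPts N h d) (hp : φ.pt ξ ∈ openDomain N R) (e : ℂ)
    (ω : Fin N → ℝ) :
    HasL (chi φ δ ξ) ξ (fun t => Phi₁ F e (φ + t • δ)) (Phi₁ F e φ ξ)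
      ((∑ i, (ω i : ℂ) * mu φ δ ξ i) + Phi₂ F φ ξ ⬝ᵥ lam φ δ ξ + Phi₃ F ω φ ξ ⬝ᵥ mu φ δ ξ) := by
  refine ((hS.hasL_comp_pt hξ (hF.differentiableAt (isOpen_openDomain.mem_nhds hp))).sub
    (HasL.const e)).of_eq rfl ?_
  have h1 : ∀ η ζ, dirD F (φ.pt ξ) η ζ = η ⬝ᵥ gradY F (φ.pt ξ) + ζ ⬝ᵥ gradZ F (φ.pt ξ) :=
    fun _ _ => rfl
  have h2 : ∑ i, (ω i : ℂ) * mu φ δ ξ i = (fun i => (ω i : ℂ)) ⬝ᵥ mu φ δ ξ := rfl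
  rw [h1, h2, Phi₂, Phi₃, add_dotProduct, mulVec_dotProduct (φ.V ξ), mulVec_dotProduct (φ.Lam ξ),
    mulVec_dotProduct (φ.W ξ), add_dotProduct, sub_dotProduct]
  ring

theorem hasL_gradY (hξ : ξ ∈ goodPts N h d) (hp : φ.pt ξ ∈ openDomain N R) (a : Fin N) :
    HasL (chi φ δ ξ) ξ (fun t η => gradY F ((φ + t • δ).pt η) a) (gradY F (φ.pt ξ) a)
      ((hessYY F (φ.pt ξ) *ᵥ (φ.V ξ *ᵥ mu φ δ ξ + φ.Lam ξ *ᵥ lam φ δ ξ)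
        + (hessZY F (φ.pt ξ))ᵀ *ᵥ (φ.W ξ *ᵥ lam φ δ ξ)) a) :=
  (hS.hasL_comp_pt hξ ((differentiableOn_dY hF a).differentiableAt
    (isOpen_openDomain.mem_nhds hp))).of_eq rfl (dirD_dY hF hp _ _ a)

theorem hasL_gradZ (hξ : ξ ∈ goodPts N h d) (hp : φ.pt ξ ∈ openDomain N R) (a : Fin 2) :
    HasL (chi φ δ ξ) ξ (fun t η => gradZ F ((φ + t • δ).pt η) a) (gradZ F (φ.pt ξ) a)
      ((hessZY F (φ.pt ξ) *ᵥ (φ.V ξ *ᵥ mu φ δ ξ + φ.Lam ξ *ᵥ lam φ δ ξ)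
        + hessZZ F (φ.pt ξ) *ᵥ (φ.W ξ *ᵥ lam φ δ ξ)) a) :=
  (hS.hasL_comp_pt hξ ((differentiableOn_dZ hF a).differentiableAt
    (isOpen_openDomain.mem_nhds hp))).of_eq rfl (dirD_dZ hF hp _ _ a)

/-- The part V((Jλ)')ᵀ of LΛ acts on ∇_yH as (Jλ)'(ω + Φ₃), whose ω-part is J∂λ. The Γ terms
assemble to ΓᵀΦ₂, the second derivatives of H paired with μ give T, and those paired with λ,
together with the R-part of LΛ, give Φ₄ + Ω. -/
theorem hasL_Phi₂ (hξ : ξ ∈ goodPts N h d) (hp : φ.pt ξ ∈ openDomain N R)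
    (ω : Fin N → ℝ) (k : ℂ) (a : Fin 2) :
    HasL (chi φ δ ξ) ξ (fun t η => Phi₂ F (φ + t • δ) η a) (Phi₂ F φ ξ a)
      ((J *ᵥ vdOm ω (lam φ δ) ξ + Om k *ᵥ lam φ δ ξ + T F φ ξ *ᵥ mu φ δ ξ
        + ((Gam φ δ ξ)ᵀ *ᵥ Phi₂ F φ ξ + Phi₄ F k φ ξ *ᵥ lam φ δ ξ
          + jac (fun η => J *ᵥ lam φ δ η) ξ *ᵥ Phi₃ F ω φ ξ)) a) := by
  refine (((hS.hasL_chi_Lam hξ).transpose.mulVec (hS.hasL_gradY hF hξ hp) a).add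
    ((hS.hasL_chi_W hξ.1).transpose.mulVec (hS.hasL_gradZ hF hξ hp) a)).of_eq rfl ?_
  rw [hS.J_mulVec_vdOm hξ, ← Pi.add_apply]
  refine congrFun ?_ a
  simp only [Matrix.transpose_add, Matrix.add_mulVec, sum_Rcol_transpose_mulVec]
  simp only [Phi₂, Phi₃, Phi₄, T, Matrix.transpose_mul, Matrix.transpose_transpose, Matrix.add_mulVec,
    Matrix.sub_mulVec, Matrix.mulVec_add, Matrix.mulVec_sub, ← Matrix.mulVec_mulVec, gradY]
  abel

/-- The variation of Vᵀ contributes -χ'(ω + Φ₃), with χ'ω = ∂χ. The second derivatives of H give S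
and, using that the Hessian in y is symmetric, the transpose of T. -/
theorem hasL_Phi₃ (hξ : ξ ∈ goodPts N h d) (hp : φ.pt ξ ∈ openDomain N R)
    (ω : Fin N → ℝ) (a : Fin N) :
    HasL (chi φ δ ξ) ξ (fun t η => Phi₃ F ω (φ + t • δ) η a) (Phi₃ F ω φ ξ a)
      ((-vdOm ω (chi φ δ) ξ + S F φ ξ *ᵥ mu φ δ ξ + (T F φ ξ)ᵀ *ᵥ lam φ δ ξ
        - jac (chi φ δ) ξ *ᵥ Phi₃ F ω φ ξ) a) := by
  refine (((hS.hasL_chi_V hξ).transpose.mulVec (hS.hasL_gradY hF hξ hp) a).sub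
    (HasL.const (ω a : ℂ))).of_eq rfl ?_
  have h1 : vdOm ω (chi φ δ) ξ = jac (chi φ δ) ξ *ᵥ fun i => (ω i : ℂ) := by
    ext a
    simp [vdOm, dOm, Matrix.mulVec, dotProduct, jac, mul_comm]
  rw [sub_zero, h1]
  refine congrFun ?_ a
  simp only [Phi₃, S, T, Matrix.transpose_add, Matrix.transpose_neg, Matrix.transpose_mul,
    Matrix.transpose_transpose, Matrix.add_mulVec, Matrix.neg_mulVec, (hessYY_isSymm hF hp).eq,
    Matrix.mulVec_add, Matrix.mulVec_sub, ← Matrix.mulVec_mulVec]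
  abel

/-- Sorting of the Leibniz rule by origin: ∂(JΓ) from LR_i, the products with Γ from all frame
factors (whose bracket is Φ₄ + Ω), U from the λ'-part of LΛ, and E and K from the derivatives of H
together with the R-part of LΛ. -/
theorem hasL_Phi₄ (hξ : ξ ∈ goodPts N h d) (hp : φ.pt ξ ∈ openDomain N R)
    (ω : Fin N → ℝ) (k : ℂ) :
    MHasL (chi φ δ ξ) ξ (fun t η => Phi₄ F k (φ + t • δ) η) (Phi₄ F k φ ξ)
      (mdOm ω (fun η => J * Gam φ δ η) ξ + Om k * Gam φ δ ξ + (Om k * Gam φ δ ξ)ᵀ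
        + (∑ i, ∑ j, pd j (fun η => lam φ δ η i) ξ • coefU F φ i j ξ)
        + (∑ i, mu φ δ ξ i • coefE F φ i ξ) + (∑ i, lam φ δ ξ i • coefK F φ i ξ)
        + ((∑ i, Phi₃ F ω φ ξ i • mpd i (fun η => J * Gam φ δ η) ξ)
          + Phi₄ F k φ ξ * Gam φ δ ξ + (Phi₄ F k φ ξ * Gam φ δ ξ)ᵀ)) := by
  have hY := hS.hasL_hess hξ hp (G := fun i j => dY i (dY j F))
    fun i j => differentiableOn_dY (differentiableOn_dY hF j) i
  have hZY := hS.hasL_hess hξ hp (G := fun i j => dZ i (dY j F))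
    fun i j => differentiableOn_dZ (differentiableOn_dY hF j) i
  have hZ := hS.hasL_hess hξ hp (G := fun i j => dZ i (dZ j F))
    fun i j => differentiableOn_dZ (differentiableOn_dZ hF j) i
  have hL := hS.hasL_chi_Lam hξ
  have hW := hS.hasL_chi_W hξ.1
  have hZYL := (hW.transpose.mul hZY).mul hL
  refine ((((((MHasL.sum Finset.univ fun i _ => MHasL.smul
    (hS.hasL_comp_pt hξ ((differentiableOn_dY hF i).differentiableAt
      (isOpen_openDomain.mem_nhds hp))) (hS.hasL_chi_R hξ i)).add
    ((hL.transpose.mul hY).mul hL)).add hZYL).add hZYL.transpose).add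
    ((hW.transpose.mul hZ).mul hW)).sub (MHasL.const (Om k))).of_eq rfl ?_
  have hc := cubic_mulVec F φ (mu φ δ ξ) (lam φ δ ξ) ξ
  set η := φ.V ξ *ᵥ mu φ δ ξ + φ.Lam ξ *ᵥ lam φ δ ξ
  set ζ := φ.W ξ *ᵥ lam φ δ ξ
  have eY : (Matrix.of fun i j => dY i (dY j F) (φ.pt ξ)) = hessYY F (φ.pt ξ) := rfl
  have eZY : (Matrix.of fun i j => dZ i (dY j F) (φ.pt ξ)) = hessZY F (φ.pt ξ) := rfl
  have eZ : (Matrix.of fun i j => dZ i (dZ j F) (φ.pt ξ)) = hessZZ F (φ.pt ξ) := rfl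
  simp only [eY, eZY, eZ]
  have sY := (hessYY_isSymm hF hp).eq
  have sZ := (hessZZ_isSymm hF hp).eq
  set A := hessYY F (φ.pt ξ)
  set B := hessZY F (φ.pt ξ)
  set C := hessZZ F (φ.pt ξ)
  set P := jac (fun η => J *ᵥ lam φ δ η) ξ with hP
  set G := Gam φ δ ξ
  set L := φ.Lam ξ with hLdef
  set W := φ.W ξ
  set Q := ∑ l, lam φ δ ξ l • Rcol φ l ξ with hQ
  -- The derivative (Jλ)' meets WᵀH_zy + ΛᵀH_yy through V, and this product with V is T.
  have hU : (∑ i, ∑ j, pd j (fun η => lam φ δ η i) ξ • coefU F φ i j ξ)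
      = T F φ ξ * Pᵀ + (T F φ ξ * Pᵀ)ᵀ := by
    have h1 : T F φ ξ * Pᵀ = ∑ i, ∑ j, pd j (fun η => lam φ δ η i) ξ •
        (Matrix.of fun p q => T F φ ξ p j * J q i) := by
      ext p q
      rw [hP, hS.jac_J_mulVec_lam hξ]
      simp only [Matrix.mul_apply, Matrix.transpose_apply, Matrix.sum_apply, Matrix.smul_apply,
        Matrix.of_apply, smul_eq_mul, jac, Finset.mul_sum]
      rw [Finset.sum_comm]
      exact Finset.sum_congr rfl fun i _ => Finset.sum_congr rfl fun j _ => by ring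
    rw [h1]
    simp only [coefU, smul_add, Finset.sum_add_distrib, Matrix.transpose_sum, Matrix.transpose_smul]
  have hK : (∑ i, lam φ δ ξ i • coefK F φ i ξ)
      = (∑ l, lam φ δ ξ l • cubic F φ (fun a => φ.Lam ξ a l) (fun c => φ.W ξ c l) ξ)
        + ((Wᵀ * B + Lᵀ * A) * Q + ((Wᵀ * B + Lᵀ * A) * Q)ᵀ) := by
    simp only [coefK, smul_add, Finset.sum_add_distrib, hQ, Matrix.mul_sum, Matrix.transpose_sum,
      Matrix.mul_smul, Matrix.transpose_smul]
    rfl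
  -- The coefficient of ∂_j(JΓ) coming from LR_i is the j-th component of Vᵀ∇_yH = ω + Φ₃.
  have hG3 : mdOm ω (fun η => J * Gam φ δ η) ξ
      + (∑ i, Phi₃ F ω φ ξ i • mpd i (fun η => J * Gam φ δ η) ξ)
      = ∑ i, dY i F (φ.pt ξ) • ∑ j, φ.V ξ i j • mpd j (fun η => J * Gam φ δ η) ξ := by
    have h1 : mdOm ω (fun η => J * Gam φ δ η) ξ
        = ∑ i, (ω i : ℂ) • mpd i (fun η => J * Gam φ δ η) ξ := by
      ext p q
      simp [mdOm, dOm, mpd, Matrix.sum_apply]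
    rw [h1, ← Finset.sum_add_distrib]
    simp only [← add_smul, Phi₃, Pi.sub_apply, add_sub_cancel, Matrix.mulVec, dotProduct,
      Matrix.transpose_apply, Finset.smul_sum, Finset.sum_smul, gradY, smul_smul]
    rw [Finset.sum_comm]
    simp only [mul_comm]
  have hR : ∑ i, dY i F (φ.pt ξ) • ((φ.R i ξ * G)ᵀ) = ((∑ i, dY i F (φ.pt ξ) • φ.R i ξ) * G)ᵀ := by
    simp only [Matrix.sum_mul, Matrix.transpose_sum, Matrix.smul_mul, Matrix.transpose_smul]
  have hR' : ∑ i, dY i F (φ.pt ξ) • (φ.R i ξ * G) = (∑ i, dY i F (φ.pt ξ) • φ.R i ξ) * G := by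
    simp only [Matrix.sum_mul, Matrix.smul_mul]
  have hcub : (∑ i, mu φ δ ξ i • coefE F φ i ξ) + (∑ l, lam φ δ ξ l •
      cubic F φ (fun a => φ.Lam ξ a l) (fun c => φ.W ξ c l) ξ) = cubic F φ η ζ ξ := hc.symm
  rw [hK, hU]
  -- Brings together the two ∂(JΓ) sums and the two third order sums, so that `hG3` and `hcub` can
  -- be applied.
  rw [show ∀ a b c u e k l f g h : Matrix (Fin 2) (Fin 2) ℂ, a + b + c + u + e + (k + l) + (f + g + h)
    = (a + f) + (e + k) + (b + c + u + l + g + h) from fun a b c u e k l f g h => by abel,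
    hG3, hcub]
  simp only [smul_add, Finset.sum_add_distrib, hR, hR', sub_zero]
  set RR := ∑ i, dY i F (φ.pt ξ) • φ.R i ξ
  have hT : T F φ ξ = Wᵀ * B * φ.V ξ + Lᵀ * A * φ.V ξ := rfl
  have hΦ : Phi₄ F k φ ξ = RR + Lᵀ * A * L + Wᵀ * B * L + (Wᵀ * B * L)ᵀ + Wᵀ * C * W - Om k := rfl
  rw [hT, hΦ]
  simp only [cubic]
  simp only [Matrix.transpose_add, Matrix.transpose_sub, Matrix.transpose_mul,
    Matrix.transpose_transpose, Matrix.mul_add, Matrix.add_mul, Matrix.sub_mul,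
    sY, sZ, Matrix.mul_assoc]
  abel

end Setting

/-! ### The potential of `μ - δβ` -/

/-- A single function viewed as a constant family, so that the algebra of `HF` also serves `MemA`.
-/
theorem MemA.toHF {h : ℝ} {d : ℕ} {f : (Fin N → ℂ) → ℂ} (hf : MemA h d f) :
    HF h d (fun (_ : Unit) _ => f) := by
  obtain ⟨C, hC, hfC⟩ := hf.normA_lt_top
  refine (HF.line hC (a := fun _ : Unit => f) (b := fun _ ξ => 0 * f ξ) (fun _ => hf)
    (fun _ => hf.const_mul 0) (fun _ => hfC) fun _ => ?_).congr fun _ t _ ξ _ => by ring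
  exact (normA_const_mul_le 0 hfC).trans (by simp)

/-- The function `ψ₀`, up to a constant. -/
def potential (φ δ : Coord N) (ξ : Fin N → ℂ) : ℂ :=
  (∑ a, φ.u ξ a * δ.β a) + (δ.φ₀ ξ - ∑ i, chi φ δ ξ i * pd i φ.φ₀ ξ)
    - φ.w ξ 1 * (δ.w ξ 0 - ∑ i, chi φ δ ξ i * pd i (fun η => φ.w η 0) ξ)

theorem memA_potential {h : ℝ} {d : ℕ} {φ δ : Coord N} (hφ : φ.Mem h (d + 1))
    (hδ : δ.Mem h (d + 1)) (hV : ∀ a b, MemA h d (fun η => φ.V η a b)) :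
    MemA h d (potential φ δ) := by
  have hχ : ∀ i, HF h d (fun (_ : Unit) _ ξ => chi φ δ ξ i) := fun i =>
    HF.sum Finset.univ fun a _ => (hV a i).toHF.mul (hδ.u a).toHF.pred
  exact (((HF.sum Finset.univ fun a _ => (hφ.u a).toHF.pred.mul (HF.const (δ.β a))).add
    (hδ.φ₀.toHF.pred.sub (HF.sum Finset.univ fun i _ => (hχ i).mul (hφ.φ₀.pd i).toHF))).sub
    ((hφ.w 1).toHF.pred.mul ((hδ.w 0).toHF.pred.sub (HF.sum Finset.univ fun i _ =>
      (hχ i).mul ((hφ.w 0).pd i).toHF)))).memA () 0 zero_mem_unit_ball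

namespace Setting
variable {h : ℝ} {d : ℕ} {φ δ : Coord N} (hS : Setting h d φ δ) {ξ : Fin N → ℂ}
include hS

theorem transpose_mul_V (hξ : ξ ∈ strip N h) : (1 + jac φ.u ξ)ᵀ * φ.V ξ = 1 := by
  rw [Coord.V, ← Matrix.transpose_mul,
    Matrix.nonsing_inv_mul _ (isUnit_iff_ne_zero.2 (hS.det ξ hξ)), Matrix.transpose_one]

/-- L is applied to v = β + V(∇φ₀ - w₂∇w₁) and the result multiplied by (I + u')ᵀ, which inverts V.
The χ' terms of LV and of the commutators cancel, and so do the terms with (Lw₂)∇w₁. What remains is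
the gradient of u·δβ + Lφ₀ - w₂ Lw₁. -/
theorem grad_potential (hξ : ξ ∈ goodPts N h d) :
    grad (potential φ δ) ξ = mu φ δ ξ - δ.β := by
  set χ := chi φ δ
  set ℓ₀ : (Fin N → ℂ) → ℂ := fun η => δ.φ₀ η - ∑ i, χ η i * pd i φ.φ₀ η with hℓ₀
  have hχ := fun i k => hS.dirDiff_chi hξ i k
  have hβ : ∀ a, HasL (χ ξ) ξ (fun t _ => (φ + t • δ).β a) (φ.β a) (δ.β a) := fun a => by
    have h1 : HasDerivAt (fun s : ℝ => φ.β a + (s : ℂ) * δ.β a) (δ.β a) 0 := by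
      simpa using ((Complex.ofRealCLM.hasDerivAt (x := (0 : ℝ))).mul_const (δ.β a)).const_add (φ.β a)
    refine (HasL.of_hasDerivAt (c := χ ξ) (Q := fun t _ => (φ + t • δ).β a) (ξ := ξ) h1
      fun i => dirDiff_const _ _ _).of_eq ?_ ?_
    · rw [Coord.add_zero_smul]
    · simp only [pd_const, mul_zero, Finset.sum_const_zero, sub_zero]
  have hφ₀ : ∀ k, HasL (χ ξ) ξ (fun t => pd k (φ + t • δ).φ₀) (pd k φ.φ₀ ξ)
      (pd k ℓ₀ ξ + ∑ i, pd i φ.φ₀ ξ * jac χ ξ i k) := fun k => by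
    refine ((hS.jC2_φ₀ hξ).hasL_pd_of_hasL hξ.1 (fun η hη => hS.hasL_φ₀ hη (χ η))
      fun i => hχ i k).of_eq ?_ ?_
    · rw [Coord.add_zero_smul]
    · rw [Coord.add_zero_smul]; rfl
  set y := φ.W ξ *ᵥ lam φ δ ξ
  set Y := jac (fun η => φ.W η *ᵥ lam φ δ η) ξ with hY
  have hg : ∀ k, HasL (χ ξ) ξ (fun t η => (φ + t • δ).g η k) (φ.g ξ k)
      ((fun k => pd k ℓ₀ ξ - y 1 * jac φ.w ξ 0 k - φ.w ξ 1 * Y 0 k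
        + ((jac χ ξ)ᵀ *ᵥ φ.g ξ) k) k) := fun k => by
    refine ((hφ₀ k).sub ((hS.hasL_chi_w hξ.1 1).mul (hS.hasL_jac_w hξ 0 k))).of_eq rfl ?_
    simp only [Matrix.mulVec, dotProduct, Matrix.transpose_apply, Coord.g, Pi.sub_apply,
      Pi.smul_apply, smul_eq_mul, mul_sub, Finset.sum_sub_distrib, Matrix.add_apply, grad,
      Matrix.mul_apply, mul_add, Finset.mul_sum]
    have e1 : ∑ i, pd i φ.φ₀ ξ * jac χ ξ i k = ∑ i, jac χ ξ i k * pd i φ.φ₀ ξ :=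
      Finset.sum_congr rfl fun i _ => mul_comm _ _
    have e2 : ∑ i, φ.w ξ 1 * (jac φ.w ξ 0 i * jac χ ξ i k)
        = ∑ i, jac χ ξ i k * (φ.w ξ 1 * pd i (fun η => φ.w η 0) ξ) :=
      Finset.sum_congr rfl fun i _ => by
        rw [show jac φ.w ξ 0 i = pd i (fun η => φ.w η 0) ξ from rfl]; ring
    rw [e1, e2, hY, show y 1 = ∑ q, φ.W ξ 1 q * lam φ δ ξ q from rfl]
    ring
  have hv : φ.V ξ *ᵥ mu φ δ ξ + φ.Lam ξ *ᵥ lam φ δ ξ = δ.β + (-(φ.V ξ * (jac χ ξ)ᵀ) *ᵥ φ.g ξ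
      + φ.V ξ *ᵥ fun k => pd k ℓ₀ ξ - y 1 * jac φ.w ξ 0 k - φ.w ξ 1 * Y 0 k
        + ((jac χ ξ)ᵀ *ᵥ φ.g ξ) k) :=
    funext fun a => (hS.hasL_chi_v hξ a).unique ((hβ a).add ((hS.hasL_chi_V hξ).mulVec hg a))
  have hA := hS.transpose_mul_V hξ.1
  have h2 := congrArg (fun x => (1 + jac φ.u ξ)ᵀ *ᵥ x) hv
  simp only [Matrix.mulVec_add, Matrix.mulVec_mulVec, Coord.Lam, Matrix.mul_neg,
    ← Matrix.mul_assoc, hA, Matrix.one_mul, Matrix.one_mulVec] at h2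
  -- Written out, Λλ contributes -(Lw₂)∇w₁ + (Lw₁)∇w₂ after multiplication by (I + u')ᵀ. The first
  -- term matches one on the other side, the second completes the gradient of w₂ Lw₁.
  have hJ : (-((jac φ.w ξ)ᵀ * J * φ.W ξ)) *ᵥ lam φ δ ξ
      = fun k => -(jac φ.w ξ 0 k * y 1) + jac φ.w ξ 1 k * y 0 := by
    ext k
    rw [Matrix.neg_mulVec, ← Matrix.mulVec_mulVec, ← Matrix.mulVec_mulVec]
    simp [Matrix.mulVec, dotProduct, Fin.sum_univ_two, J, y]
    ring
  rw [hJ] at h2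
  ext k
  have h3 := congrFun h2 k
  simp only [Pi.add_apply, Matrix.neg_mulVec, Pi.neg_apply] at h3
  have e1 : ((1 + jac φ.u ξ)ᵀ *ᵥ δ.β) k = δ.β k + ∑ a, pd k (fun η => φ.u η a) ξ * δ.β a := by
    rw [Matrix.transpose_add, Matrix.transpose_one, Matrix.add_mulVec, Matrix.one_mulVec]
    rfl
  have du := fun a => (hS.mem.u a).dirDiff hS.hd hξ.1 k
  have dw := fun a => (hS.mem.w a).dirDiff hS.hd hξ.1 k
  have dℓ : DirDiff k ℓ₀ ξ := (hS.memδ.φ₀.dirDiff hS.hd hξ.1 k).sub (DirDiff.sum fun i _ =>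
    (hχ i k).mul (hS.mem.φ₀.dirDiff_pd hξ i k))
  have dy : DirDiff k (fun η => (φ.W η *ᵥ lam φ δ η) 0) ξ := DirDiff.sum (s := Finset.univ)
    fun q _ => (hS.dirDiff_W hξ.1 0 q k).mul (hS.dirDiff_lam hξ q k)
  have ds : DirDiff k (fun η => ∑ a, φ.u η a * δ.β a) ξ :=
    DirDiff.sum fun a _ => (du a).mul (dirDiff_const _ _ _)
  have e2 : grad (potential φ δ) ξ k = (∑ a, pd k (fun η => φ.u η a) ξ * δ.β a) + pd k ℓ₀ ξ
      - (jac φ.w ξ 1 k * y 0 + φ.w ξ 1 * Y 0 k) := by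
    have e3 : grad (potential φ δ) ξ k = pd k (fun η => (∑ a, φ.u η a * δ.β a) + ℓ₀ η
        - φ.w η 1 * (φ.W η *ᵥ lam φ δ η) 0) ξ :=
      pd_congr (fun η hη => by rw [hS.W_mulVec_lam hη]; rfl) hξ.1 k
    rw [e3, pd_sub (ds.add dℓ) ((dw 1).mul dy), pd_add ds dℓ, pd_mul (dw 1) dy,
      pd_sum fun a _ => (du a).mul (dirDiff_const _ _ _)]
    simp only [fun a => pd_mul (du a) (dirDiff_const (δ.β a) k ξ), pd_const, mul_zero, add_zero]
    rfl
  rw [e2, Pi.sub_apply]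
  rw [e1] at h3
  linear_combination -h3

end Setting

/-! ### Mean values -/

/-- Divergence theorem on the cube: the contributions of opposite faces cancel by periodicity. -/
theorem integral_fderiv_eq_zero_of_periodic {G : (Fin N → ℝ) → ℂ} (hG : ContDiff ℝ 1 G)
    (hper : ∀ x j, G (x + Pi.single j (2 * Real.pi)) = G x) (i : Fin N) :
    ∫ x in Set.Icc (0 : Fin N → ℝ) (fun _ => 2 * Real.pi), fderiv ℝ G x (Pi.single i 1) = 0 := by
  obtain ⟨n, rfl⟩ : ∃ n, N = n + 1 := ⟨N - 1, by have := i.pos; omega⟩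
  have hle : (0 : Fin (n + 1) → ℝ) ≤ fun _ => 2 * Real.pi := fun _ => Real.two_pi_pos.le
  have hc : Continuous fun x => fderiv ℝ G x (Pi.single i 1) :=
    (hG.continuous_fderiv (by norm_num)).clm_apply continuous_const
  -- The vector field has `G` as its i-th component and zero elsewhere, so its divergence is the
  -- partial derivative in question.
  have key := integral_divergence_of_hasFDerivAt_off_countable' (0 : Fin (n + 1) → ℝ)
    (fun _ => 2 * Real.pi) hle (fun k x => if k = i then G x else 0)
    (fun k x => if k = i then fderiv ℝ G x else 0) ∅ Set.countable_empty
    (fun k => by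
      by_cases hk : k = i
      · simpa [hk] using hG.continuous.continuousOn
      · simpa [hk] using continuousOn_const)
    (fun x _ k => by
      by_cases hk : k = i
      · simpa [hk] using (hG.differentiable (by norm_num) x).hasFDerivAt
      · simpa [hk] using hasFDerivAt_const (0 : ℂ) x)
    (by
      have : (fun x => ∑ k, (if k = i then fderiv ℝ G x else 0) (Pi.single k 1))
          = fun x => fderiv ℝ G x (Pi.single i 1) := by
        ext x
        rw [Finset.sum_eq_single i (fun k _ hk => by simp [hk]) (by simp)]
        simp
      rw [this]
      exact hc.continuousOn.integrableOn_Icc)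
  have h1 : ∀ x, ∑ k, (if k = i then fderiv ℝ G x else 0) (Pi.single k 1)
      = fderiv ℝ G x (Pi.single i 1) := fun x => by
    rw [Finset.sum_eq_single i (fun k _ hk => by simp [hk]) (by simp)]
    simp
  simp only [h1] at key
  rw [key]
  refine Finset.sum_eq_zero fun k _ => ?_
  by_cases hk : k = i
  · simp only [hk, if_true, sub_eq_zero]
    refine integral_congr_ae (Eventually.of_forall fun x => ?_)
    have h2 : Fin.insertNth (α := fun _ => ℝ) i (2 * Real.pi) x
        = Fin.insertNth (α := fun _ => ℝ) i 0 x + Pi.single i (2 * Real.pi) := by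
      ext j
      refine Fin.succAboveCases i ?_ (fun j => ?_) j
      · simp
      · simp
    simp only [Pi.zero_apply]
    rw [h2, hper]
  · simp [hk]

theorem ofReal_mem_strip {h : ℝ} (hh : 0 ≤ h) (x : Fin N → ℝ) : (fun j => (x j : ℂ)) ∈ strip N h :=
  fun j => by simpa using hh

theorem slice_zero (x : Fin N → ℝ) : slice 0 x = fun j => (x j : ℂ) := by
  ext j; simp [slice]

/-- If d = 0, differentiability on the real torus comes from holomorphy, since the torus lies in the
open strip as soon as h > 0. -/
theorem mean_pd_add {h : ℝ} (hh : 0 ≤ h) {d : ℕ} {ψ : (Fin N → ℂ) → ℂ} (hψ : MemA h d ψ)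
    (hd : 1 ≤ d ∨ 0 < h) (i : Fin N) (c : ℂ) : mean (fun ξ => pd i ψ ξ + c) = c := by
  have hG : ContDiff ℝ 1 (fun x : Fin N → ℝ => ψ (slice 0 x)) := by
    rcases hd with hd | hd
    · exact (hψ.contDiff 0 fun j => by simpa using hh).of_le (by exact_mod_cast hd)
    · refine contDiff_iff_contDiffAt.2 fun x => ?_
      have ho : slice 0 x ∈ openStrip N h := fun j => by simpa [slice] using hd
      have h1 : ContDiffAt ℂ 1 ψ (slice 0 x) :=
        (contDiffOn_of_differentiableOn isOpen_openStrip 1 hψ.holomorphic).contDiffAt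
          (isOpen_openStrip.mem_nhds ho)
      exact (h1.restrict_scalars ℝ).comp x ((contDiff_slice _ 1).contDiffAt)
  have h0 := integral_fderiv_eq_zero_of_periodic hG (fun x j => by
    have h3 := hψ.periodic (slice 0 x) (slice_mem_strip (fun j => by simpa using hh) x) j
    rw [← slice_add_single]
    push_cast
    exact h3) i
  have hc : Continuous fun x => fderiv ℝ (fun x : Fin N → ℝ => ψ (slice 0 x)) x (Pi.single i 1) :=
    (hG.continuous_fderiv (by norm_num)).clm_apply continuous_const
  have h1 : volume.real (Set.Icc (0 : Fin N → ℝ) (fun _ => 2 * Real.pi)) = (2 * Real.pi) ^ N := by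
    rw [Measure.real, Real.volume_Icc_pi_toReal
      (show (0 : Fin N → ℝ) ≤ fun _ => 2 * Real.pi from fun _ => Real.two_pi_pos.le)]
    simp
  have h2 : ∀ x : Fin N → ℝ, pd i ψ (fun j => (x j : ℂ))
      = fderiv ℝ (fun x : Fin N → ℝ => ψ (slice 0 x)) x (Pi.single i 1) := fun x => by
    rw [← slice_zero, pd_slice (hG.differentiable (by norm_num) x)]
  unfold mean
  simp only [h2]
  rw [integral_add hc.continuousOn.integrableOn_Icc
    (by exact integrableOn_const measure_Icc_lt_top.ne (by simp)), h0, zero_add, setIntegral_const,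
    h1, Complex.real_smul, ← mul_assoc, ← Complex.ofReal_mul, inv_mul_cancel₀ (by positivity)]
  simp

theorem mean_congr {f g : (Fin N → ℂ) → ℂ} (hfg : ∀ x : Fin N → ℝ,
    f (fun j => (x j : ℂ)) = g (fun j => (x j : ℂ))) : mean f = mean g := by
  simp only [mean, hfg]

theorem Setting.mean_mu {h : ℝ} {d : ℕ} {φ δ : Coord N} (hS : Setting h (d + 1) φ δ) (hh : 0 ≤ h)
    (hV : ∀ a b, MemA h d (fun η => φ.V η a b)) (hd : 1 ≤ d ∨ 0 < h) (i : Fin N) :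
    mean (fun ξ => mu φ δ ξ i) = δ.β i := by
  rw [← mean_pd_add hh (memA_potential hS.mem hS.memδ hV) hd i (δ.β i)]
  refine mean_congr fun x => ?_
  have hx : (fun j => (x j : ℂ)) ∈ goodPts N h (d + 1) :=
    ⟨ofReal_mem_strip hh x, hd.imp (fun h => by omega) fun h j => by simpa using h⟩
  have h1 := congrFun (hS.grad_potential hx) i
  rw [Pi.sub_apply] at h1
  exact (eq_add_of_sub_eq h1.symm)

/-! ### The mean value of `w₁` -/

theorem integrableOn_torus {h : ℝ} (hh : 0 ≤ h) {d : ℕ} {f : (Fin N → ℂ) → ℂ} (hf : MemA h d f) :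
    IntegrableOn (fun x : Fin N → ℝ => f (fun j => (x j : ℂ)))
      (Set.Icc (0 : Fin N → ℝ) (fun _ => 2 * Real.pi)) := by
  have h1 : Continuous fun x : Fin N → ℝ => f (fun j => (x j : ℂ)) :=
    hf.base.cont.comp_continuous (by fun_prop) (ofReal_mem_strip hh)
  exact h1.continuousOn.integrableOn_Icc

/-- Φ₅ is affine in the coordinates with linear part the mean of δw₁, and the definition of λ
rewrites δw₁ as (Wλ)₁ + χ_i ∂_i w₁. -/
theorem Setting.hasDerivAt_Phi₅ {h : ℝ} {d : ℕ} {φ δ : Coord N} (hS : Setting h d φ δ) (hh : 0 ≤ h)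
    (α : ℂ) : HasDerivAt (fun t : ℂ => Phi₅ α (φ + t • δ))
      (mean (fun ξ => (φ.W ξ *ᵥ lam φ δ ξ) 0
        + ∑ i, chi φ δ ξ i * pd i (fun η => φ.w η 0) ξ)) 0 := by
  have h1 : mean (fun ξ => (φ.W ξ *ᵥ lam φ δ ξ) 0
      + ∑ i, chi φ δ ξ i * pd i (fun η => φ.w η 0) ξ) = mean (fun ξ => δ.w ξ 0) :=
    mean_congr fun x => by rw [hS.W_mulVec_lam (ofReal_mem_strip hh x)]; ring
  have h2 : (fun t : ℂ => Phi₅ α (φ + t • δ))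
      = fun t => mean (fun ξ => φ.w ξ 0) + t * mean (fun ξ => δ.w ξ 0) - α := by
    ext t
    have h3 : Phi₅ α (φ + t • δ) = mean (fun ξ => φ.w ξ 0 + t * δ.w ξ 0) - α := rfl
    rw [h3]
    unfold mean
    rw [integral_add (integrableOn_torus hh (hS.mem.w 0))
      ((integrableOn_torus hh (hS.memδ.w 0)).const_mul t), integral_const_mul]
    ring
  rw [h1, h2]
  simpa using (((hasDerivAt_id (0 : ℂ)).mul_const (mean (fun ξ => δ.w ξ 0))).const_add
    (mean (fun ξ => φ.w ξ 0))).sub_const α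

/-! ### The remainders at solutions -/

section Remainders
variable {h : ℝ} {P₁ : (Fin N → ℂ) → ℂ} {P₂ : (Fin N → ℂ) → Fin 2 → ℂ}
  {P₃ : (Fin N → ℂ) → Fin N → ℂ} {P₄ : (Fin N → ℂ) → Matrix (Fin 2) (Fin 2) ℂ}
  {ξ : Fin N → ℂ} (hξ : ξ ∈ strip N h)
include hξ

theorem pd_eq_zero {f : (Fin N → ℂ) → ℂ} (hf : ∀ η ∈ strip N h, f η = 0) (i : Fin N) :
    pd i f ξ = 0 := by
  rw [pd_congr (g := fun _ => 0) hf hξ i, pd_const]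

theorem Pi₁_eq_zero (h₁ : ∀ η ∈ strip N h, P₁ η = 0) (h₂ : ∀ η ∈ strip N h, P₂ η = 0)
    (h₃ : ∀ η ∈ strip N h, P₃ η = 0) (χ μ : (Fin N → ℂ) → Fin N → ℂ)
    (l : (Fin N → ℂ) → Fin 2 → ℂ) : Pi₁ P₁ P₂ P₃ χ μ l ξ = 0 := by
  simp [Pi₁, pd_eq_zero hξ h₁, h₂ ξ hξ, h₃ ξ hξ]

theorem Pi₂_eq_zero (h₂ : ∀ η ∈ strip N h, P₂ η = 0) (h₃ : ∀ η ∈ strip N h, P₃ η = 0)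
    (h₄ : ∀ η ∈ strip N h, P₄ η = 0) (χ : (Fin N → ℂ) → Fin N → ℂ) (l : (Fin N → ℂ) → Fin 2 → ℂ)
    (Γ : (Fin N → ℂ) → Matrix (Fin 2) (Fin 2) ℂ) : Pi₂ P₂ P₃ P₄ χ l Γ ξ = 0 := by
  have h5 : ∀ i, vpd i P₂ ξ = 0 := fun i => funext fun p =>
    pd_eq_zero hξ (fun η hη => by rw [h₂ η hη]; rfl) i
  simp [Pi₂, h5, h₂ ξ hξ, h₃ ξ hξ, h₄ ξ hξ]

theorem Pi₃_eq_zero (h₃ : ∀ η ∈ strip N h, P₃ η = 0) (χ : (Fin N → ℂ) → Fin N → ℂ) :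
    Pi₃ P₃ χ ξ = 0 := by
  have h5 : ∀ i, vpd i P₃ ξ = 0 := fun i => funext fun p =>
    pd_eq_zero hξ (fun η hη => by rw [h₃ η hη]; rfl) i
  simp [Pi₃, h5, h₃ ξ hξ]

theorem Pi₄_eq_zero (h₃ : ∀ η ∈ strip N h, P₃ η = 0) (h₄ : ∀ η ∈ strip N h, P₄ η = 0)
    (χ : (Fin N → ℂ) → Fin N → ℂ) (Γ : (Fin N → ℂ) → Matrix (Fin 2) (Fin 2) ℂ) :
    Pi₄ P₃ P₄ χ Γ ξ = 0 := by
  have h5 : ∀ i, mpd i P₄ ξ = 0 := fun i => by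
    ext p q
    exact pd_eq_zero (f := fun η => P₄ η p q) hξ (fun η hη => by rw [h₄ η hη]; rfl) i
  simp [Pi₄, h5, h₃ ξ hξ, h₄ ξ hξ]

end Remainders

/-! ### Derivatives of the modified Hamiltonian -/

section ModHam
variable {H : Phase N → ℂ} {R : ℝ} {m M : ℂ} {p : Phase N}

theorem dY_congr {f g : Phase N → ℂ} (hfg : Set.EqOn f g (openDomain N R))
    (hp : p ∈ openDomain N R) (j : Fin N) : dY j f p = dY j g p := by
  unfold dY
  rw [(hfg.eventuallyEq_of_mem (isOpen_openDomain.mem_nhds hp)).fderiv_eq]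

theorem dZ_congr {f g : Phase N → ℂ} (hfg : Set.EqOn f g (openDomain N R))
    (hp : p ∈ openDomain N R) (j : Fin 2) : dZ j f p = dZ j g p := by
  unfold dZ
  rw [(hfg.eventuallyEq_of_mem (isOpen_openDomain.mem_nhds hp)).fderiv_eq]

theorem hasFDerivAt_z (p : Phase N) : HasFDerivAt (fun p : Phase N => p.2.2 0)
    (((ContinuousLinearMap.proj (R := ℂ) (φ := fun _ : Fin 2 => ℂ) 0).comp
      (ContinuousLinearMap.snd ℂ _ _)).comp (ContinuousLinearMap.snd ℂ (Fin N → ℂ) _)) p :=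
  ((((ContinuousLinearMap.proj (R := ℂ) (φ := fun _ : Fin 2 => ℂ) 0).comp
      (ContinuousLinearMap.snd ℂ (Fin N → ℂ) _)).comp
        (ContinuousLinearMap.snd ℂ (Fin N → ℂ) _))).hasFDerivAt

theorem dY_add_linear {G : Phase N → ℂ} (hG : DifferentiableAt ℂ G p) (a b : ℂ) (j : Fin N) :
    dY j (fun q => G q + (a + b * q.2.2 0)) p = dY j G p := by
  have := hG.hasFDerivAt.fun_add (((hasFDerivAt_z p).const_mul b).const_add a)
  simp [dY, this.fderiv]

theorem dZ_add_linear {G : Phase N → ℂ} (hG : DifferentiableAt ℂ G p) (a b : ℂ) (j : Fin 2) :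
    dZ j (fun q => G q + (a + b * q.2.2 0)) p = dZ j G p + if j = 0 then b else 0 := by
  have := hG.hasFDerivAt.fun_add (((hasFDerivAt_z p).const_mul b).const_add a)
  simp [dZ, this.fderiv, Pi.single_apply, eq_comm]

variable (hH : DifferentiableOn ℂ H (openDomain N R))
include hH

theorem hasFDerivAt_modHam (hp : p ∈ openDomain N R) (m M : ℂ) :
    HasFDerivAt (modHam H m M) (fderiv ℂ H p + (m + M * p.2.2 0) •
      (((ContinuousLinearMap.proj (R := ℂ) (φ := fun _ : Fin 2 => ℂ) 0).comp
      (ContinuousLinearMap.snd ℂ _ _)).comp (ContinuousLinearMap.snd ℂ (Fin N → ℂ) _))) p := by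
  have h1 := (((hH.differentiableAt (isOpen_openDomain.mem_nhds hp)).hasFDerivAt.add
    ((hasFDerivAt_z p).const_mul m)).add (((hasFDerivAt_z p).pow 2).const_mul (M / 2)))
  refine h1.congr_fderiv ?_
  ext v <;> simp
  ring

theorem differentiableOn_modHam (m M : ℂ) :
    DifferentiableOn ℂ (modHam H m M) (openDomain N R) := fun _ hp =>
  (hasFDerivAt_modHam hH hp m M).differentiableAt.differentiableWithinAt

theorem dY_modHam (m M : ℂ) (j : Fin N) :
    Set.EqOn (dY j (modHam H m M)) (dY j H) (openDomain N R) := fun p hp => by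
  simp [dY, (hasFDerivAt_modHam hH hp m M).fderiv]

theorem dZ_modHam (m M : ℂ) (j : Fin 2) :
    Set.EqOn (dZ j (modHam H m M)) (fun q => dZ j H q + ((if j = 0 then m else 0)
      + (if j = 0 then M else 0) * q.2.2 0)) (openDomain N R) := fun p hp => by
  simp only [dZ, (hasFDerivAt_modHam hH hp m M).fderiv]
  fin_cases j <;> simp

theorem dYY_modHam (m M : ℂ) (i j : Fin N) :
    Set.EqOn (dY i (dY j (modHam H m M))) (dY i (dY j H)) (openDomain N R) := fun _ hp =>
  dY_congr (dY_modHam hH m M j) hp i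

theorem dZY_modHam (m M : ℂ) (i : Fin 2) (j : Fin N) :
    Set.EqOn (dZ i (dY j (modHam H m M))) (dZ i (dY j H)) (openDomain N R) := fun _ hp =>
  dZ_congr (dY_modHam hH m M j) hp i

theorem dZZ_modHam (m M : ℂ) (i j : Fin 2) :
    Set.EqOn (dZ i (dZ j (modHam H m M)))
      (fun q => dZ i (dZ j H) q + ((if i = 0 then if j = 0 then M else 0 else 0) + 0 * q.2.2 0))
      (openDomain N R) := fun p hp => by
  rw [dZ_congr (dZ_modHam hH m M j) hp i, dZ_add_linear
    ((differentiableOn_dZ hH j).differentiableAt (isOpen_openDomain.mem_nhds hp))]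
  simp

theorem gradY_modHam (hp : p ∈ openDomain N R) : gradY (modHam H m M) p = gradY H p :=
  funext fun j => dY_modHam hH m M j hp

theorem hessYY_modHam (hp : p ∈ openDomain N R) : hessYY (modHam H m M) p = hessYY H p := by
  ext i j; exact dYY_modHam hH m M i j hp

theorem hessZY_modHam (hp : p ∈ openDomain N R) : hessZY (modHam H m M) p = hessZY H p := by
  ext i j; exact dZY_modHam hH m M i j hp

theorem S_modHam {φ : Coord N} {ξ : Fin N → ℂ} (hp : φ.pt ξ ∈ openDomain N R) :
    S (modHam H m M) φ ξ = S H φ ξ := by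
  simp only [S, hessYY_modHam hH hp]

theorem T_modHam {φ : Coord N} {ξ : Fin N → ℂ} (hp : φ.pt ξ ∈ openDomain N R) :
    T (modHam H m M) φ ξ = T H φ ξ := by
  simp only [T, hessYY_modHam hH hp, hessZY_modHam hH hp]

/-- The added polynomial is quadratic in z₁ alone: it has no y-derivatives, and its second
z-derivative is constant, hence invisible to one more differentiation. The coefficients E and K are
therefore independent of m and M. -/
theorem cubic_modHam {φ : Coord N} {ξ : Fin N → ℂ} (hp : φ.pt ξ ∈ openDomain N R)
    (η : Fin N → ℂ) (ζ : Fin 2 → ℂ) :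
    cubic (modHam H m M) φ η ζ ξ = cubic H φ η ζ ξ := by
  have e : ∀ {f g : Phase N → ℂ}, Set.EqOn f g (openDomain N R) →
      dirD f (φ.pt ξ) η ζ = dirD g (φ.pt ξ) η ζ := fun hfg => by
    simp only [dirD, dY_congr hfg hp, dZ_congr hfg hp]
  have e1 : ∀ i j, dirD (dZ i (dZ j (modHam H m M))) (φ.pt ξ) η ζ
      = dirD (dZ i (dZ j H)) (φ.pt ξ) η ζ := fun i j => by
    have hd := (differentiableOn_dZ (differentiableOn_dZ hH j) i).differentiableAt
      (isOpen_openDomain.mem_nhds hp)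
    rw [e (dZZ_modHam hH m M i j)]
    simp only [dirD, dY_add_linear hd, dZ_add_linear hd, ite_self, add_zero]
  simp only [cubic, e (dY_modHam hH m M _), e (dYY_modHam hH m M _ _), e (dZY_modHam hH m M _ _), e1]

theorem coefU_modHam {φ : Coord N} {ξ : Fin N → ℂ} (hp : φ.pt ξ ∈ openDomain N R) (i : Fin 2)
    (j : Fin N) : coefU (modHam H m M) φ i j ξ = coefU H φ i j ξ := by
  simp only [coefU, T_modHam hH hp]

theorem coefE_modHam {φ : Coord N} {ξ : Fin N → ℂ} (hp : φ.pt ξ ∈ openDomain N R) (j : Fin N) :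
    coefE (modHam H m M) φ j ξ = coefE H φ j ξ := cubic_modHam hH hp _ _

theorem coefK_modHam {φ : Coord N} {ξ : Fin N → ℂ} (hp : φ.pt ξ ∈ openDomain N R) (l : Fin 2) :
    coefK (modHam H m M) φ l ξ = coefK H φ l ξ := by
  simp only [coefK, cubic_modHam hH hp, hessYY_modHam hH hp, hessZY_modHam hH hp]

end ModHam

/-! ### Symmetry of the coefficients -/

section Symmetry
variable {H : Phase N → ℂ} {R : ℝ}

theorem coefU_isSymm (H : Phase N → ℂ) (φ : Coord N) (i : Fin 2) (j : Fin N) (ξ : Fin N → ℂ) :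
    (coefU H φ i j ξ).IsSymm := by
  rw [coefU, Matrix.IsSymm, Matrix.transpose_add, Matrix.transpose_transpose, add_comm]

/-- Mixed second derivatives of H commute on an open set, so their directional derivatives are
symmetric as well; the R_i are symmetric because det W = 1. -/
theorem cubic_isSymm (hH : DifferentiableOn ℂ H (openDomain N R)) {φ : Coord N} {ξ : Fin N → ℂ}
    (hp : φ.pt ξ ∈ openDomain N R) (hR : ∀ i, (φ.R i ξ).IsSymm) (η : Fin N → ℂ) (ζ : Fin 2 → ℂ) :
    (cubic H φ η ζ ξ).IsSymm := by
  have e : ∀ {f g : Phase N → ℂ}, Set.EqOn f g (openDomain N R) →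
      dirD f (φ.pt ξ) η ζ = dirD g (φ.pt ξ) η ζ := fun hfg => by
    simp only [dirD, dY_congr hfg hp, dZ_congr hfg hp]
  have hY : (Matrix.of fun i j => dirD (dY i (dY j H)) (φ.pt ξ) η ζ)ᵀ
      = Matrix.of fun i j => dirD (dY i (dY j H)) (φ.pt ξ) η ζ := by
    ext i j
    exact e fun q hq => fderiv_fderiv_comm hH hq _ _
  have hZ : (Matrix.of fun i j => dirD (dZ i (dZ j H)) (φ.pt ξ) η ζ)ᵀ
      = Matrix.of fun i j => dirD (dZ i (dZ j H)) (φ.pt ξ) η ζ := by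
    ext i j
    exact e fun q hq => fderiv_fderiv_comm hH hq _ _
  unfold Matrix.IsSymm cubic
  simp only [Matrix.transpose_add, Matrix.transpose_sum, Matrix.transpose_smul, (hR _).eq,
    Matrix.transpose_mul, Matrix.transpose_transpose, hY, hZ, Matrix.mul_assoc]
  abel

theorem coefK_isSymm (hH : DifferentiableOn ℂ H (openDomain N R)) {φ : Coord N} {ξ : Fin N → ℂ}
    (hp : φ.pt ξ ∈ openDomain N R) (hR : ∀ i, (φ.R i ξ).IsSymm) (l : Fin 2) :
    (coefK H φ l ξ).IsSymm := by
  unfold coefK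
  refine (cubic_isSymm hH hp hR _ _).add ?_
  rw [Matrix.IsSymm, Matrix.transpose_add, Matrix.transpose_transpose, add_comm]

end Symmetry

/-! ### The operator along families -/

theorem MHF.mulVec {I : Type*} {h : ℝ} {d : ℕ} {ι κ : Type*} [Fintype κ]
    {A : I → ℂ → (Fin N → ℂ) → Matrix ι κ ℂ} {f : I → ℂ → (Fin N → ℂ) → κ → ℂ}
    (hA : MHF h d A) (hf : ∀ k, HF h d (fun i t ξ => f i t ξ k)) (p : ι) :
    HF h d (fun i t ξ => (A i t ξ *ᵥ f i t ξ) p) :=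
  HF.sum Finset.univ fun k _ => (hA p k).mul (hf k)

namespace CoordFam
variable {I : Type*} {ρ h : ℝ} {d : ℕ} {Φ : I → ℂ → Coord N} {F : I → Phase N → ℂ}

theorem mem_openDomain (hΦ : CoordFam ρ h d Φ) (i : I) {t : ℂ} (ht : t ∈ Metric.ball (0 : ℂ) 1)
    {ξ : Fin N → ℂ} (hξ : ξ ∈ strip N h) : (Φ i t).pt ξ ∈ openDomain N (3 * ρ) := by
  obtain ⟨R, hR, hdom⟩ := hΦ.dom
  exact phaseDomain_subset_openDomain hR (hdom i t ht ξ hξ)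

/-- The terms m z₁ + M z₁²/2 are not uniformly bounded over all α, hence the separate requirement
that w₁ be bounded along the family. It is met when the family is a single line. -/
theorem Phi₁ (hΦ : CoordFam ρ h d Φ) (hF : Nice ρ F)
    (hw : HF h d (fun i t ξ => (Φ i t).w ξ 0)) (m M e : ℂ) :
    HF h d (fun i t ξ => Phi₁ (modHam (F i) m M) e (Φ i t) ξ) := by
  refine (((hΦ.pt.comp hF).add ((HF.const m).mul hw)).add
    ((HF.const (M / 2)).mul (hw.mul hw))).sub (HF.const e) |>.congr fun i t _ ξ _ => ?_
  simp [LowerTori.Phi₁, modHam, Coord.pt, pow_two]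

theorem gradY (hΦ : CoordFam ρ h d Φ) (hF : Nice ρ F) (m M : ℂ) (a : Fin N) :
    HF h d (fun i t ξ => gradY (modHam (F i) m M) ((Φ i t).pt ξ) a) :=
  (hΦ.pt.comp (hF.dY a)).congr fun i _ ht _ hξ => by
    rw [gradY_modHam (hF.hol i) (hΦ.mem_openDomain i ht hξ)]; rfl

theorem gradZ (hΦ : CoordFam ρ h d Φ) (hF : Nice ρ F)
    (hw : HF h d (fun i t ξ => (Φ i t).w ξ 0)) (m M : ℂ) (a : Fin 2) :
    HF h d (fun i t ξ => gradZ (modHam (F i) m M) ((Φ i t).pt ξ) a) :=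
  ((hΦ.pt.comp (hF.dZ a)).add ((HF.const (if a = 0 then m else 0)).add
    ((HF.const (if a = 0 then M else 0)).mul hw))).congr fun i _ ht _ hξ =>
      (dZ_modHam (hF.hol i) m M a (hΦ.mem_openDomain i ht hξ)).symm

theorem Phi₂ (hΦ : CoordFam ρ h d Φ) (hF : Nice ρ F)
    (hw : HF h d (fun i t ξ => (Φ i t).w ξ 0)) (m M : ℂ) (p : Fin 2) :
    HF h d (fun i t ξ => Phi₂ (modHam (F i) m M) (Φ i t) ξ p) :=
  (hΦ.Lam.transpose.mulVec (hΦ.gradY hF m M) p).add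
    (hΦ.W.transpose.mulVec (hΦ.gradZ hF hw m M) p)

theorem Phi₃ (hΦ : CoordFam ρ h d Φ) (hF : Nice ρ F) (m M : ℂ) (ω : Fin N → ℝ) (p : Fin N) :
    HF h d (fun i t ξ => Phi₃ (modHam (F i) m M) ω (Φ i t) ξ p) :=
  (hΦ.V.transpose.mulVec (hΦ.gradY hF m M) p).sub (HF.const (ω p : ℂ))

theorem Phi₄ (hΦ : CoordFam ρ h d Φ) (hF : Nice ρ F) (m M k : ℂ) :
    MHF h d (fun i t ξ => Phi₄ (modHam (F i) m M) k (Φ i t) ξ) := by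
  have hY : MHF h d (fun i t ξ => LowerTori.hessYY (modHam (F i) m M) ((Φ i t).pt ξ)) := fun p q =>
    (hΦ.hessYY hF p q).congr fun i _ ht _ hξ =>
      (dYY_modHam (hF.hol i) m M p q (hΦ.mem_openDomain i ht hξ)).symm
  have hZY : MHF h d (fun i t ξ => LowerTori.hessZY (modHam (F i) m M) ((Φ i t).pt ξ)) :=
    fun p q => (hΦ.hessZY hF p q).congr fun i _ ht _ hξ =>
      (dZY_modHam (hF.hol i) m M p q (hΦ.mem_openDomain i ht hξ)).symm
  have hZ : MHF h d (fun i t ξ => hessZZ (modHam (F i) m M) ((Φ i t).pt ξ)) := fun p q =>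
    ((hΦ.pt.comp ((hF.dZ q).dZ p)).add ((HF.const (if p = 0 then if q = 0 then M else 0 else 0)).add
      (HF.const 0))).congr fun i _ ht _ hξ => by
        refine Eq.trans ?_ (dZZ_modHam (hF.hol i) m M p q (hΦ.mem_openDomain i ht hξ)).symm
        simp
  have h1 := (hΦ.W.transpose.mul hZY).mul hΦ.Lam
  have h2 := (((((MHF.sum Finset.univ fun a _ => MHF.smul (hΦ.gradY hF m M a) (hΦ.R a)).add
    ((hΦ.Lam.transpose.mul hY).mul hΦ.Lam)).add h1).add h1.transpose).add
    ((hΦ.W.transpose.mul hZ).mul hΦ.W)).add (MHF.const (-Om k))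
  intro p q
  refine (h2 p q).congr fun i t _ ξ _ => ?_
  change _ = LowerTori.Phi₄ (modHam (F i) m M) k (Φ i t) ξ p q
  rw [LowerTori.Phi₄, sub_eq_add_neg]
  rfl

end CoordFam

theorem HF.line_unit {h : ℝ} {d : ℕ} {f g : (Fin N → ℂ) → ℂ} (hf : MemA h d f) (hg : MemA h d g) :
    HF h d (fun (_ : Unit) t ξ => f ξ + t * g ξ) := by
  obtain ⟨C, hC, hfC⟩ := hf.normA_lt_top
  obtain ⟨C', hC', hgC⟩ := hg.normA_lt_top
  exact HF.line (le_max_of_le_left hC : 0 ≤ max C C') (fun _ => hf) (fun _ => hg)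
    (fun _ => hfC.trans (ENNReal.ofReal_le_ofReal (le_max_left _ _)))
    fun _ => hgC.trans (ENNReal.ofReal_le_ofReal (le_max_right _ _))

theorem Coord.smul_smul (s t : ℂ) (δ : Coord N) : t • (s • δ) = (s * t) • δ := by
  change Coord.mk (t • (s • δ.β)) (t • (s • δ.φ₀)) (t • (s • δ.u))
    (t • (s • δ.w)) (t • (s • δ.W₁₁)) (t • (s • δ.W₁₂)) (t • (s • δ.W₂₁))
    = Coord.mk ((s * t) • δ.β) ((s * t) • δ.φ₀) ((s * t) • δ.u)
    ((s * t) • δ.w) ((s * t) • δ.W₁₁) ((s * t) • δ.W₁₂) ((s * t) • δ.W₂₁)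
  simp only [_root_.smul_smul, mul_comm t s]

/-- The Gateaux differential of an operator which is holomorphic along a line. -/
theorem exists_isGateaux_of_line {h : ℝ} {d : ℕ} {P : Coord N → (Fin N → ℂ) → ℂ} {φ δ : Coord N}
    {s : ℂ} (hs : s ≠ 0) (hP : HF h d (fun (_ : Unit) t ξ => P (φ + t • (s • δ)) ξ)) :
    ∃ D, IsGateaux h d P φ δ D ∧
      ∀ ξ ∈ strip N h, HasDerivAt (fun t : ℂ => P (φ + t • δ) ξ) (D ξ) 0 :=
  exists_isGateaux hs hP (fun t _ ξ _ => by rw [Coord.smul_smul])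
    fun ξ _ => by rw [Coord.add_zero_smul]

/-- Restricting the complex derivative in t to real t identifies it with the variation used in
`HasL`, by uniqueness of derivatives. -/
theorem HasL.eq_of_hasDerivAt {P : Coord N → (Fin N → ℂ) → ℂ} {φ δ : Coord N} {c ξ : Fin N → ℂ}
    {q ℓ D : ℂ} (hL : HasL c ξ (fun t => P (φ + t • δ)) q ℓ)
    (hD : HasDerivAt (fun t : ℂ => P (φ + t • δ) ξ) D 0) : D = ℓ + ∑ i, c i * pd i (P φ) ξ := by
  have h1 := hL.deriv_eq
  rw [Coord.add_zero_smul] at h1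
  rw [← Complex.ofReal_zero] at hD
  have h2 : HasDerivAt (fun s : ℝ => P (φ + (s : ℂ) • δ) ξ) D 0 := hD.comp_ofReal
  exact h2.unique h1

/-! ### Comparison with the unperturbed Hamiltonian -/

theorem normA_add_le {h : ℝ} {d : ℕ} : ∀ {f g : (Fin N → ℂ) → ℂ} {a b : ℝ≥0∞}, MemA h d f →
    MemA h d g → normA h d f ≤ a → normA h d g ≤ b → normA h d (fun ξ => f ξ + g ξ) ≤ a + b := by
  induction d with
  | zero =>
    intro f g a b _ _ hfa hgb
    exact normA_zero_le_iff.2 fun ξ hξ => (enorm_add_le _ _).trans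
      (add_le_add (normA_zero_le_iff.1 hfa ξ hξ) (normA_zero_le_iff.1 hgb ξ hξ))
  | succ d ih =>
    intro f g a b hf hg hfa hgb
    obtain ⟨h1, h2⟩ := normA_succ_le_iff.1 hfa
    obtain ⟨h3, h4⟩ := normA_succ_le_iff.1 hgb
    refine normA_succ_le_iff.2 ⟨fun ξ hξ => (enorm_add_le _ _).trans
      (add_le_add (h1 ξ hξ) (h3 ξ hξ)), fun j => ?_⟩
    refine (normA_congr fun ξ hξ => ?_).trans_le (ih (hf.pd j) (hg.pd j) (h2 j) (h4 j))
    exact pd_add (hf.dirDiff (by omega) hξ j) (hg.dirDiff (by omega) hξ j)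

section Unperturbed
variable {G : Phase N → ℂ} {c : Phase N}

theorem dY_add_period (hG : ∀ q, G (q + c) = G q) (j : Fin N) (q : Phase N) :
    dY j G (q + c) = dY j G q := by
  unfold dY
  rw [← fderiv_comp_add_right c]
  simp only [hG]

theorem dZ_add_period (hG : ∀ q, G (q + c) = G q) (j : Fin 2) (q : Phase N) :
    dZ j G (q + c) = dZ j G q := by
  unfold dZ
  rw [← fderiv_comp_add_right c]
  simp only [hG]

end Unperturbed

theorem base_jac_u (α : ℂ) (ξ : Fin N → ℂ) : jac (Coord.base N α).u ξ = 0 := by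
  ext i j; exact pd_const (0 : ℂ) j ξ

theorem base_V (α : ℂ) (ξ : Fin N → ℂ) : (Coord.base N α).V ξ = 1 := by
  rw [Coord.V, base_jac_u]; simp

theorem base_W (α : ℂ) (ξ : Fin N → ℂ) : (Coord.base N α).W ξ = 1 := by
  ext i j
  fin_cases i <;> fin_cases j <;> simp [Coord.W, Coord.base]

theorem base_Lam (α : ℂ) (ξ : Fin N → ℂ) : (Coord.base N α).Lam ξ = 0 := by
  have : jac (Coord.base N α).w ξ = 0 := by
    ext i j; exact pd_const ((![α, 0] : Fin 2 → ℂ) i) j ξ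
  simp [Coord.Lam, this]

theorem base_pt (α : ℂ) (ξ : Fin N → ℂ) :
    (Coord.base N α).pt ξ = 0 + ((ξ, 0, ![α, 0]) : Phase N) := by
  have h1 : (Coord.base N α).v ξ = 0 := by
    have h2 : (Coord.base N α).g ξ = 0 := by
      ext k
      have h3 : (Coord.base N α).g ξ k = pd k (fun _ => (0 : ℂ)) ξ - 0 * pd k (fun _ => α) ξ := rfl
      rw [h3, pd_const]; simp
    rw [Coord.v, h2, Matrix.mulVec_zero, add_zero]; rfl
  rw [Coord.pt, h1, zero_add]
  simp [Coord.base]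

/-- The base torus consists of points differing from 0 only by a translation in x and z₁, which H₀
does not see. Hence S and T at a base point are the constants S₀ and T₀. -/
theorem lift₀_add_period (H₀ : (Fin N → ℂ) × ℂ → ℂ) (α : ℂ) (ξ : Fin N → ℂ) (q : Phase N) :
    lift₀ H₀ (q + ((ξ, 0, ![α, 0]) : Phase N)) = lift₀ H₀ q := by
  simp [lift₀]

theorem S_base (H₀ : (Fin N → ℂ) × ℂ → ℂ) (α : ℂ) (ξ : Fin N → ℂ) :
    S (lift₀ H₀) (Coord.base N α) ξ = S₀ H₀ := by
  rw [S, base_V, base_pt, S₀]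
  simp only [Matrix.transpose_one, Matrix.one_mul, Matrix.mul_one]
  ext i j
  exact dY_add_period (dY_add_period (lift₀_add_period H₀ α ξ) j) i 0

theorem T_base (H₀ : (Fin N → ℂ) × ℂ → ℂ) (α : ℂ) (ξ : Fin N → ℂ) :
    T (lift₀ H₀) (Coord.base N α) ξ = T₀ H₀ := by
  rw [T, base_V, base_pt, base_W, base_Lam, T₀]
  simp only [Matrix.transpose_one, Matrix.one_mul, Matrix.mul_one, Matrix.transpose_zero,
    Matrix.zero_mul, add_zero]
  ext i j
  exact dZ_add_period (dY_add_period (lift₀_add_period H₀ α ξ) j) i 0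

/-! ### Affine dependence of S and T on ε -/

section Linear
variable {ρ : ℝ} {H₀ : (Fin N → ℂ) × ℂ → ℂ} {H₁ : Phase N → ℂ} (hH : AnalyticHamiltonian ρ H₀ H₁)
  {p : Phase N} (hp : p ∈ openDomain N (3 * ρ))
include hH hp

theorem fderiv_fderiv_ham (ε : ℝ) (e e' : Phase N) :
    fderiv ℂ (fun q => fderiv ℂ (ham H₀ H₁ ε) q e) p e'
      = fderiv ℂ (fun q => fderiv ℂ (lift₀ H₀) q e) p e'
        + ε * fderiv ℂ (fun q => fderiv ℂ H₁ q e) p e' := by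
  have d0 := (hH.nice_lift (I := Unit)).hol ()
  have d1 := (hH.nice_pert (I := Unit)).hol ()
  have h1 : (fun q => fderiv ℂ (ham H₀ H₁ ε) q e) =ᶠ[𝓝 p]
      fun q => fderiv ℂ (lift₀ H₀) q e + ε * fderiv ℂ H₁ q e := by
    filter_upwards [isOpen_openDomain.mem_nhds hp] with q hq
    have e0 := (d0.differentiableAt (isOpen_openDomain.mem_nhds hq)).hasFDerivAt
    have e1 := (d1.differentiableAt (isOpen_openDomain.mem_nhds hq)).hasFDerivAt
    have : HasFDerivAt (ham H₀ H₁ ε) _ q := e0.fun_add (e1.const_mul (ε : ℂ))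
    rw [this.fderiv]
    simp
  have e0 := ((differentiableOn_fderiv_apply isOpen_openDomain d0 e).differentiableAt
    (isOpen_openDomain.mem_nhds hp)).hasFDerivAt
  have e1 := ((differentiableOn_fderiv_apply isOpen_openDomain d1 e).differentiableAt
    (isOpen_openDomain.mem_nhds hp)).hasFDerivAt
  rw [h1.fderiv_eq, (e0.fun_add (e1.const_mul (ε : ℂ))).fderiv]
  simp

theorem hessYY_ham (ε : ℝ) :
    hessYY (ham H₀ H₁ ε) p = hessYY (lift₀ H₀) p + (ε : ℂ) • hessYY H₁ p := by
  ext i j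
  exact fderiv_fderiv_ham hH hp ε _ _

theorem hessZY_ham (ε : ℝ) :
    hessZY (ham H₀ H₁ ε) p = hessZY (lift₀ H₀) p + (ε : ℂ) • hessZY H₁ p := by
  ext i j
  exact fderiv_fderiv_ham hH hp ε _ _

omit hp

theorem S_ham {φ : Coord N} {ξ : Fin N → ℂ} (hp : φ.pt ξ ∈ openDomain N (3 * ρ)) (ε : ℝ) :
    S (ham H₀ H₁ ε) φ ξ = S (lift₀ H₀) φ ξ + (ε : ℂ) • S H₁ φ ξ := by
  simp only [S, hessYY_ham hH hp, Matrix.mul_add, Matrix.add_mul, Matrix.mul_smul, Matrix.smul_mul]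

theorem T_ham {φ : Coord N} {ξ : Fin N → ℂ} (hp : φ.pt ξ ∈ openDomain N (3 * ρ)) (ε : ℝ) :
    T (ham H₀ H₁ ε) φ ξ = T (lift₀ H₀) φ ξ + (ε : ℂ) • T H₁ φ ξ := by
  simp only [T, hessYY_ham hH hp, hessZY_ham hH hp, Matrix.mul_add, Matrix.add_mul, Matrix.mul_smul,
    Matrix.smul_mul, smul_add]
  abel

end Linear

/-! ### Uniform bounds -/

theorem memA_const {h : ℝ} {d : ℕ} (c : ℂ) : MemA (N := N) h d (fun _ => c) :=
  (HF.const (I := Unit) c).memA () 0 zero_mem_unit_ball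

theorem MemA.sub {h : ℝ} {d : ℕ} {f g : (Fin N → ℂ) → ℂ} (hf : MemA h d f) (hg : MemA h d g) :
    MemA h d (fun ξ => f ξ - g ξ) :=
  (hf.toHF.sub hg.toHF).memA () 0 zero_mem_unit_ball

theorem Coord.base_mem (h : ℝ) (d : ℕ) (α : ℂ) : (Coord.base N α).Mem h d :=
  ⟨memA_const 0, fun _ => memA_const 0, fun i => memA_const ((![α, 0] : Fin 2 → ℂ) i), memA_const 1,
    memA_const 0, memA_const 0⟩

theorem Coord.Mem.sub {h : ℝ} {d : ℕ} {φ ψ : Coord N} (hφ : φ.Mem h d) (hψ : ψ.Mem h d) :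
    (φ - ψ).Mem h d :=
  ⟨hφ.φ₀.sub hψ.φ₀, fun i => (hφ.u i).sub (hψ.u i), fun i => (hφ.w i).sub (hψ.w i),
    hφ.W₁₁.sub hψ.W₁₁, hφ.W₁₂.sub hψ.W₁₂, hφ.W₂₁.sub hψ.W₂₁⟩

theorem Coord.sub_self_eq (φ : Coord N) : φ - φ = (0 : ℂ) • φ := by
  change Coord.mk (φ.β - φ.β) (φ.φ₀ - φ.φ₀) (φ.u - φ.u) (φ.w - φ.w) (φ.W₁₁ - φ.W₁₁)
    (φ.W₁₂ - φ.W₁₂) (φ.W₂₁ - φ.W₂₁) = Coord.mk _ _ _ _ _ _ _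
  simp only [zero_smul, sub_self]

theorem Coord.add_smul_sub (φ ψ : Coord N) {t : ℂ} (ht : t ≠ 0) :
    ψ + t • (t⁻¹ • (φ - ψ)) = φ := by
  rw [Coord.smul_smul, inv_mul_cancel₀ ht]
  change Coord.mk (ψ.β + (1 : ℂ) • (φ.β - ψ.β)) (ψ.φ₀ + (1 : ℂ) • (φ.φ₀ - ψ.φ₀))
    (ψ.u + (1 : ℂ) • (φ.u - ψ.u)) (ψ.w + (1 : ℂ) • (φ.w - ψ.w))
    (ψ.W₁₁ + (1 : ℂ) • (φ.W₁₁ - ψ.W₁₁)) (ψ.W₁₂ + (1 : ℂ) • (φ.W₁₂ - ψ.W₁₂))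
    (ψ.W₂₁ + (1 : ℂ) • (φ.W₂₁ - ψ.W₂₁)) = φ
  simp only [one_smul, add_sub_cancel]

theorem Coord.Mem.zero_smul_bd {h : ℝ} {d : ℕ} {φ : Coord N} (hφ : φ.Mem h d) {r : ℝ} (hr : 0 ≤ r) :
    ((0 : ℂ) • φ).Bd h d r := by
  obtain ⟨C, hC, hφC⟩ := hφ.exists_bd
  exact (hφC.smul 0).mono (by simpa using hr)

/-- The coordinate vectors at distance at most `r` from a base point. -/
abbrev Near (N : ℕ) (ρ h : ℝ) (d : ℕ) (r : ℝ) : Type :=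
  {x : ℂ × Coord N // |x.1.im| ≤ ρ ∧ x.2.Mem h d ∧ (x.2 - Coord.base N x.1).Bd h d r}

/-- The directions of norm at most `r` at the base points. -/
abbrev Directions (N : ℕ) (ρ h : ℝ) (d : ℕ) (r : ℝ) : Type :=
  {x : ℂ × Coord N // |x.1.im| ≤ ρ ∧ x.2.Mem h d ∧ x.2.Bd h d r}

section Bounds
variable {ρ h : ℝ} {d : ℕ} {r s : ℝ} (hρ : 0 < ρ) (hr : 0 ≤ r) (hrs : 2 * r = s) (hh : h ≤ ρ)
  (hs : IsRadius N ρ s)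
include hρ hr hrs hh hs

/-- With all points near the base points as indices and a family constant in t, a bound uniform in
the index is a bound on the whole neighbourhood. -/
theorem coordFam_near : CoordFam ρ h d (fun (i : ℝ × Near N ρ h (d + 1) r) _ => i.2.1.2) := by
  have h1 := coordFam_line (I := ℝ × Near N ρ h (d + 1) r) (δ := fun i => (0 : ℂ) • i.2.1.2)
    hρ hr hrs hh hs (fun i => i.2.2.1) (fun i => i.2.2.2.1) (fun i => i.2.2.2.1.smul 0)
    (fun i => i.2.2.2.2) fun i => i.2.2.2.1.zero_smul_bd hr
  simpa only [Coord.smul_smul, zero_mul, Coord.add_zero_smul] using h1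

theorem coordFam_base : CoordFam ρ h d
    (fun (i : Directions N ρ h (d + 1) r) t => Coord.base N i.1.1 + t • i.1.2) :=
  coordFam_line hρ hr hrs hh hs (fun i => i.2.1) (fun i => Coord.base_mem _ _ _)
    (fun i => i.2.2.1) (fun i => by
      rw [Coord.sub_self_eq]
      exact (Coord.base_mem h (d + 1) i.1.1).zero_smul_bd hr) fun i => i.2.2.2

/-- A matrix depending linearly on the Hamiltonian is close to its value for `H₀` at the base
points. -/
theorem exists_matNorm_ham_sub_le {H₀ : (Fin N → ℂ) × ℂ → ℂ} {H₁ : Phase N → ℂ}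
    (hH : AnalyticHamiltonian ρ H₀ H₁) {ι κ : Type} [Finite ι] [Finite κ]
    (A : (Phase N → ℂ) → Coord N → (Fin N → ℂ) → Matrix ι κ ℂ) (A₀ : Matrix ι κ ℂ)
    (hA : ∀ {I : Type} {Φ : I → ℂ → Coord N} {F : I → Phase N → ℂ}, CoordFam ρ h d Φ → Nice ρ F →
      MHF h d (fun i t ξ => A (F i) (Φ i t) ξ))
    (hlin : ∀ (φ : Coord N) (ξ : Fin N → ℂ), φ.pt ξ ∈ openDomain N (3 * ρ) → ∀ ε : ℝ,
      A (ham H₀ H₁ ε) φ ξ = A (lift₀ H₀) φ ξ + (ε : ℂ) • A H₁ φ ξ)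
    (hbase : ∀ α ξ, A (lift₀ H₀) (Coord.base N α) ξ = A₀) :
    ∃ C : ℝ, 0 ≤ C ∧ ∀ (ε r' : ℝ), 0 < r' → r' < r → ∀ (α : ℂ) (φ : Coord N), |α.im| ≤ ρ →
      φ.Mem h (d + 1) → (φ - Coord.base N α).Bd h (d + 1) r' →
      matNorm h d (fun ξ => A (ham H₀ H₁ ε) φ ξ - A₀) ≤ ENNReal.ofReal (C * (|ε| + r')) := by
  have h1 := coordFam_near (d := d) hρ hr hrs hh hs
  have h2 := coordFam_base (d := d) hρ hr hrs hh hs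
  have hA1 := hA h1 hH.nice_pert
  have hA2 := hA h2 hH.nice_lift
  obtain ⟨C₁, hC₁, hb₁⟩ := hA1.matNorm_le
  obtain ⟨C₂, hC₂, hb₂⟩ := hA2.matNorm_sub_le
  refine ⟨C₁ + C₂ / r, by positivity, fun ε r' hr0 hr' α φ hα hφ hφr => ?_⟩
  have hrpos : 0 < r := hr0.trans hr'
  -- The real component of the index is irrelevant: the family is the same for every value.
  let i₁ : ℝ × Near N ρ h (d + 1) r := ⟨0, ⟨(α, φ), hα, hφ, hφr.mono hr'.le⟩⟩
  -- φ is reached at this parameter on the line from the base point in a direction of norm at most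
  -- `r`. The Schwarz estimate at t then yields the factor r'/r, and r' < r keeps t inside the open
  -- disc.
  set t : ℂ := ((r' / r : ℝ) : ℂ) with ht
  have ht0 : t ≠ 0 := by
    rw [ht]; exact_mod_cast (div_pos hr0 hrpos).ne'
  have htn : ‖t‖ = r' / r := by
    rw [ht, Complex.norm_real, Real.norm_of_nonneg (by positivity)]
  have htb : t ∈ Metric.ball (0 : ℂ) 1 := by
    rw [mem_ball_zero_iff, htn, div_lt_one hrpos]; exact hr'
  have hδ : (t⁻¹ • (φ - Coord.base N α)).Bd h (d + 1) r := by
    refine (hφr.smul t⁻¹).mono (le_of_eq ?_)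
    rw [norm_inv, htn]
    field_simp
  let i₂ : Directions N ρ h (d + 1) r := ⟨(α, t⁻¹ • (φ - Coord.base N α)), hα,
    (hφ.sub (Coord.base_mem _ _ _)).smul _, hδ⟩
  have e₂ : Coord.base N α + t • (t⁻¹ • (φ - Coord.base N α)) = φ := Coord.add_smul_sub _ _ ht0
  refine iSup_le fun p => iSup_le fun q => ?_
  have b₁ : normA h d (fun ξ => A H₁ φ ξ p q) ≤ ENNReal.ofReal C₁ :=
    (le_iSup₂ (f := fun p q => normA h d (fun ξ => A H₁ φ ξ p q)) p q).trans
      (hb₁ i₁ 0 zero_mem_unit_ball)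
  have b₂ : normA h d (fun ξ => A (lift₀ H₀) φ ξ p q - A₀ p q) ≤ ENNReal.ofReal (C₂ * (r' / r)) := by
    have h3 := hb₂ i₂ t htb
    rw [htn] at h3
    refine le_trans (le_of_eq ?_) ((le_iSup₂ (f := fun p q => normA h d (fun ξ =>
      (A (lift₀ H₀) (Coord.base N i₂.1.1 + t • i₂.1.2) ξ
        - A (lift₀ H₀) (Coord.base N i₂.1.1 + (0 : ℂ) • i₂.1.2) ξ) p q)) p q).trans h3)
    refine normA_congr fun ξ _ => ?_
    rw [Coord.add_zero_smul, hbase, Matrix.sub_apply]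
    simp only [i₂, e₂]
  have m₁ : MemA h d (fun ξ => A H₁ φ ξ p q) := hA1.memA i₁ zero_mem_unit_ball p q
  have m₂ : MemA h d (fun ξ => A (lift₀ H₀) φ ξ p q - A₀ p q) := by
    have h3 := (hA2.memA i₂ htb p q).sub_const (A₀ p q)
    simp only [i₂, e₂] at h3
    exact h3
  have hdom : ∀ ξ ∈ strip N h, φ.pt ξ ∈ openDomain N (3 * ρ) := fun ξ hξ =>
    h1.mem_openDomain i₁ zero_mem_unit_ball hξ
  refine (normA_congr fun ξ hξ => ?_).trans_le ((normA_add_le m₂ (m₁.const_mul (ε : ℂ)) b₂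
    (normA_const_mul_le (ε : ℂ) b₁)).trans ?_)
  · change A (ham H₀ H₁ ε) φ ξ p q - A₀ p q = _
    rw [hlin φ ξ (hdom ξ hξ)]
    simp only [Matrix.add_apply, Matrix.smul_apply, smul_eq_mul]
    ring
  · have e : ‖(ε : ℂ)‖ₑ = ENNReal.ofReal |ε| := by
      rw [← ofReal_norm, Complex.norm_real, Real.norm_eq_abs]
    rw [e, ← ENNReal.ofReal_mul (abs_nonneg ε), ← ENNReal.ofReal_add (by positivity) (by positivity)]
    refine ENNReal.ofReal_le_ofReal ?_
    have e1 : C₂ * (r' / r) = C₂ / r * r' := by ring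
    have e2 : 0 ≤ C₂ / r * |ε| := by positivity
    have e3 : 0 ≤ C₁ * r' := by positivity
    rw [e1]
    nlinarith

/-- Here ε must be part of the index, since the coefficients are formed with H₀ + εH₁ and the
constant may depend on ε₀ only. -/
theorem exists_coef_le {H₀ : (Fin N → ℂ) × ℂ → ℂ} {H₁ : Phase N → ℂ}
    (hH : AnalyticHamiltonian ρ H₀ H₁) {ε₀ : ℝ} :
    ∃ C : ℝ, 0 ≤ C ∧ ∀ ε : ℝ, |ε| ≤ ε₀ → ∀ (α : ℂ) (φ : Coord N), |α.im| ≤ ρ →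
      φ.Mem h (d + 1) → (φ - Coord.base N α).Bd h (d + 1) r →
      (⨆ i, ⨆ j, matNorm h d (coefU (ham H₀ H₁ ε) φ i j))
        + (⨆ j, matNorm h d (coefE (ham H₀ H₁ ε) φ j))
        + (⨆ i, matNorm h d (coefK (ham H₀ H₁ ε) φ i)) ≤ ENNReal.ofReal C := by
  have h1 : CoordFam ρ h d (fun (i : {ε : ℝ // |ε| ≤ ε₀} × Near N ρ h (d + 1) r) _ => i.2.1.2) := by
    have h1 := coordFam_line (I := {ε : ℝ // |ε| ≤ ε₀} × Near N ρ h (d + 1) r)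
      (δ := fun i => (0 : ℂ) • i.2.1.2)
      hρ hr hrs hh hs (fun i => i.2.2.1) (fun i => i.2.2.2.1) (fun i => i.2.2.2.1.smul 0)
      (fun i => i.2.2.2.2) fun i => i.2.2.2.1.zero_smul_bd hr
    simpa only [Coord.smul_smul, zero_mul, Coord.add_zero_smul] using h1
  have hF : Nice ρ (fun i : {ε : ℝ // |ε| ≤ ε₀} × Near N ρ h (d + 1) r => ham H₀ H₁ i.1.1) :=
    hH.nice_ham (fun i : {ε : ℝ // |ε| ≤ ε₀} × Near N ρ h (d + 1) r => i.1.1) fun i => i.1.2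
  choose CU hCU hU using fun x : Fin 2 × Fin N => (h1.coefU hF x.1 x.2).matNorm_le
  choose CE hCE hE using fun x : Fin N => (h1.coefE hF x).matNorm_le
  choose CK hCK hK using fun x : Fin 2 => (h1.coefK hF x).matNorm_le
  obtain ⟨BU, hBU⟩ := Finite.exists_le CU
  obtain ⟨BE, hBE⟩ := Finite.exists_le CE
  obtain ⟨BK, hBK⟩ := Finite.exists_le CK
  refine ⟨max BU 0 + max BE 0 + max BK 0, by positivity, fun ε hε α φ hα hφ hφr => ?_⟩
  let i₁ : {ε : ℝ // |ε| ≤ ε₀} × Near N ρ h (d + 1) r := ⟨⟨ε, hε⟩, ⟨(α, φ), hα, hφ, hφr⟩⟩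
  rw [ENNReal.ofReal_add (by positivity) (by positivity),
    ENNReal.ofReal_add (by positivity) (by positivity)]
  refine add_le_add (add_le_add ?_ ?_) ?_
  · exact iSup_le fun a => iSup_le fun b => (hU (a, b) i₁ 0 zero_mem_unit_ball).trans
      (ENNReal.ofReal_le_ofReal ((hBU _).trans (le_max_left _ _)))
  · exact iSup_le fun a => (hE a i₁ 0 zero_mem_unit_ball).trans
      (ENNReal.ofReal_le_ofReal ((hBE _).trans (le_max_left _ _)))
  · exact iSup_le fun a => (hK a i₁ 0 zero_mem_unit_ball).trans
      (ENNReal.ofReal_le_ofReal ((hBK _).trans (le_max_left _ _)))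

end Bounds

/-! ### The Gateaux derivatives of the operator -/

section Derivatives
variable {ρ h : ℝ} {d : ℕ} {r s : ℝ} {H : Phase N → ℂ} {α : ℂ} {φ δ : Coord N}

/-- The line through `φ` in a sufficiently small multiple of the direction `δ` stays in the domain
of the operator. -/
theorem exists_line (hρ : 0 < ρ) (hr : 0 < r) (hrs : 2 * r = s) (hh : h ≤ ρ) (hs : IsRadius N ρ s)
    (hα : |α.im| ≤ ρ) (hφ : φ.Mem h (d + 1)) (hφr : (φ - Coord.base N α).Bd h (d + 1) r)
    (hδ : δ.Mem h (d + 1)) :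
    ∃ c : ℂ, c ≠ 0 ∧ CoordFam ρ h d (fun (_ : Unit) t => φ + t • (c • δ)) := by
  obtain ⟨C, hC, hδC⟩ := hδ.exists_bd
  have hC1 : 0 < C + 1 := by positivity
  -- Scaling by r/(C + 1) makes the norm of the direction at most `r`; the added 1 covers the case C
  -- = 0.
  refine ⟨((r / (C + 1) : ℝ) : ℂ), by exact_mod_cast (div_pos hr hC1).ne', ?_⟩
  refine coordFam_line (α := fun _ => α) hρ hr.le hrs hh hs (fun _ => hα) (fun _ => hφ)
    (fun _ => hδ.smul _) (fun _ => hφr) fun _ => (hδC.smul _).mono ?_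
  rw [Complex.norm_real, Real.norm_of_nonneg (div_pos hr hC1).le, div_mul_eq_mul_div,
    div_le_iff₀ hC1]
  nlinarith

/-- The derivatives of the operator exist, and pointwise they have the triangular form. -/
theorem exists_derivatives {c : ℂ} (hc : c ≠ 0)
    (hL : CoordFam ρ h d (fun (_ : Unit) t => φ + t • (c • δ)))
    (hF : Nice ρ (fun _ : Unit => H)) (hHd : DifferentiableOn ℂ H (openDomain N (3 * ρ)))
    (hpt : ∀ ξ ∈ strip N h, φ.pt ξ ∈ openDomain N (3 * ρ))
    (hS : Setting h (d + 1) φ δ) (ω : Fin N → ℝ) (k e m M : ℂ) :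
    ∃ (D₁ : (Fin N → ℂ) → ℂ) (D₂ : (Fin N → ℂ) → Fin 2 → ℂ)
      (D₃ : (Fin N → ℂ) → Fin N → ℂ) (D₄ : (Fin N → ℂ) → Matrix (Fin 2) (Fin 2) ℂ),
      IsGateaux h d (Phi₁ (modHam H m M) e) φ δ D₁ ∧
      (∀ p, IsGateaux h d (fun φ' ξ => Phi₂ (modHam H m M) φ' ξ p) φ δ (fun ξ => D₂ ξ p)) ∧
      (∀ i, IsGateaux h d (fun φ' ξ => Phi₃ (modHam H m M) ω φ' ξ i) φ δ (fun ξ => D₃ ξ i)) ∧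
      (∀ p q, IsGateaux h d (fun φ' ξ => Phi₄ (modHam H m M) k φ' ξ p q) φ δ
        (fun ξ => D₄ ξ p q)) ∧
      (∀ ψ₀ : (Fin N → ℂ) → ℂ,
        (∀ ξ ∈ goodPts N h (d + 1), grad ψ₀ ξ = mu φ δ ξ - δ.β) →
        ∀ ξ ∈ goodPts N h (d + 1),
          D₁ ξ = dOm ω ψ₀ ξ + (∑ i, (ω i : ℂ) * δ.β i)
            + Pi₁ (Phi₁ (modHam H m M) e φ) (Phi₂ (modHam H m M) φ) (Phi₃ (modHam H m M) ω φ)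
              (chi φ δ) (mu φ δ) (lam φ δ) ξ) ∧
      ∀ ξ ∈ goodPts N h (d + 1),
        D₂ ξ = J *ᵥ vdOm ω (lam φ δ) ξ + Om k *ᵥ lam φ δ ξ + T H φ ξ *ᵥ mu φ δ ξ
          + Pi₂ (Phi₂ (modHam H m M) φ) (Phi₃ (modHam H m M) ω φ) (Phi₄ (modHam H m M) k φ)
            (chi φ δ) (lam φ δ) (Gam φ δ) ξ ∧
        D₃ ξ = -vdOm ω (chi φ δ) ξ + S H φ ξ *ᵥ mu φ δ ξ + (T H φ ξ)ᵀ *ᵥ lam φ δ ξ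
          + Pi₃ (Phi₃ (modHam H m M) ω φ) (chi φ δ) ξ ∧
        D₄ ξ = mdOm ω (fun η => J * Gam φ δ η) ξ + Om k * Gam φ δ ξ + (Om k * Gam φ δ ξ)ᵀ
          + (∑ i, ∑ j, pd j (fun η => lam φ δ η i) ξ • coefU H φ i j ξ)
          + (∑ i, mu φ δ ξ i • coefE H φ i ξ) + (∑ i, lam φ δ ξ i • coefK H φ i ξ)
          + Pi₄ (Phi₃ (modHam H m M) ω φ) (Phi₄ (modHam H m M) k φ) (chi φ δ) (Gam φ δ) ξ := by
  have hFd := differentiableOn_modHam hHd m M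
  -- Along one fixed line w₁ is bounded, so the non-uniform terms m z₁ and M z₁²/2 do no harm. The
  -- existence of the derivatives needs no uniform constant.
  have hw : HF h d (fun (_ : Unit) t ξ => (φ + t • (c • δ)).w ξ 0) :=
    (HF.line_unit (hS.mem.w 0) ((hS.memδ.smul c).w 0)).pred
  obtain ⟨D₁, g₁, a₁⟩ := exists_isGateaux_of_line hc (hL.Phi₁ hF hw m M e)
  choose D₂ g₂ a₂ using fun p => exists_isGateaux_of_line
    (P := fun φ' ξ => Phi₂ (modHam H m M) φ' ξ p) hc (hL.Phi₂ hF hw m M p)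
  choose D₃ g₃ a₃ using fun i => exists_isGateaux_of_line
    (P := fun φ' ξ => Phi₃ (modHam H m M) ω φ' ξ i) hc (hL.Phi₃ hF m M ω i)
  choose D₄ g₄ a₄ using fun p q => exists_isGateaux_of_line
    (P := fun φ' ξ => Phi₄ (modHam H m M) k φ' ξ p q) hc (hL.Phi₄ hF m M k p q)
  refine ⟨D₁, fun ξ p => D₂ p ξ, fun ξ i => D₃ i ξ, fun ξ p q => D₄ p q ξ, g₁, g₂, g₃, g₄, ?_, ?_⟩
  · intro ψ₀ hψ ξ hξ
    have e1 := (hS.hasL_Phi₁ hFd hξ (hpt ξ hξ.1) e ω).eq_of_hasDerivAt (a₁ ξ hξ.1)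
    -- Only ∇ψ₀ enters, so ω·μ = ∂ψ₀ + ω·δβ for every admissible ψ₀.
    have e2 : dOm ω ψ₀ ξ + (∑ i, (ω i : ℂ) * δ.β i) = ∑ i, (ω i : ℂ) * mu φ δ ξ i := by
      rw [dOm, ← Finset.sum_add_distrib]
      refine Finset.sum_congr rfl fun i _ => ?_
      have h3 : pd i ψ₀ ξ = mu φ δ ξ i - δ.β i := congrFun (hψ ξ hξ) i
      rw [h3]
      ring
    rw [e1, e2, Pi₁]
    ring
  · intro ξ hξ
    refine ⟨funext fun a => ?_, funext fun a => ?_, ?_⟩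
    · refine ((hS.hasL_Phi₂ hFd hξ (hpt ξ hξ.1) ω k a).eq_of_hasDerivAt
        (P := fun φ' ξ => Phi₂ (modHam H m M) φ' ξ a) (a₂ a ξ hξ.1)).trans ?_
      simp only [T_modHam hHd (hpt ξ hξ.1), Pi₂, Pi.add_apply, Finset.sum_apply, Pi.smul_apply,
        smul_eq_mul, vpd]
      ring
    · refine ((hS.hasL_Phi₃ hFd hξ (hpt ξ hξ.1) ω a).eq_of_hasDerivAt
        (P := fun φ' ξ => Phi₃ (modHam H m M) ω φ' ξ a) (a₃ a ξ hξ.1)).trans ?_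
      simp only [T_modHam hHd (hpt ξ hξ.1), S_modHam hHd (hpt ξ hξ.1), Pi₃, Pi.add_apply,
        Pi.sub_apply, Finset.sum_apply, Pi.smul_apply, smul_eq_mul, vpd]
      ring
    · refine Matrix.ext fun p q => ?_
      refine ((hS.hasL_Phi₄ hFd hξ (hpt ξ hξ.1) ω k p q).eq_of_hasDerivAt
        (P := fun φ' ξ => Phi₄ (modHam H m M) k φ' ξ p q) (a₄ p q ξ hξ.1)).trans ?_
      have e3 : (∑ i, chi φ δ ξ i • mpd i (Phi₄ (modHam H m M) k φ) ξ) p q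
          = ∑ i, chi φ δ ξ i * pd i (fun η => Phi₄ (modHam H m M) k φ η p q) ξ := by
        simp only [Matrix.sum_apply, Matrix.smul_apply, smul_eq_mul, mpd, Matrix.of_apply]
      simp only [coefU_modHam hHd (hpt ξ hξ.1), coefE_modHam hHd (hpt ξ hξ.1),
        coefK_modHam hHd (hpt ξ hξ.1), Pi₄, Matrix.add_apply, e3]
      ring

end Derivatives

end LowerTori

end

/-! ### The structure theorem -/

theorem mainTheorem7 (N : ℕ) (ρ : ℝ) (hρ : 0 < ρ)
    (H₀ : (Fin N → ℂ) × ℂ → ℂ) (H₁ : Phase N → ℂ) (hH : AnalyticHamiltonian ρ H₀ H₁)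
    (σ : ℝ) (hσ₀ : 0 ≤ σ) (hσ₁ : σ ≤ 1) (d : ℕ) (hd : 1 ≤ d) :
    ∃ r₀ : ℝ, 0 < r₀ ∧ ∀ ε₀ : ℝ, 0 < ε₀ → ∃ c : ℝ, 0 < c ∧
    ∀ ε : ℝ, |ε| ≤ ε₀ → ∀ r : ℝ, 0 < r → r ≤ r₀ →
    ∀ α : ℂ, |α.im| ≤ ρ →
    ∀ φ : Coord N, φ.Mem (σ * ρ) d →
      (φ - Coord.base N α).norm (σ * ρ) d ≤ ENNReal.ofReal r →
      -- all objects are well defined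
      (∀ ξ ∈ strip N (σ * ρ), (1 + jac φ.u ξ).det ≠ 0 ∧ φ.W₁₁ ξ ≠ 0 ∧
        φ.pt ξ ∈ phaseDomain N (3 * ρ)) ∧
      -- the matrices `S` and `T`
      MatMemA (σ * ρ) (d - 1) (S (ham H₀ H₁ ε) φ) ∧
      MatMemA (σ * ρ) (d - 1) (T (ham H₀ H₁ ε) φ) ∧
      matNorm (σ * ρ) (d - 1) (fun ξ => S (ham H₀ H₁ ε) φ ξ - S₀ H₀)
        + matNorm (σ * ρ) (d - 1) (fun ξ => T (ham H₀ H₁ ε) φ ξ - T₀ H₀)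
        ≤ ENNReal.ofReal (c * (|ε| + r)) ∧
      -- the matrices `U_{ij}`, `E_i`, `K_i`
      ∃ (U : Fin 2 → Fin N → (Fin N → ℂ) → Matrix (Fin 2) (Fin 2) ℂ)
        (E : Fin N → (Fin N → ℂ) → Matrix (Fin 2) (Fin 2) ℂ)
        (K : Fin 2 → (Fin N → ℂ) → Matrix (Fin 2) (Fin 2) ℂ),
        (∀ i j, MatMemA (σ * ρ) (d - 1) (U i j)) ∧ (∀ i, MatMemA (σ * ρ) (d - 1) (E i)) ∧
        (∀ i, MatMemA (σ * ρ) (d - 1) (K i)) ∧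
        (∀ ξ ∈ strip N (σ * ρ), (∀ i j, (U i j ξ).IsSymm) ∧ (∀ i, (E i ξ).IsSymm) ∧
          ∀ i, (K i ξ).IsSymm) ∧
        (⨆ i, ⨆ j, matNorm (σ * ρ) (d - 1) (U i j)) + (⨆ i, matNorm (σ * ρ) (d - 1) (E i))
          + (⨆ i, matNorm (σ * ρ) (d - 1) (K i)) ≤ ENNReal.ofReal c ∧
        ∀ (ω : Fin N → ℝ) (k : ℂ), 0 ≤ k.re → k.re ≤ 1 → |k.im| ≤ ρ → ∀ e m M : ℂ,
          let F : Phase N → ℂ := modHam (ham H₀ H₁ ε) m M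
          ∀ δ : Coord N, δ.Mem (σ * ρ) d →
          -- the change of variables
          (∀ ξ ∈ goodPts N (σ * ρ) d, (Gam φ δ ξ).trace = 0) ∧
          ((2 ≤ d ∨ 0 < σ) → ∀ i, mean (fun ξ => mu φ δ ξ i) = δ.β i) ∧
          (∃ ψ₀ : (Fin N → ℂ) → ℂ, MemA (σ * ρ) (d - 1) ψ₀ ∧
            ∀ ξ ∈ goodPts N (σ * ρ) d, grad ψ₀ ξ = mu φ δ ξ - δ.β) ∧
          -- the derivatives of `Φ₁, …, Φ₄` in the new variables
          (∃ (D₁ : (Fin N → ℂ) → ℂ) (D₂ : (Fin N → ℂ) → Fin 2 → ℂ)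
            (D₃ : (Fin N → ℂ) → Fin N → ℂ) (D₄ : (Fin N → ℂ) → Matrix (Fin 2) (Fin 2) ℂ),
            IsGateaux (σ * ρ) (d - 1) (Phi₁ F e) φ δ D₁ ∧
            (∀ p, IsGateaux (σ * ρ) (d - 1) (fun φ' ξ => Phi₂ F φ' ξ p) φ δ
              (fun ξ => D₂ ξ p)) ∧
            (∀ i, IsGateaux (σ * ρ) (d - 1) (fun φ' ξ => Phi₃ F ω φ' ξ i) φ δ
              (fun ξ => D₃ ξ i)) ∧
            (∀ p q, IsGateaux (σ * ρ) (d - 1) (fun φ' ξ => Phi₄ F k φ' ξ p q) φ δ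
              (fun ξ => D₄ ξ p q)) ∧
            (∀ ψ₀ : (Fin N → ℂ) → ℂ,
              (∀ ξ ∈ goodPts N (σ * ρ) d, grad ψ₀ ξ = mu φ δ ξ - δ.β) →
              ∀ ξ ∈ goodPts N (σ * ρ) d,
                D₁ ξ = dOm ω ψ₀ ξ + (∑ i, (ω i : ℂ) * δ.β i)
                  + Pi₁ (Phi₁ F e φ) (Phi₂ F φ) (Phi₃ F ω φ) (chi φ δ) (mu φ δ) (lam φ δ) ξ) ∧
            ∀ ξ ∈ goodPts N (σ * ρ) d,
              D₂ ξ = J *ᵥ vdOm ω (lam φ δ) ξ + Om k *ᵥ lam φ δ ξ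
                + T (ham H₀ H₁ ε) φ ξ *ᵥ mu φ δ ξ
                + Pi₂ (Phi₂ F φ) (Phi₃ F ω φ) (Phi₄ F k φ) (chi φ δ) (lam φ δ) (Gam φ δ) ξ ∧
              D₃ ξ = -vdOm ω (chi φ δ) ξ + S (ham H₀ H₁ ε) φ ξ *ᵥ mu φ δ ξ
                + (T (ham H₀ H₁ ε) φ ξ)ᵀ *ᵥ lam φ δ ξ + Pi₃ (Phi₃ F ω φ) (chi φ δ) ξ ∧
              D₄ ξ = mdOm ω (fun η => J * Gam φ δ η) ξ + Om k * Gam φ δ ξ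
                + (Om k * Gam φ δ ξ)ᵀ
                + (∑ i, ∑ j, pd j (fun η => lam φ δ η i) ξ • U i j ξ)
                + (∑ i, mu φ δ ξ i • E i ξ) + (∑ i, lam φ δ ξ i • K i ξ)
                + Pi₄ (Phi₃ F ω φ) (Phi₄ F k φ) (chi φ δ) (Gam φ δ) ξ) ∧
          -- the derivative of `Φ₅`
          HasDerivAt (fun t : ℂ => Phi₅ α (φ + t • δ))
            (mean (fun ξ => (φ.W ξ *ᵥ lam φ δ ξ) 0
              + ∑ i, chi φ δ ξ i * pd i (fun η => φ.w η 0) ξ)) 0 ∧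
          -- the remainders vanish at solutions
          ((∀ ξ ∈ strip N (σ * ρ), Phi₁ F e φ ξ = 0 ∧ Phi₂ F φ ξ = 0 ∧ Phi₃ F ω φ ξ = 0 ∧
              Phi₄ F k φ ξ = 0) →
            ∀ ξ ∈ strip N (σ * ρ),
              Pi₁ (Phi₁ F e φ) (Phi₂ F φ) (Phi₃ F ω φ) (chi φ δ) (mu φ δ) (lam φ δ) ξ = 0 ∧
              Pi₂ (Phi₂ F φ) (Phi₃ F ω φ) (Phi₄ F k φ) (chi φ δ) (lam φ δ) (Gam φ δ) ξ = 0 ∧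
              Pi₃ (Phi₃ F ω φ) (chi φ δ) ξ = 0 ∧
              Pi₄ (Phi₃ F ω φ) (Phi₄ F k φ) (chi φ δ) (Gam φ δ) ξ = 0) := by
  obtain ⟨d, rfl⟩ : ∃ d', d = d' + 1 := ⟨d - 1, by omega⟩
  simp only [Nat.add_sub_cancel]
  obtain ⟨s, hs0, hs⟩ := exists_radius N hρ
  set h : ℝ := σ * ρ with hh_def
  have hh0 : 0 ≤ h := mul_nonneg hσ₀ hρ.le
  have hh : h ≤ ρ := mul_le_of_le_one_left hρ.le hσ₁
  have hr₁ : 0 < s / 2 := by positivity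
  have hrs : 2 * (s / 2) = s := by ring
  obtain ⟨CS, hCS, hSle⟩ := exists_matNorm_ham_sub_le hρ hr₁.le hrs hh hs hH S (S₀ H₀)
    (d := d) (fun hΦ hF => hΦ.S hF) (fun φ ξ hp ε => S_ham hH hp ε) (S_base H₀)
  obtain ⟨CT, hCT, hTle⟩ := exists_matNorm_ham_sub_le hρ hr₁.le hrs hh hs hH T (T₀ H₀)
    (d := d) (fun hΦ hF => hΦ.T hF) (fun φ ξ hp ε => T_ham hH hp ε) (T_base H₀)
  -- The lines have size s/2; a radius strictly below it makes the parameter r/(s/2) of φ smaller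
  -- than 1 and leaves room to move in the direction `δ`.
  refine ⟨s / 4, by positivity, fun ε₀ hε₀ => ?_⟩
  obtain ⟨C, hC, hcoef⟩ := exists_coef_le hρ hr₁.le hrs hh hs hH (d := d) (ε₀ := ε₀)
  refine ⟨CS + CT + C + 1, by positivity, fun ε hε r hr hrr α hα φ hφ hφn => ?_⟩
  have hφr := Coord.bd_of_norm_le hr.le hφn
  have hφr₁ : (φ - Coord.base N α).Bd h (d + 1) (s / 2) := hφr.mono (by linarith)
  have hF : Nice ρ (fun _ : Unit => ham H₀ H₁ ε) := hH.nice_ham (fun _ => ε) fun _ => hε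
  have hHd : DifferentiableOn ℂ (ham H₀ H₁ ε) (openDomain N (3 * ρ)) := hF.hol ()
  -- The line through φ with direction zero: every property of φ itself is read off from the
  -- families at t = 0.
  have hΦ : CoordFam ρ h d (fun (_ : Unit) (t : ℂ) => φ + t • ((0 : ℂ) • φ)) :=
    coordFam_line (α := fun _ => α) hρ hr₁.le hrs hh hs (fun _ => hα) (fun _ => hφ)
      (fun _ => hφ.smul 0) (fun _ => hφr₁) fun _ => hφ.zero_smul_bd hr₁.le
  have h0 : (0 : ℂ) ∈ Metric.ball (0 : ℂ) 1 := zero_mem_unit_ball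
  have hφe : φ + (0 : ℂ) • ((0 : ℂ) • φ) = φ := Coord.add_zero_smul _ _
  have hdet : ∀ ξ ∈ strip N h, (1 + jac φ.u ξ).det ≠ 0 := fun ξ hξ => by
    have h1 := hΦ.det () 0 h0 ξ hξ
    rw [hφe] at h1
    exact norm_pos_iff.1 (one_half_pos.trans_le h1)
  have hW : ∀ ξ ∈ strip N h, φ.W₁₁ ξ ≠ 0 := fun ξ hξ => by
    have h1 := hΦ.W₁₁_ge () 0 h0 ξ hξ
    rw [hφe] at h1
    exact norm_pos_iff.1 (one_half_pos.trans_le h1)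
  have hpt : ∀ ξ ∈ strip N h, φ.pt ξ ∈ openDomain N (3 * ρ) := fun ξ hξ => by
    have h1 := hΦ.mem_openDomain () h0 hξ
    rwa [hφe] at h1
  have hSm := (hΦ.S hF).memA () h0
  have hTm := (hΦ.T hF).memA () h0
  have hUm := fun i j => (hΦ.coefU hF i j).memA () h0
  have hEm := fun i => (hΦ.coefE hF i).memA () h0
  have hKm := fun i => (hΦ.coefK hF i).memA () h0
  have hVm := hΦ.V.memA () h0
  simp only [hφe] at hSm hTm hUm hEm hKm hVm
  refine ⟨fun ξ hξ => ⟨hdet ξ hξ, hW ξ hξ, openDomain_subset (hpt ξ hξ)⟩, hSm, hTm, ?_,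
    coefU (ham H₀ H₁ ε) φ, coefE (ham H₀ H₁ ε) φ, coefK (ham H₀ H₁ ε) φ, hUm, hEm, hKm, ?_, ?_, ?_⟩
  · refine (add_le_add (hSle ε r hr (by linarith) α φ hα hφ hφr)
      (hTle ε r hr (by linarith) α φ hα hφ hφr)).trans ?_
    have e1 : 0 ≤ |ε| + r := by positivity
    rw [← ENNReal.ofReal_add (by positivity) (by positivity), ← add_mul]
    exact ENNReal.ofReal_le_ofReal (mul_le_mul_of_nonneg_right (by linarith) e1)
  · intro ξ hξ
    -- Symmetry of the R_i does not involve the direction, so φ itself is used in its place.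
    have hR := (Setting.mk (by omega) hφ hφ hdet hW : Setting h (d + 1) φ φ).R_isSymm hξ
    exact ⟨fun i j => coefU_isSymm _ _ i j ξ, fun i => cubic_isSymm hHd (hpt ξ hξ) hR _ _,
      fun i => coefK_isSymm hHd (hpt ξ hξ) hR i⟩
  · exact (hcoef ε hε α φ hα hφ hφr₁).trans (ENNReal.ofReal_le_ofReal (by linarith))
  · intro ω k _ _ _ e m M δ hδ
    set F : Phase N → ℂ := modHam (ham H₀ H₁ ε) m M
    have hS : Setting h (d + 1) φ δ := ⟨by omega, hφ, hδ, hdet, hW⟩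
    obtain ⟨c, hc, hL⟩ := exists_line hρ hr₁ hrs hh hs hα hφ hφr₁ hδ
    refine ⟨fun ξ hξ => hS.trace_Gam hξ.1, fun hd' i => hS.mean_mu hh0 hVm ?_ i,
      ⟨potential φ δ, memA_potential hφ hδ hVm, fun ξ hξ => hS.grad_potential hξ⟩,
      exists_derivatives hc hL hF hHd hpt hS ω k e m M, hS.hasDerivAt_Phi₅ hh0 α, ?_⟩
    · exact hd'.imp (fun h2 => by omega) fun h2 => mul_pos h2 hρ
    · intro h0 ξ hξ
      have z₁ : ∀ η ∈ strip N h, Phi₁ F e φ η = 0 := fun η hη => (h0 η hη).1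
      have z₂ : ∀ η ∈ strip N h, Phi₂ F φ η = 0 := fun η hη => (h0 η hη).2.1
      have z₃ : ∀ η ∈ strip N h, Phi₃ F ω φ η = 0 := fun η hη => (h0 η hη).2.2.1
      have z₄ : ∀ η ∈ strip N h, Phi₄ F k φ η = 0 := fun η hη => (h0 η hη).2.2.2
      exact ⟨Pi₁_eq_zero hξ z₁ z₂ z₃ _ _ _, Pi₂_eq_zero hξ z₂ z₃ z₄ _ _ _, Pi₃_eq_zero hξ z₃ _,
        Pi₄_eq_zero hξ z₃ z₄ _ _⟩
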